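/- **Setting.** Let $n\ge 1$, let $K,M>0$, $M_1\ge 0$ and $a>0$ be rational with $a\le \frac{K}{M(1+nM_1)}$. For $R\geq 0$, $\mathbf I[-R,R]^m$ is the set of non-empty closed axis-parallel hyper-rectangles contained in $[-R,R]^m$, ordered by reverse inclusion $\sqsubseteq$. In a partial order, $x\ll y$ means: every directed set with supremum $\sqsupseteq y$ has an element $\sqsupseteq x$. *The domain $\mathcal V^1$.* For $h:[-K,K]^n\to\mathbb R$ scalar, $\overline L(h)(x)$ is the intersection of all hyper-rectangles $b\subseteq\mathbb R^n$ such that for some relatively open neighbourhood $O$ of $x$ in $[-K,K]^n$ one has $h(y)-h(z)\in\{p\cdot(y-z): p\in b\}$ for all $y,z\in O$ ($\overline L(h)(x)=\mathbb R^n$ if there is no such $b$); for vector-valued $h$, $\overline L(h)(x)$ is the set of matrices whose $i$-th row lies in $\overline L(h_i)(x)$. $\mathcal V^1$ is the set of pairs of Scott-continuous maps $u:\mathbf I[-K,K]^n\to\mathbf I[-M,M]^n$, $u':\mathbf I[-K,K]^n\to\mathbf I[-M_1,M_1]^{n^2}$ that are consistent: there is $h:[-K,K]^n\to[-M,M]^n$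 with $h(x)\in u(\alpha)$ and $\overline L(h)(x)\subseteq u'(\alpha)$ whenever $x\in\alpha$. It is ordered pointwise. *The domain $\mathcal W_{\mathcal D}$.* Let $\mathcal B_{\mathcal D}$ be the set of step functions $\theta:[0,a]\to\mathbf I[-K,K]^n$, $\theta=\bigsqcup_{i\in I} b_i\chi_{O_i}$ with $I$ finite, $O_i=(p_i,q_i]\cap[0,a]$, $p_i,q_i\in\mathbb Q$, and $b_i\in \mathbf I[-K,K]^n$ with rational end-points ($b\chi_O$ is $b$ on $O$ and $[-K,K]^n$ elsewhere). Put $\bigsqcup_i b_i\chi_{O_i}\prec\theta'$ iff $b_i\ll\theta'(t)$ for all $i$ and all $t\in O_i$; for arbitrary $f,g:[0,a]\to\mathbf I[-K,K]^n$ put $f\prec g$ iff $f\sqsubseteq\theta_1\prec\theta_2\sqsubseteq g$ for some $\theta_1,\theta_2\in\mathcal B_{\mathcal D}$. $\mathcal W_{\mathcal D}$ is the set of rounded ideals of $(\mathcal B_{\mathcal D},\prec)$ (sets $I$ closed downwards under $\prec$ in which every finite $A\subseteq I$, including $\emptyset$, has some $z\in I$ with $A\prec z$), ordered by inclusion. For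 $f:[0,a]\to\mathbf I[-K,K]^n$ let $f_*=\{b\in\mathcal B_{\mathcal D}: b\prec f\}\in\mathcal W_{\mathcal D}$, and for $\phi\in\mathcal W_{\mathcal D}$ let $\phi^*=\bigsqcup_{b\in\phi}b$ (pointwise). *The Euler operator.* Let $T_{K,n}(X)=X\cap[-K,K]^n$ for a hyper-rectangle $X$ meeting $[-K,K]^n$; if this intersection is empty, $T_{K,n}(X)$ denotes the image of $X$ under the nearest-point (coordinatewise truncation) map onto $[-K,K]^n$. For a rational partition $Q=(q_0,\dots,q_k)$ of $[0,a]$ ($k\ge1$, $0=q_0<\dots<q_k=a$), $(u,u')\in\mathcal V^1$ and $\varphi:[0,a]\to\mathbf I[-K,K]^n$, let $\Phi_{(u,u')}(Q)(\varphi)(0)=\{(0,\dots,0)\}$ and, for $q_j<x\le q_{j+1}$, $$\Phi_{(u,u')}(Q)(\varphi)(x)=T_{K,n}\Bigl[\varphi(q_j)+\int_{q_j}^x u(\varphi(q_j))+(t-q_j)\,(u'\cdot u)\bigl(T_{K,n}(G_j)\bigr)\,dt\Bigr],$$ where $G_j=\varphi(q_j)+[-M(q_{j+1}-q_j),M(q_{j+1}-q_j)]^n$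 and all operations (sum, integral, product of an interval matrix and an interval vector) are those of interval arithmetic. Let $F_{(u,u')}(Q)(\phi)=\bigl(\Phi_{(u,u')}(Q)(\phi^*)\bigr)_*$. *Effective structures.* An enumeration $b_0=\bot,b_1,b_2,\dots$ of a basis of an $\omega$-continuous pointed directed-complete partial order $D$ makes $D$ effectively given if $\{(i,j):b_i\ll b_j\}$ is recursively enumerable. A name of $x\in D$ is a sequence of natural numbers whose range is $\{i: b_i\ll x\}$. A map between such domains is computable if a Type-2 machine (equivalently, a computable monotone function on finite words) transforms every name of every $x$ into a name of its image. Enumerate $\mathcal B_{\mathcal D}$ as $b_0,b_1,\dots$ by a standard coding of the finite lists of rational data that define step functions, and $\mathcal W_{\mathcal D}$'s basis as $(b_i)_*$; enumerate likewise the consistent pairs $(u_k,u'_k)$ of rational step functions $\bigsqcup_i b_i\chi_{\{\beta:\alpha_i\ll\beta\}}$ in $\mathcal V^1$ ($\alpha_i,b_i$ rational hyper-rectangles); codes of no object denote $\bot$. Basis elements of $\mathcal V^1\times\mathcal W_{\mathcal D}$ are enumerated by pairing. **Theorem (Computability).** With these enumerations $\mathcal V^1$ and $\mathcal W_{\mathcal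 D}$ are effectively given domains, and for every fixed rational partition $Q$ of $[0,a]$ the map $$F_{(\cdot,\cdot)}(Q)(\cdot):\mathcal V^1\times\mathcal W_{\mathcal D}\to\mathcal W_{\mathcal D}$$ is computable: it is Scott-continuous, the relation $(b_i)_*\ll F_{(u_k,u'_k)}(Q)\bigl((b_j)_*\bigr)$ is recursively enumerable in $(i,(k,j))$, and the map is computable in the Type-2 sense with respect to names. -/

import Mathlib

open Set

noncomputable section

/-! ## Domain theory and effective structures -/

section DomainTheory

variable {D E : Type*} [PartialOrder D] [PartialOrder E]

/-- The way-below relation. -/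
def WayBelow (x y : D) : Prop :=
  ∀ ⦃X : Set D⦄, X.Nonempty → DirectedOn (· ≤ ·) X → ∀ ⦃s : D⦄, IsLUB X s → y ≤ s →
    ∃ d ∈ X, x ≤ d

theorem WayBelow.le {x y : D} (h : WayBelow x y) : x ≤ y := by
  obtain ⟨d, hd, hxd⟩ := h (singleton_nonempty y) (directedOn_singleton (a := y))
    isLUB_singleton le_rfl
  rw [mem_singleton_iff] at hd
  exact hd ▸ hxd

theorem WayBelow.trans_le {x y z : D} (h : WayBelow x y) (hyz : y ≤ z) : WayBelow x z :=
  fun _ hX hdir _ hs hle => h hX hdir hs (hyz.trans hle)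

theorem WayBelow.le_trans {x y z : D} (hxy : x ≤ y) (h : WayBelow y z) : WayBelow x z := by
  intro X hX hdir s hs hle
  obtain ⟨d, hd, hyd⟩ := h hX hdir hs hle
  exact ⟨d, hd, hxy.trans hyd⟩

/-- A finite supremum of elements way-below `y` is way-below `y`. -/
theorem WayBelow.of_isLUB {S : Set D} (hS : S.Finite) {x y : D} (hx : IsLUB S x)
    (h : ∀ b ∈ S, WayBelow b y) : WayBelow x y := by
  intro X hX hdir s hs hle
  have key : ∃ d ∈ X, ∀ b ∈ S, b ≤ d := by
    clear hx
    induction S, hS using Set.Finite.induction_on with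
    | empty =>
      obtain ⟨d, hd⟩ := hX
      exact ⟨d, hd, by simp⟩
    | @insert c S _ _ ih =>
      obtain ⟨d, hd, hdS⟩ := ih (fun b hb => h b (mem_insert_of_mem _ hb))
      obtain ⟨e, he, hce⟩ := h c (mem_insert _ _) hX hdir hs hle
      obtain ⟨f, hf, hdf, hef⟩ := hdir d hd e he
      refine ⟨f, hf, ?_⟩
      rintro b (rfl | hb)
      · exact hce.trans hef
      · exact (hdS b hb).trans hdf
  obtain ⟨d, hd, hdS⟩ := key
  exact ⟨d, hd, hx.2 hdS⟩

/-- `D` is an `ω`-continuous domain (a pointed directed-complete partial order with a countable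
basis), effectively given with respect to the enumeration `b 0 = ⊥, b 1, b 2, …` of a basis. -/
structure EffectivelyGiven (b : ℕ → D) : Prop where
  complete : ∀ X : Set D, X.Nonempty → DirectedOn (· ≤ ·) X → ∃ s, IsLUB X s
  bot : IsBot (b 0)
  basis_nonempty : ∀ x : D, ({d | d ∈ range b ∧ WayBelow d x}).Nonempty
  basis_directed : ∀ x : D, DirectedOn (· ≤ ·) {d | d ∈ range b ∧ WayBelow d x}
  basis_sup : ∀ x : D, IsLUB {d | d ∈ range b ∧ WayBelow d x} x
  wayBelow_re : REPred fun p : ℕ × ℕ => WayBelow (b p.1) (b p.2)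

/-- The enumeration of pairs of basis elements as a basis of a product domain. -/
def prodEnum (b : ℕ → D) (c : ℕ → E) (k : ℕ) : D × E :=
  (b k.unpair.1, c k.unpair.2)

/-- The sequence `p` is a name of the element `x`: it lists (in any order, with repetitions
allowed) exactly the indices of the basis elements way-below `x`. -/
def IsName (b : ℕ → D) (x : D) (p : ℕ → ℕ) : Prop :=
  range p = {i | WayBelow (b i) x}

/-- The initial segment `p 0, …, p (m - 1)`. -/
def initSeg (p : ℕ → ℕ) (m : ℕ) : List ℕ := (List.range m).map p

/-- Type-2 (TTE) computability of a map with respect to the representations by names: some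
computable monotone word function `g` transforms, in the limit, every name of every point `x`
into a name of `f x`. -/
def IsComputableMap (b : ℕ → D) (c : ℕ → E) (f : D → E) : Prop :=
  ∃ g : List ℕ → List ℕ, Computable g ∧ (∀ s t : List ℕ, s <+: t → g s <+: g t) ∧
    ∀ (x : D) (p : ℕ → ℕ), IsName b x p →
      ∃ q : ℕ → ℕ, IsName c (f x) q ∧ ∀ N : ℕ, ∃ m : ℕ, initSeg q N <+: g (initSeg p m)

/-- Rounded ideals of a set with a binary relation. -/
@[ext]
structure RoundedIdeal {B : Type*} (r : B → B → Prop) where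
  carrier : Set B
  nonempty : carrier.Nonempty
  lower : ∀ ⦃x y : B⦄, r x y → y ∈ carrier → x ∈ carrier
  directed : ∀ A : Set B, A.Finite → A ⊆ carrier → ∃ z ∈ carrier, ∀ x ∈ A, r x z

/-- Rounded ideals are ordered by inclusion. -/
instance {B : Type*} (r : B → B → Prop) : PartialOrder (RoundedIdeal r) :=
  PartialOrder.lift RoundedIdeal.carrier fun _ _ h => RoundedIdeal.ext h

end DomainTheory

/-! ## Hyper-rectangles -/

/-- Non-empty closed hyper-rectangles contained in the cube `[-R, R]^ι`. -/
@[ext]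
structure Box (ι : Type*) (R : ℚ≥0) where
  lo : ι → ℝ
  hi : ι → ℝ
  lo_le_hi : ∀ i, lo i ≤ hi i
  neg_le_lo : ∀ i, -(R : ℝ) ≤ lo i
  hi_le : ∀ i, hi i ≤ (R : ℝ)

theorem nnratCast_nonneg (R : ℚ≥0) : (0 : ℝ) ≤ (R : ℝ) := NNRat.cast_nonneg R

namespace Box

variable {ι : Type*} {R : ℚ≥0}

/-- The set of points of a hyper-rectangle. -/
def toSet (X : Box ι R) : Set (ι → ℝ) := Icc X.lo X.hi

/-- The coordinate intervals of a hyper-rectangle. -/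
def coord (X : Box ι R) (i : ι) : NonemptyInterval ℝ := ⟨(X.lo i, X.hi i), X.lo_le_hi i⟩

/-- The information order: reverse inclusion (see `Box.le_iff_toSet`). -/
instance : PartialOrder (Box ι R) where
  le X Y := ∀ i, X.lo i ≤ Y.lo i ∧ Y.hi i ≤ X.hi i
  le_refl X i := ⟨le_rfl, le_rfl⟩
  le_trans X Y Z h k i := ⟨(h i).1.trans (k i).1, (k i).2.trans (h i).2⟩
  le_antisymm X Y h k := by
    ext i
    · exact le_antisymm (h i).1 (k i).1
    · exact le_antisymm (k i).2 (h i).2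

theorem le_def {X Y : Box ι R} : X ≤ Y ↔ ∀ i, X.lo i ≤ Y.lo i ∧ Y.hi i ≤ X.hi i := Iff.rfl

theorem le_iff_toSet {X Y : Box ι R} : X ≤ Y ↔ Y.toSet ⊆ X.toSet := by
  unfold toSet
  rw [Icc_subset_Icc_iff (fun i => Y.lo_le_hi i)]
  exact ⟨fun h => ⟨fun i => (h i).1, fun i => (h i).2⟩, fun h i => ⟨h.1 i, h.2 i⟩⟩

/-- The bottom element is the whole cube. -/
instance : OrderBot (Box ι R) where
  bot :=
    { lo := fun _ => -(R : ℝ)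
      hi := fun _ => (R : ℝ)
      lo_le_hi := fun _ => by linarith [nnratCast_nonneg R]
      neg_le_lo := fun _ => le_rfl
      hi_le := fun _ => le_rfl }
  bot_le X i := ⟨X.neg_le_lo i, X.hi_le i⟩

theorem bot_lo (i : ι) : (⊥ : Box ι R).lo i = -(R : ℝ) := rfl

theorem bot_hi (i : ι) : (⊥ : Box ι R).hi i = (R : ℝ) := rfl

/-- The one-point hyper-rectangle `{(0, …, 0)}`. -/
def zero : Box ι R where
  lo _ := 0
  hi _ := 0
  lo_le_hi _ := le_rfl
  neg_le_lo _ := by linarith [nnratCast_nonneg R]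
  hi_le _ := nnratCast_nonneg R

/-- The cube `[-R, R]^ι` as a set. -/
def cube (ι : Type*) (R : ℚ≥0) : Set (ι → ℝ) := (⊥ : Box ι R).toSet

/-- Truncation of an interval vector to the cube `[-R, R]^ι`. It is the intersection with the
cube whenever this is non-empty (see `Box.trunc_toSet`); otherwise each coordinate interval is
replaced by its image under the nearest-point map onto `[-R, R]`. -/
def trunc (X : ι → NonemptyInterval ℝ) : Box ι R where
  lo i := max (-(R : ℝ)) (min (R : ℝ) (X i).fst)
  hi i := max (-(R : ℝ)) (min (R : ℝ) (X i).snd)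
  lo_le_hi i := max_le_max le_rfl (min_le_min le_rfl (X i).fst_le_snd)
  neg_le_lo i := le_max_left _ _
  hi_le i := max_le (by linarith [nnratCast_nonneg R]) (min_le_left _ _)

theorem trunc_toSet (X : ι → NonemptyInterval ℝ)
    (h : ({x : ι → ℝ | ∀ i, x i ∈ X i} ∩ cube ι R).Nonempty) :
    (trunc X : Box ι R).toSet = {x : ι → ℝ | ∀ i, x i ∈ X i} ∩ cube ι R := by
  obtain ⟨y, hyX, hy1, hy2⟩ := h
  ext x
  have hlo : ∀ i, (trunc X : Box ι R).lo i = max (-(R : ℝ)) (X i).fst := fun i => by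
    have h1 := (NonemptyInterval.mem_def.1 (hyX i)).1
    have h2 : y i ≤ R := hy2 i
    simp only [trunc]
    rw [min_eq_right (h1.trans h2)]
  have hhi : ∀ i, (trunc X : Box ι R).hi i = min (R : ℝ) (X i).snd := fun i => by
    have h1 := (NonemptyInterval.mem_def.1 (hyX i)).2
    have h2 : -(R : ℝ) ≤ y i := hy1 i
    simp only [trunc]
    rw [max_eq_right (le_min (by linarith [nnratCast_nonneg R]) (h2.trans h1))]
  constructor
  · rintro ⟨h1, h2⟩
    refine ⟨fun i => NonemptyInterval.mem_def.2 ⟨?_, ?_⟩, fun i => ?_, fun i => ?_⟩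
    · exact (le_max_right _ _).trans ((hlo i).symm.le.trans (h1 i))
    · exact (h2 i).trans ((hhi i).le.trans (min_le_right _ _))
    · exact (le_max_left _ _).trans ((hlo i).symm.le.trans (h1 i))
    · exact (h2 i).trans ((hhi i).le.trans (min_le_left _ _))
  · rintro ⟨h1, h2, h3⟩
    refine ⟨fun i => ?_, fun i => ?_⟩
    · rw [hlo i]
      exact max_le (h2 i) (NonemptyInterval.mem_def.1 (h1 i)).1
    · rw [hhi i]
      exact le_min (h3 i) (NonemptyInterval.mem_def.1 (h1 i)).2

/-- The hyper-rectangle `X` widened by `ε` in every direction, inside the cube. -/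
def widen (ε : ℝ) (hε : 0 ≤ ε) (X : Box ι R) : Box ι R where
  lo i := max (-(R : ℝ)) (X.lo i - ε)
  hi i := min (R : ℝ) (X.hi i + ε)
  lo_le_hi i := by
    have h1 := X.lo_le_hi i
    have h2 := X.neg_le_lo i
    have h3 := X.hi_le i
    exact max_le (le_min (by linarith) (by linarith)) (le_min (by linarith) (by linarith))
  neg_le_lo i := le_max_left _ _
  hi_le i := min_le_left _ _

/-- A set of hyper-rectangles of which any two meet in every coordinate has a least upper bound. -/
theorem exists_isLUB (S : Set (Box ι R)) (h : ∀ X ∈ S, ∀ Y ∈ S, ∀ i, X.lo i ≤ Y.hi i) :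
    ∃ X, IsLUB S X := by
  rcases S.eq_empty_or_nonempty with rfl | ⟨Z, hZ⟩
  · exact ⟨⊥, by simp⟩
  have hne : S.Nonempty := ⟨Z, hZ⟩
  have ba : ∀ i, BddAbove ((fun X : Box ι R => X.lo i) '' S) := fun i =>
    ⟨Z.hi i, by rintro _ ⟨X, hX, rfl⟩; exact h X hX Z hZ i⟩
  have bb : ∀ i, BddBelow ((fun X : Box ι R => X.hi i) '' S) := fun i =>
    ⟨Z.lo i, by rintro _ ⟨X, hX, rfl⟩; exact h Z hZ X hX i⟩
  refine ⟨⟨fun i => sSup ((fun X : Box ι R => X.lo i) '' S),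
    fun i => sInf ((fun X : Box ι R => X.hi i) '' S),
    fun i => csSup_le (hne.image _) (by
      rintro _ ⟨X, hX, rfl⟩
      exact le_csInf (hne.image _) (by rintro _ ⟨Y, hY, rfl⟩; exact h X hX Y hY i)),
    fun i => (Z.neg_le_lo i).trans (le_csSup (ba i) ⟨Z, hZ, rfl⟩),
    fun i => (csInf_le (bb i) ⟨Z, hZ, rfl⟩).trans (Z.hi_le i)⟩, ?_, ?_⟩
  · intro X hX i
    exact ⟨le_csSup (ba i) ⟨X, hX, rfl⟩, csInf_le (bb i) ⟨X, hX, rfl⟩⟩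
  · intro Y hY i
    exact ⟨csSup_le (hne.image _) (by rintro _ ⟨X, hX, rfl⟩; exact (hY hX i).1),
      le_csInf (hne.image _) (by rintro _ ⟨X, hX, rfl⟩; exact (hY hX i).2)⟩

theorem lo_le_of_isLUB {S : Set (Box ι R)} {X : Box ι R} (hX : IsLUB S X) {i : ι} {c : ℝ}
    (hc : -(R : ℝ) ≤ c) (h : ∀ b ∈ S, b.lo i ≤ c) : X.lo i ≤ c := by
  classical
  by_contra hlt
  push Not at hlt
  let X' : Box ι R :=
    { lo := Function.update X.lo i c
      hi := X.hi
      lo_le_hi := fun j => by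
        by_cases hj : j = i
        · subst hj; simpa using hlt.le.trans (X.lo_le_hi j)
        · simpa [hj] using X.lo_le_hi j
      neg_le_lo := fun j => by
        by_cases hj : j = i
        · subst hj; simpa using hc
        · simpa [hj] using X.neg_le_lo j
      hi_le := X.hi_le }
  have hub : X' ∈ upperBounds S := by
    intro b hb j
    refine ⟨?_, (hX.1 hb j).2⟩
    by_cases hj : j = i
    · subst hj; simpa [X'] using h b hb
    · simpa [X', hj] using (hX.1 hb j).1
  have := (hX.2 hub i).1
  simp [X'] at this
  linarith

theorem le_hi_of_isLUB {S : Set (Box ι R)} {X : Box ι R} (hX : IsLUB S X) {i : ι} {c : ℝ}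
    (hc : c ≤ (R : ℝ)) (h : ∀ b ∈ S, c ≤ b.hi i) : c ≤ X.hi i := by
  classical
  by_contra hlt
  push Not at hlt
  let X' : Box ι R :=
    { lo := X.lo
      hi := Function.update X.hi i c
      lo_le_hi := fun j => by
        by_cases hj : j = i
        · subst hj; simpa using (X.lo_le_hi j).trans hlt.le
        · simpa [hj] using X.lo_le_hi j
      neg_le_lo := X.neg_le_lo
      hi_le := fun j => by
        by_cases hj : j = i
        · subst hj; simpa using hc
        · simpa [hj] using X.hi_le j }
  have hub : X' ∈ upperBounds S := by
    intro b hb j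
    refine ⟨(hX.1 hb j).1, ?_⟩
    by_cases hj : j = i
    · subst hj; simpa [X'] using h b hb
    · simpa [X', hj] using (hX.1 hb j).2
  have := (hX.2 hub i).2
  simp [X'] at this
  linarith

theorem wayBelow_of_lt [Finite ι] {X Y : Box ι R}
    (h : ∀ i, (X.lo i = -(R : ℝ) ∨ X.lo i < Y.lo i) ∧ (X.hi i = (R : ℝ) ∨ Y.hi i < X.hi i)) :
    WayBelow X Y := by
  intro S hS hdir s hs hle
  have h1 : ∀ i, ∃ d ∈ S, X.lo i ≤ d.lo i ∧ d.hi i ≤ X.hi i := by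
    intro i
    have ha : ∃ d ∈ S, X.lo i ≤ d.lo i := by
      rcases (h i).1 with he | hlt
      · obtain ⟨d, hd⟩ := hS
        exact ⟨d, hd, he ▸ d.neg_le_lo i⟩
      · by_contra hcon
        push Not at hcon
        have := lo_le_of_isLUB hs (X.neg_le_lo i) (fun b hb => (hcon b hb).le)
        linarith [(hle i).1]
    have hb : ∃ d ∈ S, d.hi i ≤ X.hi i := by
      rcases (h i).2 with he | hlt
      · obtain ⟨d, hd⟩ := hS
        exact ⟨d, hd, he ▸ d.hi_le i⟩
      · by_contra hcon
        push Not at hcon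
        have := le_hi_of_isLUB hs (X.hi_le i) (fun b hb => (hcon b hb).le)
        linarith [(hle i).2]
    obtain ⟨d, hd, hd'⟩ := ha
    obtain ⟨e, he, he'⟩ := hb
    obtain ⟨f, hf, hdf, hef⟩ := hdir d hd e he
    exact ⟨f, hf, hd'.trans (hdf i).1, (hef i).2.trans he'⟩
  choose d hd hd' using h1
  have : ∀ T : Set ι, T.Finite → ∃ f ∈ S, ∀ i ∈ T, d i ≤ f := by
    intro T hT
    induction T, hT using Set.Finite.induction_on with
    | empty =>
      obtain ⟨f, hf⟩ := hS
      exact ⟨f, hf, by simp⟩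
    | @insert i T _ _ ih =>
      obtain ⟨f, hf, hfT⟩ := ih
      obtain ⟨g, hg, h2, h3⟩ := hdir (d i) (hd i) f hf
      refine ⟨g, hg, ?_⟩
      rintro j (rfl | hj)
      · exact h2
      · exact (hfT j hj).trans h3
  obtain ⟨f, hf, hall⟩ := this univ finite_univ
  exact ⟨f, hf, fun i => ⟨(hd' i).1.trans (hall i trivial i).1, (hall i trivial i).2.trans (hd' i).2⟩⟩

theorem widen_wayBelow [Finite ι] {ε δ : ℝ} (hδ : 0 ≤ δ) (h : δ < ε) (X : Box ι R) :
    WayBelow (widen ε (hδ.trans h.le) X) (widen δ hδ X) := by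
  refine wayBelow_of_lt fun i => ⟨?_, ?_⟩
  · rcases le_or_gt (X.lo i - ε) (-(R : ℝ)) with hc | hc
    · left; exact max_eq_left hc
    · right
      change max _ _ < max _ _
      rw [max_eq_right hc.le]
      exact lt_max_of_lt_right (by linarith)
  · rcases le_or_gt (R : ℝ) (X.hi i + ε) with hc | hc
    · left; exact min_eq_left hc
    · right
      change min _ _ < min _ _
      rw [min_eq_right hc.le]
      exact min_lt_of_right_lt (by linarith)

theorem widen_zero (X : Box ι R) : widen 0 le_rfl X = X := by
  ext i
  · simpa [widen] using X.neg_le_lo i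
  · simpa [widen] using X.hi_le i

theorem widen_anti {ε δ : ℝ} (hδ : 0 ≤ δ) (h : δ ≤ ε) (X : Box ι R) :
    widen ε (hδ.trans h) X ≤ widen δ hδ X := fun i =>
  ⟨max_le_max le_rfl (by linarith), min_le_min le_rfl (by linarith)⟩

theorem exists_le_widen {X Y : Box ι R} (h : WayBelow X Y) :
    ∃ (ε : ℝ) (hε : 0 < ε), X ≤ widen ε hε.le Y := by
  have hlub : IsLUB {Z | ∃ (ε : ℝ) (hε : 0 < ε), Z = widen ε hε.le Y} Y := by
    constructor
    · rintro _ ⟨ε, hε, rfl⟩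
      simpa [widen_zero] using widen_anti le_rfl hε.le Y
    · intro Z hZ i
      refine ⟨le_of_forall_pos_le_add fun ε hε => ?_, le_of_forall_pos_le_add fun ε hε => ?_⟩
      · have h1 : max (-(R : ℝ)) (Y.lo i - ε) ≤ Z.lo i := (hZ ⟨ε, hε, rfl⟩ i).1
        linarith [le_max_right (-(R : ℝ)) (Y.lo i - ε)]
      · have h1 : Z.hi i ≤ min (R : ℝ) (Y.hi i + ε) := (hZ ⟨ε, hε, rfl⟩ i).2
        linarith [min_le_right (R : ℝ) (Y.hi i + ε)]
  have hne : {Z | ∃ (ε : ℝ) (hε : 0 < ε), Z = widen ε hε.le Y}.Nonempty :=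
    ⟨_, 1, one_pos, rfl⟩
  have hdir : DirectedOn (· ≤ ·) {Z | ∃ (ε : ℝ) (hε : 0 < ε), Z = widen ε hε.le Y} := by
    rintro _ ⟨ε, hε, rfl⟩ _ ⟨δ, hδ, rfl⟩
    have hm : 0 < min ε δ := lt_min hε hδ
    exact ⟨_, ⟨min ε δ, hm, rfl⟩, widen_anti hm.le (min_le_left _ _) Y,
      widen_anti hm.le (min_le_right _ _) Y⟩
  obtain ⟨_, ⟨ε, hε, rfl⟩, hle⟩ := h hne hdir hlub le_rfl
  exact ⟨ε, hε, hle⟩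

end Box

/-- The end-points of a hyper-rectangle with rational coordinates. -/
abbrev RatBox (ι : Type*) := ι → ℚ × ℚ

/-- `X` is the hyper-rectangle with the rational end-points `d`. -/
def RatBox.Describes {ι : Type*} {R : ℚ≥0} (d : RatBox ι) (X : Box ι R) : Prop :=
  ∀ i, X.lo i = ((d i).1 : ℝ) ∧ X.hi i = ((d i).2 : ℝ)

/-- `f` is the step function `⨆ b_i χ_{O_i}` given by a finite list of pairs (basic open set,
rational hyper-rectangle): at every `x` the supremum of the `b_i` with `x ∈ O_i` exists and equals
`f x`. (List entries whose end-points do not describe a hyper-rectangle inside the cube are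
skipped.) -/
def IsStepFunOf {C X ι : Type*} {R : ℚ≥0} (O : C → Set X) (l : List (C × RatBox ι))
    (f : X → Box ι R) : Prop :=
  ∀ x, IsLUB {b : Box ι R | ∃ e ∈ l, x ∈ O e.1 ∧ e.2.Describes b} (f x)

/-! ## The abstract basis of step functions in time and its rounded ideal completion -/

/-- The interval `[0, a]`. -/
abbrev Time (a : ℚ≥0) := Icc (0 : ℝ) (a : ℝ)

/-- The basic open sets `(p, q] ∩ [0, a]` of the rational upper limit topology on `[0, a]`. -/
def timeOpen (a : ℚ≥0) (c : ℚ × ℚ) : Set (Time a) := {t | (c.1 : ℝ) < t ∧ (t : ℝ) ≤ c.2}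

/-- Rational step functions from `[0, a]` to the hyper-rectangles in `[-K, K]^n`. -/
def StepFun (n : ℕ) (K a : ℚ≥0) : Type :=
  {f : Time a → Box (Fin n) K // ∃ l, IsStepFunOf (timeOpen a) l f}

/-- The separation order on step functions `⨆ b_i χ_{O_i}` and `θ₂`: every `O_i` is mapped by `θ₂`
to elements that `b_i` is way-below. -/
def StepFun.Sep {n : ℕ} {K a : ℚ≥0} (θ₁ θ₂ : StepFun n K a) : Prop :=
  ∃ l, IsStepFunOf (timeOpen a) l θ₁.1 ∧
    ∀ e ∈ l, ∀ b : Box (Fin n) K, e.2.Describes b → ∀ t ∈ timeOpen a e.1, WayBelow b (θ₂.1 t)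

/-- The separation order on arbitrary functions. -/
def SepFun {n : ℕ} {K a : ℚ≥0} (f g : Time a → Box (Fin n) K) : Prop :=
  ∃ θ₁ θ₂ : StepFun n K a, f ≤ θ₁.1 ∧ θ₁.Sep θ₂ ∧ θ₂.1 ≤ g

/-- The domain of rounded ideals of step functions. -/
abbrev WD (n : ℕ) (K a : ℚ≥0) : Type := RoundedIdeal (StepFun.Sep (n := n) (K := K) (a := a))

section Separation

theorem RatBox.Describes.unique {ι : Type*} {R : ℚ≥0} {d : RatBox ι} {X Y : Box ι R}
    (hX : d.Describes X) (hY : d.Describes Y) : X = Y := by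
  ext i
  · rw [(hX i).1, (hY i).1]
  · rw [(hX i).2, (hY i).2]

theorem finite_stepSet {C X ι : Type*} {R : ℚ≥0} (O : C → Set X) (l : List (C × RatBox ι)) (x : X) :
    {b : Box ι R | ∃ e ∈ l, x ∈ O e.1 ∧ e.2.Describes b}.Finite := by
  have : {b : Box ι R | ∃ e ∈ l, x ∈ O e.1 ∧ e.2.Describes b} ⊆
      ⋃ e ∈ {e | e ∈ l}, {b : Box ι R | e.2.Describes b} := by
    rintro b ⟨e, he, -, hb⟩
    simp only [mem_iUnion]
    exact ⟨e, he, hb⟩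
  refine Set.Finite.subset (Set.Finite.biUnion l.finite_toSet fun e _ => ?_) this
  exact Set.Subsingleton.finite fun X hX Y hY => hX.unique hY

theorem IsStepFunOf.finite_range {C X ι : Type*} {R : ℚ≥0} {O : C → Set X}
    {l : List (C × RatBox ι)} {f : X → Box ι R} (h : IsStepFunOf O l f) : (range f).Finite := by
  classical
  let k : X → Set (C × RatBox ι) := fun x => {e | e ∈ l ∧ x ∈ O e.1}
  have hk : (range k).Finite :=
    Set.Finite.subset (Set.Finite.finite_subsets l.finite_toSet)
      (by rintro _ ⟨x, rfl⟩; exact fun e he => he.1)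
  have hkf : ∀ x y, k x = k y → f x = f y := by
    intro x y hxy
    have hx := h x
    have hy := h y
    have : {b : Box ι R | ∃ e ∈ l, x ∈ O e.1 ∧ e.2.Describes b} =
        {b : Box ι R | ∃ e ∈ l, y ∈ O e.1 ∧ e.2.Describes b} := by
      ext b
      constructor
      · rintro ⟨e, he, hxe, hb⟩
        have : e ∈ k y := hxy ▸ (⟨he, hxe⟩ : e ∈ k x)
        exact ⟨e, he, this.2, hb⟩
      · rintro ⟨e, he, hye, hb⟩
        have : e ∈ k x := hxy ▸ (⟨he, hye⟩ : e ∈ k y)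
        exact ⟨e, he, this.2, hb⟩
    rw [this] at hx
    exact hx.unique hy
  have := hk.to_subtype
  rcases isEmpty_or_nonempty X with hX | hX
  · exact (Set.range_eq_empty f) ▸ Set.finite_empty
  · refine Set.Finite.subset (hk.image fun s => f (Function.invFun k s)) ?_
    rintro _ ⟨x, rfl⟩
    exact ⟨k x, ⟨x, rfl⟩, hkf _ _ (Function.invFun_eq ⟨x, rfl⟩)⟩

variable {n : ℕ} {K a : ℚ≥0}

/-- The separation order of step functions, pointwise. -/
theorem StepFun.sep_iff {θ₁ θ₂ : StepFun n K a} :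
    θ₁.Sep θ₂ ↔ ∀ t, WayBelow (θ₁.1 t) (θ₂.1 t) := by
  constructor
  · rintro ⟨l, hl, h⟩ t
    refine WayBelow.of_isLUB (finite_stepSet _ l t) (hl t) ?_
    rintro b ⟨e, he, ht, hb⟩
    exact h e he b hb t ht
  · intro h
    obtain ⟨l, hl⟩ := θ₁.2
    exact ⟨l, hl, fun e he b hb t ht => ((hl t).1 ⟨e, he, ht, hb⟩ |> fun hle => (h t).le_trans hle)⟩

theorem StepFun.Sep.le {θ₁ θ₂ : StepFun n K a} (h : θ₁.Sep θ₂) : θ₁.1 ≤ θ₂.1 :=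
  fun t => (StepFun.sep_iff.1 h t).le

theorem isStepFunOf_bot : IsStepFunOf (timeOpen a) [] (⊥ : Time a → Box (Fin n) K) := by
  intro t
  simp

instance : Bot (StepFun n K a) := ⟨⟨⊥, [], isStepFunOf_bot⟩⟩

theorem StepFun.bot_sep (θ : StepFun n K a) : (⊥ : StepFun n K a).Sep θ := by
  rw [StepFun.sep_iff]
  rintro t X ⟨d, hd⟩ - s - -
  exact ⟨d, hd, bot_le (a := d)⟩

/-- Finitely many step functions with a common upper bound `f` have a common upper bound below `f`
that is a step function. -/
theorem StepFun.exists_sup {A : Set (StepFun n K a)} (hA : A.Finite) {f : Time a → Box (Fin n) K}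
    (h : ∀ θ ∈ A, θ.1 ≤ f) : ∃ ψ : StepFun n K a, (∀ θ ∈ A, θ.1 ≤ ψ.1) ∧ ψ.1 ≤ f := by
  induction A, hA using Set.Finite.induction_on with
  | empty => exact ⟨⊥, by simp, fun t => bot_le (a := f t)⟩
  | @insert θ A _ _ ih =>
    obtain ⟨ψ, h1, h2⟩ := ih (fun χ hχ => h χ (mem_insert_of_mem _ hχ))
    have hθ := h θ (mem_insert _ _)
    obtain ⟨l, hl⟩ := θ.2
    obtain ⟨m, hm⟩ := ψ.2
    let S : Time a → Set (Box (Fin n) K) := fun t =>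
      {b | ∃ e ∈ l ++ m, t ∈ timeOpen a e.1 ∧ e.2.Describes b}
    have hS : ∀ t, f t ∈ upperBounds (S t) := by
      rintro t b ⟨e, he, ht, hb⟩
      rcases List.mem_append.1 he with he | he
      · exact ((hl t).1 ⟨e, he, ht, hb⟩).trans (hθ t)
      · exact ((hm t).1 ⟨e, he, ht, hb⟩).trans (h2 t)
    choose g hg using fun t => Box.exists_isLUB (S t) fun X hX Y hY i =>
      (hS t hX i).1.trans (((f t).lo_le_hi i).trans (hS t hY i).2)
    have hθg : θ.1 ≤ g := fun t => (hl t).2 (by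
      rintro b ⟨e, he, ht, hb⟩
      exact (hg t).1 ⟨e, List.mem_append_left _ he, ht, hb⟩)
    have hψg : ψ.1 ≤ g := fun t => (hm t).2 (by
      rintro b ⟨e, he, ht, hb⟩
      exact (hg t).1 ⟨e, List.mem_append_right _ he, ht, hb⟩)
    refine ⟨⟨g, l ++ m, hg⟩, ?_, fun t => (hg t).2 (hS t)⟩
    rintro χ (rfl | hχ)
    · exact hθg
    · exact (h1 χ hχ).trans hψg

/-- Widening a rational step function by a rational amount gives a rational step function. -/
theorem IsStepFunOf.exists_widen {C X ι : Type*} {R : ℚ≥0} {O : C → Set X}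
    {l : List (C × RatBox ι)} {f : X → Box ι R} (h : IsStepFunOf O l f) (ε : ℚ)
    (hε : (0 : ℝ) ≤ (ε : ℝ)) : ∃ m, IsStepFunOf O m fun x => Box.widen (ε : ℝ) hε (f x) := by
  classical
  let w : RatBox ι → RatBox ι := fun d =>
    if ∃ b : Box ι R, d.Describes b then
      fun i => (max (-(R : ℚ)) ((d i).1 - ε), min (R : ℚ) ((d i).2 + ε)) else d
  have hw1 : ∀ (d : RatBox ι) (b : Box ι R), d.Describes b →
      (w d).Describes (Box.widen (ε : ℝ) hε b) := by
    intro d b hb i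
    have : w d = fun i => (max (-(R : ℚ)) ((d i).1 - ε), min (R : ℚ) ((d i).2 + ε)) :=
      if_pos ⟨b, hb⟩
    simp only [this, Box.widen, (hb i).1, (hb i).2]
    push_cast
    exact ⟨rfl, rfl⟩
  have hw2 : ∀ (d : RatBox ι) (b : Box ι R), (w d).Describes b →
      ∃ c : Box ι R, d.Describes c ∧ b = Box.widen (ε : ℝ) hε c := by
    intro d b hb
    by_cases hd : ∃ c : Box ι R, d.Describes c
    · obtain ⟨c, hc⟩ := hd
      exact ⟨c, hc, hb.unique (hw1 d c hc)⟩
    · have : w d = d := if_neg hd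
      exact absurd ⟨b, this ▸ hb⟩ hd
  refine ⟨l.map (fun e => (e.1, w e.2)), fun x => ⟨?_, ?_⟩⟩
  · rintro b ⟨e, he, hx, hb⟩
    obtain ⟨e', he', rfl⟩ := List.mem_map.1 he
    obtain ⟨c, hc, rfl⟩ := hw2 _ _ hb
    have := (h x).1 ⟨e', he', hx, hc⟩
    intro i
    exact ⟨max_le_max le_rfl (by linarith [(this i).1]),
      min_le_min le_rfl (by linarith [(this i).2])⟩
  · intro Y hY i
    have key : ∀ c ∈ {b : Box ι R | ∃ e ∈ l, x ∈ O e.1 ∧ e.2.Describes b},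
        Box.widen (ε : ℝ) hε c ≤ Y := by
      rintro c ⟨e, he, hx, hc⟩
      exact hY ⟨(e.1, w e.2), List.mem_map.2 ⟨e, he, rfl⟩, hx, hw1 _ _ hc⟩
    constructor
    · refine max_le (Y.neg_le_lo i) ?_
      have := Box.lo_le_of_isLUB (h x) (i := i) (c := Y.lo i + ε) (by linarith [Y.neg_le_lo i])
        (fun c hc => by
          have h1 : max (-(R : ℝ)) (c.lo i - ε) ≤ Y.lo i := (key c hc i).1
          linarith [le_max_right (-(R : ℝ)) (c.lo i - ε)])
      linarith
    · refine le_min (Y.hi_le i) ?_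
      have := Box.le_hi_of_isLUB (h x) (i := i) (c := Y.hi i - ε) (by linarith [Y.hi_le i])
        (fun c hc => by
          have h1 : Y.hi i ≤ min (R : ℝ) (c.hi i + ε) := (key c hc i).2
          linarith [min_le_right (R : ℝ) (c.hi i + ε)])
      linarith

/-- Interpolation for the separation order. -/
theorem StepFun.exists_between {A : Set (StepFun n K a)} (hA : A.Finite) {ψ : StepFun n K a}
    (h : ∀ θ ∈ A, θ.Sep ψ) : ∃ z : StepFun n K a, (∀ θ ∈ A, θ.Sep z) ∧ z.Sep ψ := by
  have hε : ∃ ε : ℝ, 0 < ε ∧ ∀ θ ∈ A, ∀ t, ∀ (δ : ℝ) (hδ : 0 < δ), δ ≤ ε →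
      θ.1 t ≤ Box.widen δ hδ.le (ψ.1 t) := by
    induction A, hA using Set.Finite.induction_on with
    | empty => exact ⟨1, one_pos, by simp⟩
    | @insert θ A _ _ ih =>
      obtain ⟨ε₁, h1, h2⟩ := ih fun χ hχ => h χ (mem_insert_of_mem _ hχ)
      have hθ := StepFun.sep_iff.1 (h θ (mem_insert _ _))
      let P : Set (Box (Fin n) K × Box (Fin n) K) := range fun t => (θ.1 t, ψ.1 t)
      have hP : P.Finite := by
        obtain ⟨l, hl⟩ := θ.2
        obtain ⟨m, hm⟩ := ψ.2
        refine (hl.finite_range.prod hm.finite_range).subset ?_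
        rintro _ ⟨t, rfl⟩
        exact ⟨⟨t, rfl⟩, ⟨t, rfl⟩⟩
      have hQ : ∀ Q : Set (Box (Fin n) K × Box (Fin n) K), Q.Finite → Q ⊆ P →
          ∃ ε : ℝ, 0 < ε ∧ ∀ x ∈ Q, ∀ (δ : ℝ) (hδ : 0 < δ), δ ≤ ε →
            x.1 ≤ Box.widen δ hδ.le x.2 := by
        intro Q hQ
        induction Q, hQ using Set.Finite.induction_on with
        | empty => exact fun _ => ⟨1, one_pos, by simp⟩
        | @insert x Q _ _ ih2 =>
          intro hsub
          obtain ⟨ε₂, h3, h4⟩ := ih2 fun y hy => hsub (mem_insert_of_mem _ hy)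
          obtain ⟨t, rfl⟩ := hsub (mem_insert _ _)
          obtain ⟨ε₃, h5, h6⟩ := Box.exists_le_widen (hθ t)
          refine ⟨min ε₂ ε₃, lt_min h3 h5, ?_⟩
          rintro y (rfl | hy) δ hδ hle
          · exact h6.trans (Box.widen_anti hδ.le (hle.trans (min_le_right _ _)) _)
          · exact h4 y hy δ hδ (hle.trans (min_le_left _ _))
      obtain ⟨ε₂, h3, h4⟩ := hQ P hP Subset.rfl
      refine ⟨min ε₁ ε₂, lt_min h1 h3, ?_⟩
      rintro χ (rfl | hχ) t δ hδ hle
      · exact h4 _ ⟨t, rfl⟩ δ hδ (hle.trans (min_le_right _ _))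
      · exact h2 χ hχ t δ hδ (hle.trans (min_le_left _ _))
  obtain ⟨ε, hε0, hε1⟩ := hε
  obtain ⟨q, hq0, hq1⟩ := exists_rat_btwn hε0
  obtain ⟨l, hl⟩ := ψ.2
  obtain ⟨m, hm⟩ := hl.exists_widen q hq0.le
  refine ⟨⟨_, m, hm⟩, fun θ hθ => StepFun.sep_iff.2 fun t => ?_, StepFun.sep_iff.2 fun t => ?_⟩
  · exact (Box.widen_wayBelow hq0.le hq1 (ψ.1 t)).le_trans (hε1 θ hθ t ε hε0 le_rfl)
  · simpa [Box.widen_zero] using Box.widen_wayBelow le_rfl hq0 (ψ.1 t)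

/-- On step functions the two separation orders agree. -/
theorem sepFun_iff {θ₁ θ₂ : StepFun n K a} : SepFun θ₁.1 θ₂.1 ↔ θ₁.Sep θ₂ := by
  refine ⟨?_, fun h => ⟨θ₁, θ₂, le_rfl, h, le_rfl⟩⟩
  rintro ⟨χ₁, χ₂, h1, h2, h3⟩
  exact StepFun.sep_iff.2 fun t =>
    ((StepFun.sep_iff.1 h2 t).le_trans (h1 t)).trans_le (h3 t)

end Separation

/-- The rounded ideal `f_*` of the step functions that are separated from `f`. For a step function
`b` it is the element `{b' | b' ≺ b}` of the rounded ideal completion. -/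
def lowerStar {n : ℕ} {K a : ℚ≥0} (f : Time a → Box (Fin n) K) : WD n K a where
  carrier := {b | SepFun b.1 f}
  nonempty := ⟨⊥, ⊥, ⊥, le_rfl, StepFun.bot_sep _, fun t => bot_le (a := f t)⟩
  lower := by
    rintro x y hxy ⟨θ₁, θ₂, h1, h2, h3⟩
    exact ⟨x, y, le_rfl, hxy, h1.trans (h2.le.trans h3)⟩
  directed := by
    intro A hA hsub
    choose! θ₁ θ₂ h1 h2 h3 using hsub
    obtain ⟨ψ, h4, h5⟩ := StepFun.exists_sup (hA.image θ₂) (f := f)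
      (by rintro _ ⟨b, hb, rfl⟩; exact h3 hb)
    obtain ⟨z, h6, h7⟩ := StepFun.exists_between hA (ψ := ψ) (by
      intro b hb
      rw [StepFun.sep_iff]
      intro t
      exact ((StepFun.sep_iff.1 (h2 hb) t).le_trans (h1 hb t)).trans_le
        (h4 _ ⟨b, hb, rfl⟩ t))
    exact ⟨z, ⟨z, ψ, le_rfl, h7, h5⟩, h6⟩

theorem exists_upperStar {n : ℕ} {K a : ℚ≥0} (φ : WD n K a) (t : Time a) :
    ∃ X, IsLUB {b : Box (Fin n) K | ∃ θ ∈ φ.carrier, b = θ.1 t} X := by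
  apply Box.exists_isLUB
  rintro _ ⟨θ, hθ, rfl⟩ _ ⟨χ, hχ, rfl⟩ i
  obtain ⟨z, -, hz⟩ := φ.directed {θ, χ} (by simp) (by
    rintro x (rfl | rfl)
    · exact hθ
    · exact hχ)
  have h1 := ((hz θ (by simp)).le t i).1
  have h2 := ((hz χ (by simp)).le t i).2
  exact h1.trans (((z.1 t).lo_le_hi i).trans h2)

/-- The function `φ^* = ⨆ φ` given by a rounded ideal, a pointwise supremum. -/
def upperStar {n : ℕ} {K a : ℚ≥0} (φ : WD n K a) (t : Time a) : Box (Fin n) K :=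
  (exists_upperStar φ t).choose

theorem isLUB_upperStar {n : ℕ} {K a : ℚ≥0} (φ : WD n K a) (t : Time a) :
    IsLUB {b : Box (Fin n) K | ∃ θ ∈ φ.carrier, b = θ.1 t} (upperStar φ t) :=
  (exists_upperStar φ t).choose_spec

/-! ## The domain of vector fields with their derivatives -/

/-- `f` belongs to the single-step tie `δ(O, b)`, for `O` a subset of the domain of `f` and `b` a
hyper-rectangle: `f y - f z ∈ b (y - z)` for all `y, z ∈ O`, where `b (y - z)` is the set of inner
products of the elements of `b` with `y - z`. -/
def IsTie {n : ℕ} (O : Set (Fin n → ℝ)) (b : NonemptyInterval (Fin n → ℝ))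
    (f : (Fin n → ℝ) → ℝ) : Prop :=
  ∀ y ∈ O, ∀ z ∈ O, ∃ p ∈ b, f y - f z = ∑ j, p j * (y j - z j)

/-- The hyper-rectangular `L`-derivative at `x` of a scalar function `f` with domain `S`: the
supremum for reverse inclusion (the intersection) of the hyper-rectangles `b` such that
`f ∈ δ(O, b)` for some relatively open neighbourhood `O` of `x` in `S`. It is the whole space if
there are none. -/
def lDeriv {n : ℕ} (S : Set (Fin n → ℝ)) (f : (Fin n → ℝ) → ℝ) (x : Fin n → ℝ) :
    Set (Fin n → ℝ) :=
  {p | ∀ (U : Set (Fin n → ℝ)) (b : NonemptyInterval (Fin n → ℝ)),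
    IsOpen U → x ∈ U → IsTie (U ∩ S) b f → p ∈ b}

/-- The `L`-derivative of a vector field on `S`, as the set of the matrices whose `i`-th row lies in
the `L`-derivative of the `i`-th component. -/
def lDerivMat {n : ℕ} (S : Set (Fin n → ℝ)) (h : (Fin n → ℝ) → Fin n → ℝ) (x : Fin n → ℝ) :
    Set (Fin n × Fin n → ℝ) :=
  {A | ∀ i, (fun j => A (i, j)) ∈ lDeriv S (fun y => h y i) x}

/-- `w` is below the canonical interval extension `α ↦ ⨅ x ∈ α, g x` of the set-valued map `g`
(in the reverse inclusion order): every `w α` encloses all the sets `g x`, `x ∈ α`. -/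
def BelowExtension {ι κ : Type*} {R R' : ℚ≥0} (w : Box ι R → Box κ R')
    (g : (ι → ℝ) → Set (κ → ℝ)) : Prop :=
  ∀ α : Box ι R, ∀ x ∈ α.toSet, g x ⊆ (w α).toSet

/-- The domain of consistent pairs `(u, u')` of Scott-continuous interval maps: some
`h : [-K, K]^n → [-M, M]^n` is approximated by `u` and its `L`-derivative is approximated
by `u'`. -/
@[ext]
structure V1 (n : ℕ) (K M M₁ : ℚ≥0) where
  u : Box (Fin n) K → Box (Fin n) M
  u' : Box (Fin n) K → Box (Fin n × Fin n) M₁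
  u_cont : ScottContinuous u
  u'_cont : ScottContinuous u'
  consistent : ∃ h : (Fin n → ℝ) → Fin n → ℝ,
    MapsTo h (Box.cube (Fin n) K) (Box.cube (Fin n) M) ∧
    BelowExtension u (fun x => {h x}) ∧
    BelowExtension u' (lDerivMat (Box.cube (Fin n) K) h)

/-- Pairs are ordered pointwise. -/
instance (n : ℕ) (K M M₁ : ℚ≥0) : PartialOrder (V1 n K M M₁) :=
  PartialOrder.lift (fun v => (v.u, v.u')) fun _ _ h =>
    V1.ext (congrArg Prod.fst h) (congrArg Prod.snd h)

/-- The least pair: both components are constantly the least hyper-rectangle. -/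
instance (n : ℕ) (K M M₁ : ℚ≥0) : OrderBot (V1 n K M M₁) where
  bot :=
    { u := fun _ => ⊥
      u' := fun _ => ⊥
      u_cont := ScottContinuous.const _
      u'_cont := ScottContinuous.const _
      consistent := by
        refine ⟨fun _ _ => 0, ?_, ?_, ?_⟩
        · exact fun _ _ => ⟨fun i => (Box.zero (R := M)).neg_le_lo i,
            fun i => (Box.zero (R := M)).hi_le i⟩
        · rintro α x - y hy
          rw [mem_singleton_iff] at hy
          subst hy
          exact ⟨fun i => (Box.zero (R := M)).neg_le_lo i, fun i => (Box.zero (R := M)).hi_le i⟩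
        · rintro α x - A hA
          have h0 : ∀ i j, A (i, j) = 0 := fun i j => by
            have := hA i univ (NonemptyInterval.pure 0) isOpen_univ trivial
              (fun y _ z _ => ⟨0, NonemptyInterval.mem_pure_self 0, by simp⟩)
            have h2 := NonemptyInterval.mem_def.1 this
            exact le_antisymm (h2.2 j) (h2.1 j)
          have hM := nnratCast_nonneg M₁
          refine ⟨fun ij => ?_, fun ij => ?_⟩
          · rw [show ij = (ij.1, ij.2) from rfl, h0, Box.bot_lo]; linarith
          · rw [show ij = (ij.1, ij.2) from rfl, h0, Box.bot_hi]; exact hM }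
  bot_le v := ⟨fun α => bot_le (a := v.u α), fun α => bot_le (a := v.u' α)⟩

/-! ## The second-order Euler operator -/

/-- Rational partitions `0 = q 0 < q 1 < … < q k = a` of `[0, a]`, with `k ≥ 1`. -/
structure RatPartition (a : ℚ≥0) where
  k : ℕ
  one_le_k : 1 ≤ k
  q : Fin (k + 1) → ℚ
  strictMono : StrictMono q
  q_zero : q 0 = 0
  q_last : q (Fin.last k) = (a : ℚ)

theorem RatPartition.step_pos {a : ℚ≥0} (Q : RatPartition a) (j : Fin Q.k) :
    (0 : ℝ) < ((Q.q j.succ : ℚ) : ℝ) - ((Q.q j.castSucc : ℚ) : ℝ) := by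
  have : Q.q j.castSucc < Q.q j.succ := Q.strictMono Fin.castSucc_lt_succ
  have : ((Q.q j.castSucc : ℚ) : ℝ) < ((Q.q j.succ : ℚ) : ℝ) := by exact_mod_cast this
  linarith

/-- The partition points as elements of `[0, a]`. -/
def RatPartition.pt {a : ℚ≥0} (Q : RatPartition a) (j : Fin (Q.k + 1)) : Time a :=
  ⟨(Q.q j : ℝ), by
    have h1 : Q.q 0 ≤ Q.q j := Q.strictMono.monotone (Fin.zero_le j)
    have h2 : Q.q j ≤ Q.q (Fin.last Q.k) := Q.strictMono.monotone (Fin.le_last j)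
    rw [Q.q_zero] at h1
    rw [Q.q_last] at h2
    constructor
    · exact_mod_cast h1
    · have : ((Q.q j : ℚ) : ℝ) ≤ (((a : ℚ) : ℚ) : ℝ) := by exact_mod_cast h2
      simpa using this⟩

/-- The product of two intervals. -/
def intervalMul (I J : NonemptyInterval ℝ) : NonemptyInterval ℝ where
  fst := min (min (I.fst * J.fst) (I.fst * J.snd)) (min (I.snd * J.fst) (I.snd * J.snd))
  snd := max (max (I.fst * J.fst) (I.fst * J.snd)) (max (I.snd * J.fst) (I.snd * J.snd))
  fst_le_snd := ((min_le_left _ _).trans (min_le_left _ _)).trans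
    ((le_max_left _ _).trans (le_max_left _ _))

/-- The product of an interval matrix and an interval vector. -/
def matVec {n : ℕ} {R R' : ℚ≥0} (A : Box (Fin n × Fin n) R) (v : Box (Fin n) R') (i : Fin n) :
    NonemptyInterval ℝ :=
  ∑ j, intervalMul (A.coord (i, j)) (v.coord j)

/-- The symmetric expansion of an interval by `r ≥ 0`. -/
def symExpand (I : NonemptyInterval ℝ) (r : ℝ) (hr : 0 ≤ r) : NonemptyInterval ℝ :=
  ⟨(I.fst - r, I.snd + r), by
    have := I.fst_le_snd
    change I.fst - r ≤ I.snd + r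
    linarith⟩

/-- The integral of a continuous interval-valued function over `[s, x]`. -/
def integralInterval (f : ℝ → NonemptyInterval ℝ) (s x : ℝ) (h : s ≤ x)
    (h1 : Continuous fun t => (f t).fst) (h2 : Continuous fun t => (f t).snd) :
    NonemptyInterval ℝ :=
  ⟨(∫ t in s..x, (f t).fst, ∫ t in s..x, (f t).snd),
    intervalIntegral.integral_mono_on h (h1.intervalIntegrable _ _) (h2.intervalIntegrable _ _)
      fun t _ => (f t).fst_le_snd⟩

/-- The interval-valued function `t ↦ A + (t - s) B`. -/
def affineInterval (A B : NonemptyInterval ℝ) (s t : ℝ) : NonemptyInterval ℝ :=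
  A + intervalMul (NonemptyInterval.pure (t - s)) B

theorem continuous_affineInterval_fst (A B : NonemptyInterval ℝ) (s : ℝ) :
    Continuous fun t => (affineInterval A B s t).fst := by
  simp only [affineInterval, intervalMul, NonemptyInterval.fst_add, NonemptyInterval.pure]
  fun_prop

theorem continuous_affineInterval_snd (A B : NonemptyInterval ℝ) (s : ℝ) :
    Continuous fun t => (affineInterval A B s t).snd := by
  simp only [affineInterval, intervalMul, NonemptyInterval.snd_add, NonemptyInterval.pure]
  fun_prop

section Euler

variable {n : ℕ} {K M M₁ a : ℚ≥0}

/-- The truncated symmetric expansion of `φ (q_j)` by `M (q_{j+1} - q_j)`. -/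
def eulerG (Q : RatPartition a) (M : ℚ≥0) (φ : Time a → Box (Fin n) K) (j : Fin Q.k) :
    Box (Fin n) K :=
  Box.trunc fun i => symExpand ((φ (Q.pt j.castSucc)).coord i)
    ((M : ℝ) * ((Q.q j.succ : ℝ) - (Q.q j.castSucc : ℝ)))
    (mul_nonneg (nnratCast_nonneg M) (Q.step_pos j).le)

/-- The operator on enclosures: the value is `(0, …, 0)` at `x = 0`, and for
`q_j < x ≤ q_{j+1}` it is the truncation to `[-K, K]^n` of
`φ(q_j) + ∫ t in q_j..x, (u (φ(q_j)) + (t - q_j) (u' · u)(G_j φ))`. -/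
def eulerPhi (Q : RatPartition a) (v : V1 n K M M₁) (φ : Time a → Box (Fin n) K) (x : Time a) :
    Box (Fin n) K :=
  open Classical in
  if h : ∃ j : Fin Q.k, (Q.q j.castSucc : ℝ) < x ∧ (x : ℝ) ≤ (Q.q j.succ : ℝ) then
    Box.trunc fun i =>
      (φ (Q.pt h.choose.castSucc)).coord i +
        integralInterval
          (affineInterval ((v.u (φ (Q.pt h.choose.castSucc))).coord i)
            (matVec (v.u' (eulerG Q M φ h.choose)) (v.u (eulerG Q M φ h.choose)) i)
            (Q.q h.choose.castSucc : ℝ))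
          (Q.q h.choose.castSucc : ℝ) x h.choose_spec.1.le
          (continuous_affineInterval_fst _ _ _) (continuous_affineInterval_snd _ _ _)
  else Box.zero

/-- The second-order Euler operator on the domain of rounded ideals. -/
def eulerF (Q : RatPartition a) (v : V1 n K M M₁) (φ : WD n K a) : WD n K a :=
  lowerStar (eulerPhi Q v (upperStar φ))

end Euler

/-! ## Enumerations of the bases -/

/-- Codes of rational numbers. -/
abbrev RatCode := ℕ × ℕ × ℕ

/-- The rational number `(p - q) / (r + 1)` with the code `(p, q, r)`. -/
def RatCode.val (c : RatCode) : ℚ := ((c.1 : ℚ) - c.2.1) / (c.2.2 + 1)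

/-- Codes of rational end-points of an interval. -/
abbrev PairCode := RatCode × RatCode

def PairCode.val (c : PairCode) : ℚ × ℚ := (RatCode.val c.1, RatCode.val c.2)

/-- Codes of finite lists of pairs (rational half-open time interval, rational hyper-rectangle). -/
abbrev StepCode (n : ℕ) := List (PairCode × (Fin n → PairCode))

def StepCode.val {n : ℕ} (c : StepCode n) : List ((ℚ × ℚ) × RatBox (Fin n)) :=
  c.map fun e => (PairCode.val e.1, fun i => PairCode.val (e.2 i))

/-- The step function with the given code; it is the least one if the code is not that of a step
function. -/
def StepCode.toStepFun {n : ℕ} (K a : ℚ≥0) (c : StepCode n) : StepFun n K a :=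
  open Classical in
  if h : ∃ θ : StepFun n K a, IsStepFunOf (timeOpen a) (StepCode.val c) θ.1 then h.choose else ⊥

/-- The enumeration of the rational step functions in time. -/
def enumStepFun (n : ℕ) (K a : ℚ≥0) (k : ℕ) : StepFun n K a :=
  match @Encodable.decode (StepCode n) Primcodable.toEncodable k with
  | some c => c.toStepFun K a
  | none => ⊥

/-- The enumeration of the basis `{b_* : b a rational step function}` of the domain of rounded
ideals. -/
def enumWD (n : ℕ) (K a : ℚ≥0) (k : ℕ) : WD n K a := lowerStar (enumStepFun n K a k).1

/-- The Scott open set of the elements that the hyper-rectangle with the rational end-points `d` is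
way-below. -/
def boxOpen {ι : Type*} (R : ℚ≥0) (d : RatBox ι) : Set (Box ι R) :=
  {β | ∃ α : Box ι R, d.Describes α ∧ WayBelow α β}

/-- Codes of pairs of finite lists of pairs of rational hyper-rectangles. -/
abbrev VCode (n : ℕ) :=
  List ((Fin n → PairCode) × (Fin n → PairCode)) ×
    List ((Fin n → PairCode) × (Fin n → Fin n → PairCode))

def VCode.val₁ {n : ℕ} (c : VCode n) : List (RatBox (Fin n) × RatBox (Fin n)) :=
  c.1.map fun e => (fun i => PairCode.val (e.1 i), fun i => PairCode.val (e.2 i))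

def VCode.val₂ {n : ℕ} (c : VCode n) : List (RatBox (Fin n) × RatBox (Fin n × Fin n)) :=
  c.2.map fun e => (fun i => PairCode.val (e.1 i), fun ij => PairCode.val (e.2 ij.1 ij.2))

/-- The consistent pair of step functions with the given code; it is the least pair if the code is
not that of a consistent pair of step functions. -/
def VCode.toV1 {n : ℕ} (K M M₁ : ℚ≥0) (c : VCode n) : V1 n K M M₁ :=
  open Classical in
  if h : ∃ v : V1 n K M M₁, IsStepFunOf (boxOpen K) (VCode.val₁ c) v.u ∧
    IsStepFunOf (boxOpen K) (VCode.val₂ c) v.u' then h.choose else ⊥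

/-- The enumeration of the consistent pairs of rational step functions. -/
def enumV1 (n : ℕ) (K M M₁ : ℚ≥0) (k : ℕ) : V1 n K M M₁ :=
  match @Encodable.decode (VCode n) Primcodable.toEncodable k with
  | some c => c.toV1 K M M₁
  | none => ⊥

end

/-! Everything is reduced to decidable statements about finite rational data and to one uniform
estimate for the Euler operator.

Type-2 computability follows from a general principle, `isComputableMap_of_re`. For a
Scott-continuous `f`, the relation `c i ≪ f x` holds exactly if `c i ≪ f (b m)` for some basis
element `b m ≪ x`. If `c i ≪ f (b m)` is recursively enumerable, a machine that reads a name of `x`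
can dovetail the semi-decisions and list a name of `f x`.

For the rounded ideals, `b_* ≪ φ` means `b ∈ φ` (`WD.lowerStar_wayBelow_iff`), so way-below between
basis elements is the separation order. Two coded step functions only have to be compared at
finitely many times (`exists_testTime`), and the order is decidable.

For the pairs `(u, u')` there are two difficulties. The first is that a directed supremum must again
be consistent. The bound on the `L`-derivative is local and awkward in limits, but for
Scott-continuous `u'` it amounts to bounds on difference quotients along the axes (`AxisBounds`),
and these are closed under pointwise convergence. By Tychonoff, the sets of witnesses of the members
of a directed set are compact, so they have a common point (`V1.exists_isLUB`). The second is that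
consistency of a coded pair has to be decided, since the other codes denote `⊥`. Consistency says
that for each component there is a scalar function with prescribed bounds on its values and slopes
over rational boxes (`VCode.valid_iff_solves`). On a grid fitted to all denominators the bounds
become integers after scaling. Rounding down then preserves them, and multilinear interpolation
leads back from the grid to the cube, so a finite search over integer functions decides the question
(`exists_solves_iff`, `exists_gridSolves_iff`). Way-below between coded pairs is a finite test at
the defining boxes (`V1.wayBelow_iff_stepBelow`); its necessity comes from approximating a pair by
its blurred versions.

On each interval of the partition, the value of the Euler operator is a truncated quadratic
polynomial in time whose coefficients depend on finitely many values of the data (`eulerPhi_eq`).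
Along a directed family these coefficients converge, hence the functions converge uniformly in time.
Since separation from a function survives small uniform perturbations (`SepFun.exists_of_approx`),
the operator is Scott-continuous. On basis elements the coefficients are rational, and the operator
is Lipschitz on each partition interval with an explicit constant. Separation from it is therefore
verified by finitely many rational comparisons on a sufficiently fine grid (`GridTest`), and a
search over the mesh makes the relation recursively enumerable. -/

noncomputable section

/-! ## Recursive enumerability -/

section Computability

variable {α β : Type*} [Primcodable α] [Primcodable β]

/-- Projection of a primitive recursive predicate along a number variable. -/
theorem REPred.exists_nat {p : α → ℕ → Prop} (hp : PrimrecPred fun x : α × ℕ => p x.1 x.2) :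
    REPred fun a => ∃ k, p a k := by
  classical
  have h : Partrec fun a => Nat.rfind fun k => Part.some (decide (p a k)) :=
    Partrec.rfind (hp.computablePred.decide.partrec)
  refine h.dom_re.of_eq fun a => ?_
  refine Nat.rfind_dom'.trans ?_
  simp

/-- A recursively enumerable predicate is the projection of a decidable one. -/
theorem REPred.exists_stage {p : α → Prop} (hp : REPred p) :
    ∃ f : α → ℕ → Bool, Primrec₂ f ∧ ∀ a, p a ↔ ∃ k, f a k = true := by
  obtain ⟨c, hc⟩ := Nat.Partrec.Code.exists_code.1 hp
  -- The stage `k` bounds the resources granted to a program for the semi-decision; bounded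
  -- evaluation is primitive recursive, monotone and exhausts the computation.
  refine ⟨fun a k => (Nat.Partrec.Code.evaln k c (Encodable.encode a)).isSome, ?_, fun a => ?_⟩
  · refine Primrec.option_isSome.comp ?_
    exact Nat.Partrec.Code.primrec_evaln.comp
      ((Primrec.snd.pair (Primrec.const c)).pair (Primrec.encode.comp Primrec.fst))
  · have h1 : p a ↔ (Nat.Partrec.Code.eval c (Encodable.encode a)).Dom := by
      rw [hc]
      simp [Part.assert]
    rw [h1, Part.dom_iff_mem]
    constructor
    · rintro ⟨y, hy⟩
      obtain ⟨k, hk⟩ := Nat.Partrec.Code.evaln_complete.1 hy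
      exact ⟨k, by simp [Option.mem_def.1 hk]⟩
    · rintro ⟨k, hk⟩
      obtain ⟨y, hy⟩ := Option.isSome_iff_exists.1 hk
      exact ⟨y, Nat.Partrec.Code.evaln_sound (Option.mem_def.2 hy)⟩

theorem PrimrecPred.forall_mem {f : α → List β} (hf : Primrec f) {p : α → β → Prop}
    (hp : PrimrecPred fun x : α × β => p x.1 x.2) : PrimrecPred fun a => ∀ b ∈ f a, p a b := by
  have h : PrimrecRel fun (b : β) (a : α) => p a b := PrimrecPred.comp hp (Primrec.snd.pair Primrec.fst)
  exact h.forall_mem_list.comp hf Primrec.id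

theorem PrimrecPred.exists_mem {f : α → List β} (hf : Primrec f) {p : α → β → Prop}
    (hp : PrimrecPred fun x : α × β => p x.1 x.2) : PrimrecPred fun a => ∃ b ∈ f a, p a b := by
  have h : PrimrecRel fun (b : β) (a : α) => p a b := PrimrecPred.comp hp (Primrec.snd.pair Primrec.fst)
  exact h.exists_mem_list.comp hf Primrec.id

theorem PrimrecPred.const (p : Prop) : PrimrecPred fun _ : α => p := by
  classical
  exact ⟨fun _ => Classical.dec _, Primrec.const _⟩

theorem PrimrecPred.imp {p q : α → Prop} (hp : PrimrecPred p) (hq : PrimrecPred q) :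
    PrimrecPred fun a => p a → q a :=
  (hp.not.or hq).of_eq fun a => by tauto

/-- The index type needs no coding: one primitive recursive test per index is conjoined, along an
induction on finite subsets. -/
theorem PrimrecPred.forall_finite {ι : Type*} [Finite ι] {p : ι → α → Prop}
    (hp : ∀ i, PrimrecPred (p i)) : PrimrecPred fun a => ∀ i, p i a := by
  have : ∀ S : Set ι, S.Finite → PrimrecPred fun a => ∀ i ∈ S, p i a := by
    intro S hS
    induction S, hS using Set.Finite.induction_on with
    | empty => exact (PrimrecPred.const True).of_eq (by simp)
    | @insert i S _ _ ih =>
      exact ((hp i).and ih).of_eq (by simp)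
  exact (this univ finite_univ).of_eq (by simp)

/-- The list of all lists of length `m` with entries less than `B`. -/
def allLists (B : ℕ) : ℕ → List (List ℕ)
  | 0 => [[]]
  | m + 1 => (allLists B m).flatMap fun l => (List.range B).map fun x => x :: l

theorem mem_allLists {B m : ℕ} {l : List ℕ} :
    l ∈ allLists B m ↔ l.length = m ∧ ∀ x ∈ l, x < B := by
  induction m generalizing l with
  | zero => simp only [allLists, List.mem_singleton]; constructor
            · rintro rfl; simp
            · rintro ⟨h, -⟩; exact List.length_eq_zero_iff.1 h
  | succ m ih =>
    simp only [allLists, List.mem_flatMap, List.mem_map, List.mem_range, ih]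
    constructor
    · rintro ⟨l, ⟨h1, h2⟩, x, hx, rfl⟩
      refine ⟨by simp [h1], ?_⟩
      simpa using ⟨hx, h2⟩
    · rintro ⟨h1, h2⟩
      cases l with
      | nil => simp at h1
      | cons x l =>
        simp only [List.mem_cons, forall_eq_or_imp] at h2
        exact ⟨l, ⟨by simpa using h1, h2.2⟩, x, h2.1, rfl⟩

theorem primrec_allLists : Primrec₂ allLists := by
  have h : Primrec₂ fun (B : ℕ) (m : ℕ) => (Nat.rec [[]] (fun _ L =>
      L.flatMap fun l => (List.range B).map fun x => x :: l) m : List (List ℕ)) := by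
    refine Primrec.nat_rec (α := ℕ) (β := List (List ℕ)) (f := fun _ => [[]])
      (g := fun B q => q.2.flatMap fun l => (List.range B).map fun x => x :: l)
      (Primrec.const _) ?_
    refine Primrec.list_flatMap (Primrec.snd.comp Primrec.snd) ?_
    refine Primrec.list_map (Primrec.list_range.comp (Primrec.fst.comp Primrec.fst)) ?_
    exact Primrec.list_cons.comp Primrec.snd (Primrec.snd.comp Primrec.fst)
  refine h.of_eq fun B m => ?_
  induction m with
  | zero => rfl
  | succ m ih => simp only [allLists, ← ih]

end Computability

/-! ## Primitive recursive families of rational numbers -/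

section RatPrim

theorem RatCode.exists_val (x : ℚ) : ∃ c : RatCode, c.val = x := by
  refine ⟨(x.num.toNat, (-x.num).toNat, x.den - 1), ?_⟩
  have h1 : ((x.num.toNat : ℚ) - ((-x.num).toNat : ℚ)) = x.num := by
    have := Int.toNat_sub_toNat_neg x.num
    exact_mod_cast this
  have h2 : ((x.den - 1 : ℕ) : ℚ) + 1 = x.den := by
    have := x.den_pos
    push_cast [Nat.cast_sub this]
    ring
  simp only [RatCode.val]
  rw [h1, h2, Rat.num_div_den]

/-- The rational number `f a` has a code that depends on `a` primitive recursively. -/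
def RatPrim {α : Type*} [Primcodable α] (f : α → ℚ) : Prop :=
  ∃ g : α → RatCode, Primrec g ∧ ∀ a, (g a).val = f a

variable {α β : Type*} [Primcodable α] [Primcodable β] {f g : α → ℚ}

namespace RatPrim

theorem of_eq (hf : RatPrim f) (h : ∀ a, f a = g a) : RatPrim g :=
  (funext h : f = g) ▸ hf

theorem const (x : ℚ) : RatPrim fun _ : α => x := by
  obtain ⟨c, hc⟩ := RatCode.exists_val x
  exact ⟨fun _ => c, Primrec.const c, fun _ => hc⟩

theorem val {h : α → RatCode} (hh : Primrec h) : RatPrim fun a => (h a).val := ⟨h, hh, fun _ => rfl⟩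

theorem natCast {h : α → ℕ} (hh : Primrec h) : RatPrim fun a => (h a : ℚ) :=
  ⟨fun a => (h a, 0, 0), hh.pair (Primrec.const _), fun a => by simp [RatCode.val]⟩

theorem comp {f : β → ℚ} (hf : RatPrim f) {h : α → β} (hh : Primrec h) :
    RatPrim fun a => f (h a) := by
  obtain ⟨k, hk, hkf⟩ := hf
  exact ⟨fun a => k (h a), hk.comp hh, fun a => hkf _⟩

theorem add (hf : RatPrim f) (hg : RatPrim g) : RatPrim fun a => f a + g a := by
  obtain ⟨k, hk, hkf⟩ := hf
  obtain ⟨l, hl, hlg⟩ := hg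
  -- A code stores its denominator minus one, so the last entry has to be `(k + 1) * (l + 1) - 1`,
  -- written without subtraction.
  refine ⟨fun a => ((k a).1 * ((l a).2.2 + 1) + (l a).1 * ((k a).2.2 + 1),
    (k a).2.1 * ((l a).2.2 + 1) + (l a).2.1 * ((k a).2.2 + 1),
    (k a).2.2 * (l a).2.2 + (k a).2.2 + (l a).2.2), ?_, fun a => ?_⟩
  · have k1 := Primrec.fst.comp hk
    have k2 := Primrec.fst.comp (Primrec.snd.comp hk)
    have k3 := Primrec.snd.comp (Primrec.snd.comp hk)
    have l1 := Primrec.fst.comp hl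
    have l2 := Primrec.fst.comp (Primrec.snd.comp hl)
    have l3 := Primrec.snd.comp (Primrec.snd.comp hl)
    have k3' := Primrec.succ.comp k3
    have l3' := Primrec.succ.comp l3
    exact (Primrec.nat_add.comp (Primrec.nat_mul.comp k1 l3') (Primrec.nat_mul.comp l1 k3')).pair
      ((Primrec.nat_add.comp (Primrec.nat_mul.comp k2 l3') (Primrec.nat_mul.comp l2 k3')).pair
      (Primrec.nat_add.comp (Primrec.nat_add.comp (Primrec.nat_mul.comp k3 l3) k3) l3))
  · beta_reduce
    rw [← hkf, ← hlg]
    have h1 : ((k a).2.2 : ℚ) + 1 ≠ 0 := by positivity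
    have h2 : ((l a).2.2 : ℚ) + 1 ≠ 0 := by positivity
    have h3 : ((k a).2.2 : ℚ) * (l a).2.2 + (k a).2.2 + (l a).2.2 + 1 ≠ 0 := by positivity
    simp only [RatCode.val]
    push_cast
    field_simp
    ring

theorem neg (hf : RatPrim f) : RatPrim fun a => -f a := by
  obtain ⟨k, hk, hkf⟩ := hf
  refine ⟨fun a => ((k a).2.1, (k a).1, (k a).2.2), ?_, fun a => ?_⟩
  · exact (Primrec.fst.comp (Primrec.snd.comp hk)).pair ((Primrec.fst.comp hk).pair
      (Primrec.snd.comp (Primrec.snd.comp hk)))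
  · beta_reduce
    rw [← hkf]
    simp only [RatCode.val]
    ring

theorem sub (hf : RatPrim f) (hg : RatPrim g) : RatPrim fun a => f a - g a :=
  (hf.add hg.neg).of_eq fun _ => (sub_eq_add_neg _ _).symm

theorem mul (hf : RatPrim f) (hg : RatPrim g) : RatPrim fun a => f a * g a := by
  obtain ⟨k, hk, hkf⟩ := hf
  obtain ⟨l, hl, hlg⟩ := hg
  refine ⟨fun a => ((k a).1 * (l a).1 + (k a).2.1 * (l a).2.1,
    (k a).1 * (l a).2.1 + (k a).2.1 * (l a).1,
    (k a).2.2 * (l a).2.2 + (k a).2.2 + (l a).2.2), ?_, fun a => ?_⟩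
  · have k1 := Primrec.fst.comp hk
    have k2 := Primrec.fst.comp (Primrec.snd.comp hk)
    have k3 := Primrec.snd.comp (Primrec.snd.comp hk)
    have l1 := Primrec.fst.comp hl
    have l2 := Primrec.fst.comp (Primrec.snd.comp hl)
    have l3 := Primrec.snd.comp (Primrec.snd.comp hl)
    exact (Primrec.nat_add.comp (Primrec.nat_mul.comp k1 l1) (Primrec.nat_mul.comp k2 l2)).pair
      ((Primrec.nat_add.comp (Primrec.nat_mul.comp k1 l2) (Primrec.nat_mul.comp k2 l1)).pair
      (Primrec.nat_add.comp (Primrec.nat_add.comp (Primrec.nat_mul.comp k3 l3) k3) l3))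
  · beta_reduce
    rw [← hkf, ← hlg]
    have h1 : ((k a).2.2 : ℚ) + 1 ≠ 0 := by positivity
    have h2 : ((l a).2.2 : ℚ) + 1 ≠ 0 := by positivity
    have h3 : ((k a).2.2 : ℚ) * (l a).2.2 + (k a).2.2 + (l a).2.2 + 1 ≠ 0 := by positivity
    simp only [RatCode.val]
    push_cast
    field_simp
    ring

theorem inv_succ {h : α → ℕ} (hh : Primrec h) : RatPrim fun a => ((h a : ℚ) + 1)⁻¹ :=
  ⟨fun a => (1, 0, h a), (Primrec.const _).pair ((Primrec.const _).pair hh),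
    fun a => by simp [RatCode.val]⟩

/-- Cross-multiplication, with the subtracted parts moved to the other side, leaves a comparison of
natural numbers. -/
theorem le (hf : RatPrim f) (hg : RatPrim g) : PrimrecPred fun a => f a ≤ g a := by
  obtain ⟨k, hk, hkf⟩ := hf
  obtain ⟨l, hl, hlg⟩ := hg
  have k1 := Primrec.fst.comp hk
  have k2 := Primrec.fst.comp (Primrec.snd.comp hk)
  have k3 := Primrec.succ.comp (Primrec.snd.comp (Primrec.snd.comp hk))
  have l1 := Primrec.fst.comp hl
  have l2 := Primrec.fst.comp (Primrec.snd.comp hl)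
  have l3 := Primrec.succ.comp (Primrec.snd.comp (Primrec.snd.comp hl))
  refine (Primrec.nat_le.comp
    (Primrec.nat_add.comp (Primrec.nat_mul.comp k1 l3) (Primrec.nat_mul.comp l2 k3))
    (Primrec.nat_add.comp (Primrec.nat_mul.comp l1 k3) (Primrec.nat_mul.comp k2 l3))).of_eq
    fun a => ?_
  rw [← hkf, ← hlg]
  have h1 : (0 : ℚ) < ((k a).2.2 : ℚ) + 1 := by positivity
  have h2 : (0 : ℚ) < ((l a).2.2 : ℚ) + 1 := by positivity
  simp only [RatCode.val]
  rw [div_le_div_iff₀ h1 h2, ← Nat.cast_le (α := ℚ)]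
  push_cast
  constructor <;> intro h <;> linarith

theorem lt (hf : RatPrim f) (hg : RatPrim g) : PrimrecPred fun a => f a < g a :=
  (hg.le hf).not.of_eq fun _ => not_le

theorem eq (hf : RatPrim f) (hg : RatPrim g) : PrimrecPred fun a => f a = g a :=
  ((hf.le hg).and (hg.le hf)).of_eq fun _ => le_antisymm_iff.symm

theorem ite {p : α → Prop} [DecidablePred p] (hp : PrimrecPred p) (hf : RatPrim f)
    (hg : RatPrim g) : RatPrim fun a => if p a then f a else g a := by
  obtain ⟨k, hk, hkf⟩ := hf
  obtain ⟨l, hl, hlg⟩ := hg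
  refine ⟨fun a => if p a then k a else l a, Primrec.ite hp hk hl, fun a => ?_⟩
  beta_reduce
  split_ifs
  · exact hkf a
  · exact hlg a

theorem max (hf : RatPrim f) (hg : RatPrim g) : RatPrim fun a => max (f a) (g a) :=
  (ite (hf.le hg) hg hf).of_eq fun _ => (max_def _ _).symm

theorem min (hf : RatPrim f) (hg : RatPrim g) : RatPrim fun a => min (f a) (g a) :=
  (ite (hf.le hg) hf hg).of_eq fun _ => (min_def _ _).symm

theorem sum {ι : Type*} (s : Finset ι) {f : ι → α → ℚ} (hf : ∀ i, RatPrim (f i)) :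
    RatPrim fun a => ∑ i ∈ s, f i a := by
  classical
  induction s using Finset.induction_on with
  | empty => exact (RatPrim.const 0).of_eq fun a => by simp
  | insert i s hi ih => exact ((hf i).add ih).of_eq fun a => by simp [hi]

/-- The fold is run on codes. Since `F` sees the accumulator only through its value, the result
codes the fold of the values, whichever codes occur on the way. -/
theorem foldr {l : α → List β} (hl : Primrec l) (hg : RatPrim g)
    {F : α → β → ℚ → ℚ}
    (hF : RatPrim fun x : α × β × RatCode => F x.1 x.2.1 x.2.2.val) :
    RatPrim fun a => (l a).foldr (F a) (g a) := by
  obtain ⟨k, hk, hkg⟩ := hg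
  obtain ⟨m, hm, hmF⟩ := hF
  refine ⟨fun a => (l a).foldr (fun b c => m (a, b, c)) (k a), ?_, fun a => ?_⟩
  · exact Primrec.list_foldr hl hk (Primrec.to₂ hm)
  · beta_reduce
    rw [← hkg]
    induction l a with
    | nil => rfl
    | cons b t ih => simp only [List.foldr_cons, ← ih, hmF]

end RatPrim

end RatPrim

/-! ## Continuous domains -/

section DomainLemmas

variable {D E : Type*} [PartialOrder D] [PartialOrder E]

theorem IsBot.wayBelow {x : D} (hx : IsBot x) (y : D) : WayBelow x y := by
  rintro X ⟨d, hd⟩ - s - -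
  exact ⟨d, hd, hx d⟩

/-- The basis elements that are way-below some basis element `b k ≪ y` are directed with supremum
`y`; the definition of `x ≪ y` applied to this set places `x` below one of them. -/
theorem EffectivelyGiven.interpolate {b : ℕ → D} (hb : EffectivelyGiven b) {x y : D}
    (h : WayBelow x y) : ∃ k, WayBelow x (b k) ∧ WayBelow (b k) y := by
  let X : Set D := {d | d ∈ range b ∧ ∃ k, WayBelow d (b k) ∧ WayBelow (b k) y}
  have hne : X.Nonempty := by
    obtain ⟨_, ⟨k, rfl⟩, hk⟩ := hb.basis_nonempty y
    obtain ⟨d, hd, hdk⟩ := hb.basis_nonempty (b k)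
    exact ⟨d, hd, k, hdk, hk⟩
  have hdir : DirectedOn (· ≤ ·) X := by
    rintro d₁ ⟨hd₁, k₁, h1, h1'⟩ d₂ ⟨hd₂, k₂, h2, h2'⟩
    obtain ⟨_, ⟨⟨k, rfl⟩, hk⟩, h3, h4⟩ :=
      hb.basis_directed y _ ⟨⟨k₁, rfl⟩, h1'⟩ _ ⟨⟨k₂, rfl⟩, h2'⟩
    obtain ⟨d, ⟨hd, hdk⟩, h5, h6⟩ :=
      hb.basis_directed (b k) _ ⟨hd₁, h1.trans_le h3⟩ _ ⟨hd₂, h2.trans_le h4⟩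
    exact ⟨d, ⟨hd, k, hdk, hk⟩, h5, h6⟩
  have hsup : IsLUB X y := by
    refine ⟨?_, fun z hz => (hb.basis_sup y).2 ?_⟩
    · rintro d ⟨-, k, h1, h2⟩
      exact h1.le.trans h2.le
    · rintro _ ⟨⟨k, rfl⟩, hk⟩
      refine (hb.basis_sup (b k)).2 ?_
      rintro d ⟨hd, hdk⟩
      exact hz ⟨hd, k, hdk, hk⟩
  obtain ⟨d, ⟨-, k, h1, h2⟩, hxd⟩ := h hne hdir hsup le_rfl
  exact ⟨k, h1.le_trans hxd, h2⟩

/-- The directed sets `X ×ˢ {y'}` and `{x'} ×ˢ X` isolate one coordinate. Conversely, the elements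
found for the two projections of a directed set have a common upper bound in it. -/
theorem wayBelow_prod_iff {x x' : D} {y y' : E} :
    WayBelow (x, y) (x', y') ↔ WayBelow x x' ∧ WayBelow y y' := by
  constructor
  · intro h
    constructor
    · intro X hX hdir s hs hle
      obtain ⟨⟨d, e⟩, ⟨hd, -⟩, hde⟩ := h (X := X ×ˢ {y'}) (hX.prod (singleton_nonempty _))
        (by
          rintro ⟨d, e⟩ ⟨hd, he⟩ ⟨d', e'⟩ ⟨hd', he'⟩
          obtain ⟨c, hc, h1, h2⟩ := hdir d hd d' hd'
          rw [mem_singleton_iff] at he he'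
          exact ⟨(c, y'), ⟨hc, rfl⟩, ⟨h1, he.le⟩, ⟨h2, he'.le⟩⟩)
        (s := (s, y')) (by
          rw [isLUB_prod]
          rw [fst_image_prod _ (singleton_nonempty _), snd_image_prod hX]
          exact ⟨hs, isLUB_singleton⟩) ⟨hle, le_rfl⟩
      exact ⟨d, hd, hde.1⟩
    · intro X hX hdir s hs hle
      obtain ⟨⟨d, e⟩, ⟨-, he⟩, hde⟩ := h (X := {x'} ×ˢ X) ((singleton_nonempty _).prod hX)
        (by
          rintro ⟨d, e⟩ ⟨hd, he⟩ ⟨d', e'⟩ ⟨hd', he'⟩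
          obtain ⟨c, hc, h1, h2⟩ := hdir e he e' he'
          rw [mem_singleton_iff] at hd hd'
          exact ⟨(x', c), ⟨rfl, hc⟩, ⟨hd.le, h1⟩, ⟨hd'.le, h2⟩⟩)
        (s := (x', s)) (by
          rw [isLUB_prod]
          rw [fst_image_prod _ hX, snd_image_prod (singleton_nonempty _)]
          exact ⟨isLUB_singleton, hs⟩) ⟨le_rfl, hle⟩
      exact ⟨e, he, hde.2⟩
  · rintro ⟨h1, h2⟩ X hX hdir ⟨s, t⟩ hs ⟨hle1, hle2⟩
    obtain ⟨hs1, hs2⟩ := isLUB_prod.1 hs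
    obtain ⟨_, ⟨d, hd, rfl⟩, hd'⟩ := h1 (hX.image _)
      (by
        rintro _ ⟨p, hp, rfl⟩ _ ⟨q, hq, rfl⟩
        obtain ⟨r, hr, h3, h4⟩ := hdir p hp q hq
        exact ⟨_, ⟨r, hr, rfl⟩, h3.1, h4.1⟩) hs1 hle1
    obtain ⟨_, ⟨e, he, rfl⟩, he'⟩ := h2 (hX.image _)
      (by
        rintro _ ⟨p, hp, rfl⟩ _ ⟨q, hq, rfl⟩
        obtain ⟨r, hr, h3, h4⟩ := hdir p hp q hq
        exact ⟨_, ⟨r, hr, rfl⟩, h3.2, h4.2⟩) hs2 hle2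
    obtain ⟨r, hr, h3, h4⟩ := hdir d hd e he
    exact ⟨r, hr, hd'.trans h3.1, he'.trans h4.2⟩

/-- The elements of the enumerated set `b` way-below `x`. -/
def wayBelowBasis (b : ℕ → D) (x : D) : Set D := {d | d ∈ range b ∧ WayBelow d x}

theorem wayBelowBasis_prodEnum (b : ℕ → D) (c : ℕ → E) (x : D) (y : E) :
    wayBelowBasis (prodEnum b c) (x, y) = wayBelowBasis b x ×ˢ wayBelowBasis c y := by
  ext ⟨d, e⟩
  simp only [wayBelowBasis, mem_ofPred_eq, mem_prod, wayBelow_prod_iff]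
  constructor
  · rintro ⟨⟨k, hk⟩, h1, h2⟩
    exact ⟨⟨⟨_, congrArg Prod.fst hk⟩, h1⟩, ⟨_, congrArg Prod.snd hk⟩, h2⟩
  · rintro ⟨⟨⟨i, rfl⟩, h1⟩, ⟨j, rfl⟩, h2⟩
    exact ⟨⟨Nat.pair i j, by simp [prodEnum]⟩, h1, h2⟩

/-- The elements of the enumerated set `b` form a basis of the continuous domain `D`. -/
structure IsDomainBasis (b : ℕ → D) : Prop where
  nonempty : ∀ x : D, (wayBelowBasis b x).Nonempty
  directed : ∀ x : D, DirectedOn (· ≤ ·) (wayBelowBasis b x)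
  sup : ∀ x : D, IsLUB (wayBelowBasis b x) x

theorem IsDomainBasis.prodEnum {b : ℕ → D} {c : ℕ → E} (hb : IsDomainBasis b)
    (hc : IsDomainBasis c) : IsDomainBasis (prodEnum b c) where
  nonempty := by
    rintro ⟨x, y⟩
    rw [wayBelowBasis_prodEnum]
    exact (hb.nonempty x).prod (hc.nonempty y)
  directed := by
    rintro ⟨x, y⟩
    rw [wayBelowBasis_prodEnum]
    rintro ⟨d, e⟩ ⟨hd, he⟩ ⟨d', e'⟩ ⟨hd', he'⟩
    obtain ⟨p, hp, h1, h2⟩ := hb.directed x d hd d' hd'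
    obtain ⟨q, hq, h3, h4⟩ := hc.directed y e he e' he'
    exact ⟨(p, q), ⟨hp, hq⟩, ⟨h1, h3⟩, ⟨h2, h4⟩⟩
  sup := by
    rintro ⟨x, y⟩
    rw [wayBelowBasis_prodEnum, isLUB_prod, fst_image_prod _ (hc.nonempty y),
      snd_image_prod (hb.nonempty x)]
    exact ⟨hb.sup x, hc.sup y⟩

/-- To obtain a basis it is enough to have, below every element, a directed set of enumerated
elements way-below it with the right supremum. -/
theorem isDomainBasis_of_directed {b : ℕ → D} (F : D → Set D) (hne : ∀ x, (F x).Nonempty)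
    (hdir : ∀ x, DirectedOn (· ≤ ·) (F x)) (hsup : ∀ x, IsLUB (F x) x)
    (hF : ∀ x, ∀ d ∈ F x, d ∈ range b ∧ WayBelow d x) : IsDomainBasis b where
  nonempty x := (hne x).mono (hF x)
  directed x := by
    rintro d ⟨hd, hdx⟩ e ⟨he, hex⟩
    obtain ⟨d', hd', h1⟩ := hdx (hne x) (hdir x) (hsup x) le_rfl
    obtain ⟨e', he', h2⟩ := hex (hne x) (hdir x) (hsup x) le_rfl
    obtain ⟨c, hc, h3, h4⟩ := hdir x d' hd' e' he'
    exact ⟨c, hF x c hc, h1.trans h3, h2.trans h4⟩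
  sup x := ⟨fun _ hd => hd.2.le, fun _ hz => (hsup x).2 fun d hd => hz (hF x d hd)⟩

/-- Interpolate `c i ≪ c k ≪ f x`. By Scott continuity `f x` is the directed supremum of the `f (b
m)` with `b m ≪ x`, so one of these is already above `c k`. This turns a statement on `x` into one
on the entries of a name of `x`. -/
theorem wayBelow_map_iff {b : ℕ → D} {c : ℕ → E} (hb : IsDomainBasis b)
    (hc : EffectivelyGiven c) {f : D → E} (hf : ScottContinuous f) (i : ℕ) (x : D) :
    WayBelow (c i) (f x) ↔ ∃ m, WayBelow (b m) x ∧ WayBelow (c i) (f (b m)) := by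
  constructor
  · intro h
    obtain ⟨k, h1, h2⟩ := hc.interpolate h
    have hdir : DirectedOn (· ≤ ·) (f '' wayBelowBasis b x) := by
      rintro _ ⟨d, hd, rfl⟩ _ ⟨e, he, rfl⟩
      obtain ⟨z, hz, h3, h4⟩ := hb.directed x d hd e he
      exact ⟨_, ⟨z, hz, rfl⟩, hf.monotone h3, hf.monotone h4⟩
    obtain ⟨_, ⟨_, ⟨⟨m, rfl⟩, hm⟩, rfl⟩, hle⟩ := h2 ((hb.nonempty x).image f) hdir
      (hf (hb.nonempty x) (hb.directed x) (hb.sup x)) le_rfl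
    exact ⟨m, hm, h1.trans_le hle⟩
  · rintro ⟨m, h1, h2⟩
    exact h2.trans_le (hf.monotone h1.le)

/-- The entry at stage `t = ⟨i, k, s⟩` of the output name: the index `i` if the relation tested by
`F` has been verified within `s` steps for `i` and the `k`-th entry of the input. -/
def nameEntry (F : ℕ × ℕ → ℕ → Bool) (s : List ℕ) (t : ℕ) : ℕ :=
  Option.elim (s[t.unpair.2.unpair.1]?) 0
    (fun m => bif F (t.unpair.1, m) t.unpair.2.unpair.2 then t.unpair.1 else 0)

theorem primrec_nameEntry {F : ℕ × ℕ → ℕ → Bool} (hF : Primrec₂ F) : Primrec₂ (nameEntry F) := by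
  have hu : Primrec fun x : List ℕ × ℕ => x.2.unpair := Primrec.unpair.comp Primrec.snd
  have hv : Primrec fun x : List ℕ × ℕ => x.2.unpair.2.unpair :=
    Primrec.unpair.comp (Primrec.snd.comp hu)
  have h : Primrec fun x : List ℕ × ℕ =>
      (Option.casesOn (x.1[x.2.unpair.2.unpair.1]?) 0
        (fun m => bif F (x.2.unpair.1, m) x.2.unpair.2.unpair.2 then x.2.unpair.1 else 0) : ℕ) := by
    refine Primrec.option_casesOn
      (Primrec.list_getElem?.comp Primrec.fst (Primrec.fst.comp hv)) (Primrec.const 0) ?_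
    refine Primrec.cond ?_ (Primrec.fst.comp (hu.comp Primrec.fst)) (Primrec.const 0)
    exact hF.comp ((Primrec.fst.comp (hu.comp Primrec.fst)).pair Primrec.snd)
      (Primrec.snd.comp (hv.comp Primrec.fst))
  refine h.of_eq fun x => ?_
  unfold nameEntry
  cases x.1[x.2.unpair.2.unpair.1]? <;> rfl

/-- Dovetailing: stage `⟨i, k, s⟩` emits `i` if `s` verifies the relation for `i` and the `k`-th
input entry. Otherwise it emits `0`, which is harmless because `c 0 = ⊥` belongs to every name. -/
theorem isComputableMap_of_re {b : ℕ → D} {c : ℕ → E} (hb : IsDomainBasis b)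
    (hc : EffectivelyGiven c) {f : D → E} (hf : ScottContinuous f)
    (hre : REPred fun p : ℕ × ℕ => WayBelow (c p.1) (f (b p.2))) : IsComputableMap b c f := by
  obtain ⟨F, hF, hFR⟩ := hre.exists_stage
  -- Stage `t` reads only an input entry of position at most `t`. Thus the first `N` outputs depend
  -- on the first `N` inputs, which makes the word function monotone.
  have hidx : ∀ t : ℕ, t.unpair.2.unpair.1 ≤ t := fun t =>
    (Nat.unpair_left_le _).trans (Nat.unpair_right_le _)
  have hpre : ∀ (s s' : List ℕ), s <+: s' → ∀ t < s.length, nameEntry F s t = nameEntry F s' t := by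
    rintro s _ ⟨r, rfl⟩ t ht
    unfold nameEntry
    rw [List.getElem?_append_left ((hidx t).trans_lt ht)]
  refine ⟨fun s => (List.range s.length).map (nameEntry F s), ?_, ?_, ?_⟩
  · exact (Primrec.list_map (Primrec.list_range.comp Primrec.list_length)
      (primrec_nameEntry hF)).to_comp
  · intro s s' hs
    obtain ⟨k, hk⟩ := Nat.exists_eq_add_of_le hs.length_le
    have : (List.range s.length).map (nameEntry F s) = (List.range s.length).map (nameEntry F s') :=
      List.map_congr_left fun t ht => hpre s s' hs t (List.mem_range.1 ht)
    simp only [this, hk, List.range_add, List.map_append]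
    exact List.prefix_append _ _
  · intro x p hp
    have hlen : ∀ m, (initSeg p m).length = m := fun m => by simp [initSeg]
    let q : ℕ → ℕ := fun t => nameEntry F (initSeg p (t + 1)) t
    have hq : ∀ t, q t = bif F (t.unpair.1, p t.unpair.2.unpair.1) t.unpair.2.unpair.2
        then t.unpair.1 else 0 := by
      intro t
      have : (initSeg p (t + 1))[t.unpair.2.unpair.1]? = some (p t.unpair.2.unpair.1) := by
        simp only [initSeg, List.getElem?_map]
        rw [List.getElem?_range (Nat.lt_succ_of_le (hidx t))]
        rfl
      simp only [q, nameEntry, this, Option.elim]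
    refine ⟨q, ?_, fun N => ⟨N, ?_⟩⟩
    · ext i
      rw [mem_ofPred_eq, wayBelow_map_iff hb hc hf]
      constructor
      · rintro ⟨t, rfl⟩
        rw [hq]
        have hpx : WayBelow (b (p t.unpair.2.unpair.1)) x := by
          have : p t.unpair.2.unpair.1 ∈ range p := mem_range_self _
          rw [hp] at this
          exact this
        refine ⟨_, hpx, ?_⟩
        cases hFt : F (t.unpair.1, p t.unpair.2.unpair.1) t.unpair.2.unpair.2
        · exact hc.bot.wayBelow _
        · exact (hFR _).2 ⟨_, hFt⟩
      · rintro ⟨m, h1, h2⟩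
        have hm : m ∈ range p := by rw [hp]; exact h1
        obtain ⟨k, rfl⟩ := hm
        obtain ⟨st, hst⟩ := (hFR (i, p k)).1 h2
        refine ⟨Nat.pair i (Nat.pair k st), ?_⟩
        rw [hq]
        simp only [Nat.unpair_pair, hst, cond_true]
    · have : initSeg q N = (List.range (initSeg p N).length).map (nameEntry F (initSeg p N)) := by
        rw [hlen]
        refine List.map_congr_left fun t ht => ?_
        have ht := List.mem_range.1 ht
        refine hpre _ _ ?_ t (by rw [hlen]; exact Nat.lt_succ_self t)
        obtain ⟨k, rfl⟩ := Nat.exists_eq_add_of_le (Nat.succ_le_of_lt ht)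
        simp only [initSeg, Nat.succ_eq_add_one, List.range_add, List.map_append]
        exact List.prefix_append _ _
      rw [this]

end DomainLemmas

/-! ## The domain of hyper-rectangles -/

namespace Box

variable {ι κ : Type*} {R R' : ℚ≥0}

theorem le_widen_of {X Y : Box ι R} {ε : ℝ} (hε : 0 ≤ ε)
    (h : ∀ i, (X.lo i = -(R : ℝ) ∨ X.lo i ≤ Y.lo i - ε) ∧ (X.hi i = (R : ℝ) ∨ Y.hi i + ε ≤ X.hi i)) :
    X ≤ widen ε hε Y := by
  intro i
  constructor
  · rcases (h i).1 with h | h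
    · exact h.le.trans (le_max_left _ _)
    · exact h.trans (le_max_right _ _)
  · rcases (h i).2 with h | h
    · exact (min_le_left _ _).trans h.ge
    · exact (min_le_right _ _).trans h

/-- If `X ≪ Y` then `X` is below a proper widening of `Y`; in each direction this widening either
moves by a positive amount or is stopped by the boundary of the cube. -/
theorem wayBelow_iff [Finite ι] {X Y : Box ι R} : WayBelow X Y ↔
    ∀ i, (X.lo i = -(R : ℝ) ∨ X.lo i < Y.lo i) ∧ (X.hi i = (R : ℝ) ∨ Y.hi i < X.hi i) := by
  refine ⟨fun h i => ?_, wayBelow_of_lt⟩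
  obtain ⟨ε, hε, hle⟩ := exists_le_widen h
  have h1 : X.lo i ≤ max (-(R : ℝ)) (Y.lo i - ε) := (hle i).1
  have h2 : min (R : ℝ) (Y.hi i + ε) ≤ X.hi i := (hle i).2
  constructor
  · rcases le_max_iff.1 h1 with h | h
    · exact Or.inl (le_antisymm h (X.neg_le_lo i))
    · exact Or.inr (by linarith)
  · rcases min_le_iff.1 h2 with h | h
    · exact Or.inl (le_antisymm (X.hi_le i) h)
    · exact Or.inr (by linarith)

theorem exists_isLUB_of_directedOn {S : Set (Box ι R)} (hS : DirectedOn (· ≤ ·) S) :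
    ∃ X, IsLUB S X := by
  refine exists_isLUB S fun X hX Y hY i => ?_
  obtain ⟨Z, -, h1, h2⟩ := hS X hX Y hY
  exact (h1 i).1.trans ((Z.lo_le_hi i).trans (h2 i).2)

theorem exists_isLUB_of_bddAbove {S : Set (Box ι R)} {Z : Box ι R} (hZ : Z ∈ upperBounds S) :
    ∃ X, IsLUB S X :=
  exists_isLUB S fun _ hX _ hY i => (hZ hX i).1.trans ((Z.lo_le_hi i).trans (hZ hY i).2)

theorem widen_wayBelow_self [Finite ι] {ε : ℝ} (hε : 0 < ε) (X : Box ι R) :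
    WayBelow (widen ε hε.le X) X := by
  simpa [widen_zero] using widen_wayBelow le_rfl hε X

theorem widen_le_self {ε : ℝ} (hε : 0 ≤ ε) (X : Box ι R) : widen ε hε X ≤ X := by
  simpa [widen_zero] using widen_anti le_rfl hε X

theorem widen_mono {ε : ℝ} (hε : 0 ≤ ε) {X Y : Box ι R} (h : X ≤ Y) :
    widen ε hε X ≤ widen ε hε Y := fun i =>
  ⟨max_le_max le_rfl (by linarith [(h i).1]), min_le_min le_rfl (by linarith [(h i).2])⟩

theorem le_of_forall_widen_le {X Y : Box ι R}
    (h : ∀ (ε : ℝ) (hε : 0 < ε), widen ε hε.le X ≤ Y) : X ≤ Y := by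
  intro i
  refine ⟨le_of_forall_pos_le_add fun ε hε => ?_, le_of_forall_pos_le_add fun ε hε => ?_⟩
  · have h1 : max (-(R : ℝ)) (X.lo i - ε) ≤ Y.lo i := (h ε hε i).1
    linarith [le_max_right (-(R : ℝ)) (X.lo i - ε)]
  · have h1 : Y.hi i ≤ min (R : ℝ) (X.hi i + ε) := (h ε hε i).2
    linarith [min_le_right (R : ℝ) (X.hi i + ε)]

/-- The widenings of a hyper-rectangle by positive amounts. -/
def widenings (X : Box ι R) : Set (Box ι R) := {Z | ∃ (ε : ℝ) (hε : 0 < ε), Z = widen ε hε.le X}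

theorem widenings_nonempty (X : Box ι R) : (widenings X).Nonempty := ⟨_, 1, one_pos, rfl⟩

theorem directedOn_widenings (X : Box ι R) : DirectedOn (· ≤ ·) (widenings X) := by
  rintro _ ⟨ε, hε, rfl⟩ _ ⟨δ, hδ, rfl⟩
  have hm : 0 < min ε δ := lt_min hε hδ
  exact ⟨_, ⟨min ε δ, hm, rfl⟩, widen_anti hm.le (min_le_left _ _) X,
    widen_anti hm.le (min_le_right _ _) X⟩

theorem isLUB_widenings (X : Box ι R) : IsLUB (widenings X) X := by
  refine ⟨?_, fun Z hZ => le_of_forall_widen_le fun ε hε => hZ ⟨ε, hε, rfl⟩⟩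
  rintro _ ⟨ε, hε, rfl⟩
  exact widen_le_self hε.le X

theorem widen_add_le {ε δ : ℝ} (hε : 0 ≤ ε) (hδ : 0 ≤ δ) (X : Box ι R) :
    widen (ε + δ) (add_nonneg hε hδ) X ≤ widen ε hε (widen δ hδ X) := by
  refine le_widen_of hε fun i => ?_
  have h1 := le_max_right (-(R : ℝ)) (X.lo i - δ)
  have h2 := min_le_right (R : ℝ) (X.hi i + δ)
  simp only [widen]
  constructor
  · rcases le_total (-(R : ℝ)) (X.lo i - (ε + δ)) with h | h
    · right; rw [max_eq_right h]; linarith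
    · left; exact max_eq_left h
  · rcases le_total (R : ℝ) (X.hi i + (ε + δ)) with h | h
    · left; exact min_eq_left h
    · right; rw [min_eq_right h]; linarith

theorem scottContinuous_widen {ε : ℝ} (hε : 0 ≤ ε) :
    ScottContinuous (widen ε hε : Box ι R → Box ι R) := by
  intro d _ _ X hX
  refine ⟨?_, fun Y hY i => ⟨?_, ?_⟩⟩
  · rintro _ ⟨Z, hZ, rfl⟩
    exact widen_mono hε (hX.1 hZ)
  · refine max_le (Y.neg_le_lo i) ?_
    have := lo_le_of_isLUB hX (i := i) (c := Y.lo i + ε) (by linarith [Y.neg_le_lo i])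
      fun c hc => by
        have h1 : max (-(R : ℝ)) (c.lo i - ε) ≤ Y.lo i := (hY ⟨c, hc, rfl⟩ i).1
        linarith [le_max_right (-(R : ℝ)) (c.lo i - ε)]
    linarith
  · refine le_min (Y.hi_le i) ?_
    have := le_hi_of_isLUB hX (i := i) (c := Y.hi i - ε) (by linarith [Y.hi_le i])
      fun c hc => by
        have h1 : Y.hi i ≤ min (R : ℝ) (c.hi i + ε) := (hY ⟨c, hc, rfl⟩ i).2
        linarith [min_le_right (R : ℝ) (c.hi i + ε)]
    linarith

/-- Interpolation by a rational hyper-rectangle. -/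
theorem exists_rat_between [Finite ι] {X Y : Box ι R} (h : WayBelow X Y) :
    ∃ (d : RatBox ι) (Z : Box ι R), d.Describes Z ∧ WayBelow X Z ∧ WayBelow Z Y := by
  rw [wayBelow_iff] at h
  have h1 : ∀ i, ∃ l : ℚ, -(R : ℝ) ≤ l ∧ (l : ℝ) ≤ Y.lo i ∧ (X.lo i = -(R : ℝ) ∨ X.lo i < l) ∧
      ((l : ℝ) = -(R : ℝ) ∨ (l : ℝ) < Y.lo i) := by
    intro i
    rcases (h i).1 with h | h
    · exact ⟨-(R : ℚ), by push_cast; exact le_rfl, by push_cast; exact Y.neg_le_lo i, Or.inl h,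
        Or.inl (by push_cast; rfl)⟩
    · obtain ⟨l, h1, h2⟩ := exists_rat_btwn h
      exact ⟨l, (X.neg_le_lo i).trans h1.le, h2.le, Or.inr h1, Or.inr h2⟩
  have h2 : ∀ i, ∃ l : ℚ, (l : ℝ) ≤ R ∧ Y.hi i ≤ l ∧ (X.hi i = (R : ℝ) ∨ (l : ℝ) < X.hi i) ∧
      ((l : ℝ) = (R : ℝ) ∨ Y.hi i < l) := by
    intro i
    rcases (h i).2 with h | h
    · exact ⟨(R : ℚ), by push_cast; exact le_rfl, by push_cast; exact Y.hi_le i, Or.inl h,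
        Or.inl (by push_cast; rfl)⟩
    · obtain ⟨l, h1, h2⟩ := exists_rat_btwn h
      exact ⟨l, h2.le.trans (X.hi_le i), h1.le, Or.inr h2, Or.inr h1⟩
  choose l hl1 hl2 hl3 hl4 using h1
  choose m hm1 hm2 hm3 hm4 using h2
  refine ⟨fun i => (l i, m i), ⟨fun i => l i, fun i => m i,
    fun i => (hl2 i).trans ((Y.lo_le_hi i).trans (hm2 i)), hl1, hm1⟩, fun i => ⟨rfl, rfl⟩, ?_, ?_⟩
  · exact wayBelow_of_lt fun i => ⟨hl3 i, hm3 i⟩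
  · exact wayBelow_of_lt fun i => ⟨hl4 i, hm4 i⟩

/-- Interpolation makes the set of boxes that `b` is way-below Scott open: a directed set reaching
it in the limit meets it. -/
theorem _root_.WayBelow.exists_mem_of_isLUB [Finite ι] {b s : Box ι R} (h : WayBelow b s)
    {X : Set (Box ι R)} (hX : X.Nonempty) (hdir : DirectedOn (· ≤ ·) X) (hs : IsLUB X s) :
    ∃ d ∈ X, WayBelow b d := by
  obtain ⟨-, Z, -, h1, h2⟩ := exists_rat_between h
  obtain ⟨d, hd, hle⟩ := h2 hX hdir hs le_rfl
  exact ⟨d, hd, h1.trans_le hle⟩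

theorem _root_.ScottContinuous.directedOn_image {D E : Type*} [PartialOrder D] [PartialOrder E]
    {f : D → E} (hf : ScottContinuous f) {S : Set D} (hS : DirectedOn (· ≤ ·) S) :
    DirectedOn (· ≤ ·) (f '' S) := by
  rintro _ ⟨d, hd, rfl⟩ _ ⟨e, he, rfl⟩
  obtain ⟨z, hz, h3, h4⟩ := hS d hd e he
  exact ⟨_, ⟨z, hz, rfl⟩, hf.monotone h3, hf.monotone h4⟩

/-- `β` is the directed supremum of its widenings, so `f β` is the supremum of the values there.
This is the ε–δ form of Scott continuity used below. -/
theorem _root_.ScottContinuous.exists_wayBelow_widen [Finite κ] {f : Box ι R → Box κ R'}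
    (hf : ScottContinuous f) {b : Box κ R'} {β : Box ι R} (h : WayBelow b (f β)) :
    ∃ (ε : ℝ) (hε : 0 < ε), WayBelow b (f (widen ε hε.le β)) := by
  obtain ⟨_, ⟨_, ⟨ε, hε, rfl⟩, rfl⟩, h1⟩ := h.exists_mem_of_isLUB
    ((widenings_nonempty β).image f) (hf.directedOn_image (directedOn_widenings β))
    (hf (widenings_nonempty β) (directedOn_widenings β) (isLUB_widenings β))
  exact ⟨ε, hε, h1⟩

/-- A point of the cube as a degenerate hyper-rectangle. -/
def pt (x : ι → ℝ) (hx : x ∈ cube ι R) : Box ι R :=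
  ⟨x, x, fun _ => le_rfl, hx.1, hx.2⟩

theorem le_pt_iff {X : Box ι R} {x : ι → ℝ} {hx : x ∈ cube ι R} : X ≤ pt x hx ↔ x ∈ X.toSet :=
  ⟨fun h => ⟨fun i => (h i).1, fun i => (h i).2⟩, fun h i => ⟨h.1 i, h.2 i⟩⟩

theorem toSet_subset_cube (X : Box ι R) : X.toSet ⊆ cube ι R :=
  le_iff_toSet.1 (bot_le (a := X))

theorem toSet_anti {X Y : Box ι R} (h : X ≤ Y) : Y.toSet ⊆ X.toSet := le_iff_toSet.1 h

theorem lo_mem (X : Box ι R) : X.lo ∈ X.toSet := ⟨le_rfl, X.lo_le_hi⟩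

theorem mem_toSet_of_isLUB {S : Set (Box ι R)} {X : Box ι R} (hX : IsLUB S X) {x : ι → ℝ}
    (hx : x ∈ cube ι R) (h : ∀ Y ∈ S, x ∈ Y.toSet) : x ∈ X.toSet :=
  (le_pt_iff (hx := hx)).1 (hX.2 fun Y hY => le_pt_iff.2 (h Y hY))

end Box

/-! ## Rounded ideals of step functions -/

section WDomain

variable {n : ℕ} {K a : ℚ≥0}

theorem StepFun.exists_widen (θ : StepFun n K a) (q : ℚ) (hq : (0 : ℝ) < q) :
    ∃ w : StepFun n K a, w.Sep θ ∧ ∀ t, w.1 t = Box.widen q hq.le (θ.1 t) := by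
  obtain ⟨l, hl⟩ := θ.2
  obtain ⟨m, hm⟩ := hl.exists_widen q hq.le
  exact ⟨⟨_, m, hm⟩, StepFun.sep_iff.2 fun t => Box.widen_wayBelow_self hq _, fun _ => rfl⟩

theorem SepFun.le {f g : Time a → Box (Fin n) K} (h : SepFun f g) : f ≤ g := by
  obtain ⟨θ₁, θ₂, h1, h2, h3⟩ := h
  exact h1.trans (h2.le.trans h3)

theorem SepFun.trans_le {f g g' : Time a → Box (Fin n) K} (h : SepFun f g) (hg : g ≤ g') :
    SepFun f g' := by
  obtain ⟨θ₁, θ₂, h1, h2, h3⟩ := h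
  exact ⟨θ₁, θ₂, h1, h2, h3.trans hg⟩

theorem StepFun.Sep.sepFun {θ : StepFun n K a} {χ : StepFun n K a} {f : Time a → Box (Fin n) K}
    (h : θ.Sep χ) (hf : χ.1 ≤ f) : SepFun θ.1 f := ⟨θ, χ, le_rfl, h, hf⟩

theorem lowerStar_mono {f g : Time a → Box (Fin n) K} (h : f ≤ g) : lowerStar f ≤ lowerStar g :=
  fun _ hb => SepFun.trans_le hb h

/-- All rational widenings of `θ` are separated from `θ`, hence lie below `f`, and they converge to
`θ`. -/
theorem le_of_lowerStar_le {θ : StepFun n K a} {f : Time a → Box (Fin n) K}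
    (h : lowerStar θ.1 ≤ lowerStar f) : θ.1 ≤ f := by
  intro t
  refine Box.le_of_forall_widen_le fun ε hε => ?_
  obtain ⟨q, hq0, hq⟩ := exists_rat_btwn hε
  obtain ⟨w, hw, hwt⟩ := θ.exists_widen q hq0
  have h1 : SepFun w.1 f := h (hw.sepFun le_rfl)
  have h2 := h1.le t
  rw [hwt] at h2
  exact (Box.widen_anti hq0.le hq.le _).trans h2

theorem WD.exists_sep (φ : WD n K a) {b : StepFun n K a} (hb : b ∈ φ.carrier) :
    ∃ z ∈ φ.carrier, b.Sep z := by
  obtain ⟨z, hz, h⟩ := φ.directed {b} (finite_singleton b) (by simpa using hb)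
  exact ⟨z, hz, h b rfl⟩

/-- By roundedness `z` is separated from a further member `w`, and then so is everything pointwise
below `z`. -/
theorem WD.mem_of_le (φ : WD n K a) {b z : StepFun n K a} (hz : z ∈ φ.carrier) (h : b.1 ≤ z.1) :
    b ∈ φ.carrier := by
  obtain ⟨w, hw, hzw⟩ := φ.exists_sep hz
  refine φ.lower (StepFun.sep_iff.2 fun t => ?_) hw
  exact (StepFun.sep_iff.1 hzw t).le_trans (h t)

/-- The union of a directed set of rounded ideals. -/
def WD.directedUnion (X : Set (WD n K a)) (hne : X.Nonempty) (hdir : DirectedOn (· ≤ ·) X) :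
    WD n K a where
  carrier := ⋃ φ ∈ X, φ.carrier
  nonempty := by
    obtain ⟨φ, hφ⟩ := hne
    obtain ⟨b, hb⟩ := φ.nonempty
    exact ⟨b, mem_biUnion hφ hb⟩
  lower := by
    intro x y hxy hy
    obtain ⟨φ, hφ, hb⟩ := mem_iUnion₂.1 hy
    exact mem_biUnion hφ (φ.lower hxy hb)
  directed := by
    intro A hA hsub
    have : ∃ φ ∈ X, A ⊆ φ.carrier := by
      induction A, hA using Set.Finite.induction_on with
      | empty => obtain ⟨φ, hφ⟩ := hne; exact ⟨φ, hφ, empty_subset _⟩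
      | @insert b A _ _ ih =>
        obtain ⟨φ, hφ, h1⟩ := ih ((subset_insert _ _).trans hsub)
        obtain ⟨ψ, hψ, h2⟩ := mem_iUnion₂.1 (hsub (mem_insert _ _))
        obtain ⟨χ, hχ, h3, h4⟩ := hdir φ hφ ψ hψ
        exact ⟨χ, hχ, insert_subset (h4 h2) (h1.trans h3)⟩
    obtain ⟨φ, hφ, h1⟩ := this
    obtain ⟨z, hz, h2⟩ := φ.directed A hA h1
    exact ⟨z, mem_biUnion hφ hz, h2⟩

theorem WD.isLUB_directedUnion {X : Set (WD n K a)} (hne : X.Nonempty)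
    (hdir : DirectedOn (· ≤ ·) X) : IsLUB X (WD.directedUnion X hne hdir) :=
  ⟨fun _ hφ _ hb => mem_biUnion hφ hb, fun _ hψ _ hb => by
    obtain ⟨φ, hφ, hb⟩ := mem_iUnion₂.1 hb
    exact hψ hφ hb⟩

theorem WD.exists_mem_of_isLUB {X : Set (WD n K a)} (hne : X.Nonempty)
    (hdir : DirectedOn (· ≤ ·) X) {φ : WD n K a} (hφ : IsLUB X φ) {b : StepFun n K a}
    (hb : b ∈ φ.carrier) : ∃ ψ ∈ X, b ∈ ψ.carrier := by
  rw [hφ.unique (WD.isLUB_directedUnion hne hdir)] at hb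
  obtain ⟨ψ, hψ, hb⟩ := mem_iUnion₂.1 hb
  exact ⟨ψ, hψ, hb⟩

theorem WD.lowerStar_le_of_mem {φ : WD n K a} {b : StepFun n K a} (hb : b ∈ φ.carrier) :
    lowerStar b.1 ≤ φ := by
  intro z hz
  exact φ.mem_of_le hb (SepFun.le hz)

/-- The basis elements generated by the members of a rounded ideal. -/
def WD.lowerStars (φ : WD n K a) : Set (WD n K a) := (fun b => lowerStar b.1) '' φ.carrier

theorem WD.directedOn_lowerStars (φ : WD n K a) : DirectedOn (· ≤ ·) φ.lowerStars := by
  rintro _ ⟨b, hb, rfl⟩ _ ⟨c, hc, rfl⟩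
  obtain ⟨z, hz, h⟩ := φ.directed {b, c} (by simp) (by rintro x (rfl | rfl) <;> assumption)
  exact ⟨_, ⟨z, hz, rfl⟩, lowerStar_mono (h b (by simp)).le, lowerStar_mono (h c (by simp)).le⟩

theorem WD.isLUB_lowerStars (φ : WD n K a) : IsLUB φ.lowerStars φ := by
  refine ⟨?_, fun ψ hψ b hb => ?_⟩
  · rintro _ ⟨b, hb, rfl⟩
    exact WD.lowerStar_le_of_mem hb
  · obtain ⟨z, hz, h⟩ := φ.exists_sep hb
    exact hψ ⟨z, hz, rfl⟩ (h.sepFun le_rfl)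

/-- Directed suprema are unions, so a single step function `b` enters at some member of the directed
set. Conversely `φ` is the directed supremum of the ideals generated by its members; one of them
contains that of `b`, which puts `b` below a member of `φ`. -/
theorem WD.lowerStar_wayBelow_iff {φ : WD n K a} {b : StepFun n K a} :
    WayBelow (lowerStar b.1) φ ↔ b ∈ φ.carrier := by
  constructor
  · intro h
    obtain ⟨_, ⟨z, hz, rfl⟩, hle⟩ := h (φ.nonempty.image _) φ.directedOn_lowerStars
      φ.isLUB_lowerStars le_rfl
    exact φ.mem_of_le hz (le_of_lowerStar_le hle)
  · intro hb X hX hdir s hs hle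
    obtain ⟨ψ, hψ, hbψ⟩ := WD.exists_mem_of_isLUB hX hdir hs (hle hb)
    exact ⟨ψ, hψ, WD.lowerStar_le_of_mem hbψ⟩

theorem le_upperStar {φ : WD n K a} {θ : StepFun n K a} (hθ : θ ∈ φ.carrier) :
    θ.1 ≤ upperStar φ := fun t => (isLUB_upperStar φ t).1 ⟨θ, hθ, rfl⟩

/-- On a basis element the Euler operator may be evaluated at the step function itself, without a
limit. -/
theorem upperStar_lowerStar (θ : StepFun n K a) : upperStar (lowerStar θ.1) = θ.1 := by
  funext t
  refine le_antisymm ((isLUB_upperStar _ t).2 ?_) (Box.le_of_forall_widen_le fun ε hε => ?_)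
  · rintro _ ⟨χ, hχ, rfl⟩
    exact SepFun.le hχ t
  · obtain ⟨q, hq0, hq⟩ := exists_rat_btwn hε
    obtain ⟨w, hw, hwt⟩ := θ.exists_widen q hq0
    have h2 := le_upperStar (φ := lowerStar θ.1) (hw.sepFun le_rfl) t
    rw [hwt] at h2
    exact (Box.widen_anti hq0.le hq.le _).trans h2

/-! ### The enumeration of step functions -/

theorem PairCode.exists_val (x : ℚ × ℚ) : ∃ c : PairCode, PairCode.val c = x := by
  obtain ⟨c, hc⟩ := RatCode.exists_val x.1
  obtain ⟨d, hd⟩ := RatCode.exists_val x.2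
  exact ⟨(c, d), Prod.ext hc hd⟩

theorem List.exists_map_eq {α β : Type*} {f : α → β} (hf : Function.Surjective f) (l : List β) :
    ∃ c : List α, c.map f = l :=
  List.map_surjective_iff.2 hf l

theorem StepCode.exists_val (l : List ((ℚ × ℚ) × RatBox (Fin n))) :
    ∃ c : StepCode n, StepCode.val c = l := by
  refine List.exists_map_eq ?_ l
  rintro ⟨x, d⟩
  obtain ⟨c, hc⟩ := PairCode.exists_val x
  choose e he using fun i => PairCode.exists_val (d i)
  exact ⟨(c, e), Prod.ext hc (funext he)⟩

/-- The code is that of a step function. -/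
def StepCode.Valid (K a : ℚ≥0) (c : StepCode n) : Prop :=
  ∃ θ : StepFun n K a, IsStepFunOf (timeOpen a) (StepCode.val c) θ.1

theorem StepCode.isStepFunOf_toStepFun {c : StepCode n} (hc : c.Valid K a) :
    IsStepFunOf (timeOpen a) (StepCode.val c) (c.toStepFun K a).1 := by
  have h : ∃ θ : StepFun n K a, IsStepFunOf (timeOpen a) (StepCode.val c) θ.1 := hc
  rw [StepCode.toStepFun, dif_pos h]
  exact h.choose_spec

theorem StepCode.toStepFun_of_not_valid {c : StepCode n} (hc : ¬ c.Valid K a) :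
    c.toStepFun K a = ⊥ := dif_neg hc

theorem IsStepFunOf.unique {C X ι : Type*} {R : ℚ≥0} {O : C → Set X} {l : List (C × RatBox ι)}
    {f g : X → Box ι R} (hf : IsStepFunOf O l f) (hg : IsStepFunOf O l g) : f = g :=
  funext fun x => (hf x).unique (hg x)

/-- A list determines its step function, so the choice made in decoding has only one possible
outcome. -/
theorem StepCode.toStepFun_eq {c : StepCode n} {θ : StepFun n K a}
    (h : IsStepFunOf (timeOpen a) (StepCode.val c) θ.1) : c.toStepFun K a = θ :=
  Subtype.ext ((StepCode.isStepFunOf_toStepFun ⟨θ, h⟩).unique h)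

theorem StepCode.valid_nil : StepCode.Valid K a ([] : StepCode n) := ⟨⊥, isStepFunOf_bot⟩

theorem StepCode.toStepFun_nil : StepCode.toStepFun K a ([] : StepCode n) = ⊥ :=
  StepCode.toStepFun_eq (θ := ⊥) isStepFunOf_bot

/-- The code with a given number; it is the empty list if there is none. -/
def StepCode.ofNat (n : ℕ) (k : ℕ) : StepCode n :=
  (@Encodable.decode (StepCode n) Primcodable.toEncodable k).getD []

theorem StepCode.primrec_ofNat (n : ℕ) : Primrec (StepCode.ofNat n) :=
  Primrec.option_getD.comp Primrec.decode (Primrec.const [])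

theorem enumStepFun_eq (k : ℕ) : enumStepFun n K a k = (StepCode.ofNat n k).toStepFun K a := by
  unfold enumStepFun StepCode.ofNat
  cases @Encodable.decode (StepCode n) Primcodable.toEncodable k with
  | none => exact StepCode.toStepFun_nil.symm
  | some c => rfl

theorem exists_enumStepFun_eq (θ : StepFun n K a) : ∃ k, enumStepFun n K a k = θ := by
  obtain ⟨l, hl⟩ := θ.2
  obtain ⟨c, rfl⟩ := StepCode.exists_val l
  refine ⟨@Encodable.encode (StepCode n) Primcodable.toEncodable c, ?_⟩
  rw [enumStepFun_eq, StepCode.ofNat, @Encodable.encodek (StepCode n) Primcodable.toEncodable]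
  exact StepCode.toStepFun_eq hl

/-- The number `0` codes the empty list, which makes the zeroth basis element `⊥`. -/
theorem StepCode.ofNat_zero (n : ℕ) : StepCode.ofNat n 0 = [] := by
  unfold StepCode.ofNat
  have h : @Encodable.encode (StepCode n) Primcodable.toEncodable [] = 0 := by
    exact @Encodable.encode_list_nil _ Primcodable.toEncodable
  rw [← h, @Encodable.encodek (StepCode n) Primcodable.toEncodable]
  rfl

theorem isDomainBasis_enumWD : IsDomainBasis (enumWD n K a) := by
  refine isDomainBasis_of_directed WD.lowerStars (fun φ => φ.nonempty.image _)
    WD.directedOn_lowerStars WD.isLUB_lowerStars ?_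
  rintro φ _ ⟨b, hb, rfl⟩
  obtain ⟨k, hk⟩ := exists_enumStepFun_eq b
  exact ⟨⟨k, by rw [enumWD, hk]⟩, WD.lowerStar_wayBelow_iff.2 hb⟩

theorem isBot_enumWD_zero : IsBot (enumWD n K a 0) := by
  intro φ b hb
  obtain ⟨z, hz⟩ := φ.nonempty
  refine φ.mem_of_le hz fun t => ?_
  have h : SepFun b.1 (enumStepFun n K a 0).1 := hb
  rw [enumStepFun_eq, StepCode.ofNat_zero, StepCode.toStepFun_nil] at h
  exact (h.le t).trans bot_le

end WDomain

/-! ## Evaluation of step functions -/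

section Evaluation

variable {C ι : Type*} {R : ℚ≥0}

/-- The end-points are those of a hyper-rectangle contained in `[-R, R]^ι`. -/
def RatBox.Fits (R : ℚ≥0) (d : RatBox ι) : Prop :=
  ∀ i, -(R : ℚ) ≤ (d i).1 ∧ (d i).1 ≤ (d i).2 ∧ (d i).2 ≤ (R : ℚ)

/-- The hyper-rectangle with given rational end-points. -/
def RatBox.toBox (d : RatBox ι) (h : d.Fits R) : Box ι R where
  lo i := (d i).1
  hi i := (d i).2
  lo_le_hi i := by exact_mod_cast (h i).2.1
  neg_le_lo i := by
    have := (h i).1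
    have : ((-(R : ℚ) : ℚ) : ℝ) ≤ (d i).1 := by exact_mod_cast this
    simpa using this
  hi_le i := by
    have := (h i).2.2
    have : ((d i).2 : ℝ) ≤ ((R : ℚ) : ℝ) := by exact_mod_cast this
    simpa using this

theorem RatBox.describes_toBox (d : RatBox ι) (h : d.Fits R) : d.Describes (d.toBox h) :=
  fun _ => ⟨rfl, rfl⟩

theorem RatBox.Describes.fits {d : RatBox ι} {X : Box ι R} (h : d.Describes X) : d.Fits R := by
  intro i
  have h1 := X.neg_le_lo i
  have h2 := X.lo_le_hi i
  have h3 := X.hi_le i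
  rw [(h i).1] at h1 h2
  rw [(h i).2] at h2 h3
  refine ⟨?_, by exact_mod_cast h2, ?_⟩
  · have : ((-(R : ℚ) : ℚ) : ℝ) ≤ (d i).1 := by simpa using h1
    exact_mod_cast this
  · have : ((d i).2 : ℝ) ≤ ((R : ℚ) : ℝ) := by simpa using h3
    exact_mod_cast this

open Classical in
/-- The lower end-point in coordinate `i` of the supremum of the hyper-rectangles of the list whose
label satisfies `A`. -/
def stepLo (R : ℚ≥0) (A : C → Prop) (l : List (C × RatBox ι)) (i : ι) : ℚ :=
  l.foldr (fun e r => if A e.1 ∧ e.2.Fits R then max (e.2 i).1 r else r) (-(R : ℚ))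

open Classical in
/-- The upper end-point in coordinate `i` of the supremum of the hyper-rectangles of the list whose
label satisfies `A`. -/
def stepHi (R : ℚ≥0) (A : C → Prop) (l : List (C × RatBox ι)) (i : ι) : ℚ :=
  l.foldr (fun e r => if A e.1 ∧ e.2.Fits R then min (e.2 i).2 r else r) (R : ℚ)

/-- The hyper-rectangles of the list whose label satisfies `A`. -/
def activeBoxes (R : ℚ≥0) (A : C → Prop) (l : List (C × RatBox ι)) : Set (Box ι R) :=
  {b | ∃ e ∈ l, A e.1 ∧ e.2.Describes b}

/-- The computed number is the least upper bound of the active lower end-points and `-R`. In this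
form the induction needs no supremum of boxes, which may fail to exist. -/
theorem stepLo_le_iff {A : C → Prop} {l : List (C × RatBox ι)} {i : ι} {q : ℝ} :
    (stepLo R A l i : ℝ) ≤ q ↔ -(R : ℝ) ≤ q ∧ ∀ b ∈ activeBoxes R A l, b.lo i ≤ q := by
  induction l with
  | nil => simp [stepLo, activeBoxes]
  | cons e l ih =>
    have hc : activeBoxes R A (e :: l) =
        {b | A e.1 ∧ e.2.Describes b} ∪ activeBoxes R A l := by
      ext b
      simp only [activeBoxes, List.mem_cons, exists_eq_or_imp, mem_ofPred_eq, mem_union]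
    rw [hc]
    simp only [stepLo, List.foldr_cons] at ih ⊢
    split_ifs with h
    · push_cast
      rw [max_le_iff, ih]
      constructor
      · rintro ⟨h1, h2, h3⟩
        refine ⟨h2, ?_⟩
        rintro b (⟨-, hb⟩ | hb)
        · rw [(hb i).1]; exact h1
        · exact h3 b hb
      · rintro ⟨h1, h2⟩
        exact ⟨h2 _ (Or.inl ⟨h.1, e.2.describes_toBox h.2⟩), h1, fun b hb => h2 b (Or.inr hb)⟩
    · rw [ih]
      constructor
      · rintro ⟨h2, h3⟩
        refine ⟨h2, ?_⟩
        rintro b (⟨hA, hb⟩ | hb)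
        · exact absurd ⟨hA, hb.fits⟩ h
        · exact h3 b hb
      · rintro ⟨h1, h2⟩
        exact ⟨h1, fun b hb => h2 b (Or.inr hb)⟩

theorem le_stepHi_iff {A : C → Prop} {l : List (C × RatBox ι)} {i : ι} {q : ℝ} :
    q ≤ (stepHi R A l i : ℝ) ↔ q ≤ (R : ℝ) ∧ ∀ b ∈ activeBoxes R A l, q ≤ b.hi i := by
  induction l with
  | nil => simp [stepHi, activeBoxes]
  | cons e l ih =>
    have hc : activeBoxes R A (e :: l) =
        {b | A e.1 ∧ e.2.Describes b} ∪ activeBoxes R A l := by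
      ext b
      simp only [activeBoxes, List.mem_cons, exists_eq_or_imp, mem_ofPred_eq, mem_union]
    rw [hc]
    simp only [stepHi, List.foldr_cons] at ih ⊢
    split_ifs with h
    · push_cast
      rw [le_min_iff, ih]
      constructor
      · rintro ⟨h1, h2, h3⟩
        refine ⟨h2, ?_⟩
        rintro b (⟨-, hb⟩ | hb)
        · rw [(hb i).2]; exact h1
        · exact h3 b hb
      · rintro ⟨h1, h2⟩
        exact ⟨h2 _ (Or.inl ⟨h.1, e.2.describes_toBox h.2⟩), h1, fun b hb => h2 b (Or.inr hb)⟩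
    · rw [ih]
      constructor
      · rintro ⟨h2, h3⟩
        refine ⟨h2, ?_⟩
        rintro b (⟨hA, hb⟩ | hb)
        · exact absurd ⟨hA, hb.fits⟩ h
        · exact h3 b hb
      · rintro ⟨h1, h2⟩
        exact ⟨h1, fun b hb => h2 b (Or.inr hb)⟩

theorem lo_eq_stepLo {A : C → Prop} {l : List (C × RatBox ι)} {X : Box ι R}
    (hX : IsLUB (activeBoxes R A l) X) (i : ι) : X.lo i = stepLo R A l i := by
  have h := (stepLo_le_iff (R := R) (A := A) (l := l) (i := i)).1 le_rfl
  exact le_antisymm (Box.lo_le_of_isLUB hX h.1 h.2)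
    (stepLo_le_iff.2 ⟨X.neg_le_lo i, fun b hb => (hX.1 hb i).1⟩)

theorem hi_eq_stepHi {A : C → Prop} {l : List (C × RatBox ι)} {X : Box ι R}
    (hX : IsLUB (activeBoxes R A l) X) (i : ι) : X.hi i = stepHi R A l i := by
  have h := (le_stepHi_iff (R := R) (A := A) (l := l) (i := i)).1 le_rfl
  exact le_antisymm (le_stepHi_iff.2 ⟨X.hi_le i, fun b hb => (hX.1 hb i).2⟩)
    (Box.le_hi_of_isLUB hX h.1 h.2)

/-- Intervals on a line that meet pairwise have a common point, so it suffices to compare end-points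
of pairs. -/
theorem exists_isLUB_activeBoxes_iff {A : C → Prop} {l : List (C × RatBox ι)} :
    (∃ X, IsLUB (activeBoxes R A l) X) ↔ ∀ e ∈ l, A e.1 → e.2.Fits R → ∀ e' ∈ l, A e'.1 →
      e'.2.Fits R → ∀ i, (e.2 i).1 ≤ (e'.2 i).2 := by
  constructor
  · rintro ⟨X, hX⟩ e he hA hf e' he' hA' hf' i
    have h1 := (hX.1 ⟨e, he, hA, e.2.describes_toBox hf⟩ i).1
    have h2 := (hX.1 ⟨e', he', hA', e'.2.describes_toBox hf'⟩ i).2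
    have h3 := h1.trans ((X.lo_le_hi i).trans h2)
    simp only [RatBox.toBox] at h3
    exact_mod_cast h3
  · intro h
    refine Box.exists_isLUB _ ?_
    rintro X ⟨e, he, hA, hX⟩ Y ⟨e', he', hA', hY⟩ i
    rw [(hX i).1, (hY i).2]
    exact_mod_cast h e he hA hX.fits e' he' hA' hY.fits i

end Evaluation

/-! ### Primitive recursiveness of the evaluation of step functions -/

section EvaluationPrim

variable {α β : Type*} [Primcodable α] [Primcodable β] {ι : Type*} {R : ℚ≥0}

theorem RatPrim.foldr_max {l : α → List β} (hl : Primrec l) {v : α → β → ℚ} {P : α → β → Prop}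
    [∀ a b, Decidable (P a b)] (hv : RatPrim fun x : α × β => v x.1 x.2)
    (hP : PrimrecPred fun x : α × β => P x.1 x.2) (q : ℚ) :
    RatPrim fun a => (l a).foldr (fun b r => if P a b then Max.max (v a b) r else r) q := by
  refine RatPrim.foldr hl (RatPrim.const q) (F := fun a b r => if P a b then Max.max (v a b) r else r) ?_
  have h : Primrec fun x : α × β × RatCode => (x.1, x.2.1) :=
    Primrec.fst.pair (Primrec.fst.comp Primrec.snd)
  exact RatPrim.ite (p := fun x : α × β × RatCode => P x.1 x.2.1) (hP.comp h)
    ((hv.comp h).max (RatPrim.val (Primrec.snd.comp Primrec.snd)))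
    (RatPrim.val (Primrec.snd.comp Primrec.snd))

theorem RatPrim.foldr_min {l : α → List β} (hl : Primrec l) {v : α → β → ℚ} {P : α → β → Prop}
    [∀ a b, Decidable (P a b)] (hv : RatPrim fun x : α × β => v x.1 x.2)
    (hP : PrimrecPred fun x : α × β => P x.1 x.2) (q : ℚ) :
    RatPrim fun a => (l a).foldr (fun b r => if P a b then Min.min (v a b) r else r) q := by
  refine RatPrim.foldr hl (RatPrim.const q) (F := fun a b r => if P a b then Min.min (v a b) r else r) ?_
  have h : Primrec fun x : α × β × RatCode => (x.1, x.2.1) :=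
    Primrec.fst.pair (Primrec.fst.comp Primrec.snd)
  exact RatPrim.ite (p := fun x : α × β × RatCode => P x.1 x.2.1) (hP.comp h)
    ((hv.comp h).min (RatPrim.val (Primrec.snd.comp Primrec.snd)))
    (RatPrim.val (Primrec.snd.comp Primrec.snd))

/-- The end-points of the hyper-rectangle `d a` depend on `a` primitive recursively. -/
def BoxPrim (d : α → RatBox ι) : Prop :=
  ∀ i, RatPrim (fun a => (d a i).1) ∧ RatPrim fun a => (d a i).2

theorem BoxPrim.comp {d : β → RatBox ι} (hd : BoxPrim d) {f : α → β} (hf : Primrec f) :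
    BoxPrim fun a => d (f a) := fun i => ⟨(hd i).1.comp hf, (hd i).2.comp hf⟩

theorem BoxPrim.fits [Finite ι] {d : α → RatBox ι} (hd : BoxPrim d) :
    PrimrecPred fun a => (d a).Fits R :=
  PrimrecPred.forall_finite fun i => ((RatPrim.const _).le (hd i).1).and
    (((hd i).1.le (hd i).2).and ((hd i).2.le (RatPrim.const _)))

variable {C : Type*}

theorem RatPrim.stepLo [Finite ι] {l : α → List β} (hl : Primrec l) {f : β → C × RatBox ι}
    (hf : BoxPrim fun b => (f b).2) {A : α → C → Prop}
    (hA : PrimrecPred fun x : α × β => A x.1 (f x.2).1) (i : ι) :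
    RatPrim fun a => stepLo R (A a) ((l a).map f) i := by
  classical
  simp only [_root_.stepLo, List.foldr_map]
  exact RatPrim.foldr_max (P := fun a b => A a (f b).1 ∧ (f b).2.Fits R)
    (v := fun _ b => ((f b).2 i).1) hl ((hf i).1.comp Primrec.snd)
    (hA.and (hf.fits.comp Primrec.snd)) _

theorem RatPrim.stepHi [Finite ι] {l : α → List β} (hl : Primrec l) {f : β → C × RatBox ι}
    (hf : BoxPrim fun b => (f b).2) {A : α → C → Prop}
    (hA : PrimrecPred fun x : α × β => A x.1 (f x.2).1) (i : ι) :
    RatPrim fun a => stepHi R (A a) ((l a).map f) i := by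
  classical
  simp only [_root_.stepHi, List.foldr_map]
  exact RatPrim.foldr_min (P := fun a b => A a (f b).1 ∧ (f b).2.Fits R)
    (v := fun _ b => ((f b).2 i).2) hl ((hf i).2.comp Primrec.snd)
    (hA.and (hf.fits.comp Primrec.snd)) _

theorem primrec_apply {n : ℕ} {σ : Type*} [Primcodable σ] (i : Fin n) :
    Primrec fun f : Fin n → σ => f i := by
  have h := Primrec.fin_app (n := n) (σ := σ)
  exact h.comp Primrec.id (Primrec.const i)

theorem ratPrim_pairCode_fst : RatPrim fun c : PairCode => (PairCode.val c).1 :=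
  RatPrim.val Primrec.fst

theorem ratPrim_pairCode_snd : RatPrim fun c : PairCode => (PairCode.val c).2 :=
  RatPrim.val Primrec.snd

theorem boxPrim_val (n : ℕ) :
    BoxPrim fun (c : Fin n → PairCode) => (fun i => PairCode.val (c i) : RatBox (Fin n)) :=
  fun i => ⟨ratPrim_pairCode_fst.comp (primrec_apply i), ratPrim_pairCode_snd.comp (primrec_apply i)⟩

theorem boxPrim_val₂ (n : ℕ) :
    BoxPrim fun (c : Fin n → Fin n → PairCode) =>
      (fun i => PairCode.val (c i.1 i.2) : RatBox (Fin n × Fin n)) :=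
  fun i => ⟨ratPrim_pairCode_fst.comp ((primrec_apply i.2).comp (primrec_apply i.1)),
    ratPrim_pairCode_snd.comp ((primrec_apply i.2).comp (primrec_apply i.1))⟩

end EvaluationPrim

/-! ## Decidability for step functions in time -/

section TimeSteps

variable {n : ℕ} {K a : ℚ≥0}

/-- The decoded entry of a code of a step function. -/
def StepCode.entry (e : PairCode × (Fin n → PairCode)) : (ℚ × ℚ) × RatBox (Fin n) :=
  (PairCode.val e.1, fun i => PairCode.val (e.2 i))

theorem StepCode.val_eq (c : StepCode n) : StepCode.val c = c.map StepCode.entry := rfl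

/-- The rational number `r` belongs to the half-open interval with end-points `c`. -/
def InIoc (r : ℚ) (c : ℚ × ℚ) : Prop := c.1 < r ∧ r ≤ c.2

/-- Codes of rational times that distinguish all the intervals occurring in two codes of step
functions. -/
def testTimes (ca : RatCode) (c d : StepCode n) : List RatCode :=
  ca :: (c ++ d).flatMap fun e => [e.1.1, e.1.2]

theorem primrec_testTimes (ca : RatCode) :
    Primrec fun x : StepCode n × StepCode n => testTimes ca x.1 x.2 := by
  refine Primrec.list_cons.comp (Primrec.const ca) ?_
  refine Primrec.list_flatMap (Primrec.list_append.comp Primrec.fst Primrec.snd) ?_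
  have h : Primrec fun x : (StepCode n × StepCode n) × (PairCode × (Fin n → PairCode)) => x.2.1 :=
    Primrec.fst.comp Primrec.snd
  exact Primrec.list_cons.comp (Primrec.fst.comp h)
    (Primrec.list_cons.comp (Primrec.snd.comp h) (Primrec.const []))

/-- Round `t` up to the next listed end-point. The intervals `(p, q]` are open on the left and
closed on the right, so no membership changes on the way. Listing `a` as well guarantees that such a
point exists. -/
theorem exists_testTime {ca : RatCode} (hca : ca.val = a) (c d : StepCode n) (t : Time a) :
    ∃ r ∈ testTimes ca c d, 0 ≤ r.val ∧ r.val ≤ a ∧ ∀ e ∈ c ++ d,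
      (t ∈ timeOpen a (StepCode.entry e).1 ↔ InIoc r.val (StepCode.entry e).1) := by
  classical
  let S : Finset RatCode := (testTimes ca c d).toFinset.filter fun r => (t : ℝ) ≤ r.val ∧ r.val ≤ a
  have hS : S.Nonempty := by
    refine ⟨ca, ?_⟩
    simp only [S, Finset.mem_filter, List.mem_toFinset, hca, le_refl, and_true]
    exact ⟨List.mem_cons_self, by exact_mod_cast t.2.2⟩
  obtain ⟨r, hr, hmin⟩ := S.exists_min_image RatCode.val hS
  simp only [S, Finset.mem_filter, List.mem_toFinset] at hr hmin
  refine ⟨r, hr.1, ?_, hr.2.2, fun e he => ?_⟩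
  · have := t.2.1.trans hr.2.1
    exact_mod_cast this
  · have hm : ∀ s : RatCode, s = e.1.1 ∨ s = e.1.2 → (t : ℝ) ≤ s.val → r.val ≤ s.val := by
      intro s hs hts
      by_cases hsa : s.val ≤ a
      · refine hmin s ⟨List.mem_cons_of_mem _ (List.mem_flatMap.2 ⟨e, he, ?_⟩), hts, hsa⟩
        simpa using hs
      · exact hr.2.2.trans (not_le.1 hsa).le
    change ((e.1.1.val : ℝ) < t ∧ (t : ℝ) ≤ e.1.2.val) ↔ (e.1.1.val < r.val ∧ r.val ≤ e.1.2.val)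
    constructor
    · rintro ⟨h1, h2⟩
      exact ⟨by exact_mod_cast h1.trans_le hr.2.1, hm _ (Or.inr rfl) h2⟩
    · rintro ⟨h1, h2⟩
      refine ⟨?_, hr.2.1.trans (by exact_mod_cast h2)⟩
      by_contra hcon
      exact absurd (hm _ (Or.inl rfl) (not_lt.1 hcon)) (not_le.2 h1)

/-- A rational number in `[0, a]` as a time. -/
def ratTime (r : ℚ) (h0 : 0 ≤ r) (h1 : r ≤ a) : Time a :=
  ⟨r, by exact_mod_cast h0, by
    have : (r : ℝ) ≤ ((a : ℚ) : ℝ) := by exact_mod_cast h1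
    simpa using this⟩

theorem ratTime_mem {r : ℚ} (h0 : 0 ≤ r) (h1 : r ≤ a) {c : ℚ × ℚ} :
    ratTime r h0 h1 ∈ timeOpen a c ↔ InIoc r c := by
  simp [timeOpen, ratTime, InIoc]

theorem activeBoxes_congr {C ι : Type*} {R : ℚ≥0} {A A' : C → Prop} {l : List (C × RatBox ι)}
    (h : ∀ e ∈ l, (A e.1 ↔ A' e.1)) : activeBoxes R A l = activeBoxes R A' l := by
  ext b
  constructor
  · rintro ⟨e, he, hA, hb⟩
    exact ⟨e, he, (h e he).1 hA, hb⟩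
  · rintro ⟨e, he, hA, hb⟩
    exact ⟨e, he, (h e he).2 hA, hb⟩

theorem StepCode.valid_iff {c : StepCode n} :
    c.Valid K a ↔ ∀ t : Time a, ∃ X,
      IsLUB (activeBoxes (R := K) (fun x => t ∈ timeOpen a x) (StepCode.val c)) X := by
  constructor
  · rintro ⟨θ, hθ⟩ t
    exact ⟨_, hθ t⟩
  · intro h
    choose f hf using h
    exact ⟨⟨f, _, hf⟩, hf⟩

/-- The set of active entries at an arbitrary time already occurs at a test time, so the existence
of all suprema is a finite check. -/
theorem StepCode.valid_iff_testTimes {ca : RatCode} (hca : ca.val = a) {c : StepCode n} :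
    c.Valid K a ↔ ∀ r ∈ testTimes ca c c, 0 ≤ r.val ∧ r.val ≤ a →
      ∀ e ∈ c, (InIoc r.val (StepCode.entry e).1 ∧ (StepCode.entry e).2.Fits K) →
        ∀ e' ∈ c, (InIoc r.val (StepCode.entry e').1 ∧ (StepCode.entry e').2.Fits K) →
          ∀ i, ((StepCode.entry e).2 i).1 ≤ ((StepCode.entry e').2 i).2 := by
  rw [StepCode.valid_iff]
  constructor
  · rintro h r - ⟨h0, h1⟩ e he ⟨h2, h3⟩ e' he' ⟨h4, h5⟩ i
    exact exists_isLUB_activeBoxes_iff.1 (h (ratTime r.val h0 h1)) _ (List.mem_map_of_mem he)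
      ((ratTime_mem h0 h1).2 h2) h3 _ (List.mem_map_of_mem he') ((ratTime_mem h0 h1).2 h4) h5 i
  · intro h t
    obtain ⟨r, hr, h0, h1, hiff⟩ := exists_testTime hca c c t
    rw [exists_isLUB_activeBoxes_iff]
    intro e he hA hf e' he' hA' hf' i
    obtain ⟨x, hx, rfl⟩ := List.mem_map.1 he
    obtain ⟨x', hx', rfl⟩ := List.mem_map.1 he'
    exact h r hr ⟨h0, h1⟩ x hx ⟨(hiff x (by simp [hx])).1 hA, hf⟩ x' hx'
      ⟨(hiff x' (by simp [hx'])).1 hA', hf'⟩ i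

/-- Decidable form of `b ≪ X` for the hyper-rectangles with given rational end-points. -/
def RatBelow {ι : Type*} (R : ℚ≥0) (d : RatBox ι) (lo hi : ι → ℚ) : Prop :=
  ∀ i, ((d i).1 = -(R : ℚ) ∨ (d i).1 < lo i) ∧ ((d i).2 = (R : ℚ) ∨ hi i < (d i).2)

theorem wayBelow_iff_ratBelow {ι : Type*} [Finite ι] {R : ℚ≥0} {d : RatBox ι} {b X : Box ι R}
    (hb : d.Describes b) {lo hi : ι → ℚ} (hlo : ∀ i, X.lo i = lo i) (hhi : ∀ i, X.hi i = hi i) :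
    WayBelow b X ↔ RatBelow R d lo hi := by
  rw [Box.wayBelow_iff, RatBelow]
  refine forall_congr' fun i => ?_
  rw [(hb i).1, (hb i).2, hlo, hhi]
  have h1 : ((d i).1 : ℝ) = -(R : ℝ) ↔ (d i).1 = -(R : ℚ) := by
    rw [← Rat.cast_inj (α := ℝ)]; simp
  have h2 : ((d i).2 : ℝ) = (R : ℝ) ↔ (d i).2 = (R : ℚ) := by
    rw [← Rat.cast_inj (α := ℝ)]; simp
  rw [h1, h2, Rat.cast_lt, Rat.cast_lt]

/-- At a test time `r` the value of the second step function has the end-points `stepLo` and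
`stepHi`, and each active entry of the first list is compared with it. -/
theorem StepCode.sep_iff_testTimes {ca : RatCode} (hca : ca.val = a) {c d : StepCode n}
    (hc : c.Valid K a) (hd : d.Valid K a) :
    (c.toStepFun K a).Sep (d.toStepFun K a) ↔ ∀ r ∈ testTimes ca c d, 0 ≤ r.val ∧ r.val ≤ a →
      ∀ e ∈ c, (InIoc r.val (StepCode.entry e).1 ∧ (StepCode.entry e).2.Fits K) →
        RatBelow K (StepCode.entry e).2 (stepLo K (InIoc r.val) (d.map StepCode.entry))
          (stepHi K (InIoc r.val) (d.map StepCode.entry)) := by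
  have hfc := StepCode.isStepFunOf_toStepFun hc
  have hfd := StepCode.isStepFunOf_toStepFun hd
  constructor
  · rintro h r - ⟨h0, h1⟩ e he ⟨h2, h3⟩
    have ht := StepFun.sep_iff.1 h (ratTime r.val h0 h1)
    have hle := (hfc (ratTime r.val h0 h1)).1
      ⟨_, List.mem_map_of_mem he, (ratTime_mem h0 h1).2 h2, RatBox.describes_toBox _ h3⟩
    have hd' : IsLUB (activeBoxes (R := K) (InIoc r.val) (d.map StepCode.entry))
        ((d.toStepFun K a).1 (ratTime r.val h0 h1)) := by
      have := hfd (ratTime r.val h0 h1)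
      rwa [activeBoxes_congr (A' := fun x => ratTime r.val h0 h1 ∈ timeOpen a x)
        (fun e _ => (ratTime_mem h0 h1).symm)]
    exact (wayBelow_iff_ratBelow (RatBox.describes_toBox _ h3) (lo_eq_stepLo hd')
      (hi_eq_stepHi hd')).1 (ht.le_trans hle)
  · intro h
    refine ⟨_, hfc, fun e he b hb t ht => ?_⟩
    obtain ⟨x, hx, rfl⟩ := List.mem_map.1 he
    obtain ⟨r, hr, h0, h1, hiff⟩ := exists_testTime hca c d t
    have hd' : IsLUB (activeBoxes (R := K) (InIoc r.val) (d.map StepCode.entry))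
        ((d.toStepFun K a).1 t) := by
      have := hfd t
      rwa [activeBoxes_congr (A' := fun x => t ∈ timeOpen a x)]
      intro e he
      obtain ⟨y, hy, rfl⟩ := List.mem_map.1 he
      exact (hiff y (by simp [hy])).symm
    exact (wayBelow_iff_ratBelow hb (lo_eq_stepLo hd') (hi_eq_stepHi hd')).2
      (h r hr ⟨h0, h1⟩ x hx ⟨(hiff x (by simp [hx])).1 ht, hb.fits⟩)

variable {α : Type*} [Primcodable α]

theorem BoxPrim.ratBelow {ι : Type*} [Finite ι] {R : ℚ≥0} {d : α → RatBox ι} (hd : BoxPrim d)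
    {lo hi : α → ι → ℚ} (hlo : ∀ i, RatPrim fun x => lo x i) (hhi : ∀ i, RatPrim fun x => hi x i) :
    PrimrecPred fun x => RatBelow R (d x) (lo x) (hi x) :=
  PrimrecPred.forall_finite fun i =>
    (((hd i).1.eq (RatPrim.const _)).or ((hd i).1.lt (hlo i))).and
      (((hd i).2.eq (RatPrim.const _)).or ((hhi i).lt (hd i).2))

theorem boxPrim_entry : BoxPrim fun e : PairCode × (Fin n → PairCode) => (StepCode.entry e).2 :=
  (boxPrim_val n).comp Primrec.snd

theorem primrecPred_inIoc {f : α → ℚ} {e : α → PairCode × (Fin n → PairCode)} (hf : RatPrim f)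
    (he : Primrec e) : PrimrecPred fun x => InIoc (f x) (StepCode.entry (e x)).1 := by
  have h1 : RatPrim fun x => (StepCode.entry (e x)).1.1 :=
    ratPrim_pairCode_fst.comp (Primrec.fst.comp he)
  have h2 : RatPrim fun x => (StepCode.entry (e x)).1.2 :=
    ratPrim_pairCode_snd.comp (Primrec.fst.comp he)
  exact (h1.lt hf).and (hf.le h2)

theorem primrecPred_valid (n : ℕ) (K a : ℚ≥0) :
    PrimrecPred fun c : StepCode n => c.Valid K a := by
  obtain ⟨ca, hca⟩ := RatCode.exists_val a
  refine PrimrecPred.of_eq ?_ fun c => (StepCode.valid_iff_testTimes hca).symm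
  refine PrimrecPred.forall_mem ((primrec_testTimes ca).comp (Primrec.id.pair Primrec.id)) ?_
  have hr : RatPrim fun x : StepCode n × RatCode => x.2.val := RatPrim.val Primrec.snd
  refine (((RatPrim.const 0).le hr).and (hr.le (RatPrim.const _))).imp ?_
  refine PrimrecPred.forall_mem Primrec.fst ?_
  have h1 : Primrec fun x : (StepCode n × RatCode) × (PairCode × (Fin n → PairCode)) => x.2 :=
    Primrec.snd
  refine PrimrecPred.imp ?_ ?_
  · exact (primrecPred_inIoc (hr.comp Primrec.fst) h1).and (boxPrim_entry.fits.comp h1)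
  refine PrimrecPred.forall_mem (Primrec.fst.comp Primrec.fst) ?_
  refine PrimrecPred.imp ?_ ?_
  · exact (primrecPred_inIoc (hr.comp (Primrec.fst.comp Primrec.fst)) Primrec.snd).and
      (boxPrim_entry.fits.comp Primrec.snd)
  · exact PrimrecPred.forall_finite fun i =>
      ((boxPrim_entry i).1.comp (h1.comp Primrec.fst)).le ((boxPrim_entry i).2.comp Primrec.snd)

open Classical in
/-- The code itself if it is valid, the empty list otherwise. -/
def StepCode.normalize (K a : ℚ≥0) (c : StepCode n) : StepCode n := if c.Valid K a then c else []

theorem StepCode.primrec_normalize : Primrec (StepCode.normalize (n := n) K a) := by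
  classical
  exact Primrec.ite (primrecPred_valid n K a) Primrec.id (Primrec.const [])

theorem StepCode.valid_normalize (c : StepCode n) : (c.normalize K a).Valid K a := by
  unfold StepCode.normalize
  split_ifs with h
  · exact h
  · exact StepCode.valid_nil

theorem StepCode.toStepFun_normalize (c : StepCode n) :
    (c.normalize K a).toStepFun K a = c.toStepFun K a := by
  unfold StepCode.normalize
  split_ifs with h
  · rfl
  · rw [StepCode.toStepFun_nil, StepCode.toStepFun_of_not_valid h]

-- The finite test is correct for valid codes only. Normalizing replaces an invalid code by that of
-- `⊥`, the function it denotes in any case, so that the test applies to all codes.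
set_option synthInstance.maxSize 512 in
set_option synthInstance.maxHeartbeats 200000 in
theorem primrecPred_sep (n : ℕ) (K a : ℚ≥0) :
    PrimrecPred fun x : StepCode n × StepCode n =>
      ((x.1.normalize K a).toStepFun K a).Sep ((x.2.normalize K a).toStepFun K a) := by
  obtain ⟨ca, hca⟩ := RatCode.exists_val a
  let T : StepCode n × StepCode n → Prop := fun x =>
    ∀ r ∈ testTimes ca x.1 x.2, 0 ≤ r.val ∧ r.val ≤ a →
      ∀ e ∈ x.1, (InIoc r.val (StepCode.entry e).1 ∧ (StepCode.entry e).2.Fits K) →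
        RatBelow K (StepCode.entry e).2 (stepLo K (InIoc r.val) (x.2.map StepCode.entry))
          (stepHi K (InIoc r.val) (x.2.map StepCode.entry))
  have hT : PrimrecPred T := by
    refine PrimrecPred.forall_mem (primrec_testTimes ca) ?_
    have hr : RatPrim fun x : (StepCode n × StepCode n) × RatCode => x.2.val :=
      RatPrim.val Primrec.snd
    refine (((RatPrim.const 0).le hr).and (hr.le (RatPrim.const _))).imp ?_
    refine PrimrecPred.forall_mem (Primrec.fst.comp Primrec.fst) ?_
    refine PrimrecPred.imp ?_ ?_
    · exact (primrecPred_inIoc (hr.comp Primrec.fst) Primrec.snd).and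
        (boxPrim_entry.fits.comp Primrec.snd)
    refine (boxPrim_entry.comp Primrec.snd).ratBelow (fun i => ?_) (fun i => ?_)
    · exact RatPrim.stepLo (Primrec.snd.comp (Primrec.fst.comp Primrec.fst)) boxPrim_entry
        (primrecPred_inIoc (hr.comp (Primrec.fst.comp Primrec.fst)) Primrec.snd) i
    · exact RatPrim.stepHi (Primrec.snd.comp (Primrec.fst.comp Primrec.fst)) boxPrim_entry
        (primrecPred_inIoc (hr.comp (Primrec.fst.comp Primrec.fst)) Primrec.snd) i
  have hn := StepCode.primrec_normalize (n := n) (K := K) (a := a)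
  refine (hT.comp ((hn.comp Primrec.fst).pair (hn.comp Primrec.snd))).of_eq fun x => ?_
  exact (StepCode.sep_iff_testTimes hca (StepCode.valid_normalize _)
    (StepCode.valid_normalize _)).symm

theorem enumStepFun_eq_normalize (k : ℕ) :
    enumStepFun n K a k = ((StepCode.ofNat n k).normalize K a).toStepFun K a := by
  rw [StepCode.toStepFun_normalize, enumStepFun_eq]

/-- Way-below of two basis elements is membership in an ideal, hence the separation order of the
underlying step functions; it is even primitive recursive. -/
theorem effectivelyGiven_enumWD (n : ℕ) (K a : ℚ≥0) : EffectivelyGiven (enumWD n K a) where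
  complete X hne hdir := ⟨_, WD.isLUB_directedUnion hne hdir⟩
  bot := isBot_enumWD_zero
  basis_nonempty := isDomainBasis_enumWD.nonempty
  basis_directed := isDomainBasis_enumWD.directed
  basis_sup := isDomainBasis_enumWD.sup
  wayBelow_re := by
    have h := (primrecPred_sep n K a).comp
      (((StepCode.primrec_ofNat n).comp Primrec.fst).pair
        ((StepCode.primrec_ofNat n).comp Primrec.snd) : Primrec fun p : ℕ × ℕ => _)
    refine h.computablePred.to_re.of_eq fun p => ?_
    rw [enumWD, enumWD, WD.lowerStar_wayBelow_iff]
    change _ ↔ SepFun _ _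
    rw [sepFun_iff, enumStepFun_eq_normalize, enumStepFun_eq_normalize]

end TimeSteps

/-! ## The hyper-rectangular derivative and difference quotients along the axes -/

section LDerivative

open Function Filter Topology

/-- By compactness `[p, q]` is subdivided into finitely many intervals, each inside one of the
neighbourhoods, and the inequalities are chained. -/
theorem le_of_locally_monotone {g : ℝ → ℝ} {p q : ℝ} (hpq : p ≤ q)
    (h : ∀ t ∈ Icc p q, ∃ V : Set ℝ, IsOpen V ∧ t ∈ V ∧
      ∀ t₁ ∈ V ∩ Icc p q, ∀ t₂ ∈ V ∩ Icc p q, t₁ ≤ t₂ → g t₁ ≤ g t₂) : g p ≤ g q := by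
  choose! V hV htV hmono using h
  obtain ⟨t, ht0, htm, ⟨m, hm⟩, hsub⟩ := exists_monotone_Icc_subset_open_cover_Icc hpq
    (c := fun t : Icc p q => (Subtype.val ⁻¹' V t : Set (Icc p q)))
    (fun t => (hV t t.2).preimage continuous_subtype_val)
    (fun t _ => mem_iUnion.2 ⟨t, htV t t.2⟩)
  have key : ∀ k, g p ≤ g (t k) := by
    intro k
    induction k with
    | zero => rw [ht0]
    | succ k ih =>
      obtain ⟨i, hi⟩ := hsub k
      have hle : t k ≤ t (k + 1) := htm (Nat.le_succ k)
      exact ih.trans (hmono i i.2 _ ⟨hi ⟨le_rfl, hle⟩, (t k).2⟩ _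
        ⟨hi ⟨hle, le_rfl⟩, (t (k + 1)).2⟩ hle)
  have := key m
  rwa [hm m le_rfl] at this

variable {n : ℕ} {K : ℚ≥0}

theorem update_mem_cube {x : Fin n → ℝ} (hx : x ∈ Box.cube (Fin n) K) {j : Fin n} {s : ℝ} :
    update x j s ∈ Box.cube (Fin n) K ↔ s ∈ Icc (-(K : ℝ)) K := by
  constructor
  · rintro ⟨h1, h2⟩
    have h1 := h1 j
    have h2 := h2 j
    simp only [update_self] at h1 h2
    exact ⟨h1, h2⟩
  · rintro ⟨h1, h2⟩
    refine ⟨fun k => ?_, fun k => ?_⟩ <;> by_cases hk : k = j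
    · subst hk; rw [update_self]; exact h1
    · simpa [hk] using hx.1 k
    · subst hk; rw [update_self]; exact h2
    · simpa [hk] using hx.2 k

theorem sum_mul_update_sub (p z : Fin n → ℝ) (j : Fin n) (s t : ℝ) :
    ∑ k, p k * (update z j s k - update z j t k) = p j * (s - t) := by
  rw [Finset.sum_eq_single j]
  · simp
  · intro k _ hk; simp [hk]
  · simp

/-- Move from `x` a little towards one of the two faces in direction `j`; since `K > 0`, at least
one of them does not contain `x`, and the segment stays in the cube. -/
theorem exists_near_update {x : Fin n → ℝ} (hx : x ∈ Box.cube (Fin n) K) (hK : 0 < K) (j : Fin n)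
    {U : Set (Fin n → ℝ)} (hU : IsOpen U) (hxU : x ∈ U) :
    ∃ s, s ≠ x j ∧ update x j s ∈ U ∩ Box.cube (Fin n) K := by
  have hK' : (0 : ℝ) < K := by exact_mod_cast hK
  obtain ⟨c, hc, hcx⟩ : ∃ c ∈ Icc (-(K : ℝ)) K, c ≠ x j := by
    by_cases h : x j = K
    · exact ⟨-K, ⟨le_rfl, by linarith⟩, by rw [h]; linarith⟩
    · exact ⟨K, ⟨by linarith, le_rfl⟩, fun h' => h h'.symm⟩
  have hcont : Continuous fun l : ℝ => update x j (x j + l * (c - x j)) := by fun_prop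
  have h0 : ∀ᶠ l in 𝓝 (0 : ℝ), update x j (x j + l * (c - x j)) ∈ U := by
    refine hcont.continuousAt.eventually_mem (hU.mem_nhds ?_)
    simpa using hxU
  have h1 : ∀ᶠ l in 𝓝[>] (0 : ℝ), update x j (x j + l * (c - x j)) ∈ U := h0.filter_mono inf_le_left
  have h2 : ∀ᶠ l in 𝓝[>] (0 : ℝ), l ∈ Ioo (0 : ℝ) 1 := Ioo_mem_nhdsGT one_pos
  obtain ⟨l, hl, hl0, hl1⟩ := (h1.and h2).exists
  refine ⟨x j + l * (c - x j), ?_, hl, (update_mem_cube hx).2 ?_⟩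
  · intro h
    have : l * (c - x j) = 0 := by linarith
    rcases mul_eq_zero.1 this with h | h
    · exact hl0.ne' h
    · exact hcx (by linarith)
  · have h3 : -(K : ℝ) ≤ x j := hx.1 j
    have h4 : x j ≤ K := hx.2 j
    constructor <;> nlinarith [hc.1, hc.2]

/-- Any two ties at `x` share a difference quotient along each axis, at a point close to `x` in both
neighbourhoods. Their boxes thus meet in every coordinate, and the suprema of the lower end-points
form a point common to all of them. -/
theorem lDeriv_nonempty {f : (Fin n → ℝ) → ℝ} {x : Fin n → ℝ} (hx : x ∈ Box.cube (Fin n) K)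
    (hK : 0 < K) : (lDeriv (Box.cube (Fin n) K) f x).Nonempty := by
  let T : Set (NonemptyInterval (Fin n → ℝ)) :=
    {b | ∃ U, IsOpen U ∧ x ∈ U ∧ IsTie (U ∩ Box.cube (Fin n) K) b f}
  have hpair : ∀ b ∈ T, ∀ b' ∈ T, ∀ j, b.fst j ≤ b'.snd j := by
    rintro b ⟨U, hU, hxU, ht⟩ b' ⟨U', hU', hxU', ht'⟩ j
    obtain ⟨s, hs, ⟨hsU, hsU'⟩, hsc⟩ := exists_near_update hx hK j (hU.inter hU') ⟨hxU, hxU'⟩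
    obtain ⟨p, hp, he⟩ := ht _ ⟨hsU, hsc⟩ x ⟨hxU, hx⟩
    obtain ⟨p', hp', he'⟩ := ht' _ ⟨hsU', hsc⟩ x ⟨hxU', hx⟩
    have h1 := sum_mul_update_sub p x j s (x j)
    have h2 := sum_mul_update_sub p' x j s (x j)
    rw [update_eq_self] at h1 h2
    rw [h1] at he
    rw [h2, he] at he'
    have hpp := mul_right_cancel₀ (sub_ne_zero.2 hs) he'
    exact ((NonemptyInterval.mem_def.1 hp).1 j).trans (hpp.le.trans ((NonemptyInterval.mem_def.1 hp').2 j))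
  rcases T.eq_empty_or_nonempty with hT | hT
  · refine ⟨0, fun U b hU hxU ht => ?_⟩
    have : b ∈ T := ⟨U, hU, hxU, ht⟩
    simp [hT] at this
  · refine ⟨fun j => sSup ((fun b : NonemptyInterval (Fin n → ℝ) => b.fst j) '' T),
      fun U b hU hxU ht => NonemptyInterval.mem_def.2 ⟨fun j => ?_, fun j => ?_⟩⟩
    · refine le_csSup ⟨b.snd j, ?_⟩ ⟨b, ⟨U, hU, hxU, ht⟩, rfl⟩
      rintro _ ⟨b', hb', rfl⟩
      exact hpair b' hb' b ⟨U, hU, hxU, ht⟩ j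
    · refine csSup_le (hT.image _) ?_
      rintro _ ⟨b', hb', rfl⟩
      exact hpair b' hb' b ⟨U, hU, hxU, ht⟩ j

/-- Modifying one entry of an element of the derivative of a vector field, within the bounds of all
ties. -/
theorem exists_mem_lDerivMat {h : (Fin n → ℝ) → Fin n → ℝ} {x : Fin n → ℝ}
    (hx : x ∈ Box.cube (Fin n) K) (hK : 0 < K) (i j : Fin n) (F : ℝ → ℝ)
    (hF : ∀ (U : Set (Fin n → ℝ)) (b : NonemptyInterval (Fin n → ℝ)), IsOpen U → x ∈ U →
      IsTie (U ∩ Box.cube (Fin n) K) b (fun y => h y i) → ∀ r, b.fst j ≤ r → r ≤ b.snd j →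
        b.fst j ≤ F r ∧ F r ≤ b.snd j) :
    ∃ A ∈ lDerivMat (Box.cube (Fin n) K) h x, ∃ r, A (i, j) = F r := by
  choose p hp using fun i => lDeriv_nonempty (f := fun y => h y i) hx hK
  refine ⟨fun ij => if ij = (i, j) then F (p i j) else p ij.1 ij.2, fun k => ?_, p i j, by simp⟩
  intro U b hU hxU ht
  have hb := NonemptyInterval.mem_def.1 (hp k U b hU hxU ht)
  by_cases hk : k = i
  · subst hk
    have h2 := hF U b hU hxU ht (p k j) (hb.1 j) (hb.2 j)
    refine NonemptyInterval.mem_def.2 ⟨fun l => ?_, fun l => ?_⟩ <;> by_cases hl : l = j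
    · subst hl; simpa using h2.1
    · simpa [hl] using hb.1 l
    · subst hl; simpa using h2.2
    · simpa [hl] using hb.2 l
  · have : (fun l => if (k, l) = (i, j) then F (p i j) else p k l) = p k := by
      funext l; simp [hk]
    simp only [this]
    exact NonemptyInterval.mem_def.2 hb

/-- If no tie had a lower end-point above `c`, then lowering the entry `(i, j)` of some element of
the derivative to at most `c` would keep it in every tie, hence in the derivative, against the bound
`X`. -/
theorem exists_tie_of_lt_lo {h : (Fin n → ℝ) → Fin n → ℝ} {x : Fin n → ℝ}
    (hx : x ∈ Box.cube (Fin n) K) (hK : 0 < K) {M₁ : ℚ≥0} {X : Box (Fin n × Fin n) M₁}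
    (hX : lDerivMat (Box.cube (Fin n) K) h x ⊆ X.toSet) {i j : Fin n} {c : ℝ}
    (hc : c < X.lo (i, j)) : ∃ (U : Set (Fin n → ℝ)) (b : NonemptyInterval (Fin n → ℝ)),
      IsOpen U ∧ x ∈ U ∧ IsTie (U ∩ Box.cube (Fin n) K) b (fun y => h y i) ∧ c < b.fst j := by
  by_contra hcon
  push Not at hcon
  obtain ⟨A, hA, r, hr⟩ := exists_mem_lDerivMat hx hK i j (fun r => min r c)
    fun U b hU hxU ht r h1 h2 => ⟨le_min h1 (hcon U b hU hxU ht), (min_le_left _ _).trans h2⟩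
  have := (hX hA).1 (i, j)
  rw [hr] at this
  linarith [min_le_right r c]

theorem exists_tie_of_hi_lt {h : (Fin n → ℝ) → Fin n → ℝ} {x : Fin n → ℝ}
    (hx : x ∈ Box.cube (Fin n) K) (hK : 0 < K) {M₁ : ℚ≥0} {X : Box (Fin n × Fin n) M₁}
    (hX : lDerivMat (Box.cube (Fin n) K) h x ⊆ X.toSet) {i j : Fin n} {c : ℝ}
    (hc : X.hi (i, j) < c) : ∃ (U : Set (Fin n → ℝ)) (b : NonemptyInterval (Fin n → ℝ)),
      IsOpen U ∧ x ∈ U ∧ IsTie (U ∩ Box.cube (Fin n) K) b (fun y => h y i) ∧ b.snd j < c := by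
  by_contra hcon
  push Not at hcon
  obtain ⟨A, hA, r, hr⟩ := exists_mem_lDerivMat hx hK i j (fun r => max r c)
    fun U b hU hxU ht r h1 h2 => ⟨h1.trans (le_max_left _ _), max_le h2 (hcon U b hU hxU ht)⟩
  have := (hX hA).2 (i, j)
  rw [hr] at this
  linarith [le_max_right r c]

theorem IsTie.update_bounds {O : Set (Fin n → ℝ)} {b : NonemptyInterval (Fin n → ℝ)}
    {f : (Fin n → ℝ) → ℝ} (h : IsTie O b f) {z : Fin n → ℝ} {j : Fin n} {s t : ℝ}
    (hs : update z j s ∈ O) (ht : update z j t ∈ O) (hst : s ≤ t) :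
    b.fst j * (t - s) ≤ f (update z j t) - f (update z j s) ∧
      f (update z j t) - f (update z j s) ≤ b.snd j * (t - s) := by
  obtain ⟨p, hp, he⟩ := h _ ht _ hs
  rw [sum_mul_update_sub] at he
  rw [he]
  exact ⟨mul_le_mul_of_nonneg_right ((NonemptyInterval.mem_def.1 hp).1 j) (by linarith),
    mul_le_mul_of_nonneg_right ((NonemptyInterval.mem_def.1 hp).2 j) (by linarith)⟩

/-- Bounds for the difference quotients along the axes give a tie. -/
theorem isTie_of_update_bounds {O : Set (Fin n → ℝ)}
    (hO : ∀ y ∈ O, ∀ z ∈ O, ∀ T : Finset (Fin n), T.piecewise y z ∈ O)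
    {b : NonemptyInterval (Fin n → ℝ)} {f : (Fin n → ℝ) → ℝ}
    (h : ∀ z ∈ O, ∀ j, ∀ s, update z j s ∈ O → z j ≤ s →
      b.fst j * (s - z j) ≤ f (update z j s) - f z ∧ f (update z j s) - f z ≤ b.snd j * (s - z j)) :
    IsTie O b f := by
  intro y hy z hz
  -- Pass from `z` to `y` by changing one coordinate at a time; each step determines the
  -- corresponding coordinate of the vector `p`.
  have key : ∀ T : Finset (Fin n), ∃ p ∈ b,
      f (T.piecewise y z) - f z = ∑ k ∈ T, p k * (y k - z k) := by
    intro T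
    induction T using Finset.induction_on with
    | empty => exact ⟨b.fst, NonemptyInterval.mem_def.2 ⟨le_rfl, b.fst_le_snd⟩, by simp⟩
    | insert k T hk ih =>
      obtain ⟨p, hp, he⟩ := ih
      have hp := NonemptyInterval.mem_def.1 hp
      have hw := hO y hy z hz T
      have hw' := hO y hy z hz (insert k T)
      set w := T.piecewise y z with hwdef
      have hwk : w k = z k := by simp [hwdef, hk]
      rw [Finset.piecewise_insert, ← hwdef] at hw' ⊢
      -- The new coordinate of `p` is the difference quotient. If `z k = y k` nothing moves and any
      -- admissible number will do.
      obtain ⟨r, hr1, hr2, hr⟩ : ∃ r, b.fst k ≤ r ∧ r ≤ b.snd k ∧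
          f (update w k (y k)) - f w = r * (y k - z k) := by
        rcases lt_trichotomy (z k) (y k) with hlt | heq | hgt
        · have hpos : 0 < y k - z k := by linarith
          have h1 := h w hw k (y k) hw' (by rw [hwk]; exact hlt.le)
          rw [hwk] at h1
          refine ⟨(f (update w k (y k)) - f w) / (y k - z k), ?_, ?_, ?_⟩
          · rw [le_div_iff₀ hpos]; exact h1.1
          · rw [div_le_iff₀ hpos]; exact h1.2
          · field_simp
        · refine ⟨p k, hp.1 k, hp.2 k, ?_⟩
          rw [← heq, ← hwk, update_eq_self]; simp
        · have hpos : 0 < z k - y k := by linarith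
          have hback : update (update w k (y k)) k (z k) = w := by
            rw [update_idem, ← hwk, update_eq_self]
          have h1 := h _ hw' k (z k) (by rw [hback]; exact hw) (by simpa using hgt.le)
          rw [hback, update_self] at h1
          have hne : y k - z k ≠ 0 := by linarith
          refine ⟨(f w - f (update w k (y k))) / (z k - y k), ?_, ?_, ?_⟩
          · rw [le_div_iff₀ hpos]; exact h1.1
          · rw [div_le_iff₀ hpos]; exact h1.2
          · have : y k - z k = -(z k - y k) := by ring
            rw [this]; field_simp; ring
      refine ⟨update p k r, NonemptyInterval.mem_def.2 ⟨fun l => ?_, fun l => ?_⟩, ?_⟩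
      · by_cases hl : l = k
        · subst hl; simpa using hr1
        · simpa [hl] using hp.1 l
      · by_cases hl : l = k
        · subst hl; simpa using hr2
        · simpa [hl] using hp.2 l
      · rw [Finset.sum_insert hk, update_self]
        have : ∑ l ∈ T, update p k r l * (y l - z l) = ∑ l ∈ T, p l * (y l - z l) := by
          refine Finset.sum_congr rfl fun l hl => ?_
          rw [update_of_ne]
          rintro rfl
          exact hk hl
        rw [this, ← he, ← hr]
        ring
  obtain ⟨p, hp, he⟩ := key Finset.univ
  exact ⟨p, hp, by simpa using he⟩

/-- The difference quotients of `h` along the axes respect the bounds that the interval matrices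
`u'` give at the points of the segment. -/
def AxisBounds {M₁ : ℚ≥0} (u' : Box (Fin n) K → Box (Fin n × Fin n) M₁)
    (h : (Fin n → ℝ) → Fin n → ℝ) : Prop :=
  ∀ (i j : Fin n) (z : Fin n → ℝ) (s c : ℝ), z ∈ Box.cube (Fin n) K →
    update z j s ∈ Box.cube (Fin n) K → z j ≤ s →
    ((∀ t ∈ Icc (z j) s, ∀ ht : update z j t ∈ Box.cube (Fin n) K,
        c < (u' (Box.pt _ ht)).lo (i, j)) → c * (s - z j) ≤ h (update z j s) i - h z i) ∧
    ((∀ t ∈ Icc (z j) s, ∀ ht : update z j t ∈ Box.cube (Fin n) K,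
        (u' (Box.pt _ ht)).hi (i, j) < c) → h (update z j s) i - h z i ≤ c * (s - z j))

theorem update_mem_cube_of_mem_Icc {z : Fin n → ℝ} {j : Fin n} {s t : ℝ}
    (hz : z ∈ Box.cube (Fin n) K) (hs : update z j s ∈ Box.cube (Fin n) K)
    (ht : t ∈ Icc (z j) s) : update z j t ∈ Box.cube (Fin n) K := by
  rw [update_mem_cube hz] at hs ⊢
  exact ⟨(hz.1 j).trans ht.1, ht.2.trans hs.2⟩

/-- Where the lower bound of `u'` exceeds `c` there is a tie whose `j`-th slopes exceed `c`, so `t ↦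
h - c * t` is locally increasing along the segment, hence increasing. The strict inequalities in
`AxisBounds` are what produces such ties. -/
theorem BelowExtension.axisBounds {M₁ : ℚ≥0} {u' : Box (Fin n) K → Box (Fin n × Fin n) M₁}
    {h : (Fin n → ℝ) → Fin n → ℝ} (hK : 0 < K)
    (hu : BelowExtension u' (lDerivMat (Box.cube (Fin n) K) h)) : AxisBounds u' h := by
  intro i j z s c hz hs hzs
  have hcont : Continuous fun t : ℝ => update z j t := by fun_prop
  have hsub : ∀ x (hx : x ∈ Box.cube (Fin n) K),
      lDerivMat (Box.cube (Fin n) K) h x ⊆ (u' (Box.pt x hx)).toSet :=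
    fun x hx => hu _ x (Box.le_pt_iff.1 le_rfl)
  constructor
  · intro hc
    have := le_of_locally_monotone (g := fun t => h (update z j t) i - c * t) hzs (fun t ht => by
      have htc := update_mem_cube_of_mem_Icc hz hs ht
      obtain ⟨U, b, hU, htU, htie, hcb⟩ := exists_tie_of_lt_lo htc hK (hsub _ htc) (hc t ht htc)
      refine ⟨_, hU.preimage hcont, htU, ?_⟩
      rintro t₁ ⟨h1, h1'⟩ t₂ ⟨h2, h2'⟩ hle
      have h3 := (htie.update_bounds ⟨h1, update_mem_cube_of_mem_Icc hz hs h1'⟩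
        ⟨h2, update_mem_cube_of_mem_Icc hz hs h2'⟩ hle).1
      have h4 := mul_le_mul_of_nonneg_right hcb.le (sub_nonneg.2 hle)
      beta_reduce at *
      linarith)
    simp only [update_eq_self] at this
    linarith
  · intro hc
    have := le_of_locally_monotone (g := fun t => c * t - h (update z j t) i) hzs (fun t ht => by
      have htc := update_mem_cube_of_mem_Icc hz hs ht
      obtain ⟨U, b, hU, htU, htie, hcb⟩ := exists_tie_of_hi_lt htc hK (hsub _ htc) (hc t ht htc)
      refine ⟨_, hU.preimage hcont, htU, ?_⟩
      rintro t₁ ⟨h1, h1'⟩ t₂ ⟨h2, h2'⟩ hle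
      have h3 := (htie.update_bounds ⟨h1, update_mem_cube_of_mem_Icc hz hs h1'⟩
        ⟨h2, update_mem_cube_of_mem_Icc hz hs h2'⟩ hle).2
      have h4 := mul_le_mul_of_nonneg_right hcb.le (sub_nonneg.2 hle)
      beta_reduce at *
      linarith)
    simp only [update_eq_self] at this
    linarith

theorem piecewise_mem_cube {y z : Fin n → ℝ} (hy : y ∈ Box.cube (Fin n) K)
    (hz : z ∈ Box.cube (Fin n) K) (T : Finset (Fin n)) :
    T.piecewise y z ∈ Box.cube (Fin n) K := by
  constructor <;> intro k <;> by_cases hk : k ∈ T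
  · simpa [hk] using hy.1 k
  · simpa [hk] using hz.1 k
  · simpa [hk] using hy.2 k
  · simpa [hk] using hz.2 k

theorem mem_widen_pt {x y : Fin n → ℝ} (hx : x ∈ Box.cube (Fin n) K)
    (hy : y ∈ Box.cube (Fin n) K) {ε : ℝ} (hε : 0 ≤ ε) (h : ∀ k, |y k - x k| ≤ ε) :
    Box.widen ε hε (Box.pt x hx) ≤ Box.pt y hy := by
  intro k
  have h1 := abs_le.1 (h k)
  exact ⟨max_le (hy.1 k) (by simp only [Box.pt]; linarith),
    le_min (hy.2 k) (by simp only [Box.pt]; linarith)⟩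

/-- By Scott continuity the values of `u'` near `x` stay within any given margin of `u'` at `x`. The
axis bounds then give a tie on a neighbourhood of `x` with a slightly enlarged box, and the margin
tends to zero. -/
theorem AxisBounds.belowExtension {M₁ : ℚ≥0} {u' : Box (Fin n) K → Box (Fin n × Fin n) M₁}
    {h : (Fin n → ℝ) → Fin n → ℝ} (hu : ScottContinuous u') (hb : AxisBounds u' h) :
    BelowExtension u' (lDerivMat (Box.cube (Fin n) K) h) := by
  intro α x hx A hA
  have hxc : x ∈ Box.cube (Fin n) K := Box.toSet_subset_cube α hx
  refine Box.toSet_anti (hu.monotone (Box.le_pt_iff (hx := hxc).2 hx)) ?_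
  -- One `ε` is lost to the widening, the other makes the inequalities strict as `AxisBounds`
  -- demands.
  have key : ∀ ε : ℝ, 0 < ε → ∀ i j, (u' (Box.pt x hxc)).lo (i, j) - 2 * ε ≤ A (i, j) ∧
      A (i, j) ≤ (u' (Box.pt x hxc)).hi (i, j) + 2 * ε := by
    intro ε hε i
    obtain ⟨δ, hδ, hw⟩ := hu.exists_wayBelow_widen
      (Box.widen_wayBelow_self hε (u' (Box.pt x hxc)))
    let U : Set (Fin n → ℝ) := univ.pi fun k => Ioo (x k - δ) (x k + δ)
    have hU : IsOpen U := isOpen_set_pi finite_univ fun _ _ => isOpen_Ioo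
    have hxU : x ∈ U := fun k _ => ⟨by linarith, by linarith⟩
    have hbd : ∀ y, y ∈ U ∩ Box.cube (Fin n) K → ∀ hy : y ∈ Box.cube (Fin n) K, ∀ j,
        (u' (Box.pt x hxc)).lo (i, j) - 2 * ε < (u' (Box.pt y hy)).lo (i, j) ∧
        (u' (Box.pt y hy)).hi (i, j) < (u' (Box.pt x hxc)).hi (i, j) + 2 * ε := by
      rintro y ⟨hyU, -⟩ hy j
      have h1 := hw.le.trans (hu.monotone (mem_widen_pt hxc hy hδ.le fun k => by
        have := hyU k trivial
        rw [abs_le]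
        constructor <;> linarith [this.1, this.2]))
      have h2 : max (-(M₁ : ℝ)) ((u' (Box.pt x hxc)).lo (i, j) - ε) ≤ _ := (h1 (i, j)).1
      have h3 : _ ≤ min (M₁ : ℝ) ((u' (Box.pt x hxc)).hi (i, j) + ε) := (h1 (i, j)).2
      constructor
      · linarith [le_max_right (-(M₁ : ℝ)) ((u' (Box.pt x hxc)).lo (i, j) - ε)]
      · linarith [min_le_right (M₁ : ℝ) ((u' (Box.pt x hxc)).hi (i, j) + ε)]
    let b : NonemptyInterval (Fin n → ℝ) :=
      ⟨(fun j => (u' (Box.pt x hxc)).lo (i, j) - 2 * ε,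
        fun j => (u' (Box.pt x hxc)).hi (i, j) + 2 * ε), fun j => by
          have := (u' (Box.pt x hxc)).lo_le_hi (i, j)
          change (u' (Box.pt x hxc)).lo (i, j) - 2 * ε ≤ (u' (Box.pt x hxc)).hi (i, j) + 2 * ε
          linarith⟩
    have htie : IsTie (U ∩ Box.cube (Fin n) K) b (fun y => h y i) := by
      refine isTie_of_update_bounds ?_ ?_
      · rintro y ⟨hyU, hy⟩ z ⟨hzU, hz⟩ T
        refine ⟨fun k _ => ?_, piecewise_mem_cube hy hz T⟩
        by_cases hk : k ∈ T
        · simpa [hk] using hyU k trivial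
        · simpa [hk] using hzU k trivial
      · rintro z ⟨hzU, hz⟩ j s ⟨hsU, hs⟩ hzs
        have hseg : ∀ t ∈ Icc (z j) s, update z j t ∈ U ∩ Box.cube (Fin n) K := by
          refine fun t ht => ⟨fun k _ => ?_, update_mem_cube_of_mem_Icc hz hs ht⟩
          by_cases hk : k = j
          · subst hk
            have h1 := hzU k trivial
            have h2 := hsU k trivial
            simp only [update_self] at h2 ⊢
            exact ⟨h1.1.trans_le ht.1, ht.2.trans_lt h2.2⟩
          · simpa [hk] using hzU k trivial
        exact ⟨(hb i j z s _ hz hs hzs).1 fun t ht htc => (hbd _ (hseg t ht) htc j).1,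
          (hb i j z s _ hz hs hzs).2 fun t ht htc => (hbd _ (hseg t ht) htc j).2⟩
    have hAb := NonemptyInterval.mem_def.1 (hA i U b hU hxU htie)
    exact fun j => ⟨hAb.1 j, hAb.2 j⟩
  refine ⟨fun ij => ?_, fun ij => ?_⟩
  · refine le_of_forall_pos_le_add fun ε hε => ?_
    have := (key (ε / 2) (by linarith) ij.1 ij.2).1
    simp only [Prod.mk.eta] at this
    linarith
  · refine le_of_forall_pos_le_add fun ε hε => ?_
    have := (key (ε / 2) (by linarith) ij.1 ij.2).2
    simp only [Prod.mk.eta] at this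
    linarith

theorem AxisBounds.anti {M₁ : ℚ≥0} {u' w' : Box (Fin n) K → Box (Fin n × Fin n) M₁}
    {h : (Fin n → ℝ) → Fin n → ℝ} (hw : AxisBounds w' h) (hle : u' ≤ w') : AxisBounds u' h := by
  intro i j z s c hz hs hzs
  exact ⟨fun hc => (hw i j z s c hz hs hzs).1 fun t ht htc =>
      (hc t ht htc).trans_le (hle _ (i, j)).1,
    fun hc => (hw i j z s c hz hs hzs).2 fun t ht htc =>
      ((hle _ (i, j)).2).trans_lt (hc t ht htc)⟩

theorem AxisBounds.congr {M₁ : ℚ≥0} {u' : Box (Fin n) K → Box (Fin n × Fin n) M₁}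
    {h g : (Fin n → ℝ) → Fin n → ℝ} (hh : AxisBounds u' h)
    (hg : ∀ x ∈ Box.cube (Fin n) K, g x = h x) : AxisBounds u' g := by
  intro i j z s c hz hs hzs
  rw [hg _ hz, hg _ hs]
  exact hh i j z s c hz hs hzs

/-- The premises do not involve `h`, and each conclusion is a non-strict inequality between two
values of `h`. This is the advantage over the condition on the `L`-derivative. -/
theorem isClosed_axisBounds {M₁ : ℚ≥0} (u' : Box (Fin n) K → Box (Fin n × Fin n) M₁) :
    IsClosed {h | AxisBounds u' h} := by
  unfold AxisBounds
  simp only [ofPred_forall, ofPred_and]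
  refine isClosed_iInter fun i => isClosed_iInter fun j => isClosed_iInter fun z =>
    isClosed_iInter fun s => isClosed_iInter fun c => isClosed_iInter fun _ =>
    isClosed_iInter fun _ => isClosed_iInter fun _ => IsClosed.inter ?_ ?_
  · exact isClosed_iInter fun _ => isClosed_le continuous_const (by fun_prop)
  · exact isClosed_iInter fun _ => isClosed_le (by fun_prop) continuous_const

end LDerivative

/-! ## The domain of vector fields -/

section VDomain

open Function

/-- Two suprema are interchanged: over the family of maps and over the directed set of arguments. -/
theorem ScottContinuous.of_isLUB {ι κ D : Type*} {R R' : ℚ≥0} {S : Set D}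
    {p : D → Box ι R → Box κ R'} (hp : ∀ d ∈ S, ScottContinuous (p d))
    {g : Box ι R → Box κ R'} (hg : ∀ α, IsLUB ((fun d => p d α) '' S) (g α)) :
    ScottContinuous g := by
  intro d hd hdir β hβ
  refine ⟨?_, fun Y hY => (hg β).2 ?_⟩
  · rintro _ ⟨α, hα, rfl⟩
    refine (hg α).2 ?_
    rintro _ ⟨v, hv, rfl⟩
    exact ((hp v hv).monotone (hβ.1 hα)).trans ((hg β).1 ⟨v, hv, rfl⟩)
  · rintro _ ⟨v, hv, rfl⟩
    refine (hp v hv hd hdir hβ).2 ?_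
    rintro _ ⟨α, hα, rfl⟩
    exact ((hg α).1 ⟨v, hv, rfl⟩).trans (hY ⟨α, hα, rfl⟩)

variable {n : ℕ} {K M M₁ : ℚ≥0}

theorem V1.le_def {v w : V1 n K M M₁} : v ≤ w ↔ v.u ≤ w.u ∧ v.u' ≤ w.u' := Iff.rfl

/-- A pair of Scott-continuous maps below a consistent pair is consistent. -/
def V1.ofLE (v : V1 n K M M₁) (u : Box (Fin n) K → Box (Fin n) M)
    (u' : Box (Fin n) K → Box (Fin n × Fin n) M₁) (hu : ScottContinuous u)
    (hu' : ScottContinuous u') (h : u ≤ v.u) (h' : u' ≤ v.u') : V1 n K M M₁ where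
  u := u
  u' := u'
  u_cont := hu
  u'_cont := hu'
  consistent := by
    obtain ⟨f, h1, h2, h3⟩ := v.consistent
    exact ⟨f, h1, fun α x hx => (h2 α x hx).trans (Box.toSet_anti (h α)),
      fun α x hx => (h3 α x hx).trans (Box.toSet_anti (h' α))⟩

/-- The vector fields, zero outside of the cube, that are approximated by a pair. -/
def V1.witnesses (v : V1 n K M M₁) : Set ((Fin n → ℝ) → Fin n → ℝ) :=
  (univ.pi fun _ => Box.cube (Fin n) M) ∩
    ({h | ∀ x (hx : x ∈ Box.cube (Fin n) K), h x ∈ (v.u (Box.pt x hx)).toSet} ∩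
      {h | AxisBounds v.u' h})

/-- A product of cubes is compact by Tychonoff, and both conditions are closed for pointwise
convergence. -/
theorem V1.isCompact_witnesses (v : V1 n K M M₁) : IsCompact v.witnesses := by
  refine (isCompact_univ_pi fun _ => isCompact_Icc).inter_right
    (IsClosed.inter ?_ (isClosed_axisBounds _))
  simp only [ofPred_forall]
  exact isClosed_iInter fun x => isClosed_iInter fun hx =>
    isClosed_Icc.preimage (continuous_apply x)

/-- A consistent witness is controlled on the cube only; outside it is redefined as zero to fall
into the compact product. -/
theorem V1.witnesses_nonempty (hK : 0 < K) (v : V1 n K M M₁) : v.witnesses.Nonempty := by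
  classical
  obtain ⟨f, h1, h2, h3⟩ := v.consistent
  refine ⟨fun x => if x ∈ Box.cube (Fin n) K then f x else 0, fun x _ => ?_, fun x hx => ?_, ?_⟩
  · beta_reduce
    split_ifs with hx
    · exact h1 hx
    · exact ⟨(Box.zero (R := M)).neg_le_lo, (Box.zero (R := M)).hi_le⟩
  · beta_reduce
    rw [if_pos hx]
    exact h2 _ x (Box.le_pt_iff.1 le_rfl) rfl
  · exact (h3.axisBounds hK).congr fun x hx => if_pos hx

theorem V1.witnesses_anti {v w : V1 n K M M₁} (h : v ≤ w) : w.witnesses ⊆ v.witnesses :=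
  fun _ ⟨h1, h2, h3⟩ => ⟨h1, fun x hx => Box.toSet_anti (h.1 _) (h2 x hx), h3.anti h.2⟩

/-- The maps are the pointwise suprema. For consistency, the witness sets of the members form a
directed family of non-empty compact sets, so some `h` witnesses all members at once. Scott
continuity of each member turns its axis bounds back into a bound on the derivative, and these
bounds pass to the supremum. -/
theorem V1.exists_isLUB (hK : 0 < K) {X : Set (V1 n K M M₁)} (hne : X.Nonempty)
    (hdir : DirectedOn (· ≤ ·) X) : ∃ s, IsLUB X s ∧
      (∀ α, IsLUB ((fun v : V1 n K M M₁ => v.u α) '' X) (s.u α)) ∧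
      ∀ α, IsLUB ((fun v : V1 n K M M₁ => v.u' α) '' X) (s.u' α) := by
  have hd : ∀ α, DirectedOn (· ≤ ·) ((fun v : V1 n K M M₁ => v.u α) '' X) := by
    rintro α _ ⟨v, hv, rfl⟩ _ ⟨w, hw, rfl⟩
    obtain ⟨z, hz, h1, h2⟩ := hdir v hv w hw
    exact ⟨_, ⟨z, hz, rfl⟩, h1.1 α, h2.1 α⟩
  have hd' : ∀ α, DirectedOn (· ≤ ·) ((fun v : V1 n K M M₁ => v.u' α) '' X) := by
    rintro α _ ⟨v, hv, rfl⟩ _ ⟨w, hw, rfl⟩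
    obtain ⟨z, hz, h1, h2⟩ := hdir v hv w hw
    exact ⟨_, ⟨z, hz, rfl⟩, h1.2 α, h2.2 α⟩
  choose u hu using fun α => Box.exists_isLUB_of_directedOn (hd α)
  choose u' hu' using fun α => Box.exists_isLUB_of_directedOn (hd' α)
  have hcons : ∃ h : (Fin n → ℝ) → Fin n → ℝ, ∀ v ∈ X, h ∈ v.witnesses := by
    have := hne.to_subtype
    obtain ⟨h, hh⟩ := IsCompact.nonempty_iInter_of_directed_nonempty_isCompact_isClosed
      (fun v : X => v.1.witnesses)
      (by
        rintro ⟨v, hv⟩ ⟨w, hw⟩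
        obtain ⟨z, hz, h1, h2⟩ := hdir v hv w hw
        exact ⟨⟨z, hz⟩, V1.witnesses_anti h1, V1.witnesses_anti h2⟩)
      (fun v => v.1.witnesses_nonempty hK) (fun v => v.1.isCompact_witnesses)
      (fun v => v.1.isCompact_witnesses.isClosed)
    exact ⟨h, fun v hv => mem_iInter.1 hh ⟨v, hv⟩⟩
  obtain ⟨h, hh⟩ := hcons
  obtain ⟨v₀, hv₀⟩ := hne
  let s : V1 n K M M₁ :=
    { u := u
      u' := u'
      u_cont := ScottContinuous.of_isLUB (fun v _ => v.u_cont) hu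
      u'_cont := ScottContinuous.of_isLUB (fun v _ => v.u'_cont) hu'
      consistent := by
        refine ⟨h, fun x _ => (hh v₀ hv₀).1 x trivial, ?_, ?_⟩
        · rintro α x hx y hy
          rw [mem_singleton_iff] at hy
          subst hy
          have hxc := Box.toSet_subset_cube α hx
          refine Box.mem_toSet_of_isLUB (hu α) ((hh v₀ hv₀).1 x trivial) ?_
          rintro _ ⟨v, hv, rfl⟩
          exact Box.toSet_anti (v.u_cont.monotone (Box.le_pt_iff (hx := hxc).2 hx))
            ((hh v hv).2.1 x hxc)
        · intro α x hx A hA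
          have hmem : ∀ v ∈ X, A ∈ (v.u' α).toSet := fun v hv =>
            (hh v hv).2.2.belowExtension v.u'_cont α x hx hA
          refine Box.mem_toSet_of_isLUB (hu' α) (Box.toSet_subset_cube _ (hmem v₀ hv₀)) ?_
          rintro _ ⟨v, hv, rfl⟩
          exact hmem v hv }
  refine ⟨s, ⟨fun v hv => ⟨fun α => (hu α).1 ⟨v, hv, rfl⟩, fun α => (hu' α).1 ⟨v, hv, rfl⟩⟩,
    fun w hw => ⟨fun α => (hu α).2 ?_, fun α => (hu' α).2 ?_⟩⟩, hu, hu'⟩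
  · rintro _ ⟨v, hv, rfl⟩
    exact (hw hv).1 α
  · rintro _ ⟨v, hv, rfl⟩
    exact (hw hv).2 α

/-- By uniqueness, every directed supremum is the pointwise one just constructed. -/
theorem V1.isLUB_u (hK : 0 < K) {X : Set (V1 n K M M₁)} (hne : X.Nonempty)
    (hdir : DirectedOn (· ≤ ·) X) {s : V1 n K M M₁} (hs : IsLUB X s) (α : Box (Fin n) K) :
    IsLUB ((fun v : V1 n K M M₁ => v.u α) '' X) (s.u α) := by
  obtain ⟨s', h1, h2, -⟩ := V1.exists_isLUB hK hne hdir
  rw [hs.unique h1]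
  exact h2 α

theorem V1.isLUB_u' (hK : 0 < K) {X : Set (V1 n K M M₁)} (hne : X.Nonempty)
    (hdir : DirectedOn (· ≤ ·) X) {s : V1 n K M M₁} (hs : IsLUB X s) (α : Box (Fin n) K) :
    IsLUB ((fun v : V1 n K M M₁ => v.u' α) '' X) (s.u' α) := by
  obtain ⟨s', h1, -, h2⟩ := V1.exists_isLUB hK hne hdir
  rw [hs.unique h1]
  exact h2 α

end VDomain

/-! ## Step functions of hyper-rectangles -/

section BoxSteps

variable {ι κ : Type*} {R R' : ℚ≥0}

/-- The sets `boxOpen` are Scott open, so each entry active at the supremum is already active at a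
member of the directed set. -/
theorem IsStepFunOf.scottContinuous [Finite ι] {l : List (RatBox ι × RatBox κ)} {f : Box ι R → Box κ R'}
    (hf : IsStepFunOf (boxOpen R) l f) : ScottContinuous f := by
  have hmono : Monotone f := by
    intro α β hαβ
    refine (hf α).2 ?_
    rintro b ⟨e, he, ⟨γ, h1, h2⟩, hb⟩
    exact (hf β).1 ⟨e, he, ⟨γ, h1, h2.trans_le hαβ⟩, hb⟩
  intro d hd hdir β hβ
  refine ⟨?_, fun Y hY => (hf β).2 ?_⟩
  · rintro _ ⟨α, hα, rfl⟩
    exact hmono (hβ.1 hα)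
  · rintro b ⟨e, he, ⟨γ, h1, h2⟩, hb⟩
    obtain ⟨δ, hδ, h3⟩ := h2.exists_mem_of_isLUB hd hdir hβ
    exact ((hf δ).1 ⟨e, he, ⟨γ, h1, h3⟩, hb⟩).trans (hY ⟨δ, hδ, rfl⟩)

/-- The single-step functions of the list are way-below `g`. -/
def StepBelow (R R' : ℚ≥0) (l : List (RatBox ι × RatBox κ)) (g : Box ι R → Box κ R') : Prop :=
  ∀ e ∈ l, ∀ (α : Box ι R) (b : Box κ R'), e.1.Describes α → e.2.Describes b →
    (∃ β, WayBelow α β) → WayBelow b (g α)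

theorem StepBelow.append {l m : List (RatBox ι × RatBox κ)} {g : Box ι R → Box κ R'}
    (hl : StepBelow R R' l g) (hm : StepBelow R R' m g) : StepBelow R R' (l ++ m) g := by
  intro e he
  rcases List.mem_append.1 he with he | he
  · exact hl e he
  · exact hm e he

theorem StepBelow.exists_isStepFunOf {l : List (RatBox ι × RatBox κ)} {g : Box ι R → Box κ R'}
    (hl : StepBelow R R' l g) (hg : Monotone g) :
    ∃ f, IsStepFunOf (boxOpen R) l f ∧ f ≤ g := by
  have h : ∀ β, g β ∈ upperBounds {b : Box κ R' | ∃ e ∈ l, β ∈ boxOpen R e.1 ∧ e.2.Describes b} := by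
    rintro β b ⟨e, he, ⟨α, h1, h2⟩, hb⟩
    exact (hl e he α b h1 hb ⟨β, h2⟩).le.trans (hg h2.le)
  choose f hf using fun β => Box.exists_isLUB_of_bddAbove (h β)
  exact ⟨f, hf, fun β => (hf β).2 (h β)⟩

theorem IsStepFunOf.le_of_subset {l m : List (RatBox ι × RatBox κ)} {f f' : Box ι R → Box κ R'}
    (hf : IsStepFunOf (boxOpen R) l f) (hf' : IsStepFunOf (boxOpen R) m f') (h : l ⊆ m) :
    f ≤ f' := fun β => (hf β).2 (by
  rintro b ⟨e, he, h1, h2⟩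
  exact (hf' β).1 ⟨e, h he, h1, h2⟩)

/-- A single step suffices: a rational box is interpolated in the argument, between a widening of
`β` and `β`, and another one in the value. -/
theorem exists_stepBelow [Finite ι] [Finite κ] {g : Box ι R → Box κ R'} (hg : ScottContinuous g)
    {b : Box κ R'} {β : Box ι R} (h : WayBelow b (g β)) : ∃ l : List (RatBox ι × RatBox κ), StepBelow R R' l g ∧
      ∀ f, IsStepFunOf (boxOpen R) l f → b ≤ f β := by
  obtain ⟨ε, hε, h1⟩ := hg.exists_wayBelow_widen h
  obtain ⟨d, α, hd, h2, h3⟩ := Box.exists_rat_between (Box.widen_wayBelow_self hε β)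
  obtain ⟨d', b', hd', h4, h5⟩ := Box.exists_rat_between
    (h1.trans_le (hg.monotone h2.le))
  refine ⟨[(d, d')], ?_, fun f hf => ?_⟩
  · intro e he α' c hα' hc _
    rw [List.mem_singleton] at he
    subst he
    rw [hα'.unique hd, hc.unique hd']
    exact h5
  · exact h4.le.trans ((hf β).1 ⟨_, List.mem_singleton.2 rfl, ⟨α, hd, h3⟩, hd'⟩)

/-- For each entry of the list, way-below at the single box `α` selects a member of the directed
set; finitely many of them have a common upper bound. This reduces way-below between maps to
finitely many arguments. -/
theorem StepBelow.exists_mem_le {D : Type*} [PartialOrder D] {p : D → Box ι R → Box κ R'}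
    (hp : Monotone p) {l : List (RatBox ι × RatBox κ)} {g : Box ι R → Box κ R'}
    (hl : StepBelow R R' l g) {X : Set D} (hne : X.Nonempty) (hdir : DirectedOn (· ≤ ·) X)
    (hpc : ∀ d ∈ X, Monotone (p d)) {g' : Box ι R → Box κ R'}
    (hg' : ∀ α, IsLUB ((fun d => p d α) '' X) (g' α)) (hle : g ≤ g') {f : Box ι R → Box κ R'}
    (hf : IsStepFunOf (boxOpen R) l f) : ∃ d ∈ X, f ≤ p d := by
  have hpd : ∀ α, DirectedOn (· ≤ ·) ((fun d => p d α) '' X) := by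
    rintro α _ ⟨v, hv, rfl⟩ _ ⟨w, hw, rfl⟩
    obtain ⟨z, hz, h1, h2⟩ := hdir v hv w hw
    exact ⟨_, ⟨z, hz, rfl⟩, hp h1 α, hp h2 α⟩
  have key : ∀ m : List (RatBox ι × RatBox κ), m ⊆ l → ∃ d ∈ X, ∀ e ∈ m, ∀ (α : Box ι R)
      (b : Box κ R'), e.1.Describes α → e.2.Describes b → (∃ β, WayBelow α β) → b ≤ p d α := by
    intro m
    induction m with
    | nil => intro _; obtain ⟨d, hd⟩ := hne; exact ⟨d, hd, by simp⟩
    | cons e m ih =>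
      intro hsub
      obtain ⟨d, hd, h1⟩ := ih fun x hx => hsub (List.mem_cons_of_mem _ hx)
      have h2 : ∃ d' ∈ X, ∀ (α : Box ι R) (b : Box κ R'), e.1.Describes α → e.2.Describes b →
          (∃ β, WayBelow α β) → b ≤ p d' α := by
        -- An entry that describes no boxes, or whose open set is empty, imposes nothing, and any
        -- member serves.
        by_cases hex : ∃ (α : Box ι R) (b : Box κ R'), e.1.Describes α ∧ e.2.Describes b ∧
            ∃ β, WayBelow α β
        · obtain ⟨α, b, hα, hb, hβ⟩ := hex
          obtain ⟨_, ⟨d', hd', rfl⟩, h3⟩ := hl e (hsub List.mem_cons_self) α b hα hb hβ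
            (hne.image _) (hpd α) (hg' α) (hle α)
          exact ⟨d', hd', fun α' b' hα' hb' _ => by rwa [hα'.unique hα, hb'.unique hb]⟩
        · exact ⟨d, hd, fun α b hα hb hβ => absurd ⟨α, b, hα, hb, hβ⟩ hex⟩
      obtain ⟨d', hd', h3⟩ := h2
      obtain ⟨z, hz, h4, h5⟩ := hdir d hd d' hd'
      refine ⟨z, hz, ?_⟩
      intro x hx α b hα hb hβ
      rcases List.mem_cons.1 hx with rfl | hx
      · exact (h3 α b hα hb hβ).trans (hp h5 α)
      · exact (h1 x hx α b hα hb hβ).trans (hp h4 α)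
  obtain ⟨d, hd, h1⟩ := key l (List.Subset.refl l)
  refine ⟨d, hd, fun β => (hf β).2 ?_⟩
  rintro b ⟨e, he, ⟨α, hα, hαβ⟩, hb⟩
  exact (h1 e he α b hα hb ⟨β, hαβ⟩).trans (hpc d hd hαβ.le)

/-- The hyper-rectangle `α` shrunk by at most `δ` in every direction. -/
theorem exists_wayBelow_widen_le [Finite ι] {δ : ℝ} (hδ : 0 < δ) {α : Box ι R}
    (h : ∀ i, α.lo i < α.hi i) : ∃ β, WayBelow α β ∧ Box.widen δ hδ.le β ≤ α := by
  have hm : ∀ i, 0 < min δ ((α.hi i - α.lo i) / 2) := fun i =>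
    lt_min hδ (by linarith [h i])
  have hm1 : ∀ i, min δ ((α.hi i - α.lo i) / 2) ≤ δ := fun i => min_le_left _ _
  have hm2 : ∀ i, min δ ((α.hi i - α.lo i) / 2) ≤ (α.hi i - α.lo i) / 2 := fun i =>
    min_le_right _ _
  refine ⟨⟨fun i => α.lo i + min δ ((α.hi i - α.lo i) / 2),
    fun i => α.hi i - min δ ((α.hi i - α.lo i) / 2), fun i => by linarith [hm2 i],
    fun i => by linarith [hm i, α.neg_le_lo i], fun i => by linarith [hm i, α.hi_le i]⟩, ?_, ?_⟩
  · exact Box.wayBelow_of_lt fun i => ⟨Or.inr (by simpa using hm i), Or.inr (by simpa using hm i)⟩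
  · intro i
    exact ⟨max_le (α.neg_le_lo i) (by simp only; linarith [hm1 i]),
      le_min (α.hi_le i) (by simp only; linarith [hm1 i])⟩

/-- A box with something above it in the sense of `≪` is non-degenerate in every coordinate: each
end-point lies strictly outside of `β` or on the boundary of the cube, and `R > 0` keeps the two
ends apart. -/
theorem exists_wayBelow_iff [Finite ι] (hR : 0 < R) {α : Box ι R} :
    (∃ β, WayBelow α β) ↔ ∀ i, α.lo i < α.hi i := by
  constructor
  · rintro ⟨β, hβ⟩ i
    have hR' : (0 : ℝ) < R := by exact_mod_cast hR
    have h := Box.wayBelow_iff.1 hβ i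
    have h1 := β.lo_le_hi i
    have h2 := β.neg_le_lo i
    have h3 := β.hi_le i
    rcases h with ⟨h | h, h' | h'⟩ <;> linarith
  · intro h
    obtain ⟨β, hβ, -⟩ := exists_wayBelow_widen_le one_pos h
    exact ⟨β, hβ⟩

/-- The trick is to evaluate `f` at a slightly shrunken `α`, where the entry is active. Blurring by
`δ` undoes the shrinking in the argument, and the outer widening leaves the room needed for `≪`. -/
theorem IsStepFunOf.stepBelow_of_le_widen [Finite ι] [Finite κ] (hR : 0 < R) {l : List (RatBox ι × RatBox κ)}
    {f g : Box ι R → Box κ R'} (hf : IsStepFunOf (boxOpen R) l f) (hg : Monotone g) {δ : ℝ}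
    (hδ : 0 < δ) (hle : ∀ β, f β ≤ Box.widen δ hδ.le (g (Box.widen δ hδ.le β))) :
    StepBelow R R' l g := by
  intro e he α b hα hb hβ
  obtain ⟨β, h1, h2⟩ := exists_wayBelow_widen_le hδ ((exists_wayBelow_iff hR).1 hβ)
  refine WayBelow.le_trans ?_ (Box.widen_wayBelow_self hδ (g α))
  exact ((hf β).1 ⟨e, he, ⟨α, hα, h1⟩, hb⟩).trans ((hle β).trans (Box.widen_mono hδ.le (hg h2)))

/-- The map `g` blurred by `δ`. -/
def blur (δ : ℝ) (hδ : 0 < δ) (g : Box ι R → Box κ R') (β : Box ι R) : Box κ R' :=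
  Box.widen δ hδ.le (g (Box.widen δ hδ.le β))

theorem ScottContinuous.blur {g : Box ι R → Box κ R'} (hg : ScottContinuous g) {δ : ℝ}
    (hδ : 0 < δ) : ScottContinuous (blur δ hδ g) :=
  ((Box.scottContinuous_widen hδ.le).comp hg).comp (Box.scottContinuous_widen hδ.le)

theorem blur_le {g : Box ι R → Box κ R'} (hg : Monotone g) {δ : ℝ} (hδ : 0 < δ) :
    blur δ hδ g ≤ g := fun _ => (Box.widen_le_self _ _).trans (hg (Box.widen_le_self _ _))

theorem blur_anti {g : Box ι R → Box κ R'} (hg : Monotone g) {δ ε : ℝ} (hδ : 0 < δ)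
    (h : δ ≤ ε) : blur ε (hδ.trans_le h) g ≤ blur δ hδ g := fun β =>
  (Box.widen_anti hδ.le h _).trans (Box.widen_mono hδ.le (hg (Box.widen_anti hδ.le h β)))

/-- By Scott continuity the blurred maps converge to `g` at each argument. Half of `ε` pays for the
widening in the argument and half for that in the value. -/
theorem le_of_forall_blur_le [Finite κ] {g w : Box ι R → Box κ R'} (hg : ScottContinuous g)
    (h : ∀ (δ : ℝ) (hδ : 0 < δ), blur δ hδ g ≤ w) : g ≤ w := by
  intro β
  refine Box.le_of_forall_widen_le fun ε hε => ?_
  have h2 : 0 < ε / 2 := by linarith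
  obtain ⟨δ, hδ, h1⟩ := hg.exists_wayBelow_widen (Box.widen_wayBelow_self h2 (g β))
  have hm : 0 < min δ (ε / 2) := lt_min hδ h2
  refine le_trans ?_ (h _ hm β)
  have h3 : Box.widen ε hε.le (g β) ≤ Box.widen (ε / 2) h2.le (Box.widen (ε / 2) h2.le (g β)) := by
    have := Box.widen_add_le h2.le h2.le (g β)
    simpa only [add_halves] using this
  refine h3.trans ((Box.widen_mono h2.le (h1.le.trans (hg.monotone
    (Box.widen_anti hm.le (min_le_left _ _) β)))).trans (Box.widen_anti hm.le (min_le_right _ _) _))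

end BoxSteps

/-! ## The basis of the domain of vector fields -/

section VBasis

variable {n : ℕ} {K M M₁ : ℚ≥0}

theorem V1.wayBelow_of_stepBelow (hK : 0 < K) {w v : V1 n K M M₁}
    {l₁ : List (RatBox (Fin n) × RatBox (Fin n))}
    {l₂ : List (RatBox (Fin n) × RatBox (Fin n × Fin n))}
    (h₁ : IsStepFunOf (boxOpen K) l₁ w.u) (h₂ : IsStepFunOf (boxOpen K) l₂ w.u')
    (hb₁ : StepBelow K M l₁ v.u) (hb₂ : StepBelow K M₁ l₂ v.u') : WayBelow w v := by
  intro X hne hdir s hs hle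
  obtain ⟨d, hd, h3⟩ := hb₁.exists_mem_le (p := V1.u) (fun _ _ h => (V1.le_def.1 h).1) hne hdir
    (fun v _ => v.u_cont.monotone) (V1.isLUB_u hK hne hdir hs) hle.1 h₁
  obtain ⟨e, he, h4⟩ := hb₂.exists_mem_le (p := V1.u') (fun _ _ h => (V1.le_def.1 h).2) hne hdir
    (fun v _ => v.u'_cont.monotone) (V1.isLUB_u' hK hne hdir hs) hle.2 h₂
  obtain ⟨z, hz, h5, h6⟩ := hdir d hd e he
  exact ⟨z, hz, h3.trans h5.1, h4.trans h6.2⟩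

/-- The pair `v` blurred by `δ`. -/
def V1.blur (v : V1 n K M M₁) (δ : ℝ) (hδ : 0 < δ) : V1 n K M M₁ :=
  v.ofLE (_root_.blur δ hδ v.u) (_root_.blur δ hδ v.u') (v.u_cont.blur hδ) (v.u'_cont.blur hδ)
    (blur_le v.u_cont.monotone hδ) (blur_le v.u'_cont.monotone hδ)

/-- `v` is the directed supremum of its blurred versions, which are consistent because they lie
below `v`. -/
theorem V1.exists_le_blur {w v : V1 n K M M₁} (h : WayBelow w v) :
    ∃ (δ : ℝ) (hδ : 0 < δ), w ≤ v.blur δ hδ := by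
  have hlub : IsLUB {z | ∃ (δ : ℝ) (hδ : 0 < δ), z = v.blur δ hδ} v := by
    refine ⟨?_, fun z hz => ⟨?_, ?_⟩⟩
    · rintro _ ⟨δ, hδ, rfl⟩
      exact ⟨blur_le v.u_cont.monotone hδ, blur_le v.u'_cont.monotone hδ⟩
    · exact le_of_forall_blur_le v.u_cont fun δ hδ => (hz ⟨δ, hδ, rfl⟩).1
    · exact le_of_forall_blur_le v.u'_cont fun δ hδ => (hz ⟨δ, hδ, rfl⟩).2
  obtain ⟨_, ⟨δ, hδ, rfl⟩, hle⟩ := h (X := {z | ∃ (δ : ℝ) (hδ : 0 < δ), z = v.blur δ hδ})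
    ⟨v.blur 1 one_pos, 1, one_pos, rfl⟩ (by
    rintro _ ⟨δ, hδ, rfl⟩ _ ⟨ε, hε, rfl⟩
    have hm : 0 < min δ ε := lt_min hδ hε
    exact ⟨_, ⟨min δ ε, hm, rfl⟩,
      ⟨blur_anti v.u_cont.monotone hm (min_le_left _ _),
        blur_anti v.u'_cont.monotone hm (min_le_left _ _)⟩,
      ⟨blur_anti v.u_cont.monotone hm (min_le_right _ _),
        blur_anti v.u'_cont.monotone hm (min_le_right _ _)⟩⟩) hlub le_rfl
  exact ⟨δ, hδ, hle⟩

/-- For step functions, way-below is a condition on the finitely many entries, tested at the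
defining boxes of the open sets. It is thereby accessible to computation. -/
theorem V1.wayBelow_iff_stepBelow (hK : 0 < K) {w v : V1 n K M M₁}
    {l₁ : List (RatBox (Fin n) × RatBox (Fin n))}
    {l₂ : List (RatBox (Fin n) × RatBox (Fin n × Fin n))}
    (h₁ : IsStepFunOf (boxOpen K) l₁ w.u) (h₂ : IsStepFunOf (boxOpen K) l₂ w.u') :
    WayBelow w v ↔ StepBelow K M l₁ v.u ∧ StepBelow K M₁ l₂ v.u' := by
  refine ⟨fun h => ?_, fun h => V1.wayBelow_of_stepBelow hK h₁ h₂ h.1 h.2⟩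
  obtain ⟨δ, hδ, hle⟩ := V1.exists_le_blur h
  exact ⟨h₁.stepBelow_of_le_widen hK v.u_cont.monotone hδ hle.1,
    h₂.stepBelow_of_le_widen hK v.u'_cont.monotone hδ hle.2⟩

/-- The pairs of rational step functions all of whose single-step functions are way-below `v`. -/
def V1.stepApprox (v : V1 n K M M₁) : Set (V1 n K M M₁) :=
  {w | ∃ l₁ l₂, IsStepFunOf (boxOpen K) l₁ w.u ∧ IsStepFunOf (boxOpen K) l₂ w.u' ∧
    StepBelow K M l₁ v.u ∧ StepBelow K M₁ l₂ v.u'}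

theorem V1.exists_stepApprox (v : V1 n K M M₁)
    {l₁ : List (RatBox (Fin n) × RatBox (Fin n))}
    {l₂ : List (RatBox (Fin n) × RatBox (Fin n × Fin n))} (hb₁ : StepBelow K M l₁ v.u)
    (hb₂ : StepBelow K M₁ l₂ v.u') : ∃ w ∈ v.stepApprox,
      IsStepFunOf (boxOpen K) l₁ w.u ∧ IsStepFunOf (boxOpen K) l₂ w.u' := by
  obtain ⟨f, hf, hle⟩ := hb₁.exists_isStepFunOf v.u_cont.monotone
  obtain ⟨f', hf', hle'⟩ := hb₂.exists_isStepFunOf v.u'_cont.monotone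
  exact ⟨v.ofLE f f' hf.scottContinuous hf'.scottContinuous hle hle', ⟨l₁, l₂, hf, hf', hb₁, hb₂⟩,
    hf, hf'⟩

theorem stepBelow_nil {ι κ : Type*} {R R' : ℚ≥0} [Finite ι] [Finite κ] (g : Box ι R → Box κ R') :
    StepBelow R R' [] g := by simp [StepBelow]

theorem V1.stepApprox_nonempty (v : V1 n K M M₁) : v.stepApprox.Nonempty := by
  obtain ⟨w, hw, -⟩ := v.exists_stepApprox (stepBelow_nil _) (stepBelow_nil _)
  exact ⟨w, hw⟩

theorem V1.directedOn_stepApprox (v : V1 n K M M₁) : DirectedOn (· ≤ ·) v.stepApprox := by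
  rintro w ⟨l₁, l₂, h1, h2, h3, h4⟩ z ⟨m₁, m₂, k1, k2, k3, k4⟩
  obtain ⟨y, hy, h5, h6⟩ := v.exists_stepApprox (h3.append k3) (h4.append k4)
  exact ⟨y, hy, ⟨h1.le_of_subset h5 (List.subset_append_left _ _),
    h2.le_of_subset h6 (List.subset_append_left _ _)⟩,
    ⟨k1.le_of_subset h5 (List.subset_append_right _ _),
    k2.le_of_subset h6 (List.subset_append_right _ _)⟩⟩

/-- At any argument a single step recovers the value up to `ε`. The two components can be treated
separately, with the empty list in the other one. -/
theorem V1.isLUB_stepApprox (hK : 0 < K) (v : V1 n K M M₁) : IsLUB v.stepApprox v := by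
  refine ⟨?_, fun w hw => ⟨fun β => ?_, fun β => ?_⟩⟩
  · rintro w ⟨l₁, l₂, h1, h2, h3, h4⟩
    exact (V1.wayBelow_of_stepBelow hK h1 h2 h3 h4).le
  · refine Box.le_of_forall_widen_le fun ε hε => ?_
    obtain ⟨l, hl, h1⟩ := exists_stepBelow v.u_cont (Box.widen_wayBelow_self hε (v.u β))
    obtain ⟨z, hz, h2, -⟩ := v.exists_stepApprox hl (stepBelow_nil _)
    exact (h1 _ h2).trans ((hw hz).1 β)
  · refine Box.le_of_forall_widen_le fun ε hε => ?_
    obtain ⟨l, hl, h1⟩ := exists_stepBelow v.u'_cont (Box.widen_wayBelow_self hε (v.u' β))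
    obtain ⟨z, hz, -, h2⟩ := v.exists_stepApprox (stepBelow_nil _) hl
    exact (h1 _ h2).trans ((hw hz).2 β)

/-! ### The enumeration of pairs of step functions -/

/-- The code is that of a consistent pair of step functions. -/
def VCode.Valid (K M M₁ : ℚ≥0) (c : VCode n) : Prop :=
  ∃ v : V1 n K M M₁, IsStepFunOf (boxOpen K) (VCode.val₁ c) v.u ∧
    IsStepFunOf (boxOpen K) (VCode.val₂ c) v.u'

theorem VCode.isStepFunOf_toV1 {c : VCode n} (hc : c.Valid K M M₁) :
    IsStepFunOf (boxOpen K) (VCode.val₁ c) (c.toV1 K M M₁).u ∧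
      IsStepFunOf (boxOpen K) (VCode.val₂ c) (c.toV1 K M M₁).u' := by
  have h : ∃ v : V1 n K M M₁, IsStepFunOf (boxOpen K) (VCode.val₁ c) v.u ∧
    IsStepFunOf (boxOpen K) (VCode.val₂ c) v.u' := hc
  rw [VCode.toV1, dif_pos h]
  exact h.choose_spec

theorem VCode.toV1_of_not_valid {c : VCode n} (hc : ¬ c.Valid K M M₁) : c.toV1 K M M₁ = ⊥ :=
  dif_neg hc

theorem VCode.toV1_eq {c : VCode n} {v : V1 n K M M₁}
    (h₁ : IsStepFunOf (boxOpen K) (VCode.val₁ c) v.u)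
    (h₂ : IsStepFunOf (boxOpen K) (VCode.val₂ c) v.u') : c.toV1 K M M₁ = v := by
  obtain ⟨h3, h4⟩ := VCode.isStepFunOf_toV1 ⟨v, h₁, h₂⟩
  exact V1.ext (h3.unique h₁) (h4.unique h₂)

theorem isStepFunOf_boxOpen_nil {ι κ : Type*} {R R' : ℚ≥0} :
    IsStepFunOf (boxOpen R) ([] : List (RatBox ι × RatBox κ))
      (fun _ => (⊥ : Box κ R')) := by
  intro t
  simp

theorem VCode.valid_nil : VCode.Valid K M M₁ (([], []) : VCode n) :=
  ⟨⊥, isStepFunOf_boxOpen_nil, isStepFunOf_boxOpen_nil⟩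

theorem VCode.toV1_nil : VCode.toV1 K M M₁ (([], []) : VCode n) = ⊥ :=
  VCode.toV1_eq (v := ⊥) isStepFunOf_boxOpen_nil isStepFunOf_boxOpen_nil

/-- The code with a given number; it consists of two empty lists if there is none. -/
def VCode.ofNat (n : ℕ) (k : ℕ) : VCode n :=
  (@Encodable.decode (VCode n) Primcodable.toEncodable k).getD ([], [])

theorem VCode.primrec_ofNat (n : ℕ) : Primrec (VCode.ofNat n) :=
  Primrec.option_getD.comp Primrec.decode (Primrec.const ([], []))

theorem enumV1_eq (k : ℕ) : enumV1 n K M M₁ k = (VCode.ofNat n k).toV1 K M M₁ := by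
  unfold enumV1 VCode.ofNat
  cases @Encodable.decode (VCode n) Primcodable.toEncodable k with
  | none => exact VCode.toV1_nil.symm
  | some c => rfl

theorem VCode.exists_val (l₁ : List (RatBox (Fin n) × RatBox (Fin n)))
    (l₂ : List (RatBox (Fin n) × RatBox (Fin n × Fin n))) :
    ∃ c : VCode n, VCode.val₁ c = l₁ ∧ VCode.val₂ c = l₂ := by
  obtain ⟨c₁, h₁⟩ := List.exists_map_eq (f := fun e : (Fin n → PairCode) × (Fin n → PairCode) =>
    ((fun i => PairCode.val (e.1 i), fun i => PairCode.val (e.2 i)) :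
      RatBox (Fin n) × RatBox (Fin n))) (by
      rintro ⟨d, d'⟩
      choose e he using fun i => PairCode.exists_val (d i)
      choose e' he' using fun i => PairCode.exists_val (d' i)
      exact ⟨(e, e'), Prod.ext (funext he) (funext he')⟩) l₁
  obtain ⟨c₂, h₂⟩ := List.exists_map_eq
    (f := fun e : (Fin n → PairCode) × (Fin n → Fin n → PairCode) =>
    ((fun i => PairCode.val (e.1 i), fun ij => PairCode.val (e.2 ij.1 ij.2)) :
      RatBox (Fin n) × RatBox (Fin n × Fin n))) (by
      rintro ⟨d, d'⟩
      choose e he using fun i => PairCode.exists_val (d i)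
      choose e' he' using fun i j => PairCode.exists_val (d' (i, j))
      exact ⟨(e, e'), Prod.ext (funext he) (funext fun ij => he' ij.1 ij.2)⟩) l₂
  exact ⟨(c₁, c₂), h₁, h₂⟩

theorem exists_enumV1_eq {v : V1 n K M M₁} {l₁ : List (RatBox (Fin n) × RatBox (Fin n))}
    {l₂ : List (RatBox (Fin n) × RatBox (Fin n × Fin n))}
    (h₁ : IsStepFunOf (boxOpen K) l₁ v.u) (h₂ : IsStepFunOf (boxOpen K) l₂ v.u') :
    ∃ k, enumV1 n K M M₁ k = v := by
  obtain ⟨c, rfl, rfl⟩ := VCode.exists_val l₁ l₂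
  refine ⟨@Encodable.encode (VCode n) Primcodable.toEncodable c, ?_⟩
  rw [enumV1_eq, VCode.ofNat, @Encodable.encodek (VCode n) Primcodable.toEncodable]
  exact VCode.toV1_eq h₁ h₂

theorem VCode.ofNat_zero (n : ℕ) : VCode.ofNat n 0 = ([], []) := by
  unfold VCode.ofNat
  have h : @Encodable.encode (VCode n) Primcodable.toEncodable ([], []) = 0 := rfl
  rw [← h, @Encodable.encodek (VCode n) Primcodable.toEncodable]
  rfl

theorem isBot_enumV1_zero : IsBot (enumV1 n K M M₁ 0) := by
  rw [enumV1_eq, VCode.ofNat_zero, VCode.toV1_nil]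
  exact isBot_bot

theorem isDomainBasis_enumV1 (hK : 0 < K) : IsDomainBasis (enumV1 n K M M₁) := by
  refine isDomainBasis_of_directed V1.stepApprox V1.stepApprox_nonempty V1.directedOn_stepApprox
    (V1.isLUB_stepApprox hK) ?_
  rintro v w ⟨l₁, l₂, h1, h2, h3, h4⟩
  exact ⟨exists_enumV1_eq h1 h2, V1.wayBelow_of_stepBelow hK h1 h2 h3 h4⟩

end VBasis

/-! ## Multilinear interpolation -/

section Interpolation

open Function

variable {n : ℕ}

theorem add_mul_le_of_forall_add_one {φ : ℤ → ℝ} {l : ℝ} {p q : ℤ} (hpq : p ≤ q)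
    (h : ∀ m, p ≤ m → m < q → l ≤ φ (m + 1) - φ m) : φ p + l * (q - p) ≤ φ q := by
  induction q, hpq using Int.leInduction with
  | base => simp
  | succ q hpq ih =>
    have h1 := ih fun m h1 h2 => h m h1 (by omega)
    have h2 := h q hpq (by omega)
    push_cast
    linarith

/-- Piecewise linear interpolation of a function of integers. -/
def lerp (φ : ℤ → ℝ) (t : ℝ) : ℝ := (1 - Int.fract t) * φ ⌊t⌋ + Int.fract t * φ (⌊t⌋ + 1)

/-- A convex combination of two neighbouring values. At an integer `t` the right neighbour may leave
the range, but its weight is zero. -/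
theorem le_lerp {φ : ℤ → ℝ} {c : ℝ} {p q : ℤ} (h : ∀ m, p ≤ m → m ≤ q → c ≤ φ m) {t : ℝ}
    (hp : (p : ℝ) ≤ t) (hq : t ≤ q) : c ≤ lerp φ t := by
  have h1 : c ≤ φ ⌊t⌋ := h _ (Int.le_floor.2 hp) (by
    have := (Int.floor_le t).trans hq
    exact_mod_cast this)
  rcases (Int.fract_nonneg t).eq_or_lt with h0 | h0
  · simpa [lerp, ← h0] using h1
  · have h2 : c ≤ φ (⌊t⌋ + 1) := h _ ((Int.le_floor.2 hp).trans (by omega)) (by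
      have : (⌊t⌋ : ℝ) < q := by linarith [Int.floor_add_fract t]
      have : ⌊t⌋ < q := by exact_mod_cast this
      omega)
    have h3 := Int.fract_lt_one t
    unfold lerp
    nlinarith

/-- The interpolant has slope at least `l` in each cell. Unless both points lie in one cell, the
increment splits into the rest of the first cell, whole cells and the beginning of the last one. -/
theorem mul_le_lerp_sub_lerp {φ : ℤ → ℝ} {l : ℝ} {p q : ℤ}
    (h : ∀ m, p ≤ m → m < q → l ≤ φ (m + 1) - φ m) {t s : ℝ} (hp : (p : ℝ) ≤ t) (hts : t ≤ s)
    (hq : s ≤ q) : l * (s - t) ≤ lerp φ s - lerp φ t := by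
  have hfl : ∀ r : ℝ, (p : ℝ) ≤ r → r ≤ q → Int.fract r * l ≤
      Int.fract r * (φ (⌊r⌋ + 1) - φ ⌊r⌋) := by
    intro r h1 h2
    rcases (Int.fract_nonneg r).eq_or_lt with h0 | h0
    · simp [← h0]
    · refine mul_le_mul_of_nonneg_left (h _ (Int.le_floor.2 h1) ?_) h0.le
      have : (⌊r⌋ : ℝ) < q := by linarith [Int.floor_add_fract r]
      exact_mod_cast this
  have e1 : ∀ r : ℝ, lerp φ r = φ ⌊r⌋ + Int.fract r * (φ (⌊r⌋ + 1) - φ ⌊r⌋) := fun r => by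
    unfold lerp; ring
  have hs := hfl s (hp.trans hts) hq
  have ht := hfl t hp (hts.trans hq)
  have hs' := Int.floor_add_fract s
  have ht' := Int.floor_add_fract t
  have hfs := Int.fract_lt_one s
  have hft := Int.fract_lt_one t
  rcases (Int.floor_mono hts).eq_or_lt with he | hlt
  · rw [e1 s, e1 t, ← he]
    rw [← he] at hs hs'
    rcases (Int.fract_nonneg s).eq_or_lt with h0 | h0
    · have : Int.fract t = 0 := by linarith [Int.fract_nonneg t]
      have : s = t := by linarith
      subst this
      simp
    · have h1 : l ≤ φ (⌊t⌋ + 1) - φ ⌊t⌋ := le_of_mul_le_mul_left hs h0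
      have h2 : s - t = Int.fract s - Int.fract t := by linarith
      rw [h2]
      nlinarith
  · have h1 : φ (⌊t⌋ + 1) + l * ((⌊s⌋ : ℤ) - ((⌊t⌋ + 1 : ℤ) : ℝ)) ≤ φ ⌊s⌋ := by
      refine add_mul_le_of_forall_add_one (by omega) fun m h1 h2 => h m ?_ ?_
      · have := Int.le_floor.2 hp
        omega
      · have : (⌊s⌋ : ℝ) ≤ q := by linarith [Int.fract_nonneg s]
        have : ⌊s⌋ ≤ q := by exact_mod_cast this
        omega
    have h3 : l ≤ φ (⌊t⌋ + 1) - φ ⌊t⌋ := by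
      refine h _ (Int.le_floor.2 hp) ?_
      have h4 : (⌊s⌋ : ℝ) ≤ q := by linarith [Int.fract_nonneg s]
      have h5 : ⌊s⌋ ≤ q := by exact_mod_cast h4
      omega
    push_cast at h1
    rw [e1 s, e1 t]
    have h4 : (1 - Int.fract t) * l ≤ (1 - Int.fract t) * (φ (⌊t⌋ + 1) - φ ⌊t⌋) :=
      mul_le_mul_of_nonneg_left h3 (by linarith)
    -- The length `s - t` is split in the same manner: whole cells, fractional part of `s`,
    -- complement of the fractional part of `t`.
    have h5 : l * (s - t) = l * (⌊s⌋ - (⌊t⌋ + 1)) + Int.fract s * l + (1 - Int.fract t) * l := by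
      conv_lhs => rw [← hs', ← ht']
      ring
    linarith

/-- Multilinear interpolation in the coordinates of the list. -/
def interpolate (w : (Fin n → ℤ) → ℝ) : List (Fin n) → (Fin n → ℝ) → ℝ
  | [], x => w fun k => ⌊x k⌋
  | k :: L, x => lerp (fun m => interpolate w L (update x k (m : ℝ))) (x k)

theorem lerp_neg (φ : ℤ → ℝ) (t : ℝ) : lerp (fun m => -φ m) t = -lerp φ t := by
  unfold lerp; ring

theorem interpolate_neg (w : (Fin n → ℤ) → ℝ) (L : List (Fin n)) (x : Fin n → ℝ) :
    interpolate (fun z => -w z) L x = -interpolate w L x := by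
  induction L generalizing x with
  | nil => rfl
  | cons k L ih =>
    simp only [interpolate, ih]
    exact lerp_neg _ _

/-- The coordinates of `x` outside of the list are integers. -/
def IntegralOff (L : List (Fin n)) (x : Fin n → ℝ) : Prop := ∀ k ∉ L, ∃ m : ℤ, x k = m

theorem IntegralOff.update {k : Fin n} {L : List (Fin n)} {x : Fin n → ℝ}
    (h : IntegralOff (k :: L) x) (m : ℤ) : IntegralOff L (update x k (m : ℝ)) := by
  intro l hl
  by_cases hlk : l = k
  · subst hlk; exact ⟨m, by simp⟩
  · rw [update_of_ne hlk]
    exact h l (by simp [hlk, hl])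

/-- The points of a hyper-rectangle with integer vertices. -/
def intBox (lo hi : Fin n → ℤ) : Set (Fin n → ℝ) := {x | ∀ k, (lo k : ℝ) ≤ x k ∧ x k ≤ hi k}

theorem update_mem_intBox {lo hi : Fin n → ℤ} {x : Fin n → ℝ} (hx : x ∈ intBox lo hi) {k : Fin n}
    {t : ℝ} (h1 : (lo k : ℝ) ≤ t) (h2 : t ≤ hi k) : update x k t ∈ intBox lo hi := by
  intro l
  by_cases hl : l = k
  · subst hl; simpa using ⟨h1, h2⟩
  · simpa [hl] using hx l

theorem floor_mem_of_integral {lo hi : Fin n → ℤ} {x : Fin n → ℝ} (hx : x ∈ intBox lo hi) :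
    lo ≤ (fun k => ⌊x k⌋) ∧ (fun k => ⌊x k⌋) ≤ hi :=
  ⟨fun k => Int.le_floor.2 (hx k).1, fun k => by
    have := (Int.floor_le (x k)).trans (hx k).2
    exact_mod_cast this⟩

theorem le_interpolate {w : (Fin n → ℤ) → ℝ} {lo hi : Fin n → ℤ} {c : ℝ}
    (h : ∀ z, lo ≤ z → z ≤ hi → c ≤ w z) (L : List (Fin n)) {x : Fin n → ℝ}
    (hx : x ∈ intBox lo hi) : c ≤ interpolate w L x := by
  induction L generalizing x with
  | nil => exact h _ (floor_mem_of_integral hx).1 (floor_mem_of_integral hx).2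
  | cons k L ih =>
    refine le_lerp (p := lo k) (q := hi k) (fun m h1 h2 => ih ?_) (hx k).1 (hx k).2
    exact update_mem_intBox hx (by exact_mod_cast h1) (by exact_mod_cast h2)

/-- Induction on the list. When the direction `j` itself is interpolated, the bound comes from unit
steps by `mul_le_lerp_sub_lerp`; any other direction only averages the increments. Coordinates no
longer in the list are integers, so the base case telescopes along the grid. -/
theorem mul_le_interpolate_sub {w : (Fin n → ℤ) → ℝ} {lo hi : Fin n → ℤ} {j : Fin n} {l : ℝ}
    (h : ∀ z, lo ≤ z → update z j (z j + 1) ≤ hi → l ≤ w (update z j (z j + 1)) - w z)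
    (L : List (Fin n)) {x : Fin n → ℝ} {s : ℝ} (hx : x ∈ intBox lo hi)
    (hs : update x j s ∈ intBox lo hi) (hL : IntegralOff L x) (hL' : IntegralOff L (update x j s))
    (hxs : x j ≤ s) : l * (s - x j) ≤ interpolate w L (update x j s) - interpolate w L x := by
  induction L generalizing x s with
  | nil =>
    obtain ⟨p, hp⟩ := hL j (by simp)
    obtain ⟨q, hq⟩ := hL' j (by simp)
    rw [update_self] at hq
    subst hq
    have hsj := hs j
    have hxj := hx j
    rw [update_self] at hsj
    rw [hp] at hxs hxj ⊢
    have hpq : p ≤ q := by exact_mod_cast hxs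
    have hfl := floor_mem_of_integral hx
    have e : ∀ m : ℤ, update (fun k => ⌊x k⌋) j m = fun k => ⌊update x j (m : ℝ) k⌋ := by
      intro m; funext k
      by_cases hk : k = j
      · subst hk; simp
      · simp [hk]
    have := add_mul_le_of_forall_add_one (φ := fun m => w (update (fun k => ⌊x k⌋) j m)) (l := l)
      hpq (by
        intro m h1 h2
        have h3 := h (update (fun k => ⌊x k⌋) j m) ?_ ?_
        · simpa using h3
        · intro k
          by_cases hk : k = j
          · subst hk
            have : lo k ≤ p := by exact_mod_cast hxj.1
            simp; omega
          · simpa [hk] using hfl.1 k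
        · intro k
          by_cases hk : k = j
          · subst hk
            have : q ≤ hi k := by exact_mod_cast hsj.2
            simp; omega
          · simpa [hk] using hfl.2 k)
    have e0 : update (fun k => ⌊x k⌋) j p = fun k => ⌊x k⌋ := by
      have : p = (fun k => ⌊x k⌋) j := by simp [hp]
      conv_lhs => rw [this]
      exact update_eq_self _ _
    rw [e0, e q] at this
    simp only [interpolate]
    linarith
  | cons k L ih =>
    by_cases hk : k = j
    · subst hk
      simp only [interpolate, update_idem, update_self]
      have hsk := hs k
      rw [update_self] at hsk
      refine mul_le_lerp_sub_lerp (p := lo k) (q := hi k) (fun m h1 h2 => ?_) (hx k).1 hxs hsk.2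
      have h3 := ih (x := update x k (m : ℝ)) (s := ((m + 1 : ℤ) : ℝ)) ?_ ?_ (hL.update m) ?_ ?_
      · simpa using h3
      · exact update_mem_intBox hx (by exact_mod_cast h1) (by exact_mod_cast h2.le)
      · rw [update_idem]
        exact update_mem_intBox hx (by exact_mod_cast h1.trans (by omega)) (by exact_mod_cast h2)
      · rw [update_idem]
        exact hL.update _
      · simp
    · have hkj : j ≠ k := fun h => hk h.symm
      simp only [interpolate, update_of_ne hk]
      -- Interpolation in direction `k ≠ j` uses the same weights at both points, so the increment
      -- is the interpolation of the increments.
      have h1 := le_lerp (φ := fun m : ℤ => interpolate w L (update (update x j s) k (m : ℝ)) -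
        interpolate w L (update x k (m : ℝ))) (c := l * (s - x j)) (p := lo k) (q := hi k)
        (fun m h1 h2 => by
          have h3 := ih (x := update x k (m : ℝ)) (s := s)
            (update_mem_intBox hx (by exact_mod_cast h1) (by exact_mod_cast h2)) ?_ (hL.update m)
            ?_ ?_
          · rwa [update_of_ne hkj, update_comm hk] at h3
          · rw [update_comm hk]
            exact update_mem_intBox hs (by exact_mod_cast h1) (by exact_mod_cast h2)
          · rw [update_comm hk]
            exact hL'.update m
          · rwa [update_of_ne hkj]) (hx k).1 (hx k).2
      refine h1.trans (le_of_eq ?_)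
      unfold lerp
      ring

/-- The difference quotients of `f` along the axes inside of `A` are bounded by `l` and `u`. -/
def SlopeBound (A : Set (Fin n → ℝ)) (l u : Fin n → ℝ) (f : (Fin n → ℝ) → ℝ) : Prop :=
  ∀ x ∈ A, ∀ j s, update x j s ∈ A → x j ≤ s →
    l j * (s - x j) ≤ f (update x j s) - f x ∧ f (update x j s) - f x ≤ u j * (s - x j)

/-- A function on the integer grid extends to a function that satisfies the same bounds for its
values and its slopes on all hyper-rectangles with integer vertices. -/
theorem exists_interpolation (w : (Fin n → ℤ) → ℝ) : ∃ g : (Fin n → ℝ) → ℝ,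
    (∀ (lo hi : Fin n → ℤ) (l u : ℝ), (∀ z, lo ≤ z → z ≤ hi → l ≤ w z ∧ w z ≤ u) →
      ∀ x ∈ intBox lo hi, l ≤ g x ∧ g x ≤ u) ∧
    (∀ (lo hi : Fin n → ℤ) (l u : Fin n → ℝ),
      (∀ z j, lo ≤ z → update z j (z j + 1) ≤ hi →
        l j ≤ w (update z j (z j + 1)) - w z ∧ w (update z j (z j + 1)) - w z ≤ u j) →
      SlopeBound (intBox lo hi) l u g) := by
  have hall : ∀ x : Fin n → ℝ, IntegralOff (List.finRange n) x := fun x k hk =>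
    absurd (List.mem_finRange k) hk
  refine ⟨interpolate w (List.finRange n), fun lo hi l u h x hx => ⟨?_, ?_⟩,
    fun lo hi l u h x hx j s hs hxs => ⟨?_, ?_⟩⟩
  · exact le_interpolate (fun z h1 h2 => (h z h1 h2).1) _ hx
  · have := le_interpolate (w := fun z => -w z) (c := -u)
      (fun z h1 h2 => neg_le_neg (h z h1 h2).2) (List.finRange n) hx
    rw [interpolate_neg] at this
    linarith
  · exact mul_le_interpolate_sub (fun z h1 h2 => (h z j h1 h2).1) _ hx hs (hall _) (hall _) hxs
  · have := mul_le_interpolate_sub (w := fun z => -w z) (l := -u j)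
      (fun z h1 h2 => by linarith [(h z j h1 h2).2]) (List.finRange n) hx hs (hall _) (hall _) hxs
    rw [interpolate_neg, interpolate_neg] at this
    linarith

end Interpolation

/-! ## Consistency of pairs of step functions -/

section Consistency

open Function Filter Topology

variable {n : ℕ} {K M M₁ : ℚ≥0}

/-- The points of the hyper-rectangle with given rational end-points. -/
def RatBox.region {ι : Type*} (d : RatBox ι) : Set (ι → ℝ) :=
  {x | ∀ k, ((d k).1 : ℝ) ≤ x k ∧ x k ≤ (d k).2}

/-- The end-points are those of a hyper-rectangle of full dimension contained in `[-R, R]^ι`. -/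
def RatBox.Proper {ι : Type*} (R : ℚ≥0) (d : RatBox ι) : Prop :=
  d.Fits R ∧ ∀ k, (d k).1 < (d k).2

/-- The end-points of the cube. -/
def cubeEnds (ι : Type*) (R : ℚ≥0) : RatBox ι := fun _ => (-(R : ℚ), (R : ℚ))

theorem cubeEnds_fits (ι : Type*) (R : ℚ≥0) : (cubeEnds ι R).Fits R := fun _ => by
  have : (0 : ℚ) ≤ R := R.2
  refine ⟨le_rfl, ?_, le_rfl⟩
  simp only [cubeEnds]
  linarith

theorem cubeEnds_proper (ι : Type*) {R : ℚ≥0} (hR : 0 < R) : (cubeEnds ι R).Proper R := by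
  refine ⟨cubeEnds_fits ι R, fun _ => ?_⟩
  have : (0 : ℚ) < R := by exact_mod_cast hR
  simp only [cubeEnds]
  linarith

theorem region_cubeEnds (ι : Type*) (R : ℚ≥0) : (cubeEnds ι R).region = Box.cube ι R := by
  ext x
  simp only [RatBox.region, cubeEnds, Box.cube, Box.toSet, mem_ofPred_eq, mem_Icc, Pi.le_def,
    Box.bot_lo, Box.bot_hi, ← forall_and]
  push_cast
  rfl

theorem RatBox.Fits.region_subset {ι : Type*} {R : ℚ≥0} {d : RatBox ι} (h : d.Fits R) :
    d.region ⊆ Box.cube ι R := by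
  intro x hx
  rw [← region_cubeEnds]
  intro k
  have h1 := h k
  have h2 : ((-(R : ℚ) : ℚ) : ℝ) ≤ (d k).1 := by exact_mod_cast h1.1
  have h3 : ((d k).2 : ℝ) ≤ ((R : ℚ) : ℝ) := by exact_mod_cast h1.2.2
  exact ⟨h2.trans (hx k).1, (hx k).2.trans h3⟩

/-- The scalar function `f` satisfies the constraints that the two lists of single-step functions
impose on the values and on the slopes of the `i`-th component of a vector field. -/
def Solves (K M M₁ : ℚ≥0) (L₁ : List (RatBox (Fin n) × RatBox (Fin n)))
    (L₂ : List (RatBox (Fin n) × RatBox (Fin n × Fin n))) (i : Fin n) (f : (Fin n → ℝ) → ℝ) :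
    Prop :=
  (∀ e ∈ L₁, e.1.Proper K → e.2.Fits M → ∀ x ∈ e.1.region,
    ((e.2 i).1 : ℝ) ≤ f x ∧ f x ≤ (e.2 i).2) ∧
  ∀ e ∈ L₂, e.1.Proper K → e.2.Fits M₁ →
    SlopeBound e.1.region (fun j => ((e.2 (i, j)).1 : ℝ)) (fun j => ((e.2 (i, j)).2 : ℝ)) f

theorem SlopeBound.isTie {A O : Set (Fin n → ℝ)} {b : NonemptyInterval (Fin n → ℝ)}
    {f : (Fin n → ℝ) → ℝ} (h : SlopeBound A b.fst b.snd f) (hOA : O ⊆ A)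
    (hO : ∀ y ∈ O, ∀ z ∈ O, ∀ T : Finset (Fin n), T.piecewise y z ∈ O) : IsTie O b f :=
  isTie_of_update_bounds hO fun z hz j s hs hzs => h z (hOA hz) j s (hOA hs) hzs

theorem piecewise_mem_of_forall {P : Fin n → ℝ → Prop} {y z : Fin n → ℝ} (hy : ∀ k, P k (y k))
    (hz : ∀ k, P k (z k)) (T : Finset (Fin n)) (k : Fin n) : P k (T.piecewise y z k) := by
  by_cases hk : k ∈ T
  · simpa [hk] using hy k
  · simpa [hk] using hz k

theorem RatBox.Describes.region_eq {ι : Type*} {R : ℚ≥0} {d : RatBox ι} {α : Box ι R}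
    (h : d.Describes α) : d.region = α.toSet := by
  ext x
  simp only [RatBox.region, Box.toSet, mem_ofPred_eq, mem_Icc, Pi.le_def, ← forall_and]
  exact forall_congr' fun k => by rw [(h k).1, (h k).2]

/-- A slope bound on a hyper-rectangle bounds the derivative at the points that it is way-below. -/
theorem lDerivMat_subset_of_slopeBound {h : (Fin n → ℝ) → Fin n → ℝ} {α : Box (Fin n) K}
    {b : Box (Fin n × Fin n) M₁}
    (hb : ∀ i, SlopeBound α.toSet (fun j => b.lo (i, j)) (fun j => b.hi (i, j)) fun y => h y i)
    {x : Fin n → ℝ} {hx : x ∈ Box.cube (Fin n) K} (hα : WayBelow α (Box.pt x hx)) :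
    lDerivMat (Box.cube (Fin n) K) h x ⊆ b.toSet := by
  intro A hA
  -- The interior of `α` relative to the cube: faces of `α` on the boundary of the cube impose no
  -- condition.
  let U : Set (Fin n → ℝ) := univ.pi fun k =>
    {t | (α.lo k = -(K : ℝ) ∨ α.lo k < t) ∧ (α.hi k = K ∨ t < α.hi k)}
  have hU : IsOpen U := by
    refine isOpen_set_pi finite_univ fun k _ => ?_
    rw [ofPred_and, ofPred_or, ofPred_or]
    exact (isOpen_const.union isOpen_Ioi).inter (isOpen_const.union isOpen_Iio)
  have hxU : x ∈ U := fun k _ => Box.wayBelow_iff.1 hα k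
  have hsub : U ∩ Box.cube (Fin n) K ⊆ α.toSet := by
    rintro y ⟨hyU, hyc⟩
    refine ⟨fun k => ?_, fun k => ?_⟩
    · rcases (hyU k trivial).1 with h1 | h1
      · rw [h1]; exact hyc.1 k
      · exact h1.le
    · rcases (hyU k trivial).2 with h1 | h1
      · rw [h1]; exact hyc.2 k
      · exact h1.le
  have key : ∀ i, (fun j => b.lo (i, j)) ≤ (fun j => A (i, j)) ∧
      (fun j => A (i, j)) ≤ fun j => b.hi (i, j) := by
    intro i
    exact NonemptyInterval.mem_def.1 (hA i U
      ⟨(fun j => b.lo (i, j), fun j => b.hi (i, j)), fun j => b.lo_le_hi (i, j)⟩ hU hxU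
      (SlopeBound.isTie (hb i) hsub fun y hy z hz T =>
        ⟨fun k _ => piecewise_mem_of_forall (fun k => hy.1 k trivial) (fun k => hz.1 k trivial) T k,
          piecewise_mem_cube hy.2 hz.2 T⟩))
  exact ⟨fun ij => (key ij.1).1 ij.2, fun ij => (key ij.1).2 ij.2⟩

theorem lDerivMat_nonempty {h : (Fin n → ℝ) → Fin n → ℝ} {x : Fin n → ℝ}
    (hx : x ∈ Box.cube (Fin n) K) (hK : 0 < K) : (lDerivMat (Box.cube (Fin n) K) h x).Nonempty := by
  choose p hp using fun i => lDeriv_nonempty (f := fun y => h y i) hx hK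
  exact ⟨fun ij => p ij.1 ij.2, hp⟩

theorem exists_isLUB_of_forall_mem {ι : Type*} {R : ℚ≥0} {S : Set (Box ι R)} {p : ι → ℝ}
    (h : ∀ b ∈ S, p ∈ b.toSet) : ∃ X, IsLUB S X :=
  Box.exists_isLUB S fun _ hX _ hY i => ((h _ hX).1 i).trans ((h _ hY).2 i)

theorem describes_proper (hK : 0 < K) {d : RatBox (Fin n)} {α : Box (Fin n) K}
    (hd : d.Describes α) {β : Box (Fin n) K} (h : WayBelow α β) : d.Proper K := by
  refine ⟨hd.fits, fun k => ?_⟩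
  have := (exists_wayBelow_iff hK).1 ⟨β, h⟩ k
  rw [(hd k).1, (hd k).2] at this
  exact_mod_cast this

/-- Solutions of the constraints of all components yield a consistent pair. -/
theorem exists_V1_of_solves (hK : 0 < K) {l₁ : List (RatBox (Fin n) × RatBox (Fin n))}
    {l₂ : List (RatBox (Fin n) × RatBox (Fin n × Fin n))} {h : (Fin n → ℝ) → Fin n → ℝ}
    (hh : ∀ i, Solves K M M₁ ((cubeEnds _ K, cubeEnds _ M) :: l₁)
      ((cubeEnds _ K, cubeEnds _ M₁) :: l₂) i fun x => h x i) :
    ∃ v : V1 n K M M₁, IsStepFunOf (boxOpen K) l₁ v.u ∧ IsStepFunOf (boxOpen K) l₂ v.u' := by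
  have hval : ∀ {d : RatBox (Fin n)} {d' : RatBox (Fin n)} {b : Box (Fin n) M},
      (d, d') ∈ ((cubeEnds _ K, cubeEnds _ M) :: l₁) → d.Proper K → d'.Describes b →
      ∀ x ∈ d.region, h x ∈ b.toSet := by
    intro d d' b hm hd hb x hx
    refine ⟨fun i => ?_, fun i => ?_⟩
    · rw [(hb i).1]; exact ((hh i).1 _ hm hd hb.fits x hx).1
    · rw [(hb i).2]; exact ((hh i).1 _ hm hd hb.fits x hx).2
  have hslope : ∀ {d : RatBox (Fin n)} {d' : RatBox (Fin n × Fin n)} {b : Box (Fin n × Fin n) M₁}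
      {α : Box (Fin n) K}, (d, d') ∈ ((cubeEnds _ K, cubeEnds _ M₁) :: l₂) → d.Proper K →
      d.Describes α → d'.Describes b → ∀ x (hx : x ∈ Box.cube (Fin n) K),
      WayBelow α (Box.pt x hx) → lDerivMat (Box.cube (Fin n) K) h x ⊆ b.toSet := by
    intro d d' b α hm hd hα hb x hx hw
    refine lDerivMat_subset_of_slopeBound (fun i => ?_) hw
    have h1 := (hh i).2 _ hm hd hb.fits
    rw [hα.region_eq] at h1
    convert h1 using 1
    · funext j; exact (hb (i, j)).1
    · funext j; exact (hb (i, j)).2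
  have hcube : ∀ {ι : Type} {R : ℚ≥0}, (cubeEnds ι R).Describes (⊥ : Box ι R) := by
    intro ι R k
    simp [cubeEnds, Box.bot_lo, Box.bot_hi]
  -- The cube entry at the head of the second list supplies the global bound, which is needed where
  -- no entry of `l₂` is active.
  have hM₁ : ∀ x ∈ Box.cube (Fin n) K,
      lDerivMat (Box.cube (Fin n) K) h x ⊆ Box.cube (Fin n × Fin n) M₁ := fun x hx =>
    hslope List.mem_cons_self (cubeEnds_proper _ hK) hcube hcube x hx (isBot_bot.wayBelow _)
  have hact₁ : ∀ (β : Box (Fin n) K) x, x ∈ β.toSet →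
      ∀ b ∈ {b : Box (Fin n) M | ∃ e ∈ l₁, β ∈ boxOpen K e.1 ∧ e.2.Describes b},
        h x ∈ b.toSet := by
    rintro β x hx b ⟨e, he, ⟨α, hα, hw⟩, hb⟩
    refine hval (List.mem_cons_of_mem _ he) (describes_proper hK hα hw) hb x ?_
    rw [hα.region_eq]
    exact Box.toSet_anti hw.le hx
  have hact₂ : ∀ (β : Box (Fin n) K) x, x ∈ β.toSet →
      ∀ b ∈ {b : Box (Fin n × Fin n) M₁ | ∃ e ∈ l₂, β ∈ boxOpen K e.1 ∧ e.2.Describes b},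
        lDerivMat (Box.cube (Fin n) K) h x ⊆ b.toSet := by
    rintro β x hx b ⟨e, he, ⟨α, hα, hw⟩, hb⟩
    exact hslope (List.mem_cons_of_mem _ he) (describes_proper hK hα hw) hα hb x
      (Box.toSet_subset_cube β hx) (hw.trans_le (Box.le_pt_iff.2 hx))
  choose u hu using fun β : Box (Fin n) K =>
    exists_isLUB_of_forall_mem (hact₁ β β.lo β.lo_mem)
  have hne : ∀ β : Box (Fin n) K, ∃ X, IsLUB
      {b : Box (Fin n × Fin n) M₁ | ∃ e ∈ l₂, β ∈ boxOpen K e.1 ∧ e.2.Describes b} X := by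
    intro β
    obtain ⟨A, hA⟩ := lDerivMat_nonempty (h := h) (Box.toSet_subset_cube β β.lo_mem) hK
    exact exists_isLUB_of_forall_mem fun b hb => hact₂ β β.lo β.lo_mem b hb hA
  choose u' hu' using hne
  refine ⟨⟨u, u', IsStepFunOf.scottContinuous (l := l₁) hu,
    IsStepFunOf.scottContinuous (l := l₂) hu', h, fun x hx => ?_, ?_, ?_⟩, hu, hu'⟩
  · refine hval List.mem_cons_self (cubeEnds_proper _ hK) hcube x ?_
    rwa [region_cubeEnds]
  · rintro β x hx y hy
    rw [mem_singleton_iff] at hy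
    subst hy
    refine Box.mem_toSet_of_isLUB (hu β) ?_ (hact₁ β x hx)
    refine hval List.mem_cons_self (cubeEnds_proper _ hK) hcube x ?_
    rw [region_cubeEnds]
    exact Box.toSet_subset_cube β hx
  · intro β x hx A hA
    exact Box.mem_toSet_of_isLUB (hu' β) (hM₁ x (Box.toSet_subset_cube β hx) hA)
      fun b hb => hact₂ β x hx b hb hA

/-- Slope bounds along the axes combine to a tie, and a tie is a Lipschitz estimate. -/
theorem SlopeBound.continuousOn {A : Set (Fin n → ℝ)}
    (hA : ∀ y ∈ A, ∀ z ∈ A, ∀ T : Finset (Fin n), T.piecewise y z ∈ A)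
    {b : NonemptyInterval (Fin n → ℝ)} {f : (Fin n → ℝ) → ℝ} (h : SlopeBound A b.fst b.snd f) :
    ContinuousOn f A := by
  have htie := h.isTie Subset.rfl hA
  intro x hx
  have hb : ∀ y ∈ A, |f y - f x| ≤ ∑ j, max |b.fst j| |b.snd j| * |y j - x j| := by
    intro y hy
    obtain ⟨p, hp, he⟩ := htie y hy x hx
    rw [he]
    refine (Finset.abs_sum_le_sum_abs _ _).trans (Finset.sum_le_sum fun j _ => ?_)
    rw [abs_mul]
    exact mul_le_mul_of_nonneg_right (abs_le_max_abs_abs ((NonemptyInterval.mem_def.1 hp).1 j)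
      ((NonemptyInterval.mem_def.1 hp).2 j)) (abs_nonneg _)
  have hlim : Tendsto (fun y : Fin n → ℝ => ∑ j, max |b.fst j| |b.snd j| * |y j - x j|)
      (𝓝[A] x) (𝓝 0) := by
    have hc : Continuous fun y : Fin n → ℝ => ∑ j, max |b.fst j| |b.snd j| * |y j - x j| := by
      fun_prop
    have := hc.tendsto x
    simp only [sub_self, abs_zero, mul_zero, Finset.sum_const_zero] at this
    exact this.mono_left inf_le_left
  rw [ContinuousWithinAt, tendsto_iff_dist_tendsto_zero]
  refine squeeze_zero' (Eventually.of_forall fun _ => dist_nonneg) ?_ hlim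
  filter_upwards [self_mem_nhdsWithin] with y hy
  exact hb y hy

/-- A bound for the slopes in the interior of a hyper-rectangle holds on its closure. -/
theorem le_of_forall_interior {d : RatBox (Fin n)} (hd : d.Proper K) {G : (Fin n → ℝ) → ℝ → ℝ}
    {j : Fin n} (hG : ContinuousOn (fun p : (Fin n → ℝ) × ℝ => G p.1 p.2)
      {p | p.1 ∈ Box.cube (Fin n) K ∧ update p.1 j p.2 ∈ Box.cube (Fin n) K ∧ p.1 j ≤ p.2})
    (h : ∀ x s, (∀ k, ((d k).1 : ℝ) < x k ∧ x k < ((d k).2 : ℝ)) →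
      (∀ k, ((d k).1 : ℝ) < update x j s k ∧ update x j s k < ((d k).2 : ℝ)) → x j ≤ s → 0 ≤ G x s)
    {x : Fin n → ℝ} {s : ℝ} (hx : x ∈ d.region) (hs : update x j s ∈ d.region) (hxs : x j ≤ s) :
    0 ≤ G x s := by
  -- Contracting both points towards the centre `c` of the box moves them into the interior and
  -- keeps them on a common line in direction `j`; then the contraction tends to the identity.
  let c : Fin n → ℝ := fun k => (((d k).1 : ℝ) + (d k).2) / 2
  let y : ℝ → Fin n → ℝ := fun t => fun k => x k + t * (c k - x k)
  let r : ℝ → ℝ := fun t => s + t * (c j - s)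
  have hdk : ∀ k, ((d k).1 : ℝ) < (d k).2 := fun k => by exact_mod_cast hd.2 k
  have hlt : ∀ (k : Fin n) (q t : ℝ), 0 < t → t < 1 → ((d k).1 : ℝ) ≤ q → q ≤ (d k).2 →
      ((d k).1 : ℝ) < q + t * (c k - q) ∧ q + t * (c k - q) < ((d k).2 : ℝ) := by
    intro k q t h0 h1 h2 h3
    have := hdk k
    simp only [c]
    constructor <;> nlinarith [mul_nonneg h0.le (sub_nonneg.2 h2), mul_nonneg h0.le (sub_nonneg.2 h3)]
  have hyr : ∀ t, update (y t) j (r t) = fun k => update x j s k + t * (c k - update x j s k) := by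
    intro t; funext k
    by_cases hk : k = j
    · subst hk; simp [r]
    · simp [hk, y]
  have hle : ∀ t, 0 < t → t < 1 → y t j ≤ r t := fun t h0 h1 => by simp only [y, r]; nlinarith
  have hin : ∀ t, 0 < t → t < 1 → (∀ k, ((d k).1 : ℝ) < y t k ∧ y t k < ((d k).2 : ℝ)) ∧
      ∀ k, ((d k).1 : ℝ) < update (y t) j (r t) k ∧ update (y t) j (r t) k < ((d k).2 : ℝ) := by
    intro t h0 h1
    refine ⟨fun k => hlt k _ t h0 h1 (hx k).1 (hx k).2, fun k => ?_⟩
    rw [hyr]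
    exact hlt k _ t h0 h1 (hs k).1 (hs k).2
  have hlim : Tendsto (fun t : ℝ => (y t, r t)) (𝓝[>] 0)
      (𝓝[{p | p.1 ∈ Box.cube (Fin n) K ∧ update p.1 j p.2 ∈ Box.cube (Fin n) K ∧ p.1 j ≤ p.2}]
        (x, s)) := by
    refine tendsto_nhdsWithin_iff.2 ⟨?_, ?_⟩
    · have hc : Continuous fun t : ℝ => (y t, r t) := by fun_prop
      have := hc.tendsto 0
      simp only [y, r, zero_mul, add_zero] at this
      exact this.mono_left inf_le_left
    · filter_upwards [Ioo_mem_nhdsGT (zero_lt_one' ℝ)] with t ht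
      obtain ⟨h1, h2⟩ := hin t ht.1 ht.2
      exact ⟨hd.1.region_subset fun k => ⟨(h1 k).1.le, (h1 k).2.le⟩,
        hd.1.region_subset fun k => ⟨(h2 k).1.le, (h2 k).2.le⟩, hle t ht.1 ht.2⟩
  have hmem : (x, s) ∈ {p : (Fin n → ℝ) × ℝ |
      p.1 ∈ Box.cube (Fin n) K ∧ update p.1 j p.2 ∈ Box.cube (Fin n) K ∧ p.1 j ≤ p.2} :=
    ⟨hd.1.region_subset hx, hd.1.region_subset hs, hxs⟩
  refine ge_of_tendsto ((hG _ hmem).tendsto.comp hlim) ?_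
  filter_upwards [Ioo_mem_nhdsGT (zero_lt_one' ℝ)] with t ht
  exact h _ _ (hin t ht.1 ht.2).1 (hin t ht.1 ht.2).2 (hle t ht.1 ht.2)

theorem wayBelow_pt_of_lt {α : Box (Fin n) K} {x : Fin n → ℝ} {hx : x ∈ Box.cube (Fin n) K}
    (h : ∀ k, α.lo k < x k ∧ x k < α.hi k) : WayBelow α (Box.pt x hx) :=
  Box.wayBelow_of_lt fun k => ⟨Or.inr (h k).1, Or.inr (h k).2⟩

/-- `AxisBounds` needs strict premises, so it is applied with the end-points of `b` moved outwards
by a small amount, which then tends to zero. -/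
theorem AxisBounds.le_of_forall_le {u' : Box (Fin n) K → Box (Fin n × Fin n) M₁}
    {h : (Fin n → ℝ) → Fin n → ℝ} (hb : AxisBounds u' h) {b : Box (Fin n × Fin n) M₁} {i j : Fin n}
    {z : Fin n → ℝ} {s : ℝ} (hz : z ∈ Box.cube (Fin n) K) (hs : update z j s ∈ Box.cube (Fin n) K)
    (hzs : z j ≤ s) (hle : ∀ t ∈ Icc (z j) s, ∀ ht : update z j t ∈ Box.cube (Fin n) K,
      b ≤ u' (Box.pt _ ht)) :
    b.lo (i, j) * (s - z j) ≤ h (update z j s) i - h z i ∧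
      h (update z j s) i - h z i ≤ b.hi (i, j) * (s - z j) := by
  have h0 : 0 ≤ s - z j := by linarith
  have hlim : ∀ q : ℝ, Tendsto (fun ε : ℝ => (q + ε) * (s - z j)) (𝓝 0) (𝓝 (q * (s - z j))) := by
    intro q
    have hc : Continuous fun ε : ℝ => (q + ε) * (s - z j) := by fun_prop
    simpa using hc.tendsto 0
  constructor
  · refine le_of_tendsto ((hlim _).mono_left (nhdsWithin_le_nhds (s := Iio (0 : ℝ)))) ?_
    filter_upwards [self_mem_nhdsWithin] with ε hε
    refine (hb i j z s _ hz hs hzs).1 fun t ht htc => ?_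
    have := (hle t ht htc (i, j)).1
    have hε : ε < 0 := hε
    linarith
  · refine ge_of_tendsto ((hlim _).mono_left (nhdsWithin_le_nhds (s := Ioi (0 : ℝ)))) ?_
    filter_upwards [self_mem_nhdsWithin] with ε hε
    refine (hb i j z s _ hz hs hzs).2 fun t ht htc => ?_
    have := (hle t ht htc (i, j)).2
    have hε : 0 < ε := hε
    linarith

/-- A consistent pair yields solutions of the constraints. -/
theorem exists_solves_of_V1 (hK : 0 < K) {l₁ : List (RatBox (Fin n) × RatBox (Fin n))}
    {l₂ : List (RatBox (Fin n) × RatBox (Fin n × Fin n))} {v : V1 n K M M₁}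
    (h₁ : IsStepFunOf (boxOpen K) l₁ v.u) (h₂ : IsStepFunOf (boxOpen K) l₂ v.u') :
    ∃ h : (Fin n → ℝ) → Fin n → ℝ, ∀ i, Solves K M M₁ ((cubeEnds _ K, cubeEnds _ M) :: l₁)
      ((cubeEnds _ K, cubeEnds _ M₁) :: l₂) i fun x => h x i := by
  obtain ⟨h, hM, hu, hu'⟩ := v.consistent
  have hax := hu'.axisBounds hK
  -- The bound `⊥ ≤ u'` makes every witness Lipschitz. Continuity is needed because the entries of
  -- the lists speak about interiors only.
  have hcont : ∀ i, ContinuousOn (fun x => h x i) (Box.cube (Fin n) K) := by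
    intro i
    refine SlopeBound.continuousOn (fun y hy z hz T => piecewise_mem_cube hy hz T)
      (b := ⟨(fun j => (⊥ : Box (Fin n × Fin n) M₁).lo (i, j),
        fun j => (⊥ : Box (Fin n × Fin n) M₁).hi (i, j)),
        fun j => (⊥ : Box (Fin n × Fin n) M₁).lo_le_hi (i, j)⟩) ?_
    intro z hz j s hs hzs
    exact hax.le_of_forall_le (b := ⊥) hz hs hzs fun t _ _ => bot_le
  have hcube : ∀ {ι : Type} {R : ℚ≥0} {b : Box ι R}, (cubeEnds ι R).Describes b → b = ⊥ := by
    intro ι R b hb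
    refine hb.unique fun k => ?_
    simp [cubeEnds, Box.bot_lo, Box.bot_hi]
  have hbound₁ : ∀ e ∈ ((cubeEnds _ K, cubeEnds _ M) :: l₁), ∀ (α : Box (Fin n) K)
      (b : Box (Fin n) M), e.1.Describes α → e.2.Describes b → ∀ β, WayBelow α β → b ≤ v.u β := by
    intro e he α b hα hb β hw
    rcases List.mem_cons.1 he with rfl | he
    · rw [hcube hb]; exact bot_le
    · exact (h₁ β).1 ⟨e, he, ⟨α, hα, hw⟩, hb⟩
  have hbound₂ : ∀ e ∈ ((cubeEnds _ K, cubeEnds _ M₁) :: l₂), ∀ (α : Box (Fin n) K)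
      (b : Box (Fin n × Fin n) M₁), e.1.Describes α → e.2.Describes b →
        ∀ β, WayBelow α β → b ≤ v.u' β := by
    intro e he α b hα hb β hw
    rcases List.mem_cons.1 he with rfl | he
    · rw [hcube hb]; exact bot_le
    · exact (h₂ β).1 ⟨e, he, ⟨α, hα, hw⟩, hb⟩
  refine ⟨h, fun i => ⟨?_, ?_⟩⟩
  · intro e he hp hf x hx
    -- At interior points the entry is active, and the constraint is immediate;
    -- `le_of_forall_interior` extends it to the closed box.
    have hint : ∀ x, (∀ k, ((e.1 k).1 : ℝ) < x k ∧ x k < ((e.1 k).2 : ℝ)) →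
        ((e.2 i).1 : ℝ) ≤ h x i ∧ h x i ≤ (e.2 i).2 := by
      intro x hx
      have hxc : x ∈ Box.cube (Fin n) K :=
        hp.1.region_subset fun k => ⟨(hx k).1.le, (hx k).2.le⟩
      have h1 := hbound₁ e he _ _ (e.1.describes_toBox hp.1) (e.2.describes_toBox hf) (Box.pt x hxc)
        (wayBelow_pt_of_lt hx)
      have h2 : h x ∈ _ := Box.toSet_anti h1 (hu _ x (Box.le_pt_iff.1 le_rfl) rfl)
      exact ⟨h2.1 i, h2.2 i⟩
    have hc : ContinuousOn (fun p : (Fin n → ℝ) × ℝ => h p.1 i) {p | p.1 ∈ Box.cube (Fin n) K ∧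
        update p.1 i p.2 ∈ Box.cube (Fin n) K ∧ p.1 i ≤ p.2} :=
      (hcont i).comp continuous_fst.continuousOn fun p hp => hp.1
    have hxx : update x i (x i) ∈ e.1.region := by rwa [update_eq_self]
    constructor
    · have := le_of_forall_interior hp (G := fun x _ => h x i - (e.2 i).1) (j := i)
        (hc.sub continuousOn_const) (fun x s hx _ _ => sub_nonneg.2 (hint x hx).1) hx hxx le_rfl
      exact sub_nonneg.1 this
    · have := le_of_forall_interior hp (G := fun x _ => (e.2 i).2 - h x i) (j := i)
        (continuousOn_const.sub hc) (fun x s hx _ _ => sub_nonneg.2 (hint x hx).2) hx hxx le_rfl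
      exact sub_nonneg.1 this
  · intro e he hp hf x hx j s hs hxs
    have hint : ∀ x s, (∀ k, ((e.1 k).1 : ℝ) < x k ∧ x k < ((e.1 k).2 : ℝ)) →
        (∀ k, ((e.1 k).1 : ℝ) < update x j s k ∧ update x j s k < ((e.1 k).2 : ℝ)) → x j ≤ s →
        ((e.2 (i, j)).1 : ℝ) * (s - x j) ≤ h (update x j s) i - h x i ∧
          h (update x j s) i - h x i ≤ (e.2 (i, j)).2 * (s - x j) := by
      intro x s hx hs hxs
      refine hax.le_of_forall_le (b := e.2.toBox hf)
        (hp.1.region_subset fun k => ⟨(hx k).1.le, (hx k).2.le⟩)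
        (hp.1.region_subset fun k => ⟨(hs k).1.le, (hs k).2.le⟩) hxs fun t ht htc => ?_
      refine hbound₂ e he _ _ (e.1.describes_toBox hp.1) (e.2.describes_toBox hf) _
        (wayBelow_pt_of_lt fun k => ?_)
      by_cases hk : k = j
      · subst hk
        have h1 := hs k
        rw [update_self] at h1 ⊢
        exact ⟨(hx k).1.trans_le ht.1, ht.2.trans_lt h1.2⟩
      · rw [update_of_ne hk]
        exact hx k
    have hc1 : ContinuousOn (fun p : (Fin n → ℝ) × ℝ => h p.1 i) {p | p.1 ∈ Box.cube (Fin n) K ∧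
        update p.1 j p.2 ∈ Box.cube (Fin n) K ∧ p.1 j ≤ p.2} :=
      (hcont i).comp continuous_fst.continuousOn fun p hp => hp.1
    have hc2 : ContinuousOn (fun p : (Fin n → ℝ) × ℝ => h (update p.1 j p.2) i)
        {p | p.1 ∈ Box.cube (Fin n) K ∧ update p.1 j p.2 ∈ Box.cube (Fin n) K ∧ p.1 j ≤ p.2} :=
      (hcont i).comp (Continuous.continuousOn (by fun_prop)) fun p hp => hp.2.1
    constructor
    · have := le_of_forall_interior hp
        (G := fun x s => h (update x j s) i - h x i - (e.2 (i, j)).1 * (s - x j)) (j := j)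
        ((hc2.sub hc1).sub (Continuous.continuousOn (by fun_prop)))
        (fun x s hx hs hxs => sub_nonneg.2 (hint x s hx hs hxs).1) hx hs hxs
      exact sub_nonneg.1 this
    · have := le_of_forall_interior hp
        (G := fun x s => (e.2 (i, j)).2 * (s - x j) - (h (update x j s) i - h x i)) (j := j)
        ((Continuous.continuousOn (by fun_prop)).sub (hc2.sub hc1))
        (fun x s hx hs hxs => sub_nonneg.2 (hint x s hx hs hxs).2) hx hs hxs
      exact sub_nonneg.1 this

/-- The constraints on the rows of the derivative and on the values do not couple different
components, so each component may be solved separately. -/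
theorem VCode.valid_iff_solves (hK : 0 < K) {c : VCode n} :
    c.Valid K M M₁ ↔ ∀ i, ∃ f, Solves K M M₁ ((cubeEnds _ K, cubeEnds _ M) :: VCode.val₁ c)
      ((cubeEnds _ K, cubeEnds _ M₁) :: VCode.val₂ c) i f := by
  constructor
  · rintro ⟨v, h₁, h₂⟩ i
    obtain ⟨h, hh⟩ := exists_solves_of_V1 hK h₁ h₂
    exact ⟨_, hh i⟩
  · intro h
    choose f hf using h
    exact exists_V1_of_solves hK (h := fun x i => f i x) hf

end Consistency

/-! ## Consistency is decidable -/

section Grid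

open Function

variable {n : ℕ} {K M M₁ : ℚ≥0}

/-- The end-points become integers when multiplied by `D`. -/
def RatBox.IntegralAt {ι : Type*} (D : ℕ) (d : RatBox ι) : Prop :=
  ∀ k, (∃ m : ℤ, (m : ℚ) = D * (d k).1) ∧ ∃ m : ℤ, (m : ℚ) = D * (d k).2

/-- The point `z / D` of the grid with step `1 / D` belongs to the hyper-rectangle `d`. -/
def GridMem (D : ℕ) (d : RatBox (Fin n)) (z : Fin n → ℤ) : Prop :=
  ∀ k, D * (d k).1 ≤ z k ∧ (z k : ℚ) ≤ D * (d k).2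

/-- The integer function `w` on the grid with step `1 / D` satisfies, after scaling, the constraints
that two lists of single-step functions impose on the `i`-th component of a vector field. -/
def GridSolves (K M M₁ : ℚ≥0) (D : ℕ) (L₁ : List (RatBox (Fin n) × RatBox (Fin n)))
    (L₂ : List (RatBox (Fin n) × RatBox (Fin n × Fin n))) (i : Fin n) (w : (Fin n → ℤ) → ℤ) :
    Prop :=
  (∀ e ∈ L₁, e.1.Proper K → e.2.Fits M → ∀ z, GridMem D e.1 z →
    D * D * (e.2 i).1 ≤ w z ∧ (w z : ℚ) ≤ D * D * (e.2 i).2) ∧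
  ∀ e ∈ L₂, e.1.Proper K → e.2.Fits M₁ → ∀ z j, GridMem D e.1 z →
    GridMem D e.1 (update z j (z j + 1)) →
    D * (e.2 (i, j)).1 ≤ w (update z j (z j + 1)) - w z ∧
      (w (update z j (z j + 1)) - w z : ℚ) ≤ D * (e.2 (i, j)).2

theorem GridMem.div_mem {D : ℕ} (hD : 0 < D) {d : RatBox (Fin n)} {z : Fin n → ℤ}
    (h : GridMem D d z) : (fun k => (z k : ℝ) / D) ∈ d.region := by
  have hD' : (0 : ℝ) < D := by exact_mod_cast hD
  intro k
  have h1 : ((D : ℝ) * (d k).1) ≤ z k := by exact_mod_cast (h k).1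
  have h2 : (z k : ℝ) ≤ D * (d k).2 := by exact_mod_cast (h k).2
  constructor
  · rw [le_div_iff₀ hD']; linarith
  · rw [div_le_iff₀ hD']; linarith

/-- Integer bounds for a difference survive rounding, as the floor commutes with integer
translations. This is why the scaled bounds have to be integral. -/
theorem floor_bounds {x y : ℝ} {p q : ℤ} (h1 : (p : ℝ) ≤ y - x) (h2 : y - x ≤ q) :
    p ≤ ⌊y⌋ - ⌊x⌋ ∧ ⌊y⌋ - ⌊x⌋ ≤ q := by
  constructor
  · have : p + ⌊x⌋ ≤ ⌊y⌋ := Int.le_floor.2 (by push_cast; linarith [Int.floor_le x])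
    omega
  · have : ⌊y⌋ - q ≤ ⌊x⌋ := Int.le_floor.2 (by push_cast; linarith [Int.floor_le y])
    omega

/-- Sample on the grid of mesh `1 / D`, scale the values by `D * D` and round down. A slope bound
`r` becomes `D * r` for neighbours and a value bound `r` becomes `D * D * r`; both are integers if
`D * r` is one. Scaling by `D` alone would leave `r` itself for neighbours. -/
theorem Solves.gridSolves {D : ℕ} (hD : 0 < D) {L₁ : List (RatBox (Fin n) × RatBox (Fin n))}
    {L₂ : List (RatBox (Fin n) × RatBox (Fin n × Fin n))}
    (h₁ : ∀ e ∈ L₁, e.2.IntegralAt D) (h₂ : ∀ e ∈ L₂, e.2.IntegralAt D) {i : Fin n}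
    {f : (Fin n → ℝ) → ℝ} (hf : Solves K M M₁ L₁ L₂ i f) :
    GridSolves K M M₁ D L₁ L₂ i fun z => ⌊(D : ℝ) * D * f fun k => (z k : ℝ) / D⌋ := by
  have hD' : (0 : ℝ) < D := by exact_mod_cast hD
  refine ⟨fun e he hp hb z hz => ?_, fun e he hp hb z j hz hz' => ?_⟩
  · obtain ⟨⟨p, hp'⟩, q, hq⟩ := h₁ e he i
    obtain ⟨h3, h4⟩ := hf.1 e he hp hb _ (hz.div_mem hD)
    have hp'' : (p : ℝ) = D * (e.2 i).1 := by exact_mod_cast hp'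
    have hq' : (q : ℝ) = D * (e.2 i).2 := by exact_mod_cast hq
    have := floor_bounds (x := 0) (y := (D : ℝ) * D * f fun k => (z k : ℝ) / D) (p := D * p)
      (q := D * q) (by push_cast; rw [hp'']; nlinarith [mul_pos hD' hD'])
      (by push_cast; rw [hq']; nlinarith [mul_pos hD' hD'])
    simp only [Int.floor_zero, sub_zero] at this
    rw [mul_assoc, mul_assoc, ← hq, ← hp']
    exact ⟨by exact_mod_cast this.1, by exact_mod_cast this.2⟩
  · obtain ⟨⟨p, hp'⟩, q, hq⟩ := h₂ e he (i, j)
    have e1 : (fun k => ((update z j (z j + 1) k : ℤ) : ℝ) / D) =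
        update (fun k => (z k : ℝ) / D) j (((z j : ℝ) + 1) / D) := by
      funext k
      by_cases hk : k = j
      · subst hk; simp
      · simp [hk]
    have hm := hz'.div_mem hD
    rw [e1] at hm
    have h3 := hf.2 e he hp hb _ (hz.div_mem hD) j (((z j : ℝ) + 1) / D) hm
      (by gcongr; linarith)
    have e2 : ((z j : ℝ) + 1) / D - (z j : ℝ) / D = 1 / D := by ring
    rw [e2, ← e1] at h3
    have hp'' : (p : ℝ) = D * (e.2 (i, j)).1 := by exact_mod_cast hp'
    have hq' : (q : ℝ) = D * (e.2 (i, j)).2 := by exact_mod_cast hq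
    have e3 : ∀ r : ℝ, (D : ℝ) * D * (r * (1 / D)) = D * r := fun r => by field_simp
    have hDD := mul_pos hD' hD'
    have := floor_bounds (p := p) (q := q)
      (x := (D : ℝ) * D * f fun k => (z k : ℝ) / D)
      (y := (D : ℝ) * D * f fun k => ((update z j (z j + 1) k : ℤ) : ℝ) / D)
      (by rw [hp'', ← e3 (e.2 (i, j)).1, ← mul_sub]; exact mul_le_mul_of_nonneg_left h3.1 hDD.le)
      (by rw [hq', ← e3 (e.2 (i, j)).2, ← mul_sub]; exact mul_le_mul_of_nonneg_left h3.2 hDD.le)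
    rw [← hq, ← hp']
    exact ⟨by exact_mod_cast this.1, by exact_mod_cast this.2⟩

theorem RatBox.IntegralAt.exists_intBox {D : ℕ} {d : RatBox (Fin n)} (h : d.IntegralAt D) :
    ∃ lo hi : Fin n → ℤ, (∀ z : Fin n → ℤ, lo ≤ z → z ≤ hi → GridMem D d z) ∧
      ∀ x ∈ d.region, (fun k => (D : ℝ) * x k) ∈ intBox lo hi := by
  choose h1 h2 using h
  choose lo hlo using h1
  choose hi hhi using h2
  refine ⟨lo, hi, fun z hz hz' k => ⟨?_, ?_⟩, fun x hx k => ⟨?_, ?_⟩⟩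
  · rw [← hlo]; exact_mod_cast hz k
  · rw [← hhi]; exact_mod_cast hz' k
  · have : (lo k : ℝ) = D * (d k).1 := by exact_mod_cast hlo k
    rw [this]
    exact mul_le_mul_of_nonneg_left (hx k).1 (Nat.cast_nonneg _)
  · have : (hi k : ℝ) = D * (d k).2 := by exact_mod_cast hhi k
    rw [this]
    exact mul_le_mul_of_nonneg_left (hx k).2 (Nat.cast_nonneg _)

/-- Interpolate multilinearly and undo the scaling. Here the end-points of the regions must lie on
the grid, so that each region is a union of cells. -/
theorem GridSolves.exists_solves {D : ℕ} (hD : 0 < D)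
    {L₁ : List (RatBox (Fin n) × RatBox (Fin n))}
    {L₂ : List (RatBox (Fin n) × RatBox (Fin n × Fin n))}
    (h₁ : ∀ e ∈ L₁, e.1.IntegralAt D) (h₂ : ∀ e ∈ L₂, e.1.IntegralAt D) {i : Fin n}
    {w : (Fin n → ℤ) → ℤ} (hw : GridSolves K M M₁ D L₁ L₂ i w) :
    ∃ f, Solves K M M₁ L₁ L₂ i f := by
  have hD' : (0 : ℝ) < D := by exact_mod_cast hD
  have hDD := mul_pos hD' hD'
  obtain ⟨g, hg₁, hg₂⟩ := exists_interpolation fun z => (w z : ℝ)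
  refine ⟨fun x => g (fun k => D * x k) / (D * D), fun e he hp hb x hx => ?_,
    fun e he hp hb x hx j s hs hxs => ?_⟩
  · obtain ⟨lo, hi, h3, h4⟩ := (h₁ e he).exists_intBox
    have := hg₁ lo hi (D * D * (e.2 i).1) (D * D * (e.2 i).2) (fun z hz hz' => by
      have := hw.1 e he hp hb z (h3 z hz hz')
      exact ⟨by exact_mod_cast this.1, by exact_mod_cast this.2⟩) _ (h4 x hx)
    rw [le_div_iff₀ hDD, div_le_iff₀ hDD]
    constructor <;> linarith
  · obtain ⟨lo, hi, h3, h4⟩ := (h₂ e he).exists_intBox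
    have e1 : (fun k => (D : ℝ) * update x j s k) = update (fun k => (D : ℝ) * x k) j (D * s) := by
      funext k
      by_cases hk : k = j
      · subst hk; simp
      · simp [hk]
    have hm := h4 _ hs
    rw [e1] at hm
    have := hg₂ lo hi (fun j => D * (e.2 (i, j)).1) (fun j => D * (e.2 (i, j)).2)
      (fun z j hz hz' => by
        have hle : z ≤ update z j (z j + 1) := by
          intro k
          by_cases hk : k = j
          · subst hk; simp
          · simp [hk]
        have := hw.2 e he hp hb z j (h3 z hz (hle.trans hz')) (h3 _ (hz.trans hle) hz')
        exact ⟨by exact_mod_cast this.1, by exact_mod_cast this.2⟩) _ (h4 x hx) j (D * s) hm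
      (mul_le_mul_of_nonneg_left hxs hD'.le)
    rw [← e1] at this
    beta_reduce at this ⊢
    rw [← sub_div, le_div_iff₀ hDD, div_le_iff₀ hDD]
    constructor <;> nlinarith

/-- This equivalence makes consistency decidable: real-valued solutions exist exactly if
integer-valued ones do on a single grid. -/
theorem exists_solves_iff {D : ℕ} (hD : 0 < D) {L₁ : List (RatBox (Fin n) × RatBox (Fin n))}
    {L₂ : List (RatBox (Fin n) × RatBox (Fin n × Fin n))}
    (h₁ : ∀ e ∈ L₁, e.1.IntegralAt D ∧ e.2.IntegralAt D)
    (h₂ : ∀ e ∈ L₂, e.1.IntegralAt D ∧ e.2.IntegralAt D) {i : Fin n} :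
    (∃ f, Solves K M M₁ L₁ L₂ i f) ↔ ∃ w, GridSolves K M M₁ D L₁ L₂ i w :=
  ⟨fun ⟨_, hf⟩ => ⟨_, hf.gridSolves hD (fun e he => (h₁ e he).2) fun e he => (h₂ e he).2⟩,
    fun ⟨_, hw⟩ => hw.exists_solves hD (fun e he => (h₁ e he).1) fun e he => (h₂ e he).1⟩

/-! ### Functions on the grid as lists of numbers -/

/-- The list codes of the vertices of the grid in `[-B, B]^n`. -/
def gridVertices (n B : ℕ) : List (List ℕ) := allLists (2 * B + 1) n

/-- The vertex with a given list code. -/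
def gridPt (B : ℕ) (y : List ℕ) : Fin n → ℤ := fun k => (y.getD k 0 : ℤ) - B

/-- The value at the vertex `y` of the function on the grid with the list code `W`. -/
def gridVal (n B B' : ℕ) (W y : List ℕ) : ℤ :=
  (W.getD ((gridVertices n B).idxOf y) 0 : ℤ) - B'

/-- The vertex `y'` is the neighbour of `y` in the direction `j`. -/
def GridAdj (j : Fin n) (y y' : List ℕ) : Prop :=
  ∀ k : Fin n, y'.getD k 0 = if k = j then y.getD k 0 + 1 else y.getD k 0

/-- The function on the grid with the list code `W` satisfies the constraints for the `i`-th
component of a vector field. -/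
def ListSolves (K M M₁ : ℚ≥0) (D B B' : ℕ) (L₁ : List (RatBox (Fin n) × RatBox (Fin n)))
    (L₂ : List (RatBox (Fin n) × RatBox (Fin n × Fin n))) (i : Fin n) (W : List ℕ) : Prop :=
  (∀ e ∈ L₁, (e.1.Proper K ∧ e.2.Fits M) → ∀ y ∈ gridVertices n B, GridMem D e.1 (gridPt B y) →
    D * D * (e.2 i).1 ≤ gridVal n B B' W y ∧ (gridVal n B B' W y : ℚ) ≤ D * D * (e.2 i).2) ∧
  ∀ e ∈ L₂, (e.1.Proper K ∧ e.2.Fits M₁) → ∀ y ∈ gridVertices n B, ∀ y' ∈ gridVertices n B,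
    (GridMem D e.1 (gridPt B y) ∧ GridMem D e.1 (gridPt B y')) → ∀ j, GridAdj j y y' →
    D * (e.2 (i, j)).1 ≤ gridVal n B B' W y' - gridVal n B B' W y ∧
      (gridVal n B B' W y' - gridVal n B B' W y : ℚ) ≤ D * (e.2 (i, j)).2

theorem GridAdj.gridPt_eq {B : ℕ} {j : Fin n} {y y' : List ℕ} (h : GridAdj j y y') :
    gridPt B y' = update (gridPt B y) j (gridPt B y j + 1) := by
  funext k
  have := h k
  by_cases hk : k = j
  · subst hk
    rw [if_pos rfl] at this
    simp only [gridPt, update_self]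
    rw [this]; push_cast; ring
  · rw [if_neg hk] at this
    simp only [gridPt, update_of_ne hk]
    rw [this]

/-- The list code of a vertex. -/
def gridCode (B : ℕ) (z : Fin n → ℤ) : List ℕ := List.ofFn fun k => (z k + B).toNat

theorem gridCode_getD (B : ℕ) (z : Fin n → ℤ) (k : Fin n) :
    (gridCode B z).getD k 0 = (z k + B).toNat := by
  simp [gridCode, List.getD_eq_getElem?_getD]

theorem gridPt_gridCode {B : ℕ} {z : Fin n → ℤ} (h : ∀ k, -(B : ℤ) ≤ z k) :
    gridPt B (gridCode B z) = z := by
  funext k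
  have := h k
  unfold gridPt
  rw [gridCode_getD]
  omega

theorem gridCode_mem {B : ℕ} {z : Fin n → ℤ} (h : ∀ k, -(B : ℤ) ≤ z k ∧ z k ≤ B) :
    gridCode B z ∈ gridVertices n B := by
  refine mem_allLists.2 ⟨by simp [gridCode], fun x hx => ?_⟩
  obtain ⟨k, rfl⟩ := (List.mem_ofFn' _ _).1 hx
  have := h k
  change (z k + (B : ℤ)).toNat < 2 * B + 1
  omega

theorem GridMem.bounds {D B : ℕ} (hB : (D : ℚ) * K ≤ B) {d : RatBox (Fin n)} (hd : d.Fits K)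
    {z : Fin n → ℤ} (h : GridMem D d z) (k : Fin n) : -(B : ℤ) ≤ z k ∧ z k ≤ B := by
  have h0 : (0 : ℚ) ≤ D := Nat.cast_nonneg _
  have h1 := mul_le_mul_of_nonneg_left (hd k).1 h0
  have h2 := mul_le_mul_of_nonneg_left (hd k).2.2 h0
  have h3 := h k
  constructor
  · have : -(B : ℚ) ≤ z k := by linarith [h3.1]
    exact_mod_cast this
  · have : (z k : ℚ) ≤ B := by linarith [h3.2]
    exact_mod_cast this

theorem gridMem_cubeEnds {D : ℕ} {d : RatBox (Fin n)} (hd : d.Fits K) {z : Fin n → ℤ}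
    (h : GridMem D d z) : GridMem D (cubeEnds _ K) z := fun k => by
  have h0 : (0 : ℚ) ≤ D := Nat.cast_nonneg _
  exact ⟨(mul_le_mul_of_nonneg_left (hd k).1 h0).trans (h k).1,
    (h k).2.trans (mul_le_mul_of_nonneg_left (hd k).2.2 h0)⟩

/-- All regions lie in the cube, so finitely many vertices matter. The cube entry in `L₁` bounds the
values there by `D * D * M`, which leaves finitely many candidate functions. -/
theorem exists_gridSolves_iff (hK : 0 < K) {D B B' : ℕ} (hB : (D : ℚ) * K ≤ B)
    (hB' : (D : ℚ) * D * M ≤ B') {L₁ : List (RatBox (Fin n) × RatBox (Fin n))}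
    {L₂ : List (RatBox (Fin n) × RatBox (Fin n × Fin n))}
    (hL : (cubeEnds _ K, cubeEnds _ M) ∈ L₁) {i : Fin n} :
    (∃ w, GridSolves K M M₁ D L₁ L₂ i w) ↔
      ∃ W ∈ allLists (2 * B' + 1) (gridVertices n B).length,
        ListSolves K M M₁ D B B' L₁ L₂ i W := by
  constructor
  · rintro ⟨w, hw⟩
    -- Values are shifted by `B'` to become natural numbers. The minimum matters only at vertices
    -- outside of the cube, where `w` is not constrained but the code must stay in range.
    let v : List ℕ → ℕ := fun y => min (w (gridPt B y) + B').toNat (2 * B')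
    have hv : ∀ y ∈ gridVertices n B, ∀ d : RatBox (Fin n), d.Fits K → GridMem D d (gridPt B y) →
        gridVal n B B' ((gridVertices n B).map v) y = w (gridPt B y) := by
      intro y hy d hd hm
      have h1 := hw.1 _ hL (cubeEnds_proper _ hK) (cubeEnds_fits _ _) _ (gridMem_cubeEnds hd hm)
      simp only [cubeEnds] at h1
      have h2 : -(B' : ℤ) ≤ w (gridPt B y) := by
        have : -(B' : ℚ) ≤ w (gridPt B y) := by linarith [h1.1]
        exact_mod_cast this
      have h3 : w (gridPt B y) ≤ B' := by
        have : (w (gridPt B y) : ℚ) ≤ B' := by linarith [h1.2]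
        exact_mod_cast this
      have h4 : ((gridVertices n B).map v).getD ((gridVertices n B).idxOf y) 0 = v y := by
        have h5 := List.idxOf_lt_length_iff.2 hy
        rw [List.getD_eq_getElem _ _ (by simpa using h5), List.getElem_map, List.getElem_idxOf h5]
      rw [gridVal, h4]
      simp only [v]
      omega
    refine ⟨(gridVertices n B).map v, mem_allLists.2 ⟨by simp, fun x hx => ?_⟩,
      fun e he hp y hy hm => ?_, fun e he hp y hy y' hy' hm j hj => ?_⟩
    · obtain ⟨y, -, rfl⟩ := List.mem_map.1 hx
      simp only [v]
      omega
    · rw [hv y hy _ hp.1.1 hm]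
      exact hw.1 e he hp.1 hp.2 _ hm
    · rw [hv y hy _ hp.1.1 hm.1, hv y' hy' _ hp.1.1 hm.2]
      have h1 := hm.2
      rw [hj.gridPt_eq] at h1 ⊢
      exact hw.2 e he hp.1 hp.2 _ j hm.1 h1
  · rintro ⟨W, -, hW⟩
    refine ⟨fun z => gridVal n B B' W (gridCode B z), fun e he hp hb z hz => ?_,
      fun e he hp hb z j hz hz' => ?_⟩
    · have h1 := hz.bounds hB hp.1
      refine hW.1 e he ⟨hp, hb⟩ _ (gridCode_mem h1) ?_
      rwa [gridPt_gridCode fun k => (h1 k).1]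
    · have h1 := hz.bounds hB hp.1
      have h2 := hz'.bounds hB hp.1
      refine hW.2 e he ⟨hp, hb⟩ _ (gridCode_mem h1) _ (gridCode_mem h2) ⟨?_, ?_⟩ j fun k => ?_
      · rwa [gridPt_gridCode fun k => (h1 k).1]
      · rwa [gridPt_gridCode fun k => (h2 k).1]
      · rw [gridCode_getD, gridCode_getD]
        by_cases hk : k = j
        · subst hk
          have := h1 k
          simp only [update_self, if_true]
          omega
        · simp [hk]

end Grid

/-! ### A common denominator for a coded pair of step functions -/

section DecideConsistency

variable {n : ℕ} {K M M₁ : ℚ≥0}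

theorem Primrec.list_prod {α : Type*} [Primcodable α] {f : α → List ℕ} (hf : Primrec f) :
    Primrec fun a => (f a).prod := by
  have h : Primrec fun a => (f a).foldr (fun x y => x * y) 1 :=
    Primrec.list_foldr hf (Primrec.const 1) (Primrec.nat_mul.comp (Primrec.fst.comp Primrec.snd)
      (Primrec.snd.comp Primrec.snd)).to₂
  exact h.of_eq fun a => by rw [List.prod_eq_foldr]

/-- A common multiple of the denominators of the end-points. -/
def boxDen (b : Fin n → PairCode) : ℕ :=
  ((List.finRange n).map fun k => ((b k).1.2.2 + 1) * ((b k).2.2.2 + 1)).prod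

theorem primrec_boxDen : Primrec (boxDen (n := n)) := by
  refine Primrec.list_prod (Primrec.list_map (Primrec.const _) ?_)
  have h : Primrec fun x : (Fin n → PairCode) × Fin n => x.1 x.2 :=
    Primrec.fin_app.comp Primrec.fst Primrec.snd
  exact Primrec.nat_mul.comp
    (Primrec.succ.comp (Primrec.snd.comp (Primrec.snd.comp (Primrec.fst.comp h))))
    (Primrec.succ.comp (Primrec.snd.comp (Primrec.snd.comp (Primrec.snd.comp h))))

/-- A common multiple of the denominators of all end-points in the code. -/
def VCode.den (c : VCode n) : ℕ :=
  (c.1.map fun e => boxDen e.1 * boxDen e.2).prod *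
    (c.2.map fun e => boxDen e.1 * ((List.finRange n).map fun k => boxDen (e.2 k)).prod).prod

theorem VCode.primrec_den : Primrec (VCode.den (n := n)) := by
  refine Primrec.nat_mul.comp (Primrec.list_prod (Primrec.list_map Primrec.fst ?_))
    (Primrec.list_prod (Primrec.list_map Primrec.snd ?_))
  · exact Primrec.nat_mul.comp (primrec_boxDen.comp (Primrec.fst.comp Primrec.snd))
      (primrec_boxDen.comp (Primrec.snd.comp Primrec.snd))
  · refine Primrec.nat_mul.comp (primrec_boxDen.comp (Primrec.fst.comp Primrec.snd))
      (Primrec.list_prod (Primrec.list_map (Primrec.const _) ?_))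
    exact primrec_boxDen.comp (Primrec.fin_app.comp
      (Primrec.snd.comp (Primrec.snd.comp Primrec.fst)) Primrec.snd)

theorem boxDen_pos (b : Fin n → PairCode) : 0 < boxDen b := by
  refine Nat.pos_of_ne_zero (List.prod_ne_zero ?_)
  simp

theorem VCode.den_pos (c : VCode n) : 0 < c.den := by
  refine Nat.mul_pos (Nat.pos_of_ne_zero (List.prod_ne_zero ?_))
    (Nat.pos_of_ne_zero (List.prod_ne_zero ?_))
  · simp only [List.mem_map, not_exists, not_and]
    exact fun e _ => (Nat.mul_pos (boxDen_pos _) (boxDen_pos _)).ne'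
  · simp only [List.mem_map, not_exists, not_and]
    refine fun e _ => (Nat.mul_pos (boxDen_pos _) (Nat.pos_of_ne_zero (List.prod_ne_zero ?_))).ne'
    simp only [List.mem_map, not_exists, not_and]
    exact fun k _ => (boxDen_pos _).ne'

theorem RatCode.exists_int_eq {c : RatCode} {D : ℕ} (h : c.2.2 + 1 ∣ D) :
    ∃ m : ℤ, (m : ℚ) = D * c.val := by
  obtain ⟨k, rfl⟩ := h
  refine ⟨k * ((c.1 : ℤ) - c.2.1), ?_⟩
  unfold RatCode.val
  push_cast
  field_simp

theorem integralAt_of_boxDen_dvd {b : Fin n → PairCode} {D : ℕ} (h : boxDen b ∣ D) (k : Fin n) :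
    (∃ m : ℤ, (m : ℚ) = D * (PairCode.val (b k)).1) ∧
      ∃ m : ℤ, (m : ℚ) = D * (PairCode.val (b k)).2 := by
  have h1 : ((b k).1.2.2 + 1) * ((b k).2.2.2 + 1) ∣ D :=
    (List.dvd_prod (List.mem_map.2 ⟨k, List.mem_finRange k, rfl⟩)).trans h
  exact ⟨RatCode.exists_int_eq ((Dvd.intro _ rfl).trans h1),
    RatCode.exists_int_eq ((Dvd.intro_left _ rfl).trans h1)⟩

theorem VCode.integralAt₁ (c : VCode n) {e : RatBox (Fin n) × RatBox (Fin n)}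
    (he : e ∈ VCode.val₁ c) : e.1.IntegralAt c.den ∧ e.2.IntegralAt c.den := by
  obtain ⟨x, hx, rfl⟩ := List.mem_map.1 he
  have h : boxDen x.1 * boxDen x.2 ∣ c.den :=
    (List.dvd_prod (List.mem_map.2 ⟨x, hx, rfl⟩)).trans (Dvd.intro _ rfl)
  exact ⟨integralAt_of_boxDen_dvd ((Dvd.intro _ rfl).trans h),
    integralAt_of_boxDen_dvd ((Dvd.intro_left _ rfl).trans h)⟩

theorem VCode.integralAt₂ (c : VCode n) {e : RatBox (Fin n) × RatBox (Fin n × Fin n)}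
    (he : e ∈ VCode.val₂ c) : e.1.IntegralAt c.den ∧ e.2.IntegralAt c.den := by
  obtain ⟨x, hx, rfl⟩ := List.mem_map.1 he
  have h : boxDen x.1 * ((List.finRange n).map fun k => boxDen (x.2 k)).prod ∣ c.den :=
    (List.dvd_prod (List.mem_map_of_mem (f := fun e : (Fin n → PairCode) × (Fin n → Fin n → PairCode)
      => boxDen e.1 * ((List.finRange n).map fun k => boxDen (e.2 k)).prod) hx)).trans
        (Dvd.intro_left _ rfl)
  refine ⟨integralAt_of_boxDen_dvd ((Dvd.intro _ rfl).trans h), fun ij => ?_⟩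
  exact integralAt_of_boxDen_dvd (((List.dvd_prod (List.mem_map.2 ⟨ij.1, List.mem_finRange _, rfl⟩)).trans
    (Dvd.intro_left _ rfl)).trans h) ij.2

end DecideConsistency

/-! ### Primitive recursiveness of the consistency test -/

section ConsistencyPrim

variable {n : ℕ} {K M M₁ : ℚ≥0} {α : Type*} [Primcodable α]

theorem BoxPrim.proper {ι : Type*} [Finite ι] {R : ℚ≥0} {d : α → RatBox ι} (hd : BoxPrim d) :
    PrimrecPred fun a => (d a).Proper R :=
  hd.fits.and (PrimrecPred.forall_finite fun i => (hd i).1.lt (hd i).2)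

theorem RatPrim.intCast_natCast_sub {f g : α → ℕ} (hf : Primrec f) (hg : Primrec g) :
    RatPrim fun a => (((f a : ℤ) - (g a : ℤ) : ℤ) : ℚ) :=
  ((RatPrim.natCast hf).sub (RatPrim.natCast hg)).of_eq fun a => by push_cast; rfl

theorem primrec_gridVertices : Primrec (gridVertices n) :=
  primrec_allLists.comp (Primrec.succ.comp (Primrec.nat_mul.comp (Primrec.const 2) Primrec.id))
    (Primrec.const n)

theorem primrec_getD {f : α → List ℕ} {g : α → ℕ} (hf : Primrec f) (hg : Primrec g) :
    Primrec fun a => (f a).getD (g a) 0 :=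
  (Primrec.list_getD 0).comp hf hg

theorem BoxPrim.gridMem {d : α → RatBox (Fin n)} (hd : BoxPrim d) {D B : α → ℕ}
    {y : α → List ℕ} (hD : Primrec D) (hB : Primrec B) (hy : Primrec y) :
    PrimrecPred fun a => GridMem (D a) (d a) (gridPt (B a) (y a)) :=
  PrimrecPred.forall_finite fun k =>
    (((RatPrim.natCast hD).mul (hd k).1).le
      (RatPrim.intCast_natCast_sub (primrec_getD hy (Primrec.const (k : ℕ))) hB)).and
    ((RatPrim.intCast_natCast_sub (primrec_getD hy (Primrec.const (k : ℕ))) hB).le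
      ((RatPrim.natCast hD).mul (hd k).2))

theorem primrec_idxOf : Primrec₂ fun (y : List ℕ) (l : List (List ℕ)) => l.idxOf y := by
  have e : (instBEqOfDecidableEq : BEq (List ℕ)) = List.instBEq := lawful_beq_subsingleton _ _
  have h : Primrec₂ (@List.idxOf (List ℕ) instBEqOfDecidableEq) := Primrec.list_idxOf
  rw [e] at h
  exact h

theorem ratPrim_gridVal {B B' : α → ℕ} {W y : α → List ℕ} (hB : Primrec B) (hB' : Primrec B')
    (hW : Primrec W) (hy : Primrec y) :
    RatPrim fun a => (gridVal n (B a) (B' a) (W a) (y a) : ℚ) :=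
  RatPrim.intCast_natCast_sub (primrec_getD hW
    (primrec_idxOf.comp hy (primrec_gridVertices.comp hB))) hB'

theorem primrecPred_gridAdj {y y' : α → List ℕ} (hy : Primrec y) (hy' : Primrec y') (j : Fin n) :
    PrimrecPred fun a => GridAdj j (y a) (y' a) := by
  refine PrimrecPred.forall_finite fun k => ?_
  by_cases hk : k = j
  · simp only [if_pos hk]
    exact Primrec.eq.comp (primrec_getD hy' (Primrec.const _))
      (Primrec.succ.comp (primrec_getD hy (Primrec.const _)))
  · simp only [if_neg hk]
    exact Primrec.eq.comp (primrec_getD hy' (Primrec.const _)) (primrec_getD hy (Primrec.const _))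

theorem boxPrim_fst {m : ℕ} {σ : Type*} [Primcodable σ] :
    BoxPrim fun e : (Fin m → PairCode) × σ =>
      (fun i => PairCode.val (e.1 i) : RatBox (Fin m)) :=
  (boxPrim_val m).comp Primrec.fst

theorem boxPrim_snd {σ : Type*} [Primcodable σ] :
    BoxPrim fun e : σ × (Fin n → PairCode) => (fun i => PairCode.val (e.2 i) : RatBox (Fin n)) :=
  (boxPrim_val n).comp Primrec.snd

theorem boxPrim_snd₂ {σ : Type*} [Primcodable σ] :
    BoxPrim fun e : σ × (Fin n → Fin n → PairCode) =>
      (fun i => PairCode.val (e.2 i.1 i.2) : RatBox (Fin n × Fin n)) :=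
  (boxPrim_val₂ n).comp Primrec.snd

set_option synthInstance.maxSize 512 in
set_option synthInstance.maxHeartbeats 200000 in
theorem primrecPred_listSolves {c : α → VCode n} {D B B' : α → ℕ} {W : α → List ℕ}
    (hc : Primrec c) (hD : Primrec D) (hB : Primrec B) (hB' : Primrec B') (hW : Primrec W)
    (i : Fin n) : PrimrecPred fun a => ListSolves K M M₁ (D a) (B a) (B' a)
      (VCode.val₁ (c a)) (VCode.val₂ (c a)) i (W a) := by
  simp only [ListSolves, VCode.val₁, VCode.val₂, List.forall_mem_map]
  refine PrimrecPred.and ?_ ?_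
  · refine PrimrecPred.forall_mem (Primrec.fst.comp hc) ?_
    refine PrimrecPred.imp ((boxPrim_fst.proper.and boxPrim_snd.fits).comp Primrec.snd) ?_
    refine PrimrecPred.forall_mem (primrec_gridVertices.comp (hB.comp Primrec.fst)) ?_
    let β := (α × ((Fin n → PairCode) × (Fin n → PairCode))) × List ℕ
    have ha : Primrec fun x : β => x.1.1 := Primrec.fst.comp Primrec.fst
    have he : Primrec fun x : β => x.1.2 := Primrec.snd.comp Primrec.fst
    have hy : Primrec fun x : β => x.2 := Primrec.snd
    refine PrimrecPred.imp ((boxPrim_fst.comp he).gridMem (hD.comp ha) (hB.comp ha) hy) ?_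
    have hv := ratPrim_gridVal (n := n) (hB.comp ha) (hB'.comp ha) (hW.comp ha) hy
    have hDD := (RatPrim.natCast (hD.comp ha)).mul (RatPrim.natCast (hD.comp ha))
    exact ((hDD.mul ((boxPrim_snd.comp he) i).1).le hv).and
      (hv.le (hDD.mul ((boxPrim_snd.comp he) i).2))
  · refine PrimrecPred.forall_mem (Primrec.snd.comp hc) ?_
    refine PrimrecPred.imp ((boxPrim_fst.proper.and boxPrim_snd₂.fits).comp Primrec.snd) ?_
    refine PrimrecPred.forall_mem (primrec_gridVertices.comp (hB.comp Primrec.fst)) ?_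
    refine PrimrecPred.forall_mem
      (primrec_gridVertices.comp (hB.comp (Primrec.fst.comp Primrec.fst))) ?_
    let β := ((α × ((Fin n → PairCode) × (Fin n → Fin n → PairCode))) × List ℕ) × List ℕ
    have ha : Primrec fun x : β => x.1.1.1 := Primrec.fst.comp (Primrec.fst.comp Primrec.fst)
    have he : Primrec fun x : β => x.1.1.2 := Primrec.snd.comp (Primrec.fst.comp Primrec.fst)
    have hy : Primrec fun x : β => x.1.2 := Primrec.snd.comp Primrec.fst
    have hy' : Primrec fun x : β => x.2 := Primrec.snd
    refine PrimrecPred.imp (((boxPrim_fst.comp he).gridMem (hD.comp ha) (hB.comp ha) hy).and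
      ((boxPrim_fst.comp he).gridMem (hD.comp ha) (hB.comp ha) hy')) ?_
    refine PrimrecPred.forall_finite fun j => (primrecPred_gridAdj hy hy' j).imp ?_
    have hv := (ratPrim_gridVal (n := n) (hB.comp ha) (hB'.comp ha) (hW.comp ha) hy').sub
      (ratPrim_gridVal (n := n) (hB.comp ha) (hB'.comp ha) (hW.comp ha) hy)
    have hD' := RatPrim.natCast (hD.comp ha)
    exact ((hD'.mul ((boxPrim_snd₂.comp he) (i, j)).1).le hv).and
      (hv.le (hD'.mul ((boxPrim_snd₂.comp he) (i, j)).2))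

/-- A code of the end-points of the interval `[-R, R]`. -/
def cubeCode (R : ℚ≥0) : PairCode :=
  ((RatCode.exists_val (-(R : ℚ))).choose, (RatCode.exists_val (R : ℚ)).choose)

theorem cubeCode_val (R : ℚ≥0) : PairCode.val (cubeCode R) = (-(R : ℚ), (R : ℚ)) :=
  Prod.ext (RatCode.exists_val (-(R : ℚ))).choose_spec (RatCode.exists_val (R : ℚ)).choose_spec

/-- The code with the least single-step functions added to both lists. -/
def VCode.augment (K M M₁ : ℚ≥0) (c : VCode n) : VCode n :=
  ((fun _ => cubeCode K, fun _ => cubeCode M) :: c.1,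
    (fun _ => cubeCode K, fun _ _ => cubeCode M₁) :: c.2)

theorem VCode.val₁_augment (c : VCode n) :
    VCode.val₁ (c.augment K M M₁) = (cubeEnds _ K, cubeEnds _ M) :: VCode.val₁ c := by
  simp only [VCode.val₁, VCode.augment, List.map_cons, cubeCode_val]
  rfl

theorem VCode.val₂_augment (c : VCode n) :
    VCode.val₂ (c.augment K M M₁) = (cubeEnds _ K, cubeEnds _ M₁) :: VCode.val₂ c := by
  simp only [VCode.val₂, VCode.augment, List.map_cons, cubeCode_val]
  rfl

theorem VCode.primrec_augment : Primrec (VCode.augment (n := n) K M M₁) :=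
  (Primrec.list_cons.comp (Primrec.const _) Primrec.fst).pair
    (Primrec.list_cons.comp (Primrec.const _) Primrec.snd)

/-- The grid of the common denominator meets all integrality requirements, including those of the
added cube entries. Rounding `K` and `M` up to integers gives the bounds for the search. -/
theorem VCode.valid_iff_listSolves (hK : 0 < K) (c : VCode n) :
    c.Valid K M M₁ ↔ ∀ i, ∃ W ∈ allLists
        (2 * ((c.augment K M M₁).den * (c.augment K M M₁).den * ⌈M⌉₊) + 1)
        (gridVertices n ((c.augment K M M₁).den * ⌈K⌉₊)).length,
      ListSolves K M M₁ (c.augment K M M₁).den ((c.augment K M M₁).den * ⌈K⌉₊)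
        ((c.augment K M M₁).den * (c.augment K M M₁).den * ⌈M⌉₊)
        (VCode.val₁ (c.augment K M M₁)) (VCode.val₂ (c.augment K M M₁)) i W := by
  have hceil : ∀ R : ℚ≥0, (R : ℚ) ≤ (⌈R⌉₊ : ℚ) := fun R => by exact_mod_cast Nat.le_ceil R
  rw [VCode.valid_iff_solves hK, ← VCode.val₁_augment, ← VCode.val₂_augment]
  refine forall_congr' fun i => ?_
  rw [exists_solves_iff (VCode.den_pos _) (fun e he => VCode.integralAt₁ _ he)
    (fun e he => VCode.integralAt₂ _ he)]
  refine exists_gridSolves_iff hK ?_ ?_ ?_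
  · push_cast
    exact mul_le_mul_of_nonneg_left (hceil K) (by positivity)
  · push_cast
    exact mul_le_mul_of_nonneg_left (hceil M) (by positivity)
  · rw [VCode.val₁_augment]
    exact List.mem_cons_self

/-- Only bounded quantifiers over computed lists and rational comparisons remain. -/
theorem VCode.primrecPred_valid (hK : 0 < K) :
    PrimrecPred fun c : VCode n => c.Valid K M M₁ := by
  refine PrimrecPred.of_eq ?_ fun c => (VCode.valid_iff_listSolves hK c).symm
  have ha := VCode.primrec_augment (n := n) (K := K) (M := M) (M₁ := M₁)
  have hD := VCode.primrec_den.comp ha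
  have hB : Primrec fun c : VCode n => (c.augment K M M₁).den * ⌈K⌉₊ :=
    Primrec.nat_mul.comp hD (Primrec.const _)
  have hB' : Primrec fun c : VCode n =>
      (c.augment K M M₁).den * (c.augment K M M₁).den * ⌈M⌉₊ :=
    Primrec.nat_mul.comp (Primrec.nat_mul.comp hD hD) (Primrec.const _)
  refine PrimrecPred.forall_finite fun i => PrimrecPred.exists_mem ?_ ?_
  · exact primrec_allLists.comp
      (Primrec.succ.comp (Primrec.nat_mul.comp (Primrec.const 2) hB'))
      (Primrec.list_length.comp (primrec_gridVertices.comp hB))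
  · exact primrecPred_listSolves (ha.comp Primrec.fst) (hD.comp Primrec.fst) (hB.comp Primrec.fst)
      (hB'.comp Primrec.fst) Primrec.snd i

open Classical in
/-- The code itself if it is valid, the empty code otherwise. -/
def VCode.normalize (K M M₁ : ℚ≥0) (c : VCode n) : VCode n :=
  if c.Valid K M M₁ then c else ([], [])

theorem VCode.primrec_normalize (hK : 0 < K) : Primrec (VCode.normalize (n := n) K M M₁) := by
  classical
  exact Primrec.ite (VCode.primrecPred_valid hK) Primrec.id (Primrec.const _)

theorem VCode.valid_normalize (c : VCode n) : (c.normalize K M M₁).Valid K M M₁ := by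
  unfold VCode.normalize
  split_ifs with h
  · exact h
  · exact VCode.valid_nil

theorem VCode.toV1_normalize (c : VCode n) :
    (c.normalize K M M₁).toV1 K M M₁ = c.toV1 K M M₁ := by
  unfold VCode.normalize
  split_ifs with h
  · rfl
  · rw [VCode.toV1_nil, VCode.toV1_of_not_valid h]

theorem enumV1_eq_normalize (k : ℕ) :
    enumV1 n K M M₁ k = ((VCode.ofNat n k).normalize K M M₁).toV1 K M M₁ := by
  rw [VCode.toV1_normalize, enumV1_eq]

end ConsistencyPrim

/-! ## Evaluation of step functions of hyper-rectangles -/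

section BoxEvaluation

variable {ι κ : Type*} [Finite ι] {R R' : ℚ≥0}

/-- The end-points `d` describe a hyper-rectangle that is way-below the one with the end-points `lo`
and `hi`. -/
def BoxActive (R : ℚ≥0) (lo hi : ι → ℚ) (d : RatBox ι) : Prop := d.Fits R ∧ RatBelow R d lo hi

theorem mem_boxOpen_iff_boxActive {lo hi : ι → ℚ} {β : Box ι R} (hlo : ∀ i, β.lo i = lo i)
    (hhi : ∀ i, β.hi i = hi i) {d : RatBox ι} : β ∈ boxOpen R d ↔ BoxActive R lo hi d := by
  constructor
  · rintro ⟨α, hα, hw⟩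
    exact ⟨hα.fits, (wayBelow_iff_ratBelow hα hlo hhi).1 hw⟩
  · rintro ⟨h1, h2⟩
    exact ⟨d.toBox h1, d.describes_toBox h1,
      (wayBelow_iff_ratBelow (d.describes_toBox h1) hlo hhi).2 h2⟩

theorem IsStepFunOf.isLUB_activeBoxes {l : List (RatBox ι × RatBox κ)} {f : Box ι R → Box κ R'}
    (hf : IsStepFunOf (boxOpen R) l f) {lo hi : ι → ℚ} {β : Box ι R} (hlo : ∀ i, β.lo i = lo i)
    (hhi : ∀ i, β.hi i = hi i) : IsLUB (activeBoxes R' (BoxActive R lo hi) l) (f β) := by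
  have h := hf β
  simp only [mem_boxOpen_iff_boxActive hlo hhi] at h
  exact h

variable {α β : Type*} [Primcodable α] [Primcodable β]

theorem primrecPred_boxActive {d : α → RatBox ι} (hd : BoxPrim d) {lo hi : α → ι → ℚ}
    (hlo : ∀ i, RatPrim fun x => lo x i) (hhi : ∀ i, RatPrim fun x => hi x i) :
    PrimrecPred fun x => BoxActive R (lo x) (hi x) (d x) :=
  hd.fits.and (hd.ratBelow hlo hhi)

theorem ratPrim_stepLo_boxActive [Finite κ] {l : α → List β} (hl : Primrec l)
    {f : β → RatBox ι × RatBox κ} (hf₁ : BoxPrim fun b => (f b).1) (hf₂ : BoxPrim fun b => (f b).2)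
    {lo hi : α → ι → ℚ} (hlo : ∀ i, RatPrim fun x => lo x i) (hhi : ∀ i, RatPrim fun x => hi x i)
    (i : κ) : RatPrim fun a => stepLo R' (BoxActive R (lo a) (hi a)) ((l a).map f) i :=
  RatPrim.stepLo hl hf₂ (primrecPred_boxActive (hf₁.comp Primrec.snd)
    (fun i => (hlo i).comp Primrec.fst) fun i => (hhi i).comp Primrec.fst) i

theorem ratPrim_stepHi_boxActive [Finite κ] {l : α → List β} (hl : Primrec l)
    {f : β → RatBox ι × RatBox κ} (hf₁ : BoxPrim fun b => (f b).1) (hf₂ : BoxPrim fun b => (f b).2)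
    {lo hi : α → ι → ℚ} (hlo : ∀ i, RatPrim fun x => lo x i) (hhi : ∀ i, RatPrim fun x => hi x i)
    (i : κ) : RatPrim fun a => stepHi R' (BoxActive R (lo a) (hi a)) ((l a).map f) i :=
  RatPrim.stepHi hl hf₂ (primrecPred_boxActive (hf₁.comp Primrec.snd)
    (fun i => (hlo i).comp Primrec.fst) fun i => (hhi i).comp Primrec.fst) i

/-- The step function `g` is evaluated at the rational box that defines the open set of an entry.
The requirement that this open set be non-empty becomes `RatBox.Proper`. -/
theorem stepBelow_iff_ratBelow [Finite κ] (hR : 0 < R) {l l' : List (RatBox ι × RatBox κ)}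
    {g : Box ι R → Box κ R'} (hg : IsStepFunOf (boxOpen R) l' g) :
    StepBelow R R' l g ↔ ∀ e ∈ l, (e.1.Proper R ∧ e.2.Fits R') →
      RatBelow R' e.2
        (stepLo R' (BoxActive R (fun i => (e.1 i).1) fun i => (e.1 i).2) l')
        (stepHi R' (BoxActive R (fun i => (e.1 i).1) fun i => (e.1 i).2) l') := by
  refine forall₂_congr fun e he => ⟨fun h hp => ?_, fun h α b hα hb hβ => ?_⟩
  · have hα := e.1.describes_toBox hp.1.1
    have hlub := hg.isLUB_activeBoxes (fun i => (hα i).1) (fun i => (hα i).2)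
    refine (wayBelow_iff_ratBelow (e.2.describes_toBox hp.2) (lo_eq_stepLo hlub)
      (hi_eq_stepHi hlub)).1 (h _ _ hα (e.2.describes_toBox hp.2) ?_)
    refine (exists_wayBelow_iff hR).2 fun i => ?_
    rw [(hα i).1, (hα i).2]
    exact_mod_cast hp.1.2 i
  · have hlub := hg.isLUB_activeBoxes (fun i => (hα i).1) (fun i => (hα i).2)
    refine (wayBelow_iff_ratBelow hb (lo_eq_stepLo hlub) (hi_eq_stepHi hlub)).2
      (h ⟨⟨hα.fits, fun i => ?_⟩, hb.fits⟩)
    have := (exists_wayBelow_iff hR).1 hβ i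
    rw [(hα i).1, (hα i).2] at this
    exact_mod_cast this

set_option synthInstance.maxSize 512 in
set_option synthInstance.maxHeartbeats 200000 in
theorem primrecPred_stepBelow [Finite κ] {l l' : α → List β} (hl : Primrec l) (hl' : Primrec l')
    {f : β → RatBox ι × RatBox κ} (hf₁ : BoxPrim fun b => (f b).1)
    (hf₂ : BoxPrim fun b => (f b).2) :
    PrimrecPred fun a => ∀ e ∈ (l a).map f, (e.1.Proper R ∧ e.2.Fits R') →
      RatBelow R' e.2
        (stepLo R' (BoxActive R (fun i => (e.1 i).1) fun i => (e.1 i).2) ((l' a).map f))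
        (stepHi R' (BoxActive R (fun i => (e.1 i).1) fun i => (e.1 i).2) ((l' a).map f)) := by
  simp only [List.forall_mem_map]
  refine PrimrecPred.forall_mem hl (PrimrecPred.imp ((hf₁.proper.and hf₂.fits).comp Primrec.snd) ?_)
  have h1 : BoxPrim fun x : α × β => (f x.2).1 := hf₁.comp Primrec.snd
  exact (hf₂.comp Primrec.snd).ratBelow
    (fun i => ratPrim_stepLo_boxActive (hl'.comp Primrec.fst) hf₁ hf₂ (fun i => (h1 i).1)
      (fun i => (h1 i).2) i)
    (fun i => ratPrim_stepHi_boxActive (hl'.comp Primrec.fst) hf₁ hf₂ (fun i => (h1 i).1)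
      (fun i => (h1 i).2) i)

end BoxEvaluation

/-! ### Effectivity of the domain of vector fields -/

section VEffective

variable {n : ℕ} {K M M₁ : ℚ≥0}

/-- The decoded entry of a list of single-step functions. -/
def VCode.entry₁ (e : (Fin n → PairCode) × (Fin n → PairCode)) : RatBox (Fin n) × RatBox (Fin n) :=
  (fun i => PairCode.val (e.1 i), fun i => PairCode.val (e.2 i))

/-- The decoded entry of a list of single-step functions with values in the interval matrices. -/
def VCode.entry₂ (e : (Fin n → PairCode) × (Fin n → Fin n → PairCode)) :
    RatBox (Fin n) × RatBox (Fin n × Fin n) :=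
  (fun i => PairCode.val (e.1 i), fun ij => PairCode.val (e.2 ij.1 ij.2))

-- Consistency being decidable, codes can be normalized primitive recursively; way-below is then
-- decided by the finite test on the two lists of entries.
set_option synthInstance.maxSize 512 in
set_option synthInstance.maxHeartbeats 200000 in
theorem effectivelyGiven_enumV1 (hK : 0 < K) : EffectivelyGiven (enumV1 n K M M₁) where
  complete X hne hdir := by
    obtain ⟨s, hs, -⟩ := V1.exists_isLUB hK hne hdir
    exact ⟨s, hs⟩
  bot := isBot_enumV1_zero
  basis_nonempty := (isDomainBasis_enumV1 hK).nonempty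
  basis_directed := (isDomainBasis_enumV1 hK).directed
  basis_sup := (isDomainBasis_enumV1 hK).sup
  wayBelow_re := by
    have hn : Primrec fun k => (VCode.ofNat n k).normalize K M M₁ :=
      (VCode.primrec_normalize hK).comp (VCode.primrec_ofNat n)
    have h1 : Primrec fun p : ℕ × ℕ => (VCode.ofNat n p.1).normalize K M M₁ := hn.comp Primrec.fst
    have h2 : Primrec fun p : ℕ × ℕ => (VCode.ofNat n p.2).normalize K M M₁ := hn.comp Primrec.snd
    have h := (primrecPred_stepBelow (R := K) (R' := M) (f := VCode.entry₁ (n := n))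
      (Primrec.fst.comp h1) (Primrec.fst.comp h2) boxPrim_fst boxPrim_snd).and
      (primrecPred_stepBelow (R := K) (R' := M₁) (f := VCode.entry₂ (n := n))
      (Primrec.snd.comp h1) (Primrec.snd.comp h2) boxPrim_fst boxPrim_snd₂)
    refine h.computablePred.to_re.of_eq fun p => ?_
    have e1 := VCode.isStepFunOf_toV1 (VCode.valid_normalize (K := K) (M := M) (M₁ := M₁)
      (VCode.ofNat n p.1))
    have e2 := VCode.isStepFunOf_toV1 (VCode.valid_normalize (K := K) (M := M) (M₁ := M₁)
      (VCode.ofNat n p.2))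
    rw [enumV1_eq_normalize, enumV1_eq_normalize, V1.wayBelow_iff_stepBelow hK e1.1 e1.2,
      stepBelow_iff_ratBelow hK e2.1, stepBelow_iff_ratBelow hK e2.2]
    rfl

end VEffective

/-! ## The Euler operator -/

section IntervalArithmetic

theorem min_mul_le_mul {p q x y : ℝ} (h1 : p ≤ x) (h2 : x ≤ q) : min (p * y) (q * y) ≤ x * y := by
  rcases le_total 0 y with hy | hy
  · exact (min_le_left _ _).trans (mul_le_mul_of_nonneg_right h1 hy)
  · exact (min_le_right _ _).trans (mul_le_mul_of_nonpos_right h2 hy)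

theorem mul_le_max_mul {p q x y : ℝ} (h1 : p ≤ x) (h2 : x ≤ q) : x * y ≤ max (p * y) (q * y) := by
  rcases le_total 0 y with hy | hy
  · exact (mul_le_mul_of_nonneg_right h2 hy).trans (le_max_right _ _)
  · exact (mul_le_mul_of_nonpos_right h1 hy).trans (le_max_left _ _)

/-- A bilinear function on a rectangle is bounded by its values at the corners, one variable at a
time. -/
theorem mul_mem_intervalMul {I J : NonemptyInterval ℝ} {x y : ℝ} (hx : I.fst ≤ x ∧ x ≤ I.snd)
    (hy : J.fst ≤ y ∧ y ≤ J.snd) :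
    (intervalMul I J).fst ≤ x * y ∧ x * y ≤ (intervalMul I J).snd := by
  have h1 : ∀ p : ℝ, min (p * J.fst) (p * J.snd) ≤ p * y := fun p => by
    have := min_mul_le_mul (y := p) hy.1 hy.2
    simpa only [mul_comm] using this
  have h2 : ∀ p : ℝ, p * y ≤ max (p * J.fst) (p * J.snd) := fun p => by
    have := mul_le_max_mul (y := p) hy.1 hy.2
    simpa only [mul_comm] using this
  exact ⟨(min_le_min (h1 _) (h1 _)).trans (min_mul_le_mul hx.1 hx.2),
    (mul_le_max_mul hx.1 hx.2).trans (max_le_max (h2 _) (h2 _))⟩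

/-- The four corner products of the smaller intervals lie in the product of the larger ones. -/
theorem intervalMul_mono {I I' J J' : NonemptyInterval ℝ}
    (hI : I.fst ≤ I'.fst ∧ I'.snd ≤ I.snd) (hJ : J.fst ≤ J'.fst ∧ J'.snd ≤ J.snd) :
    (intervalMul I J).fst ≤ (intervalMul I' J').fst ∧
      (intervalMul I' J').snd ≤ (intervalMul I J).snd := by
  have i1 : I.fst ≤ I'.fst ∧ I'.fst ≤ I.snd := ⟨hI.1, I'.fst_le_snd.trans hI.2⟩
  have i2 : I.fst ≤ I'.snd ∧ I'.snd ≤ I.snd := ⟨hI.1.trans I'.fst_le_snd, hI.2⟩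
  have j1 : J.fst ≤ J'.fst ∧ J'.fst ≤ J.snd := ⟨hJ.1, J'.fst_le_snd.trans hJ.2⟩
  have j2 : J.fst ≤ J'.snd ∧ J'.snd ≤ J.snd := ⟨hJ.1.trans J'.fst_le_snd, hJ.2⟩
  have a1 := mul_mem_intervalMul i1 j1
  have a2 := mul_mem_intervalMul i1 j2
  have a3 := mul_mem_intervalMul i2 j1
  have a4 := mul_mem_intervalMul i2 j2
  exact ⟨le_min (le_min a1.1 a2.1) (le_min a3.1 a4.1), max_le (max_le a1.2 a2.2) (max_le a3.2 a4.2)⟩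

theorem NonemptyInterval.fst_sum {ι : Type*} (s : Finset ι) (f : ι → NonemptyInterval ℝ) :
    (∑ i ∈ s, f i).fst = ∑ i ∈ s, (f i).fst := by
  classical
  induction s using Finset.induction_on with
  | empty => rfl
  | insert i s hi ih => rw [Finset.sum_insert hi, Finset.sum_insert hi, NonemptyInterval.fst_add, ih]

theorem NonemptyInterval.snd_sum {ι : Type*} (s : Finset ι) (f : ι → NonemptyInterval ℝ) :
    (∑ i ∈ s, f i).snd = ∑ i ∈ s, (f i).snd := by
  classical
  induction s using Finset.induction_on with
  | empty => rfl
  | insert i s hi ih => rw [Finset.sum_insert hi, Finset.sum_insert hi, NonemptyInterval.snd_add, ih]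

theorem matVec_fst {n : ℕ} {R R' : ℚ≥0} (A : Box (Fin n × Fin n) R) (v : Box (Fin n) R')
    (i : Fin n) : (matVec A v i).fst = ∑ j,
      min (min (A.lo (i, j) * v.lo j) (A.lo (i, j) * v.hi j))
        (min (A.hi (i, j) * v.lo j) (A.hi (i, j) * v.hi j)) := by
  rw [matVec, NonemptyInterval.fst_sum]
  rfl

theorem matVec_snd {n : ℕ} {R R' : ℚ≥0} (A : Box (Fin n × Fin n) R) (v : Box (Fin n) R')
    (i : Fin n) : (matVec A v i).snd = ∑ j,
      max (max (A.lo (i, j) * v.lo j) (A.lo (i, j) * v.hi j))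
        (max (A.hi (i, j) * v.lo j) (A.hi (i, j) * v.hi j)) := by
  rw [matVec, NonemptyInterval.snd_sum]
  rfl

theorem matVec_mono {n : ℕ} {R R' : ℚ≥0} {A A' : Box (Fin n × Fin n) R} {v v' : Box (Fin n) R'}
    (hA : A ≤ A') (hv : v ≤ v') (i : Fin n) :
    (matVec A v i).fst ≤ (matVec A' v' i).fst ∧ (matVec A' v' i).snd ≤ (matVec A v i).snd := by
  simp only [matVec, NonemptyInterval.fst_sum, NonemptyInterval.snd_sum]
  have h := fun j => intervalMul_mono (I := A.coord (i, j)) (I' := A'.coord (i, j))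
    (J := v.coord j) (J' := v'.coord j) (hA (i, j)) (hv j)
  exact ⟨Finset.sum_le_sum fun j _ => (h j).1, Finset.sum_le_sum fun j _ => (h j).2⟩

theorem Box.abs_lo_le {ι : Type*} {R : ℚ≥0} (X : Box ι R) (i : ι) : |X.lo i| ≤ R :=
  abs_le.2 ⟨X.neg_le_lo i, (X.lo_le_hi i).trans (X.hi_le i)⟩

theorem Box.abs_hi_le {ι : Type*} {R : ℚ≥0} (X : Box ι R) (i : ι) : |X.hi i| ≤ R :=
  abs_le.2 ⟨(X.neg_le_lo i).trans (X.lo_le_hi i), X.hi_le i⟩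

theorem abs_mul_le_mul {x y R R' : ℝ} (hx : |x| ≤ R) (hy : |y| ≤ R') : |x * y| ≤ R * R' := by
  rw [abs_mul]
  exact mul_le_mul hx hy (abs_nonneg _) ((abs_nonneg _).trans hx)

theorem abs_min_le_of {x y R : ℝ} (hx : |x| ≤ R) (hy : |y| ≤ R) : |min x y| ≤ R := by
  rcases min_choice x y with h | h <;> rw [h] <;> assumption

theorem abs_max_le_of {x y R : ℝ} (hx : |x| ≤ R) (hy : |y| ≤ R) : |max x y| ≤ R := by
  rcases max_choice x y with h | h <;> rw [h] <;> assumption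

/-- This bounds the second-order coefficient and enters the Lipschitz constant of the Euler
operator. -/
theorem abs_matVec_le {n : ℕ} {R R' : ℚ≥0} (A : Box (Fin n × Fin n) R) (v : Box (Fin n) R')
    (i : Fin n) : |(matVec A v i).fst| ≤ n * (R * R') ∧ |(matVec A v i).snd| ≤ n * (R * R') := by
  have hb : ∀ j, |A.lo (i, j) * v.lo j| ≤ R * R' ∧ |A.lo (i, j) * v.hi j| ≤ R * R' ∧
      |A.hi (i, j) * v.lo j| ≤ R * R' ∧ |A.hi (i, j) * v.hi j| ≤ (R : ℝ) * R' := fun j =>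
    ⟨abs_mul_le_mul (A.abs_lo_le _) (v.abs_lo_le _), abs_mul_le_mul (A.abs_lo_le _) (v.abs_hi_le _),
      abs_mul_le_mul (A.abs_hi_le _) (v.abs_lo_le _), abs_mul_le_mul (A.abs_hi_le _) (v.abs_hi_le _)⟩
  have hc : (n : ℝ) * (R * R') = ∑ _j : Fin n, (R : ℝ) * R' := by simp
  rw [matVec_fst, matVec_snd, hc]
  refine ⟨(Finset.abs_sum_le_sum_abs _ _).trans (Finset.sum_le_sum fun j _ => ?_),
    (Finset.abs_sum_le_sum_abs _ _).trans (Finset.sum_le_sum fun j _ => ?_)⟩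
  · exact abs_min_le_of (abs_min_le_of (hb j).1 (hb j).2.1) (abs_min_le_of (hb j).2.2.1 (hb j).2.2.2)
  · exact abs_max_le_of (abs_max_le_of (hb j).1 (hb j).2.1) (abs_max_le_of (hb j).2.2.1 (hb j).2.2.2)

theorem integral_affine (p q s x : ℝ) :
    ∫ t in s..x, (p + (t - s) * q) = (x - s) * p + (x - s) ^ 2 / 2 * q := by
  have h : ∀ t ∈ uIcc s x, HasDerivAt (fun t => (t - s) * p + (t - s) ^ 2 / 2 * q)
      (p + (t - s) * q) t := by
    intro t _
    have h1 : HasDerivAt (fun t : ℝ => t - s) 1 t := (hasDerivAt_id t).sub_const s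
    exact HasDerivAt.congr_deriv ((h1.mul_const p).add (((h1.pow 2).div_const 2).mul_const q))
      (by norm_num)
  rw [intervalIntegral.integral_eq_sub_of_hasDerivAt h
    (Continuous.intervalIntegrable (by fun_prop) _ _)]
  simp

/-- For `t ≥ s` the scalar factor is non-negative, so the end-points keep their order and the
integrand is affine on each side. -/
theorem affineInterval_eq {A B : NonemptyInterval ℝ} {s t : ℝ} (h : s ≤ t) :
    (affineInterval A B s t).fst = A.fst + (t - s) * B.fst ∧
      (affineInterval A B s t).snd = A.snd + (t - s) * B.snd := by
  have h1 : (t - s) * B.fst ≤ (t - s) * B.snd :=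
    mul_le_mul_of_nonneg_left B.fst_le_snd (by linarith)
  simp only [affineInterval, intervalMul, NonemptyInterval.fst_add, NonemptyInterval.snd_add,
    NonemptyInterval.pure, min_self, max_self, min_eq_left h1, max_eq_right h1, and_self]

theorem integralInterval_affine (A B : NonemptyInterval ℝ) {s x : ℝ} (h : s ≤ x)
    (h1 : Continuous fun t => (affineInterval A B s t).fst)
    (h2 : Continuous fun t => (affineInterval A B s t).snd) :
    (integralInterval (affineInterval A B s) s x h h1 h2).fst =
        (x - s) * A.fst + (x - s) ^ 2 / 2 * B.fst ∧
      (integralInterval (affineInterval A B s) s x h h1 h2).snd =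
        (x - s) * A.snd + (x - s) ^ 2 / 2 * B.snd := by
  rw [← integral_affine, ← integral_affine]
  constructor
  · refine intervalIntegral.integral_congr fun t ht => ?_
    rw [uIcc_of_le h] at ht
    exact (affineInterval_eq ht.1).1
  · refine intervalIntegral.integral_congr fun t ht => ?_
    rw [uIcc_of_le h] at ht
    exact (affineInterval_eq ht.1).2

end IntervalArithmetic

/-! ### Closed form, monotonicity and stability of the Euler operator -/

section EulerFormula

variable {n : ℕ} {K M M₁ a : ℚ≥0}

namespace RatPartition

theorem eq_zero_or_exists (Q : RatPartition a) (x : Time a) : (x : ℝ) = 0 ∨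
    ∃ j : Fin Q.k, (Q.q j.castSucc : ℝ) < x ∧ (x : ℝ) ≤ (Q.q j.succ : ℝ) := by
  have key : ∀ m : Fin (Q.k + 1), (x : ℝ) ≤ (Q.q m : ℝ) → (x : ℝ) = 0 ∨
      ∃ j : Fin Q.k, (Q.q j.castSucc : ℝ) < x ∧ (x : ℝ) ≤ (Q.q j.succ : ℝ) := by
    intro m
    induction m using Fin.induction with
    | zero =>
      intro h
      rw [Q.q_zero] at h
      exact Or.inl (le_antisymm (by simpa using h) x.2.1)
    | succ j ih =>
      intro h
      by_cases h' : (x : ℝ) ≤ (Q.q j.castSucc : ℝ)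
      · exact ih h'
      · exact Or.inr ⟨j, not_le.1 h', h⟩
  refine key (Fin.last _) ?_
  rw [Q.q_last]
  simpa using x.2.2

theorem q_nonneg (Q : RatPartition a) (m : Fin (Q.k + 1)) : 0 ≤ Q.q m := by
  rw [← Q.q_zero]
  exact Q.strictMono.monotone (Fin.zero_le m)

theorem q_le (Q : RatPartition a) (m : Fin (Q.k + 1)) : Q.q m ≤ (a : ℚ) := by
  rw [← Q.q_last]
  exact Q.strictMono.monotone (Fin.le_last m)

/-- The definition of the operator chooses the partition interval of `x`; uniqueness makes the
choice harmless. -/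
theorem index_unique (Q : RatPartition a) {x : ℝ} {i j : Fin Q.k}
    (hi : (Q.q i.castSucc : ℝ) < x ∧ x ≤ (Q.q i.succ : ℝ))
    (hj : (Q.q j.castSucc : ℝ) < x ∧ x ≤ (Q.q j.succ : ℝ)) : i = j := by
  have key : ∀ {i j : Fin Q.k}, (Q.q j.castSucc : ℝ) < x → x ≤ (Q.q i.succ : ℝ) → j ≤ i := by
    intro i j h1 h2
    have : Q.q j.castSucc < Q.q i.succ := by exact_mod_cast h1.trans_le h2
    exact Fin.castSucc_lt_succ_iff.1 (Q.strictMono.lt_iff_lt.1 this)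
  exact le_antisymm (key hi.1 hj.2) (key hj.1 hi.2)

/-- The length of a step of the partition. -/
def step (Q : RatPartition a) (j : Fin Q.k) : ℚ := Q.q j.succ - Q.q j.castSucc

theorem step_pos' (Q : RatPartition a) (j : Fin Q.k) : 0 < Q.step j :=
  sub_pos.2 (Q.strictMono Fin.castSucc_lt_succ)

end RatPartition

/-- The nearest-point map onto `[-K, K]`. -/
def clamp (K r : ℝ) : ℝ := max (-K) (min K r)

theorem clamp_mono (K : ℝ) : Monotone (clamp K) := fun _ _ h =>
  max_le_max le_rfl (min_le_min le_rfl h)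

/-- Truncation is monotone and does not increase distances. -/
theorem clamp_le_add {K r r' d : ℝ} (hd : 0 ≤ d) (h : r ≤ r' + d) : clamp K r ≤ clamp K r' + d := by
  unfold clamp
  refine max_le (by linarith [le_max_left (-K) (min K r')]) ?_
  rcases le_total K r' with h1 | h1
  · rw [min_eq_left h1]
    linarith [le_max_right (-K) K, min_le_left K r]
  · rw [min_eq_right h1]
    linarith [le_max_right (-K) r', min_le_right K r]

/-- The expanded box always meets the cube, so its truncation is an intersection, which is
Scott-continuous in the box. -/
theorem eulerG_eq (Q : RatPartition a) (M : ℚ≥0) (φ : Time a → Box (Fin n) K) (j : Fin Q.k) :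
    eulerG Q M φ j = Box.widen ((M : ℝ) * ((Q.q j.succ : ℝ) - (Q.q j.castSucc : ℝ)))
      (mul_nonneg (nnratCast_nonneg M) (Q.step_pos j).le) (φ (Q.pt j.castSucc)) := by
  have hr := mul_nonneg (nnratCast_nonneg M) (Q.step_pos j).le
  ext i
  · have h1 := ((φ (Q.pt j.castSucc)).lo_le_hi i).trans ((φ (Q.pt j.castSucc)).hi_le i)
    have h2 : (φ (Q.pt j.castSucc)).lo i -
        (M : ℝ) * ((Q.q j.succ : ℝ) - (Q.q j.castSucc : ℝ)) ≤ K := by linarith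
    exact congrArg (max (-(K : ℝ))) (min_eq_right h2)
  · have h1 := ((φ (Q.pt j.castSucc)).neg_le_lo i).trans ((φ (Q.pt j.castSucc)).lo_le_hi i)
    have h2 : -(K : ℝ) ≤ min (K : ℝ) ((φ (Q.pt j.castSucc)).hi i +
        (M : ℝ) * ((Q.q j.succ : ℝ) - (Q.q j.castSucc : ℝ))) :=
      le_min (by linarith [nnratCast_nonneg K]) (by linarith)
    exact max_eq_right h2

/-- The product `(u' · u) (G_j)` of the interval matrix and the interval vector. -/
def eulerSlope (Q : RatPartition a) (v : V1 n K M M₁) (φ : Time a → Box (Fin n) K) (j : Fin Q.k)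
    (i : Fin n) : NonemptyInterval ℝ :=
  matVec (v.u' (eulerG Q M φ j)) (v.u (eulerG Q M φ j)) i

/-- The lower end-point before truncation. -/
def eulerLo (Q : RatPartition a) (v : V1 n K M M₁) (φ : Time a → Box (Fin n) K) (j : Fin Q.k)
    (i : Fin n) (s : ℝ) : ℝ :=
  (φ (Q.pt j.castSucc)).lo i + (s * (v.u (φ (Q.pt j.castSucc))).lo i +
    s ^ 2 / 2 * (eulerSlope Q v φ j i).fst)

/-- The upper end-point before truncation. -/
def eulerHi (Q : RatPartition a) (v : V1 n K M M₁) (φ : Time a → Box (Fin n) K) (j : Fin Q.k)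
    (i : Fin n) (s : ℝ) : ℝ :=
  (φ (Q.pt j.castSucc)).hi i + (s * (v.u (φ (Q.pt j.castSucc))).hi i +
    s ^ 2 / 2 * (eulerSlope Q v φ j i).snd)

/-- Integration of the affine integrand gives, at each end-point, a quadratic polynomial in the
elapsed time. Its coefficients depend only on the values of the data at `q_j` and `G_j`. -/
theorem eulerPhi_eq (Q : RatPartition a) (v : V1 n K M M₁) (φ : Time a → Box (Fin n) K)
    {x : Time a} {j : Fin Q.k} (h : (Q.q j.castSucc : ℝ) < x ∧ (x : ℝ) ≤ (Q.q j.succ : ℝ))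
    (i : Fin n) :
    (eulerPhi Q v φ x).lo i = clamp K (eulerLo Q v φ j i (x - Q.q j.castSucc)) ∧
      (eulerPhi Q v φ x).hi i = clamp K (eulerHi Q v φ j i (x - Q.q j.castSucc)) := by
  have hex : ∃ j : Fin Q.k, (Q.q j.castSucc : ℝ) < x ∧ (x : ℝ) ≤ (Q.q j.succ : ℝ) := ⟨j, h⟩
  have hj : hex.choose = j := Q.index_unique hex.choose_spec h
  rw [eulerPhi, dif_pos hex]
  simp only [Box.trunc, NonemptyInterval.fst_add, NonemptyInterval.snd_add,
    (integralInterval_affine _ _ _ _ _).1, (integralInterval_affine _ _ _ _ _).2, hj]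
  exact ⟨rfl, rfl⟩

theorem eulerPhi_zero (Q : RatPartition a) (v : V1 n K M M₁) (φ : Time a → Box (Fin n) K)
    {x : Time a} (h : (x : ℝ) = 0) : eulerPhi Q v φ x = Box.zero := by
  rw [eulerPhi, dif_neg]
  rintro ⟨j, h1, -⟩
  rw [h] at h1
  have : (0 : ℝ) ≤ (Q.q j.castSucc : ℝ) := by exact_mod_cast Q.q_nonneg _
  linarith

theorem eulerPhi_mono (Q : RatPartition a) {v w : V1 n K M M₁} {φ ψ : Time a → Box (Fin n) K}
    (hv : v ≤ w) (hφ : φ ≤ ψ) : eulerPhi Q v φ ≤ eulerPhi Q w ψ := by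
  intro x
  rcases Q.eq_zero_or_exists x with h | ⟨j, h⟩
  · rw [eulerPhi_zero Q v φ h, eulerPhi_zero Q w ψ h]
  · intro i
    have hG : eulerG Q M φ j ≤ eulerG Q M ψ j := by
      rw [eulerG_eq, eulerG_eq]
      exact Box.widen_mono _ (hφ _)
    have hu : v.u (φ (Q.pt j.castSucc)) ≤ w.u (ψ (Q.pt j.castSucc)) :=
      (v.u_cont.monotone (hφ _)).trans (hv.1 _)
    have hs := matVec_mono ((v.u'_cont.monotone hG).trans (hv.2 _))
      ((v.u_cont.monotone hG).trans (hv.1 _)) i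
    have h0 : 0 ≤ (x : ℝ) - Q.q j.castSucc := by linarith [h.1]
    have h1 := mul_le_mul_of_nonneg_left (hu i).1 h0
    have h2 := mul_le_mul_of_nonneg_left (hu i).2 h0
    have h4 : 0 ≤ ((x : ℝ) - Q.q j.castSucc) ^ 2 / 2 := by positivity
    have h5 := mul_le_mul_of_nonneg_left hs.1 h4
    have h6 := mul_le_mul_of_nonneg_left hs.2 h4
    rw [(eulerPhi_eq Q v φ h i).1, (eulerPhi_eq Q v φ h i).2, (eulerPhi_eq Q w ψ h i).1,
      (eulerPhi_eq Q w ψ h i).2]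
    refine ⟨clamp_mono _ ?_, clamp_mono _ ?_⟩
    · unfold eulerLo eulerSlope
      linarith [(hφ (Q.pt j.castSucc) i).1]
    · unfold eulerHi eulerSlope
      linarith [(hφ (Q.pt j.castSucc) i).2]

/-- The Euler operator is uniformly close for close data. -/
theorem widen_eulerPhi_le (Q : RatPartition a) {v w : V1 n K M M₁}
    {φ ψ : Time a → Box (Fin n) K} {η δ : ℝ} (hη : 0 ≤ η) (hδ : 0 ≤ δ)
    (hle : η * (1 + a + a ^ 2) ≤ δ)
    (h : ∀ (j : Fin Q.k) (i : Fin n),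
      ((φ (Q.pt j.castSucc)).lo i ≤ (ψ (Q.pt j.castSucc)).lo i + η ∧
        (ψ (Q.pt j.castSucc)).hi i ≤ (φ (Q.pt j.castSucc)).hi i + η) ∧
      ((v.u (φ (Q.pt j.castSucc))).lo i ≤ (w.u (ψ (Q.pt j.castSucc))).lo i + η ∧
        (w.u (ψ (Q.pt j.castSucc))).hi i ≤ (v.u (φ (Q.pt j.castSucc))).hi i + η) ∧
      (eulerSlope Q v φ j i).fst ≤ (eulerSlope Q w ψ j i).fst + η ∧
        (eulerSlope Q w ψ j i).snd ≤ (eulerSlope Q v φ j i).snd + η) (x : Time a) :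
    Box.widen δ hδ (eulerPhi Q v φ x) ≤ eulerPhi Q w ψ x := by
  rcases Q.eq_zero_or_exists x with hx | ⟨j, hx⟩
  · rw [eulerPhi_zero Q v φ hx, eulerPhi_zero Q w ψ hx]
    exact Box.widen_le_self _ _
  · intro i
    obtain ⟨⟨h1, h2⟩, ⟨h3, h4⟩, h5, h6⟩ := h j i
    have h0 : 0 ≤ (x : ℝ) - Q.q j.castSucc := by linarith [hx.1]
    have hq : (0 : ℝ) ≤ Q.q j.castSucc := by exact_mod_cast Q.q_nonneg _
    -- An error `η` in each coefficient contributes at most `η`, `a * η` and `a ^ 2 * η`, since the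
    -- elapsed time is at most `a`.
    have hxa : (x : ℝ) - Q.q j.castSucc ≤ a := by linarith [x.2.2]
    have hs : 0 ≤ ((x : ℝ) - Q.q j.castSucc) ^ 2 / 2 := by positivity
    have hsa : ((x : ℝ) - Q.q j.castSucc) ^ 2 / 2 ≤ a ^ 2 := by nlinarith
    have e1 := mul_le_mul_of_nonneg_left h3 h0
    have e2 := mul_le_mul_of_nonneg_left h4 h0
    have e3 := mul_le_mul_of_nonneg_left h5 hs
    have e4 := mul_le_mul_of_nonneg_left h6 hs
    have e5 := mul_le_mul_of_nonneg_right hxa hη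
    have e6 := mul_le_mul_of_nonneg_right hsa hη
    refine ⟨max_le (Box.neg_le_lo _ i) ?_, le_min (Box.hi_le _ i) ?_⟩
    · rw [(eulerPhi_eq Q v φ hx i).1, (eulerPhi_eq Q w ψ hx i).1, sub_le_iff_le_add]
      refine clamp_le_add hδ ?_
      unfold eulerLo
      linarith
    · rw [(eulerPhi_eq Q v φ hx i).2, (eulerPhi_eq Q w ψ hx i).2]
      refine clamp_le_add hδ ?_
      unfold eulerHi
      linarith

end EulerFormula

/-! ### Uniform approximation and Scott continuity -/

/-! ## Scott continuity of the Euler operator -/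

section EulerContinuity

open Filter Topology

variable {ι κ : Type*} {R R' : ℚ≥0}

/-- Step functions take finitely many pairs of values, so the margins at the single times have a
positive minimum. -/
theorem StepFun.Sep.exists_le_widen {n : ℕ} {K a : ℚ≥0} {θ₁ θ₂ : StepFun n K a} (h : θ₁.Sep θ₂) :
    ∃ (ε : ℝ) (hε : 0 < ε), ∀ t, θ₁.1 t ≤ Box.widen ε hε.le (θ₂.1 t) := by
  have hP : (range fun t => (θ₁.1 t, θ₂.1 t)).Finite := by
    obtain ⟨l, hl⟩ := θ₁.2
    obtain ⟨m, hm⟩ := θ₂.2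
    refine (hl.finite_range.prod hm.finite_range).subset ?_
    rintro _ ⟨t, rfl⟩
    exact ⟨⟨t, rfl⟩, ⟨t, rfl⟩⟩
  have hev : ∀ᶠ ε in 𝓝[>] (0 : ℝ), ∀ p ∈ range fun t => (θ₁.1 t, θ₂.1 t),
      ∀ hε : 0 < ε, p.1 ≤ Box.widen ε hε.le p.2 := by
    rw [eventually_all_finite hP]
    rintro _ ⟨t, rfl⟩
    obtain ⟨ε, hε, hle⟩ := Box.exists_le_widen (StepFun.sep_iff.1 h t)
    filter_upwards [Ioo_mem_nhdsGT hε] with δ hδ hδ'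
    exact hle.trans (Box.widen_anti hδ'.le hδ.2.le _)
  obtain ⟨ε, hε, hε0⟩ := (hev.and self_mem_nhdsWithin).exists
  exact ⟨ε, hε0, fun t => hε _ ⟨t, rfl⟩ hε0⟩

theorem SepFun.exists_le_widen {n : ℕ} {K a : ℚ≥0} {f g : Time a → Box (Fin n) K}
    (h : SepFun f g) : ∃ (ε : ℝ) (hε : 0 < ε), ∀ t, f t ≤ Box.widen ε hε.le (g t) := by
  obtain ⟨θ₁, θ₂, h1, h2, h3⟩ := h
  obtain ⟨ε, hε, hle⟩ := h2.exists_le_widen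
  exact ⟨ε, hε, fun t => (h1 t).trans ((hle t).trans (Box.widen_mono hε.le (h3 t)))⟩

/-- Half of the mechanism of Scott continuity: separation holds with a uniform margin `ε`, and a
rational widening of `θ₂` by less than `ε` fits between `θ₁` and every function uniformly close to
`g`. -/
theorem SepFun.exists_of_approx {n : ℕ} {K a : ℚ≥0} {f g : Time a → Box (Fin n) K}
    (h : SepFun f g) : ∃ (δ : ℝ) (hδ : 0 < δ), ∀ g' : Time a → Box (Fin n) K,
      (∀ t, Box.widen δ hδ.le (g t) ≤ g' t) → SepFun f g' := by
  obtain ⟨θ₁, θ₂, h1, h2, h3⟩ := h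
  obtain ⟨ε, hε, hle⟩ := h2.exists_le_widen
  obtain ⟨q, hq0, hq⟩ := exists_rat_btwn hε
  obtain ⟨w, -, hwt⟩ := θ₂.exists_widen q hq0
  refine ⟨q, hq0, fun g' hg' => ⟨θ₁, w, h1, StepFun.sep_iff.2 fun t => ?_, fun t => ?_⟩⟩
  · rw [hwt]
    exact (Box.widen_wayBelow hq0.le hq _).le_trans (hle t)
  · rw [hwt]
    exact (Box.widen_mono hq0.le (h3 t)).trans (hg' t)

variable {I : Type*} [Preorder I] [Nonempty I] {Y : I → Box ι R} {X : Box ι R}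

theorem Box.tendsto_lo (hY : Monotone Y) (hX : IsLUB (range Y) X) (i : ι) :
    Tendsto (fun p => (Y p).lo i) atTop (𝓝 (X.lo i)) := by
  refine tendsto_atTop_isLUB (fun p q h => (hY h i).1) ⟨?_, fun c hc => ?_⟩
  · rintro _ ⟨p, rfl⟩
    exact (hX.1 ⟨p, rfl⟩ i).1
  · obtain ⟨p⟩ := ‹Nonempty I›
    refine Box.lo_le_of_isLUB hX (((Y p).neg_le_lo i).trans (hc ⟨p, rfl⟩)) ?_
    rintro _ ⟨q, rfl⟩
    exact hc ⟨q, rfl⟩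

theorem Box.tendsto_hi (hY : Monotone Y) (hX : IsLUB (range Y) X) (i : ι) :
    Tendsto (fun p => (Y p).hi i) atTop (𝓝 (X.hi i)) := by
  refine tendsto_atTop_isGLB (fun p q h => (hY h i).2) ⟨?_, fun c hc => ?_⟩
  · rintro _ ⟨p, rfl⟩
    exact (hX.1 ⟨p, rfl⟩ i).2
  · obtain ⟨p⟩ := ‹Nonempty I›
    refine Box.le_hi_of_isLUB hX ((hc ⟨p, rfl⟩).trans ((Y p).hi_le i)) ?_
    rintro _ ⟨q, rfl⟩
    exact hc ⟨q, rfl⟩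

theorem directedOn_range_of_monotone {I : Type*} [Preorder I] [IsDirectedOrder I] {D : Type*} [PartialOrder D] {Y : I → D}
    (hY : Monotone Y) : DirectedOn (· ≤ ·) (range Y) := by
  rintro _ ⟨p, rfl⟩ _ ⟨q, rfl⟩
  obtain ⟨r, hp, hq⟩ := exists_ge_ge p q
  exact ⟨_, ⟨r, rfl⟩, hY hp, hY hq⟩

/-- For a directed index set, the double supremum over maps and arguments is attained along the
diagonal. -/
theorem isLUB_range_apply [IsDirectedOrder I] {g : I → Box ι R → Box κ R'}
    (hg : Monotone g) (hgc : ∀ p, ScottContinuous (g p)) {g' : Box ι R → Box κ R'}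
    (hg' : ∀ β, IsLUB (range fun p => g p β) (g' β)) (hY : Monotone Y) (hX : IsLUB (range Y) X) :
    IsLUB (range fun p => g p (Y p)) (g' X) := by
  refine ⟨?_, fun Z hZ => (hg' X).2 ?_⟩
  · rintro _ ⟨p, rfl⟩
    exact ((hgc p).monotone (hX.1 ⟨p, rfl⟩)).trans ((hg' X).1 ⟨p, rfl⟩)
  · rintro _ ⟨p, rfl⟩
    refine (hgc p (range_nonempty Y) (directedOn_range_of_monotone hY) hX).2 ?_
    rintro _ ⟨_, ⟨q, rfl⟩, rfl⟩
    obtain ⟨r, hp, hq⟩ := exists_ge_ge p q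
    exact ((hgc p).monotone (hY hq)).trans ((hg hp _).trans (hZ ⟨r, rfl⟩))

variable {n : ℕ} {K M M₁ a : ℚ≥0}

theorem upperStar_mono {φ ψ : WD n K a} (h : φ ≤ ψ) : upperStar φ ≤ upperStar ψ := by
  intro t
  refine (isLUB_upperStar φ t).2 ?_
  rintro _ ⟨θ, hθ, rfl⟩
  exact le_upperStar (h hθ) t

theorem isLUB_range_upperStar [IsDirectedOrder I] {Φ : I → WD n K a} (hΦ : Monotone Φ)
    {φ : WD n K a} (hφ : IsLUB (range Φ) φ) (t : Time a) :
    IsLUB (range fun p => upperStar (Φ p) t) (upperStar φ t) := by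
  refine ⟨?_, fun Z hZ => (isLUB_upperStar φ t).2 ?_⟩
  · rintro _ ⟨p, rfl⟩
    exact upperStar_mono (hφ.1 ⟨p, rfl⟩) t
  · rintro _ ⟨θ, hθ, rfl⟩
    obtain ⟨_, ⟨p, rfl⟩, hp⟩ := WD.exists_mem_of_isLUB (range_nonempty Φ)
      (directedOn_range_of_monotone hΦ) hφ hθ
    exact (le_upperStar hp t).trans (hZ ⟨p, rfl⟩)

theorem tendsto_matVec {Y : I → Box (Fin n × Fin n) R} {Z : I → Box (Fin n) R'}
    {X : Box (Fin n × Fin n) R} {W : Box (Fin n) R'} (hY : Monotone Y) (hX : IsLUB (range Y) X)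
    (hZ : Monotone Z) (hW : IsLUB (range Z) W) (i : Fin n) :
    Tendsto (fun p => (matVec (Y p) (Z p) i).fst) atTop (𝓝 (matVec X W i).fst) ∧
      Tendsto (fun p => (matVec (Y p) (Z p) i).snd) atTop (𝓝 (matVec X W i).snd) := by
  simp only [matVec_fst, matVec_snd]
  have h1 := fun j => Box.tendsto_lo hY hX (i, j)
  have h2 := fun j => Box.tendsto_hi hY hX (i, j)
  have h3 := fun j => Box.tendsto_lo hZ hW j
  have h4 := fun j => Box.tendsto_hi hZ hW j
  exact ⟨tendsto_finsetSum _ fun j _ => ((((h1 j).mul (h3 j)).min ((h1 j).mul (h4 j))).min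
      (((h2 j).mul (h3 j)).min ((h2 j).mul (h4 j)))),
    tendsto_finsetSum _ fun j _ => ((((h1 j).mul (h3 j)).max ((h1 j).mul (h4 j))).max
      (((h2 j).mul (h3 j)).max ((h2 j).mul (h4 j))))⟩

/-- Along a directed family the values of the Euler operator converge uniformly. -/
theorem exists_widen_eulerPhi_le [IsDirectedOrder I] (hK : 0 < K) (Q : RatPartition a)
    {V : I → V1 n K M M₁} (hV : Monotone V) {v : V1 n K M M₁} (hv : IsLUB (range V) v)
    {Φ : I → WD n K a} (hΦ : Monotone Φ) {φ : WD n K a} (hφ : IsLUB (range Φ) φ) {δ : ℝ}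
    (hδ : 0 < δ) : ∃ p, ∀ x, Box.widen δ hδ.le (eulerPhi Q v (upperStar φ) x) ≤
      eulerPhi Q (V p) (upperStar (Φ p)) x := by
  have hdir := directedOn_range_of_monotone hV
  have hu : ∀ β, IsLUB (range fun p => (V p).u β) (v.u β) := fun β => by
    have := V1.isLUB_u hK (range_nonempty V) hdir hv β
    rwa [← range_comp] at this
  have hu' : ∀ β, IsLUB (range fun p => (V p).u' β) (v.u' β) := fun β => by
    have := V1.isLUB_u' hK (range_nonempty V) hdir hv β
    rwa [← range_comp] at this
  have hX := fun t => isLUB_range_upperStar hΦ hφ t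
  have hXm : ∀ t, Monotone fun p => upperStar (Φ p) t := fun t p q h => upperStar_mono (hΦ h) t
  have hG : ∀ j, IsLUB (range fun p => eulerG Q M (upperStar (Φ p)) j)
      (eulerG Q M (upperStar φ) j) := by
    intro j
    simp only [eulerG_eq]
    have := Box.scottContinuous_widen (mul_nonneg (nnratCast_nonneg M) (Q.step_pos j).le)
      (range_nonempty _) (directedOn_range_of_monotone (hXm (Q.pt j.castSucc)))
      (hX (Q.pt j.castSucc))
    rwa [← range_comp] at this
  have hGm : ∀ j, Monotone fun p => eulerG Q M (upperStar (Φ p)) j := by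
    intro j p q h
    simp only [eulerG_eq]
    exact Box.widen_mono _ (hXm _ h)
  have hVu : Monotone fun p => (V p).u := fun p q h => (V1.le_def.1 (hV h)).1
  have hVu' : Monotone fun p => (V p).u' := fun p q h => (V1.le_def.1 (hV h)).2
  have hmu : ∀ {Y : I → Box (Fin n) K}, Monotone Y → Monotone fun p => (V p).u (Y p) :=
    fun hY p q h => ((V p).u_cont.monotone (hY h)).trans (hVu h _)
  have hmu' : ∀ {Y : I → Box (Fin n) K}, Monotone Y → Monotone fun p => (V p).u' (Y p) :=
    fun hY p q h => ((V p).u'_cont.monotone (hY h)).trans (hVu' h _)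
  have hA := fun t => isLUB_range_apply hVu (fun p => (V p).u_cont) hu (hXm t) (hX t)
  have hB := fun j => isLUB_range_apply hVu (fun p => (V p).u_cont) hu (hGm j) (hG j)
  have hB' := fun j => isLUB_range_apply hVu' (fun p => (V p).u'_cont) hu' (hGm j) (hG j)
  have hpos : (0 : ℝ) < 1 + a + a ^ 2 := by
    have := nnratCast_nonneg a
    positivity
  -- The accuracy of the coefficients that `widen_eulerPhi_le` requires for an error of `δ` in the
  -- values.
  let η : ℝ := δ / (1 + a + a ^ 2)
  have hη : 0 < η := div_pos hδ hpos
  have hlo : ∀ {f : I → ℝ} {c : ℝ}, Tendsto f atTop (𝓝 c) → ∀ᶠ p in atTop, c ≤ f p + η := by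
    intro f c hf
    filter_upwards [hf.eventually (lt_mem_nhds (sub_lt_self c hη))] with p hp
    linarith
  have hhi : ∀ {f : I → ℝ} {c : ℝ}, Tendsto f atTop (𝓝 c) → ∀ᶠ p in atTop, f p ≤ c + η := by
    intro f c hf
    filter_upwards [hf.eventually (gt_mem_nhds (lt_add_of_pos_right c hη))] with p hp
    linarith
  have hev : ∀ᶠ p in atTop, ∀ (j : Fin Q.k) (i : Fin n),
      ((upperStar φ (Q.pt j.castSucc)).lo i ≤ (upperStar (Φ p) (Q.pt j.castSucc)).lo i + η ∧
        (upperStar (Φ p) (Q.pt j.castSucc)).hi i ≤ (upperStar φ (Q.pt j.castSucc)).hi i + η) ∧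
      ((v.u (upperStar φ (Q.pt j.castSucc))).lo i ≤
          ((V p).u (upperStar (Φ p) (Q.pt j.castSucc))).lo i + η ∧
        ((V p).u (upperStar (Φ p) (Q.pt j.castSucc))).hi i ≤
          (v.u (upperStar φ (Q.pt j.castSucc))).hi i + η) ∧
      (eulerSlope Q v (upperStar φ) j i).fst ≤
          (eulerSlope Q (V p) (upperStar (Φ p)) j i).fst + η ∧
        (eulerSlope Q (V p) (upperStar (Φ p)) j i).snd ≤
          (eulerSlope Q v (upperStar φ) j i).snd + η := by
    -- There are only finitely many coefficients, so their convergence is simultaneous; this is the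
    -- source of uniformity in time.
    refine eventually_all.2 fun j => eventually_all.2 fun i => ?_
    have hS := tendsto_matVec (hmu' (hGm j)) (hB' j) (hmu (hGm j)) (hB j) i
    exact ((hlo (Box.tendsto_lo (hXm _) (hX _) i)).and
      (hhi (Box.tendsto_hi (hXm _) (hX _) i))).and
      (((hlo (Box.tendsto_lo (hmu (hXm _)) (hA _) i)).and
      (hhi (Box.tendsto_hi (hmu (hXm _)) (hA _) i))).and ((hlo hS.1).and (hhi hS.2)))
  obtain ⟨p, hp⟩ := hev.exists
  refine ⟨p, widen_eulerPhi_le Q hη.le hδ.le ?_ hp⟩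
  exact (div_mul_cancel₀ δ hpos.ne').le

theorem eulerF_mono (Q : RatPartition a) {v w : V1 n K M M₁} {φ ψ : WD n K a} (hv : v ≤ w)
    (hφ : φ ≤ ψ) : eulerF Q v φ ≤ eulerF Q w ψ :=
  lowerStar_mono (eulerPhi_mono Q hv (upperStar_mono hφ))

/-- A step function separated from the limit is separated from every uniformly close function, in
particular from the value at some member of the directed set; it thus belongs to the ideal of that
member. -/
theorem scottContinuous_eulerF (hK : 0 < K) (Q : RatPartition a) :
    ScottContinuous fun p : V1 n K M M₁ × WD n K a => eulerF Q p.1 p.2 := by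
  intro X hne hdir s hs
  refine ⟨?_, fun ψ hψ b hb => ?_⟩
  · rintro _ ⟨p, hp, rfl⟩
    exact eulerF_mono Q (hs.1 hp).1 (hs.1 hp).2
  · have := hne.to_subtype
    have : IsDirectedOrder X := directedOn_iff_isDirectedOrder.1 hdir
    obtain ⟨h1, h2⟩ := isLUB_prod.1 hs
    rw [image_eq_range] at h1 h2
    obtain ⟨δ, hδ, happ⟩ := SepFun.exists_of_approx hb
    obtain ⟨p, hp⟩ := exists_widen_eulerPhi_le hK Q (V := fun p : X => p.1.1)
      (monotone_fst.comp (Subtype.mono_coe _)) h1 (Φ := fun p : X => p.1.2) (monotone_snd.comp (Subtype.mono_coe _)) h2 hδ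
    exact hψ ⟨p, p.2, rfl⟩ (happ _ hp)

end EulerContinuity

/-! ## Separation from piecewise Lipschitz functions -/

section GridTest

variable {n : ℕ} {K a : ℚ≥0}

namespace RatPartition

/-- The points of the subdivision of the `j`-th interval of the partition into `N + 1` equal
parts. -/
def node (Q : RatPartition a) (j : Fin Q.k) (N m : ℕ) : ℚ :=
  min (Q.q j.succ) (Q.q j.castSucc + m * (Q.step j * ((N : ℚ) + 1)⁻¹))

variable (Q : RatPartition a) (j : Fin Q.k) (N m : ℕ)

theorem mesh_pos : 0 < Q.step j * ((N : ℚ) + 1)⁻¹ := mul_pos (Q.step_pos' j) (by positivity)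

theorem le_node : Q.q j.castSucc ≤ Q.node j N m :=
  le_min (Q.strictMono.monotone Fin.castSucc_lt_succ.le)
    (le_add_of_nonneg_right (mul_nonneg (Nat.cast_nonneg m) (Q.mesh_pos j N).le))

theorem lt_node_succ : Q.q j.castSucc < Q.node j N (m + 1) :=
  lt_min (Q.strictMono Fin.castSucc_lt_succ)
    (lt_add_of_pos_right _ (mul_pos (Nat.cast_pos.2 m.succ_pos) (Q.mesh_pos j N)))

theorem node_le : Q.node j N m ≤ Q.q j.succ := min_le_left _ _

theorem node_succ_le : Q.node j N (m + 1) ≤ Q.node j N m + Q.step j * ((N : ℚ) + 1)⁻¹ := by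
  have h := Q.mesh_pos j N
  rw [node, node, ← min_add_add_right]
  refine min_le_min (le_add_of_nonneg_right h.le) (le_of_eq ?_)
  push_cast
  ring

theorem node_zero : Q.node j N 0 = Q.q j.castSucc := by
  simpa [node] using Q.strictMono.monotone (Fin.castSucc_lt_succ (i := j)).le

theorem node_last : Q.node j N (N + 1) = Q.q j.succ := by
  have h : ((N : ℚ) + 1) ≠ 0 := by positivity
  have : Q.q j.castSucc + ((N + 1 : ℕ) : ℚ) * (Q.step j * ((N : ℚ) + 1)⁻¹) = Q.q j.succ := by
    rw [step]
    push_cast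
    field_simp
    ring
  rw [node, this, min_self]

theorem exists_node {t : ℝ} (ht : (Q.q j.castSucc : ℝ) < t ∧ t ≤ (Q.q j.succ : ℝ)) :
    ∃ m ∈ List.range (N + 1), (Q.node j N m : ℝ) < t ∧ t ≤ (Q.node j N (m + 1) : ℝ) := by
  classical
  have hex : ∃ m, t ≤ (Q.node j N m : ℝ) := ⟨N + 1, by rw [node_last]; exact ht.2⟩
  have h0 : Nat.find hex ≠ 0 := fun h => by
    have := Nat.find_spec hex
    rw [h, node_zero] at this
    exact this.not_gt ht.1
  obtain ⟨m, hm⟩ := Nat.exists_eq_succ_of_ne_zero h0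
  have hle : Nat.find hex ≤ N + 1 := Nat.find_min' hex (by rw [node_last]; exact ht.2)
  refine ⟨m, List.mem_range.2 (by omega), lt_of_not_ge (Nat.find_min hex (by omega)), ?_⟩
  have := Nat.find_spec hex
  rwa [hm] at this

/-- The points of the subdivision as times. -/
def nodeTime : Time a :=
  ratTime (Q.node j N m) ((Q.q_nonneg _).trans (Q.le_node j N m)) ((Q.node_le j N m).trans (Q.q_le _))

end RatPartition

/-- On every interval of the partition `Q`, the map `Φ` is Lipschitz with the constant `L`. -/
def PiecewiseLipschitz (Q : RatPartition a) (L : ℚ≥0) (Φ : Time a → Box (Fin n) K) : Prop :=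
  ∀ (j : Fin Q.k) (t t' : Time a), (Q.q j.castSucc : ℝ) < t ∧ (t : ℝ) ≤ (Q.q j.succ : ℝ) →
    (Q.q j.castSucc : ℝ) < t' ∧ (t' : ℝ) ≤ (Q.q j.succ : ℝ) →
      ∀ (δ : ℝ) (hδ : 0 ≤ δ), L * |(t : ℝ) - t'| ≤ δ → Box.widen δ hδ (Φ t) ≤ Φ t'

/-- The amount by which a Lipschitz map can vary between adjacent points of the subdivision. -/
def gridGap (Q : RatPartition a) (L : ℚ≥0) (j : Fin Q.k) (N : ℕ) : ℚ :=
  L * (Q.step j * ((N : ℚ) + 1)⁻¹)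

theorem gridGap_nonneg (Q : RatPartition a) (L : ℚ≥0) (j : Fin Q.k) (N : ℕ) :
    (0 : ℝ) ≤ gridGap Q L j N :=
  Rat.cast_nonneg.2 (mul_nonneg (NNRat.cast_nonneg L) (Q.mesh_pos j N).le)

/-- A hyper-rectangle that bounds the map `Φ` between two adjacent points of the subdivision. -/
def gridBox (Q : RatPartition a) (L : ℚ≥0) (Φ : Time a → Box (Fin n) K) (j : Fin Q.k) (N m : ℕ) :
    Box (Fin n) K :=
  Box.widen (gridGap Q L j N) (gridGap_nonneg Q L j N) (Φ (Q.nodeTime j N (m + 1)))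

/-- The hyper-rectangle with the end-points `d`, if there is one, is way-below `X`. -/
def DescribesBelow {ι : Type*} {R : ℚ≥0} (d : RatBox ι) (X : Box ι R) : Prop :=
  ∀ b : Box ι R, d.Describes b → WayBelow b X

/-- The finitely many comparisons that verify, with `N + 1` points in every interval of the
partition, that the step function of the list `l` is separated from `Φ`. -/
def GridTest (Q : RatPartition a) (L : ℚ≥0) (Φ : Time a → Box (Fin n) K)
    (l : List ((ℚ × ℚ) × RatBox (Fin n))) (N : ℕ) : Prop :=
  ∀ e ∈ l, (InIoc 0 e.1 → DescribesBelow e.2 (Φ (Q.pt 0))) ∧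
    ∀ j, ∀ m ∈ List.range (N + 1), max e.1.1 (Q.node j N m) < min e.1.2 (Q.node j N (m + 1)) →
      DescribesBelow e.2 (gridBox Q L Φ j N m)

variable {Q : RatPartition a} {L : ℚ≥0} {Φ : Time a → Box (Fin n) K}

/-- Within a cell, times differ from its right end by at most the mesh, and the Lipschitz bound is
used in both directions. -/
theorem PiecewiseLipschitz.near (hΦ : PiecewiseLipschitz Q L Φ) {j : Fin Q.k} {N m : ℕ} {t : Time a}
    (ht : (Q.node j N m : ℝ) < t ∧ (t : ℝ) ≤ (Q.node j N (m + 1) : ℝ)) :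
    gridBox Q L Φ j N m ≤ Φ t ∧
      Box.widen (gridGap Q L j N) (gridGap_nonneg Q L j N) (Φ t) ≤ Φ (Q.nodeTime j N (m + 1)) := by
  have h1 : (Q.q j.castSucc : ℝ) ≤ Q.node j N m := by exact_mod_cast Q.le_node j N m
  have h2 : (Q.node j N (m + 1) : ℝ) ≤ Q.q j.succ := by exact_mod_cast Q.node_le j N (m + 1)
  have h3 : (Q.q j.castSucc : ℝ) < Q.node j N (m + 1) := by exact_mod_cast Q.lt_node_succ j N m
  have h4 : (Q.node j N (m + 1) : ℝ) ≤
      Q.node j N m + ((Q.step j * ((N : ℚ) + 1)⁻¹ : ℚ) : ℝ) := by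
    exact_mod_cast Q.node_succ_le j N m
  have e1 := And.intro (h1.trans_lt ht.1) (ht.2.trans h2)
  have e2 : (Q.q j.castSucc : ℝ) < Q.nodeTime j N (m + 1) ∧
      (Q.nodeTime j N (m + 1) : ℝ) ≤ (Q.q j.succ : ℝ) := ⟨h3, h2⟩
  have h5 : |(t : ℝ) - Q.nodeTime j N (m + 1)| ≤ ((Q.step j * ((N : ℚ) + 1)⁻¹ : ℚ) : ℝ) := by
    change |(t : ℝ) - Q.node j N (m + 1)| ≤ _
    rw [abs_le]
    constructor <;> linarith [ht.1, ht.2]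
  have h6 : (L : ℝ) * |(t : ℝ) - Q.nodeTime j N (m + 1)| ≤ gridGap Q L j N := by
    refine (mul_le_mul_of_nonneg_left h5 (nnratCast_nonneg L)).trans (le_of_eq ?_)
    rw [gridGap]
    push_cast
    rfl
  exact ⟨hΦ j _ _ e2 e1 _ _ (by rwa [abs_sub_comm]), hΦ j _ _ e1 e2 _ _ h6⟩

/-- A finite family of rational hyper-rectangles that bound `Φ` on intervals has a step function
as its supremum. -/
theorem exists_stepFun_le {l : List ((ℚ × ℚ) × RatBox (Fin n))}
    (h : ∀ e ∈ l, ∀ t ∈ timeOpen a e.1, ∀ b, e.2.Describes b → b ≤ Φ t) :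
    ∃ ψ : StepFun n K a, IsStepFunOf (timeOpen a) l ψ.1 ∧ ψ.1 ≤ Φ := by
  have hb : ∀ t, Φ t ∈ upperBounds
      {b : Box (Fin n) K | ∃ e ∈ l, t ∈ timeOpen a e.1 ∧ e.2.Describes b} := by
    rintro t b ⟨e, he, ht, hb⟩
    exact h e he t ht b hb
  choose ψ hψ using fun t => Box.exists_isLUB_of_bddAbove (hb t)
  exact ⟨⟨ψ, l, hψ⟩, hψ, fun t => (hψ t).2 (hb t)⟩

/-- The boxes attached to the cells lie below `Φ` on their cells, hence are jointly consistent and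
form a rational step function below `Φ`. -/
theorem exists_stepFun_grid (hΦ : PiecewiseLipschitz Q L Φ)
    (h0 : ∃ d : RatBox (Fin n), d.Describes (Φ (Q.pt 0))) {N : ℕ}
    (hrat : ∀ j m, ∃ d : RatBox (Fin n), d.Describes (gridBox Q L Φ j N m)) :
    ∃ ψ : StepFun n K a, ψ.1 ≤ Φ ∧ Φ (Q.pt 0) ≤ ψ.1 (Q.pt 0) ∧
      ∀ j, ∀ m ∈ List.range (N + 1), ∀ t : Time a,
        (Q.node j N m : ℝ) < t ∧ (t : ℝ) ≤ (Q.node j N (m + 1) : ℝ) →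
          gridBox Q L Φ j N m ≤ ψ.1 t := by
  obtain ⟨d₀, hd₀⟩ := h0
  choose d hd using hrat
  have hpt : ((Q.pt 0 : Time a) : ℝ) = 0 := by simp [RatPartition.pt, Q.q_zero]
  -- The cells are open on the left and miss the time `0`; the interval `(-1, 0]` isolates it in
  -- `[0, a]`.
  let l : List ((ℚ × ℚ) × RatBox (Fin n)) := ((-1, 0), d₀) ::
    (List.finRange Q.k).flatMap fun j => (List.range (N + 1)).map fun m =>
      ((Q.node j N m, Q.node j N (m + 1)), d j m)
  have hmem : ∀ j, ∀ m ∈ List.range (N + 1),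
      ((Q.node j N m, Q.node j N (m + 1)), d j m) ∈ l := fun j m hm =>
    List.mem_cons_of_mem _ (List.mem_flatMap.2 ⟨j, List.mem_finRange j, List.mem_map_of_mem hm⟩)
  obtain ⟨ψ, hψ, hle⟩ := exists_stepFun_le (Φ := Φ) (l := l) (by
    intro e he t ht b hb
    rcases List.mem_cons.1 he with rfl | he
    · have h1 : (t : ℝ) ≤ 0 := by simpa using ht.2
      have h2 : t = Q.pt 0 := Subtype.ext (by rw [hpt]; exact le_antisymm h1 t.2.1)
      rw [h2, hb.unique hd₀]
    · obtain ⟨j, -, he⟩ := List.mem_flatMap.1 he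
      obtain ⟨m, -, rfl⟩ := List.mem_map.1 he
      rw [hb.unique (hd j m)]
      exact (hΦ.near ht).1)
  refine ⟨ψ, hle, (hψ _).1 ⟨_, List.mem_cons_self, ⟨?_, ?_⟩, hd₀⟩, fun j m hm t ht =>
    (hψ t).1 ⟨_, hmem j m hm, ht, hd j m⟩⟩
  · simp [hpt]
  · simp [hpt]

/-- Soundness: the step function of the cell boxes is interposed. If an entry is active at `t` in a
cell, the two intervals overlap, so the test has compared that entry with that cell. -/
theorem sepFun_of_gridTest (hΦ : PiecewiseLipschitz Q L Φ)
    (h0 : ∃ d : RatBox (Fin n), d.Describes (Φ (Q.pt 0))) {N : ℕ}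
    (hrat : ∀ j m, ∃ d : RatBox (Fin n), d.Describes (gridBox Q L Φ j N m))
    {θ : StepFun n K a} {l : List ((ℚ × ℚ) × RatBox (Fin n))}
    (hθ : IsStepFunOf (timeOpen a) l θ.1) (h : GridTest Q L Φ l N) : SepFun θ.1 Φ := by
  obtain ⟨ψ, hψ, hψ0, hψm⟩ := exists_stepFun_grid hΦ h0 hrat
  refine ⟨θ, ψ, le_rfl, ⟨l, hθ, fun e he b hb t ht => ?_⟩, hψ⟩
  rcases Q.eq_zero_or_exists t with h1 | ⟨j, hj⟩
  · have h2 : t = Q.pt 0 := Subtype.ext (by rw [h1]; simp [RatPartition.pt, Q.q_zero])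
    have h3 : InIoc 0 e.1 := by
      obtain ⟨h4, h5⟩ := ht
      rw [h1] at h4 h5
      exact ⟨by exact_mod_cast h4, by exact_mod_cast h5⟩
    rw [h2]
    exact ((h e he).1 h3 b hb).trans_le hψ0
  · obtain ⟨m, hm, h1⟩ := Q.exists_node j N hj
    have h2 : max e.1.1 (Q.node j N m) < min e.1.2 (Q.node j N (m + 1)) := by
      have := (max_lt ht.1 h1.1).trans_le (le_min ht.2 h1.2)
      exact_mod_cast this
    exact ((h e he).2 j m hm h2 b hb).trans_le (hψm j m hm t h1)

/-- Completeness: separation has a uniform margin, and a fine grid makes the loss from replacing `Φ`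
by the cell boxes smaller than it. -/
theorem exists_gridTest (hΦ : PiecewiseLipschitz Q L Φ) {θ : StepFun n K a}
    {l : List ((ℚ × ℚ) × RatBox (Fin n))} (hθ : IsStepFunOf (timeOpen a) l θ.1)
    (h : SepFun θ.1 Φ) : ∃ N, GridTest Q L Φ l N := by
  obtain ⟨ε, hε, hle⟩ := h.exists_le_widen
  obtain ⟨N, hN⟩ := exists_nat_gt (2 * (L * a) / ε)
  have hN1 : (0 : ℝ) < (N : ℝ) + 1 := by positivity
  have hgap : ∀ j, gridGap Q L j N + gridGap Q L j N < ε := fun j => by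
    have h1 : (Q.step j : ℝ) ≤ a := by
      have h2 := Q.q_le j.succ
      have h3 := Q.q_nonneg j.castSucc
      have : Q.step j ≤ ((a : ℚ≥0) : ℚ) := by rw [RatPartition.step]; linarith
      exact_mod_cast this
    have h2 : (gridGap Q L j N : ℝ) = L * Q.step j / ((N : ℝ) + 1) := by
      rw [gridGap]
      push_cast
      field_simp
    have h3 := mul_le_mul_of_nonneg_left h1 (nnratCast_nonneg L)
    rw [div_lt_iff₀ hε] at hN
    rw [h2, ← add_div, div_lt_iff₀ hN1]
    nlinarith
  refine ⟨N, fun e he => ⟨fun h0 b hb => ?_, fun j m hm hlt b hb => ?_⟩⟩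
  · have ht : Q.pt 0 ∈ timeOpen a e.1 := by
      have hpt : ((Q.pt 0 : Time a) : ℝ) = 0 := by simp [RatPartition.pt, Q.q_zero]
      rw [timeOpen, mem_ofPred_eq, hpt]
      exact ⟨by exact_mod_cast h0.1, by exact_mod_cast h0.2⟩
    exact WayBelow.le_trans (((hθ _).1 ⟨e, he, ht, hb⟩).trans (hle _))
      (Box.widen_wayBelow_self hε _)
  · obtain ⟨h1, h2⟩ := max_lt_iff.1 hlt
    -- The smaller right end-point belongs to both intervals, as they are closed on the right; it is
    -- a time at which the entry is active within the cell.
    have hr0 : 0 ≤ min e.1.2 (Q.node j N (m + 1)) :=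
      ((Q.q_nonneg _).trans (Q.le_node j N m)).trans h2.le
    have hr1 : min e.1.2 (Q.node j N (m + 1)) ≤ a :=
      (min_le_right _ _).trans ((Q.node_le j N (m + 1)).trans (Q.q_le _))
    have ht : ratTime _ hr0 hr1 ∈ timeOpen a e.1 := (ratTime_mem hr0 hr1).2 ⟨h1, min_le_left _ _⟩
    have hnear := (hΦ.near (j := j) (N := N) (m := m) (t := ratTime _ hr0 hr1)
      ⟨Rat.cast_lt.2 h2, Rat.cast_le.2 (min_le_right _ _)⟩).2
    have hg := gridGap_nonneg Q L j N
    refine WayBelow.le_trans (((hθ _).1 ⟨e, he, ht, hb⟩).trans (hle _))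
      ((Box.widen_wayBelow (add_nonneg hg hg) (hgap j) _).trans_le ?_)
    exact (Box.widen_add_le hg hg _).trans (Box.widen_mono hg hnear)

end GridTest

/-! ## Effectivity of the Euler operator -/

section RealPrim

variable {α β : Type*} [Primcodable α] [Primcodable β] {f g : α → ℝ}

/-- The real number `f a` is rational, with a code that depends on `a` primitive recursively. -/
def RealPrim (f : α → ℝ) : Prop := ∃ F : α → ℚ, RatPrim F ∧ ∀ a, f a = F a

namespace RealPrim

theorem ratCast {F : α → ℚ} (hF : RatPrim F) : RealPrim fun a => (F a : ℝ) := ⟨F, hF, fun _ => rfl⟩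

theorem const (q : ℚ) : RealPrim fun _ : α => (q : ℝ) := ratCast (RatPrim.const q)

theorem of_eq (hf : RealPrim f) (h : ∀ a, f a = g a) : RealPrim g :=
  (funext h : f = g) ▸ hf

theorem add (hf : RealPrim f) (hg : RealPrim g) : RealPrim fun a => f a + g a := by
  obtain ⟨F, hF, hf⟩ := hf
  obtain ⟨G, hG, hg⟩ := hg
  exact ⟨_, hF.add hG, fun a => by simp only [hf, hg]; push_cast; rfl⟩

theorem sub (hf : RealPrim f) (hg : RealPrim g) : RealPrim fun a => f a - g a := by
  obtain ⟨F, hF, hf⟩ := hf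
  obtain ⟨G, hG, hg⟩ := hg
  exact ⟨_, hF.sub hG, fun a => by simp only [hf, hg]; push_cast; rfl⟩

theorem mul (hf : RealPrim f) (hg : RealPrim g) : RealPrim fun a => f a * g a := by
  obtain ⟨F, hF, hf⟩ := hf
  obtain ⟨G, hG, hg⟩ := hg
  exact ⟨_, hF.mul hG, fun a => by simp only [hf, hg]; push_cast; rfl⟩

theorem max (hf : RealPrim f) (hg : RealPrim g) : RealPrim fun a => max (f a) (g a) := by
  obtain ⟨F, hF, hf⟩ := hf
  obtain ⟨G, hG, hg⟩ := hg
  exact ⟨_, hF.max hG, fun a => by simp only [hf, hg]; push_cast; rfl⟩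

theorem min (hf : RealPrim f) (hg : RealPrim g) : RealPrim fun a => min (f a) (g a) := by
  obtain ⟨F, hF, hf⟩ := hf
  obtain ⟨G, hG, hg⟩ := hg
  exact ⟨_, hF.min hG, fun a => by simp only [hf, hg]; push_cast; rfl⟩

theorem sum {ι : Type*} (s : Finset ι) {f : ι → α → ℝ} (hf : ∀ i, RealPrim (f i)) :
    RealPrim fun a => ∑ i ∈ s, f i a := by
  choose F hF hf using hf
  exact ⟨_, RatPrim.sum s hF, fun a => by simp only [hf]; push_cast; rfl⟩

theorem nnratCast (R : ℚ≥0) : RealPrim fun _ : α => (R : ℝ) :=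
  ⟨_, RatPrim.const (R : ℚ), fun _ => (Rat.cast_nnratCast R).symm⟩

theorem negNNRatCast (R : ℚ≥0) : RealPrim fun _ : α => -(R : ℝ) :=
  ⟨_, RatPrim.const (-(R : ℚ)), fun _ => by push_cast; rfl⟩

end RealPrim

variable {ι κ : Type*} {R R' : ℚ≥0}

/-- The hyper-rectangle `X a` has rational end-points that depend on `a` primitive recursively. -/
def BoxValPrim (X : α → Box ι R) : Prop :=
  ∀ i, RealPrim (fun a => (X a).lo i) ∧ RealPrim fun a => (X a).hi i

namespace BoxValPrim

variable {X : α → Box ι R}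

theorem exists_rat (hX : BoxValPrim X) : ∃ lo hi : α → ι → ℚ,
    (∀ i, RatPrim fun a => lo a i) ∧ (∀ i, RatPrim fun a => hi a i) ∧
      ∀ a i, (X a).lo i = lo a i ∧ (X a).hi i = hi a i := by
  choose lo hlo lo_eq using fun i => (hX i).1
  choose hi hhi hi_eq using fun i => (hX i).2
  exact ⟨fun a i => lo i a, fun a i => hi i a, hlo, hhi, fun a i => ⟨lo_eq i a, hi_eq i a⟩⟩

theorem exists_describes (hX : BoxValPrim X) (a : α) : ∃ d : RatBox ι, d.Describes (X a) := by
  obtain ⟨lo, hi, -, -, h⟩ := hX.exists_rat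
  exact ⟨fun i => (lo a i, hi a i), h a⟩

theorem zero : BoxValPrim fun _ : α => (Box.zero : Box ι R) := fun _ =>
  ⟨⟨_, RatPrim.const 0, fun _ => Rat.cast_zero.symm⟩, ⟨_, RatPrim.const 0, fun _ => Rat.cast_zero.symm⟩⟩

theorem widen (hX : BoxValPrim X) {δ : α → ℝ} (hδ : RealPrim δ) (h : ∀ a, 0 ≤ δ a) :
    BoxValPrim fun a => Box.widen (δ a) (h a) (X a) := fun i =>
  ⟨(RealPrim.negNNRatCast R).max ((hX i).1.sub hδ), (RealPrim.nnratCast R).min ((hX i).2.add hδ)⟩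

theorem primrecPred_describesBelow [Finite ι] (hX : BoxValPrim X) {d : α → RatBox ι}
    (hd : BoxPrim d) : PrimrecPred fun a => DescribesBelow (d a) (X a) := by
  obtain ⟨lo, hi, hlo, hhi, h⟩ := hX.exists_rat
  refine ((hd.fits (R := R)).imp (hd.ratBelow (R := R) hlo hhi)).of_eq fun a => ⟨fun H b hb => ?_, fun H hf => ?_⟩
  · exact (wayBelow_iff_ratBelow hb (fun i => (h a i).1) fun i => (h a i).2).2 (H hb.fits)
  · exact (wayBelow_iff_ratBelow ((d a).describes_toBox hf) (fun i => (h a i).1)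
      fun i => (h a i).2).1 (H _ ((d a).describes_toBox hf))

theorem stepFun [Finite ι] [Finite κ] (hX : BoxValPrim X) {l : α → List β} (hl : Primrec l)
    {e : β → RatBox ι × RatBox κ} (he₁ : BoxPrim fun b => (e b).1) (he₂ : BoxPrim fun b => (e b).2)
    {w : α → Box ι R → Box κ R'} (hw : ∀ a, IsStepFunOf (boxOpen R) ((l a).map e) (w a)) :
    BoxValPrim fun a => w a (X a) := by
  obtain ⟨lo, hi, hlo, hhi, h⟩ := hX.exists_rat
  have hlub := fun a => (hw a).isLUB_activeBoxes (fun i => (h a i).1) fun i => (h a i).2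
  exact fun i => ⟨⟨_, ratPrim_stepLo_boxActive hl he₁ he₂ hlo hhi i, fun a => lo_eq_stepLo (hlub a) i⟩,
    ⟨_, ratPrim_stepHi_boxActive hl he₁ he₂ hlo hhi i, fun a => hi_eq_stepHi (hlub a) i⟩⟩

theorem matVec {n : ℕ} {A : α → Box (Fin n × Fin n) R} {v : α → Box (Fin n) R'}
    (hA : BoxValPrim A) (hv : BoxValPrim v) (i : Fin n) :
    RealPrim (fun a => (matVec (A a) (v a) i).fst) ∧
      RealPrim fun a => (_root_.matVec (A a) (v a) i).snd := by
  simp only [matVec_fst, matVec_snd]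
  have h := fun j => And.intro (And.intro ((hA (i, j)).1.mul (hv j).1) ((hA (i, j)).1.mul (hv j).2))
    (And.intro ((hA (i, j)).2.mul (hv j).1) ((hA (i, j)).2.mul (hv j).2))
  exact ⟨RealPrim.sum _ fun j => ((h j).1.1.min (h j).1.2).min ((h j).2.1.min (h j).2.2),
    RealPrim.sum _ fun j => ((h j).1.1.max (h j).1.2).max ((h j).2.1.max (h j).2.2)⟩

end BoxValPrim

end RealPrim

/-! ### Effectivity of the Euler operator -/

section EulerEffective

variable {n : ℕ} {K M M₁ a : ℚ≥0}

/-- The polynomial `s * B + s ^ 2 / 2 * C` has derivative `B + s * C`, with `|B| ≤ M`, `|C| ≤ n *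
(M₁ * M)` and `0 ≤ s ≤ a`. Truncation does not increase differences. The constant does not depend on
the data. -/
theorem piecewiseLipschitz_eulerPhi (Q : RatPartition a) (v : V1 n K M M₁)
    (φ : Time a → Box (Fin n) K) :
    PiecewiseLipschitz Q (M + a * (n * (M₁ * M))) (eulerPhi Q v φ) := by
  intro j t t' ht ht' δ hδ hle
  push_cast at hle
  have hq : (0 : ℝ) ≤ Q.q j.castSucc := by exact_mod_cast Q.q_nonneg _
  have key : ∀ A B C : ℝ, |B| ≤ M → |C| ≤ n * (M₁ * M) →
      |(A + (((t : ℝ) - Q.q j.castSucc) * B + ((t : ℝ) - Q.q j.castSucc) ^ 2 / 2 * C)) -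
        (A + (((t' : ℝ) - Q.q j.castSucc) * B + ((t' : ℝ) - Q.q j.castSucc) ^ 2 / 2 * C))| ≤ δ := by
    intro A B C hB hC
    have hs : |(((t : ℝ) - Q.q j.castSucc) + (t' - Q.q j.castSucc)) / 2| ≤ a := by
      rw [abs_le]
      constructor <;> linarith [t.2.2, t'.2.2, ht.1, ht'.1, nnratCast_nonneg a]
    have h1 : |B + (((t : ℝ) - Q.q j.castSucc) + (t' - Q.q j.castSucc)) / 2 * C| ≤
        M + a * (n * (M₁ * M)) := (abs_add_le _ _).trans (add_le_add hB (abs_mul_le_mul hs hC))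
    -- The difference of the two values factors exactly as `B + s * C`, at the mean `s` of the two
    -- elapsed times, times the difference of the times.
    refine le_trans (le_of_eq ?_) ((mul_le_mul_of_nonneg_right h1 (abs_nonneg _)).trans hle)
    rw [← abs_mul]
    congr 1
    ring
  intro i
  have hS := abs_matVec_le (v.u' (eulerG Q M φ j)) (v.u (eulerG Q M φ j)) i
  have h1 := key ((φ (Q.pt j.castSucc)).lo i) _ _ (Box.abs_lo_le (v.u (φ (Q.pt j.castSucc))) i) hS.1
  have h2 := key ((φ (Q.pt j.castSucc)).hi i) _ _ (Box.abs_hi_le (v.u (φ (Q.pt j.castSucc))) i) hS.2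
  refine ⟨max_le (Box.neg_le_lo _ i) ?_, le_min (Box.hi_le _ i) ?_⟩
  · rw [(eulerPhi_eq Q v φ ht i).1, (eulerPhi_eq Q v φ ht' i).1, sub_le_iff_le_add]
    refine clamp_le_add hδ ?_
    unfold eulerLo eulerSlope
    linarith [(abs_le.1 h1).2]
  · rw [(eulerPhi_eq Q v φ ht i).2, (eulerPhi_eq Q v φ ht' i).2]
    refine clamp_le_add hδ ?_
    unfold eulerHi eulerSlope
    linarith [(abs_le.1 h2).1]

variable {α : Type*} [Primcodable α] {c : α → VCode n} {d : α → StepCode n}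

theorem boxValPrim_stepCode (hd : Primrec d) (hdv : ∀ x, (d x).Valid K a) {r : ℚ} (h0 : 0 ≤ r)
    (h1 : r ≤ a) : BoxValPrim fun x => ((d x).toStepFun K a).1 (ratTime r h0 h1) := by
  have hlub : ∀ x, IsLUB (activeBoxes (R := K) (InIoc r) ((d x).map StepCode.entry))
      (((d x).toStepFun K a).1 (ratTime r h0 h1)) := fun x => by
    have := StepCode.isStepFunOf_toStepFun (hdv x) (ratTime r h0 h1)
    rwa [activeBoxes_congr (A' := fun y => ratTime r h0 h1 ∈ timeOpen a y)
      (fun e _ => (ratTime_mem h0 h1).symm)]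
  have hA : PrimrecPred fun x : α × (PairCode × (Fin n → PairCode)) =>
      InIoc r (StepCode.entry x.2).1 := primrecPred_inIoc (RatPrim.const r) Primrec.snd
  exact fun i => ⟨⟨_, RatPrim.stepLo hd boxPrim_entry hA i, fun x => lo_eq_stepLo (hlub x) i⟩,
    ⟨_, RatPrim.stepHi hd boxPrim_entry hA i, fun x => hi_eq_stepHi (hlub x) i⟩⟩

theorem boxValPrim_u (hc : Primrec c) (hcv : ∀ x, (c x).Valid K M M₁) {X : α → Box (Fin n) K}
    (hX : BoxValPrim X) : BoxValPrim fun x => ((c x).toV1 K M M₁).u (X x) :=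
  hX.stepFun (Primrec.fst.comp hc) (e := VCode.entry₁) boxPrim_fst boxPrim_snd
    (w := fun x => ((c x).toV1 K M M₁).u) fun x => (VCode.isStepFunOf_toV1 (hcv x)).1

theorem boxValPrim_u' (hc : Primrec c) (hcv : ∀ x, (c x).Valid K M M₁) {X : α → Box (Fin n) K}
    (hX : BoxValPrim X) : BoxValPrim fun x => ((c x).toV1 K M M₁).u' (X x) :=
  hX.stepFun (Primrec.snd.comp hc) (e := VCode.entry₂) boxPrim_fst boxPrim_snd₂
    (w := fun x => ((c x).toV1 K M M₁).u') fun x => (VCode.isStepFunOf_toV1 (hcv x)).2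

/-- At rational times the closed form needs only ring operations, minima and maxima of rational
numbers, and evaluations of step functions at rational boxes. -/
theorem boxValPrim_eulerPhi (hc : Primrec c) (hcv : ∀ x, (c x).Valid K M M₁) (hd : Primrec d)
    (hdv : ∀ x, (d x).Valid K a) (Q : RatPartition a) (j : Fin Q.k) {t : α → Time a} {r : α → ℚ}
    (hr : RatPrim r) (htr : ∀ x, (t x : ℝ) = r x)
    (ht : ∀ x, (Q.q j.castSucc : ℝ) < t x ∧ (t x : ℝ) ≤ (Q.q j.succ : ℝ)) :
    BoxValPrim fun x => eulerPhi Q ((c x).toV1 K M M₁) ((d x).toStepFun K a).1 (t x) := by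
  have hX : BoxValPrim fun x => ((d x).toStepFun K a).1 (Q.pt j.castSucc) :=
    boxValPrim_stepCode hd hdv (Q.q_nonneg _) (Q.q_le _)
  have hr' : RealPrim fun x => (t x : ℝ) := ⟨r, hr, htr⟩
  have hG : BoxValPrim fun x => eulerG Q M ((d x).toStepFun K a).1 j := by
    simp only [eulerG_eq]
    exact hX.widen ((RealPrim.nnratCast M).mul ((RealPrim.const _).sub (RealPrim.const _))) _
  have hs : RealPrim fun x => (t x : ℝ) - Q.q j.castSucc := hr'.sub (RealPrim.const _)
  have hs2 : RealPrim fun x => ((t x : ℝ) - Q.q j.castSucc) ^ 2 / 2 :=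
    ((hs.mul hs).mul (RealPrim.const (1 / 2))).of_eq fun x => by push_cast; ring
  intro i
  have hU := boxValPrim_u hc hcv hX i
  have hS := (boxValPrim_u' hc hcv hG).matVec (boxValPrim_u hc hcv hG) i
  constructor
  · refine RealPrim.of_eq ((RealPrim.negNNRatCast K).max ((RealPrim.nnratCast K).min
      ((hX i).1.add ((hs.mul hU.1).add (hs2.mul hS.1))))) fun x => ?_
    exact ((eulerPhi_eq Q _ _ (ht x) i).1).symm
  · refine RealPrim.of_eq ((RealPrim.negNNRatCast K).max ((RealPrim.nnratCast K).min
      ((hX i).2.add ((hs.mul hU.2).add (hs2.mul hS.2))))) fun x => ?_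
    exact ((eulerPhi_eq Q _ _ (ht x) i).2).symm

theorem RatPrim.node (Q : RatPartition a) (j : Fin Q.k) {N m : α → ℕ} (hN : Primrec N)
    (hm : Primrec m) : RatPrim fun x => Q.node j (N x) (m x) :=
  (RatPrim.const _).min ((RatPrim.const _).add ((RatPrim.natCast hm).mul
    ((RatPrim.const _).mul (RatPrim.inv_succ hN))))

theorem boxValPrim_gridBox (hc : Primrec c) (hcv : ∀ x, (c x).Valid K M M₁) (hd : Primrec d)
    (hdv : ∀ x, (d x).Valid K a) (Q : RatPartition a) (L : ℚ≥0) (j : Fin Q.k) {N m : α → ℕ}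
    (hN : Primrec N) (hm : Primrec m) :
    BoxValPrim fun x => gridBox Q L (eulerPhi Q ((c x).toV1 K M M₁) ((d x).toStepFun K a).1) j
      (N x) (m x) := by
  refine BoxValPrim.widen (boxValPrim_eulerPhi hc hcv hd hdv Q j
    (RatPrim.node Q j hN (Primrec.succ.comp hm)) (fun x => rfl) fun x => ⟨?_, ?_⟩)
    (δ := fun x => (gridGap Q L j (N x) : ℝ)) (RealPrim.ratCast ((RatPrim.const _).mul
      ((RatPrim.const _).mul (RatPrim.inv_succ hN)))) _
  · exact Rat.cast_lt.2 (Q.lt_node_succ j (N x) (m x))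
  · exact Rat.cast_le.2 (Q.node_le j (N x) (m x + 1))

theorem eulerPhi_pt_zero (Q : RatPartition a) (v : V1 n K M M₁) (φ : Time a → Box (Fin n) K) :
    eulerPhi Q v φ (Q.pt 0) = Box.zero :=
  eulerPhi_zero Q v φ (by simp [RatPartition.pt, Q.q_zero])

set_option synthInstance.maxSize 512 in
set_option synthInstance.maxHeartbeats 200000 in
theorem primrecPred_gridTest {b : α → StepCode n} (hb : Primrec b) (hc : Primrec c)
    (hcv : ∀ x, (c x).Valid K M M₁) (hd : Primrec d) (hdv : ∀ x, (d x).Valid K a)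
    (Q : RatPartition a) (L : ℚ≥0) {N : α → ℕ} (hN : Primrec N) :
    PrimrecPred fun x =>
      GridTest Q L (eulerPhi Q ((c x).toV1 K M M₁) ((d x).toStepFun K a).1) (StepCode.val (b x))
        (N x) := by
  simp only [GridTest, StepCode.val_eq, List.forall_mem_map, eulerPhi_pt_zero]
  refine PrimrecPred.forall_mem hb (PrimrecPred.and ?_ ?_)
  · exact (primrecPred_inIoc (RatPrim.const 0) Primrec.snd).imp
      (BoxValPrim.zero.primrecPred_describesBelow (boxPrim_entry.comp Primrec.snd))
  refine PrimrecPred.forall_finite fun j => ?_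
  refine PrimrecPred.forall_mem (Primrec.list_range.comp (Primrec.succ.comp
    (hN.comp Primrec.fst))) ?_
  have hN' : Primrec fun x : (α × (PairCode × (Fin n → PairCode))) × ℕ => N x.1.1 :=
    hN.comp (Primrec.fst.comp Primrec.fst)
  have he : Primrec fun x : (α × (PairCode × (Fin n → PairCode))) × ℕ => x.1.2 :=
    Primrec.snd.comp Primrec.fst
  refine PrimrecPred.imp (RatPrim.lt ?_ ?_) ?_
  · exact RatPrim.max (ratPrim_pairCode_fst.comp (Primrec.fst.comp he))
      (RatPrim.node Q j hN' Primrec.snd)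
  · exact RatPrim.min (ratPrim_pairCode_snd.comp (Primrec.fst.comp he))
      (RatPrim.node Q j hN' (Primrec.succ.comp Primrec.snd))
  · exact (boxValPrim_gridBox (hc.comp (Primrec.fst.comp Primrec.fst)) (fun x => hcv _)
      (hd.comp (Primrec.fst.comp Primrec.fst)) (fun x => hdv _) Q L j hN'
      Primrec.snd).primrecPred_describesBelow (boxPrim_entry.comp he)

/-- For each mesh the grid test is decidable; it succeeds for some mesh exactly if separation holds.
-/
theorem rePred_sepFun_eulerPhi {b : α → StepCode n} (hb : Primrec b) (hbv : ∀ x, (b x).Valid K a)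
    (hc : Primrec c) (hcv : ∀ x, (c x).Valid K M M₁) (hd : Primrec d) (hdv : ∀ x, (d x).Valid K a)
    (Q : RatPartition a) :
    REPred fun x => SepFun ((b x).toStepFun K a).1
      (eulerPhi Q ((c x).toV1 K M M₁) ((d x).toStepFun K a).1) := by
  have h := REPred.exists_nat (p := fun x N => GridTest Q (M + a * (n * (M₁ * M)))
    (eulerPhi Q ((c x).toV1 K M M₁) ((d x).toStepFun K a).1) (StepCode.val (b x)) N)
    (primrecPred_gridTest (hb.comp Primrec.fst) (hc.comp Primrec.fst) (fun x => hcv _)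
      (hd.comp Primrec.fst) (fun x => hdv _) Q _ Primrec.snd)
  refine h.of_eq fun x => ⟨?_, exists_gridTest (piecewiseLipschitz_eulerPhi Q _ _)
    (StepCode.isStepFunOf_toStepFun (hbv x))⟩
  rintro ⟨N, hN⟩
  refine sepFun_of_gridTest (piecewiseLipschitz_eulerPhi Q _ _) ?_ (fun j m => ?_)
    (StepCode.isStepFunOf_toStepFun (hbv x)) hN
  · rw [eulerPhi_pt_zero]
    exact (BoxValPrim.zero (α := ℕ)).exists_describes 0
  · exact (boxValPrim_gridBox hc hcv hd hdv Q _ j (Primrec.const N)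
      (Primrec.const m)).exists_describes x

-- Normalization makes all codes valid, `WD.lowerStar_wayBelow_iff` turns way-below into separation,
-- and `upperStar_lowerStar` removes the passage through ideals.
set_option synthInstance.maxSize 512 in
set_option synthInstance.maxHeartbeats 200000 in
theorem rePred_wayBelow_eulerF (hK : 0 < K) (Q : RatPartition a) :
    REPred fun p : ℕ × ℕ => WayBelow (enumWD n K a p.1)
      (eulerF Q (prodEnum (enumV1 n K M M₁) (enumWD n K a) p.2).1
        (prodEnum (enumV1 n K M M₁) (enumWD n K a) p.2).2) := by
  have hs : Primrec fun k => (StepCode.ofNat n k).normalize K a :=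
    StepCode.primrec_normalize.comp (StepCode.primrec_ofNat n)
  have hv : Primrec fun k => (VCode.ofNat n k).normalize K M M₁ :=
    (VCode.primrec_normalize hK).comp (VCode.primrec_ofNat n)
  have hu : Primrec fun p : ℕ × ℕ => p.2.unpair := Primrec.unpair.comp Primrec.snd
  refine (rePred_sepFun_eulerPhi (hs.comp Primrec.fst) (fun p => StepCode.valid_normalize _)
    (hv.comp (Primrec.fst.comp hu)) (fun p => VCode.valid_normalize _)
    (hs.comp (Primrec.snd.comp hu)) (fun p => StepCode.valid_normalize _) Q).of_eq fun p => ?_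
  rw [enumWD, WD.lowerStar_wayBelow_iff]
  change SepFun _ _ ↔ SepFun _ (eulerPhi Q _ (upperStar (lowerStar _)))
  rw [upperStar_lowerStar, enumStepFun_eq_normalize]
  simp only [prodEnum, enumV1_eq_normalize, enumStepFun_eq_normalize]

end EulerEffective

end

/-! ### The computability theorem -/

theorem mainTheorem3 (n : ℕ) (hn : 1 ≤ n) (K M M₁ a : ℚ≥0) (hK : 0 < K) (hM : 0 < M) (ha : 0 < a)
    (haK : a ≤ K / (M * (1 + n * M₁))) (Q : RatPartition a) :
    EffectivelyGiven (enumV1 n K M M₁) ∧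
    EffectivelyGiven (enumWD n K a) ∧
    ScottContinuous (fun p : V1 n K M M₁ × WD n K a => eulerF Q p.1 p.2) ∧
    (REPred fun p : ℕ × ℕ => WayBelow (enumWD n K a p.1)
      (eulerF Q (prodEnum (enumV1 n K M M₁) (enumWD n K a) p.2).1
        (prodEnum (enumV1 n K M M₁) (enumWD n K a) p.2).2)) ∧
    IsComputableMap (prodEnum (enumV1 n K M M₁) (enumWD n K a)) (enumWD n K a)
      (fun p : V1 n K M M₁ × WD n K a => eulerF Q p.1 p.2) :=
  have hre := rePred_wayBelow_eulerF (M := M) (M₁ := M₁) (n := n) hK Q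
  ⟨effectivelyGiven_enumV1 hK, effectivelyGiven_enumWD n K a, scottContinuous_eulerF hK Q, hre,
    isComputableMap_of_re ((isDomainBasis_enumV1 hK).prodEnum isDomainBasis_enumWD)
      (effectivelyGiven_enumWD n K a) (scottContinuous_eulerF hK Q) hre⟩
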